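/- **Setting.** Let $n,m\in\mathbb N$, $\omega\in\mathbb R^n$, $\Omega\in\mathbb R^m$, and write $|\cdot|$ for the $\ell^1$-norm of integer vectors and multi-indices. For $r,s,\rho>0$ let $D^d_r\subset\mathbb C^d$ be the open Euclidean ball of radius $r$ centred at $0$, $\mathbb T^n_s=\{\varphi\in\mathbb C^n:|\mathrm{Im}\,\varphi_j|<s\}$ (modulo $2\pi\mathbb Z^n$), and $\mathcal D_{r,s,\rho}=D^n_r\times\mathbb T^n_s\times D^{2m}_\rho$. Points are written $(I,\varphi,z,\bar z)$, where $z,\bar z\in\mathbb C^m$ are independent variables on the complex domain; a point is *real* if $I,\varphi$ are real and $\bar z$ is the complex conjugate of $z$. The symplectic form is $dI\wedge d\varphi+\mathrm i\,dz\wedge d\bar z$. "Real analytic" means holomorphic on the complex domain, and real-valued at real points. Assume the second order Melnikov conditions, for some $\gamma,\tau>0$: $$|\omega\cdot\ell+\Omega\cdot h|\ \ge\ \frac{\gamma}{1+|\ell|^\tau}\qquad\forall\,\ell\in\mathbb Z^n,\ h\in\mathbb Z^m,\ |h|\le 2,\ (\ell,h)\ne(0,0).$$ Let $r_*,s_*,\rho_*>0$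 and let $r,\rho>0$, $0<s\le s_*$. Let $$\mathcal H_*=\omega\cdot I+\Omega z\bar z+\sum_{2|k|+|a+\bar a|\ge3}R^*_{k,a,\bar a}(\varphi)\,I^kz^a\bar z^{\bar a}$$ be real analytic on $\mathcal D_{r_*,s_*,\rho_*}$, where $\Omega z\bar z=\sum_j\Omega_jz_j\bar z_j$ and $R^*_{k,a,\bar a}(\varphi)=\sum_{\ell\in\mathbb Z^n}R^*_{k,a,\bar a,\ell}\,e^{\mathrm i\ell\cdot\varphi}$. For $\eta>0$ let $$\mathcal H(I,\varphi,z,\bar z)=\eta^{-2}\mathcal H_*(\eta^2I,\varphi,\eta z,\eta\bar z).$$ Define $$\mathcal R_{i,i'}=(1+\delta_{i,i'})R^*_{e_i+e_{i'},0,0,0}-\sum_{1\le j\le m,\ \ell\in\mathbb Z^n}\frac{1}{\omega\cdot\ell+\Omega_j}\Big(R^*_{e_i,e_j,0,\ell}R^*_{e_{i'},0,e_j,-\ell}+R^*_{e_i,0,e_j,-\ell}R^*_{e_{i'},e_j,0,\ell}\Big),$$ $$\mathcal Q_{ji}=R^*_{e_i,e_j,e_j,0}-\sum_{1\le i'\le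 n,\ \ell\in\mathbb Z^n}\frac{\ell_{i'}}{\omega\cdot\ell+\Omega_j}\Big(R^*_{e_i,e_j,0,\ell}R^*_{e_{i'},0,e_j,-\ell}+R^*_{e_i,0,e_j,-\ell}R^*_{e_{i'},e_j,0,\ell}\Big)$$ $$\qquad-\sum_{1\le j'\le m,\ \ell\in\mathbb Z^n}\frac{1+\delta_{j,j'}}{\omega\cdot\ell+\Omega_{j'}}\Big(R^*_{0,e_j,e_j+e_{j'},-\ell}R^*_{e_i,e_{j'},0,\ell}+R^*_{0,e_j+e_{j'},e_j,\ell}R^*_{e_i,0,e_{j'},-\ell}\Big).$$ **Proposition (Averaging).** There is $\eta_0>0$, depending only on $n,m,\omega,\Omega,\gamma,\tau,r,s,\rho,r_*,s_*,\rho_*$, with $\eta_0^2r\le r_*$ and $\eta_0\rho\le\rho_*$ (so that $\mathcal H$ is real analytic on $\mathcal D_{r,s,\rho}$ for $0<\eta\le\eta_0$), such that for every $\mathcal H_*$ as above the following holds. The series defining $\mathcal R$ and $\mathcal Q$ converge absolutely, $\mathcal R$ is a real symmetric $n\times n$ matrix and $\mathcal Q$ is a real $m\times n$ matrix. There are functions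 $R_{k,a,\bar a}(\phi)$, analytic on $\mathbb T^n_{s/2}$ and independent of $\eta$, and a constant $C$ (depending possibly also on $\mathcal H_*$, but not on $\eta$) such that for every $0<\eta\le\eta_0$ there is a real analytic, injective, canonical change of coordinates $$\Phi:\mathcal D_{r/2,s/2,\rho/2}\to\mathcal D_{r,s,\rho},\qquad \sup|\Phi-\mathrm{id}|\le C\eta,$$ with $$\mathcal H\circ\Phi=\omega\cdot I+\Omega z\bar z+\eta\sum_{|a+\bar a|=3}R^*_{0,a,\bar a}(\phi)z^a\bar z^{\bar a}+\eta^2\Big[\tfrac12\mathcal RI\cdot I+\sum_{j,i}\mathcal Q_{ji}I_iz_j\bar z_j+\sum_{|a+\bar a|=4}R_{0,a,\bar a}(\phi)z^a\bar z^{\bar a}\Big]$$ $$\qquad+\eta^3\sum_{2|k|+|a+\bar a|=5,\ |a+\bar a|\in\{3,5\}}R_{k,a,\bar a}(\phi)I^kz^a\bar z^{\bar a}+E_\eta,$$ where $E_\eta$ is real analytic on $\mathcal D_{r/2,s/2,\rho/2}$ and $|E_\eta|\le C\eta^4$ there. -/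

import Mathlib

open scoped BigOperators

noncomputable section

/-- Complexified phase space, with coordinates `(I, φ, z, w)`: actions, angles (on the universal
cover of the torus) and the normal coordinates `z` and `w`. The variable `w` stands for the
conjugate coordinate `z̄`, which becomes an independent variable after complexification. -/
abbrev Phase (n m : ℕ) : Type :=
  (Fin n → ℂ) × (Fin n → ℂ) × (Fin m → ℂ) × (Fin m → ℂ)

/-- Multi-indices `(k, a, ā)`. -/
abbrev MIdx (n m : ℕ) : Type :=
  (Fin n → ℕ) × (Fin m → ℕ) × (Fin m → ℕ)

/-- The complex strip `𝕋ⁿ_s` (on the universal cover). -/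
def strip (n : ℕ) (s : ℝ) : Set (Fin n → ℂ) :=
  {φ | ∀ i, |(φ i).im| < s}

/-- The domain `Dⁿ_r × 𝕋ⁿ_s × D²ᵐ_ρ`, with Euclidean complex balls `D`. -/
def domain (n m : ℕ) (r s ρ : ℝ) : Set (Phase n m) :=
  {x | ∑ i, ‖x.1 i‖ ^ 2 < r ^ 2 ∧ x.2.1 ∈ strip n s ∧
    ∑ j, ‖x.2.2.1 j‖ ^ 2 + ∑ j, ‖x.2.2.2 j‖ ^ 2 < ρ ^ 2}

/-- The real phase space: `I` and `φ` are real and `w` is the complex conjugate of `z`. -/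
def realPoints (n m : ℕ) : Set (Phase n m) :=
  {x | (∀ i, (x.1 i).im = 0) ∧ (∀ i, (x.2.1 i).im = 0) ∧
    ∀ j, x.2.2.2 j = (starRingEnd ℂ) (x.2.2.1 j)}

/-- The deck translation `φ ↦ φ + 2πℓ`. -/
def angleShift {n : ℕ} (ℓ : Fin n → ℤ) : Fin n → ℂ :=
  fun i => 2 * (Real.pi : ℂ) * (ℓ i : ℂ)

/-- The degree `2|k| + |a + ā|`. -/
def wdeg {n m : ℕ} (p : MIdx n m) : ℕ :=
  2 * ∑ i, p.1 i + (∑ j, p.2.1 j + ∑ j, p.2.2 j)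

/-- The monomial `I^k z^a w^ā`. -/
def mono {n m : ℕ} (p : MIdx n m) (x : Phase n m) : ℂ :=
  (∏ i, x.1 i ^ p.1 i) * (∏ j, x.2.2.1 j ^ p.2.1 j) * ∏ j, x.2.2.2 j ^ p.2.2 j

/-- The quadratic (in weighted degree) integrable part `ω·I + Ω z·w`. -/
def linearPart {n m : ℕ} (ω : Fin n → ℝ) (Ω : Fin m → ℝ) (x : Phase n m) : ℂ :=
  ∑ i, (ω i : ℂ) * x.1 i + ∑ j, (Ω j : ℂ) * x.2.2.1 j * x.2.2.2 j

/-- `∑_{|k| = q, |a + ā| = d} c_{k,a,ā}(φ) I^k z^a w^ā`. -/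
def homogPart {n m : ℕ} (q d : ℕ) (c : MIdx n m → (Fin n → ℂ) → ℂ) (x : Phase n m) : ℂ :=
  ∑ k ∈ Finset.piAntidiag (Finset.univ : Finset (Fin n)) q,
    ∑ e ∈ Finset.HasAntidiagonal.antidiagonal d,
      ∑ a ∈ Finset.piAntidiag (Finset.univ : Finset (Fin m)) e.1,
        ∑ b ∈ Finset.piAntidiag (Finset.univ : Finset (Fin m)) e.2,
          c (k, a, b) x.2.1 * mono (k, a, b) x

/-- `H` is a real analytic Hamiltonian on `Dⁿ_r × 𝕋ⁿ_s × D²ᵐ_ρ` of the form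
`H = ω·I + Ω z·z̄ + ∑_{2|k| + |a + ā| ≥ 3} R_{k,a,ā}(φ) I^k z^a z̄^ā`. -/
structure IsEllipticHamiltonian {n m : ℕ} (ω : Fin n → ℝ) (Ω : Fin m → ℝ) (r s ρ : ℝ)
    (H : Phase n m → ℂ) (R : MIdx n m → (Fin n → ℂ) → ℂ) : Prop where
  analytic : AnalyticOnNhd ℂ H (domain n m r s ρ)
  periodic : ∀ x ∈ domain n m r s ρ, ∀ ℓ : Fin n → ℤ,
    H (x.1, x.2.1 + angleShift ℓ, x.2.2) = H x
  real : ∀ x ∈ domain n m r s ρ, x ∈ realPoints n m → (H x).im = 0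
  expansion : ∀ x ∈ domain n m r s ρ,
    HasSum (fun p : MIdx n m => if 3 ≤ wdeg p then R p x.2.1 * mono p x else 0)
      (H x - linearPart ω Ω x)

/-- Second order Melnikov non-resonance conditions. -/
def Melnikov {n m : ℕ} (ω : Fin n → ℝ) (Ω : Fin m → ℝ) (γ τ : ℝ) : Prop :=
  ∀ (ℓ : Fin n → ℤ) (h : Fin m → ℤ), ∑ j, |h j| ≤ 2 → (ℓ ≠ 0 ∨ h ≠ 0) →
    γ / (1 + ((∑ i, |ℓ i| : ℤ) : ℝ) ^ τ) ≤ |∑ i, ω i * (ℓ i : ℝ) + ∑ j, Ω j * (h j : ℝ)|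

/-- The Fourier coefficient `(2π)⁻ⁿ ∫_{[0,2π]ⁿ} f(θ) e^{-iℓ·θ} dθ`. -/
def torusCoeff {n : ℕ} (f : (Fin n → ℂ) → ℂ) (ℓ : Fin n → ℤ) : ℂ :=
  (2 * (Real.pi : ℂ))⁻¹ ^ n *
    ∫ θ in Set.Icc (0 : Fin n → ℝ) (fun _ => 2 * Real.pi),
      f (fun i => (θ i : ℂ)) * Complex.exp (-(Complex.I * ∑ i, (ℓ i : ℂ) * (θ i : ℂ)))

/-- The unit multi-index `e_i`. -/
def unit {d : ℕ} (i : Fin d) : Fin d → ℕ := Pi.single i 1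

/-- The Taylor-Fourier coefficient `R_{k,a,ā,ℓ}`. -/
def tfCoeff {n m : ℕ} (R : MIdx n m → (Fin n → ℂ) → ℂ) (k : Fin n → ℕ) (a b : Fin m → ℕ)
    (ℓ : Fin n → ℤ) : ℂ :=
  torusCoeff (R (k, a, b)) ℓ

/-- The divisor `ω·ℓ + Ω_j`. -/
def divisor {n m : ℕ} (ω : Fin n → ℝ) (Ω : Fin m → ℝ) (j : Fin m) (ℓ : Fin n → ℤ) : ℂ :=
  ∑ i, (ω i : ℂ) * (ℓ i : ℂ) + (Ω j : ℂ)

/-- The term of index `(j, ℓ)` in the series of the twist matrix. -/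
def twistTerm {n m : ℕ} (ω : Fin n → ℝ) (Ω : Fin m → ℝ) (R : MIdx n m → (Fin n → ℂ) → ℂ)
    (i i' : Fin n) (p : Fin m × (Fin n → ℤ)) : ℂ :=
  1 / divisor ω Ω p.1 p.2 *
    (tfCoeff R (unit i) (unit p.1) 0 p.2 * tfCoeff R (unit i') 0 (unit p.1) (-p.2) +
      tfCoeff R (unit i) 0 (unit p.1) (-p.2) * tfCoeff R (unit i') (unit p.1) 0 p.2)

/-- The twist matrix `𝓡` (as a complex matrix). -/
def twistMatrix {n m : ℕ} (ω : Fin n → ℝ) (Ω : Fin m → ℝ)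
    (R : MIdx n m → (Fin n → ℂ) → ℂ) : Matrix (Fin n) (Fin n) ℂ :=
  Matrix.of fun i i' =>
    (1 + if i = i' then 1 else 0) * tfCoeff R (unit i + unit i') 0 0 0 -
      ∑' p, twistTerm ω Ω R i i' p

/-- The term of index `(i', ℓ)` in the first series of the coupling matrix. -/
def couplingTermA {n m : ℕ} (ω : Fin n → ℝ) (Ω : Fin m → ℝ) (R : MIdx n m → (Fin n → ℂ) → ℂ)
    (j : Fin m) (i : Fin n) (p : Fin n × (Fin n → ℤ)) : ℂ :=
  (p.2 p.1 : ℂ) / divisor ω Ω j p.2 *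
    (tfCoeff R (unit i) (unit j) 0 p.2 * tfCoeff R (unit p.1) 0 (unit j) (-p.2) +
      tfCoeff R (unit i) 0 (unit j) (-p.2) * tfCoeff R (unit p.1) (unit j) 0 p.2)

/-- The term of index `(j', ℓ)` in the second series of the coupling matrix. The factor
`1 + δ_{jj'}` comes from differentiating `w_j w_{j'}` (respectively `z_j z_{j'}`). -/
def couplingTermB {n m : ℕ} (ω : Fin n → ℝ) (Ω : Fin m → ℝ) (R : MIdx n m → (Fin n → ℂ) → ℂ)
    (j : Fin m) (i : Fin n) (p : Fin m × (Fin n → ℤ)) : ℂ :=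
  (1 + if j = p.1 then 1 else 0) / divisor ω Ω p.1 p.2 *
    (tfCoeff R 0 (unit j) (unit j + unit p.1) (-p.2) * tfCoeff R (unit i) (unit p.1) 0 p.2 +
      tfCoeff R 0 (unit j + unit p.1) (unit j) p.2 * tfCoeff R (unit i) 0 (unit p.1) (-p.2))

/-- The coupling matrix `𝓠` (as a complex matrix). -/
def couplingMatrix {n m : ℕ} (ω : Fin n → ℝ) (Ω : Fin m → ℝ)
    (R : MIdx n m → (Fin n → ℂ) → ℂ) : Matrix (Fin m) (Fin n) ℂ :=
  Matrix.of fun j i =>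
    tfCoeff R (unit i) (unit j) (unit j) 0 - ∑' p, couplingTermA ω Ω R j i p -
      ∑' p, couplingTermB ω Ω R j i p

/-- The rescaled Hamiltonian `η⁻² H(η² I, φ, η z, η w)`. -/
def rescaled {n m : ℕ} (H : Phase n m → ℂ) (η : ℝ) (x : Phase n m) : ℂ :=
  ((η : ℂ) ^ 2)⁻¹ *
    H ((η : ℂ) ^ 2 • x.1, x.2.1, (η : ℂ) • x.2.2.1, (η : ℂ) • x.2.2.2)

/-- The symplectic form `dI ∧ dφ + i dz ∧ dw`. -/
def sympl {n m : ℕ} (u v : Phase n m) : ℂ :=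
  ∑ i, (u.1 i * v.2.1 i - u.2.1 i * v.1 i) +
    Complex.I * ∑ j, (u.2.2.1 j * v.2.2.2 j - u.2.2.2 j * v.2.2.1 j)

/-- `Φ` is a (real) analytic canonical change of coordinates from `U` into `V`: it is holomorphic
and injective on `U`, it descends to the torus, it maps real points to real points and it
preserves the symplectic form. -/
structure IsCanonicalChange {n m : ℕ} (Φ : Phase n m → Phase n m) (U V : Set (Phase n m)) :
    Prop where
  analytic : AnalyticOnNhd ℂ Φ U
  mapsTo : Set.MapsTo Φ U V
  injOn : Set.InjOn Φ U
  equivariant : ∀ x ∈ U, ∀ ℓ : Fin n → ℤ,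
    Φ (x.1, x.2.1 + angleShift ℓ, x.2.2) = ((Φ x).1, (Φ x).2.1 + angleShift ℓ, (Φ x).2.2)
  real : ∀ x ∈ U, x ∈ realPoints n m → Φ x ∈ realPoints n m
  symplectic : ∀ x ∈ U, ∀ u v : Phase n m,
    sympl (fderiv ℂ Φ x u) (fderiv ℂ Φ x v) = sympl u v

/-- The explicit part of the averaged Hamiltonian:
`ω·I + Ω z·w + η ∑_{|a+ā|=3} R_{0,a,ā}(φ) z^a w^ā
 + η² [½ 𝓡 I·I + 𝓠 I·z w + ∑_{|a+ā|=4} S_{0,a,ā}(φ) z^a w^ā]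
 + η³ ∑_{2|k|+|a+ā|=5, |a+ā|=3,5} S_{k,a,ā}(φ) I^k z^a w^ā`. -/
def averagedPart {n m : ℕ} (ω : Fin n → ℝ) (Ω : Fin m → ℝ) (R S : MIdx n m → (Fin n → ℂ) → ℂ)
    (A : Matrix (Fin n) (Fin n) ℝ) (Q : Matrix (Fin m) (Fin n) ℝ) (η : ℝ)
    (x : Phase n m) : ℂ :=
  linearPart ω Ω x + (η : ℂ) * homogPart 0 3 R x +
    (η : ℂ) ^ 2 *
      (1 / 2 * ∑ i, ∑ i', (A i i' : ℂ) * x.1 i' * x.1 i +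
        ∑ j, ∑ i, (Q j i : ℂ) * x.1 i * x.2.2.1 j * x.2.2.2 j + homogPart 0 4 S x) +
    (η : ℂ) ^ 3 * (homogPart 1 3 S x + homogPart 0 5 S x)

end

/-!
One step of averaging: the rescaled Hamiltonian `ω·I + Ωzw + ηK₃ + η²K₄ + η³K₅ + O(η⁴)`, where
`K_d` collects the monomials `I^k z^a w^b` with `2|k| + |a| + |b| = d`, is transformed by a
symplectic map generated by `F = ηF₃ + η²F₄ + η³F₅`, with `F_d` homogeneous of the same weighted
degree `d`. The expansion in `η` is Taylor's formula along the dilations `(μ²I, φ, μz, μw)`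
(`exists_norm_rescaled_sub_le`).

**The change of coordinates.** Instead of the time-one flow of `F` it is the implicit midpoint
map `y - X(y)/2 ↦ y + X(y)/2`, where `X` is the Hamiltonian vector field of `F`. It needs no
differential equation, only the contraction principle for the inverse of `y ↦ y - X(y)/2`, and it
is exactly symplectic: the derivative of a Hamiltonian vector field is infinitesimally
symplectic, and `1 ± A/2` then change the symplectic form in the same way
(`sympl_add_half_eq_sub_half`, `isCanonicalChange_midpointMap`). For the quadratic polynomial
`ω·I + Ωzw` the difference of the values at `y ± X/2` is exactly its derivative at `y` along `X`
(`linearPart_add_half_sub`), that is, the bracket `L F` with `F`. Therefore, with `{K, F}`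
denoting the derivative of `K` along the Hamiltonian vector field of `F`, all terms of order less
than four cancel in the difference between the rescaled Hamiltonian at `y + X/2` and the normal
form at `y - X/2`, provided that `K₃ + L F₃ = G₃`, `K₄ + {K₃ + G₃, F₃}/2 + L F₄ = G₄` and a
similar equation of degree five hold (`transform_identity`, `exists_transform_bound`,
`exists_sources`).

**The homological equations.** `L` acts on each monomial separately, and on Fourier modes by
multiplication with `i(ω·ℓ + Ω·(a - b))`. Only monomials containing an action and at most two
elliptic variables are normalized, so that the Melnikov conditions bound these divisors from
below by a power of `|ℓ|`. Fourier coefficients of functions analytic on the strip of width `s`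
decay exponentially at every rate below `s`, and division by the divisors does not affect this
(`IsCoeffFun.expDecay`, `expDecay_homCoeff`). Solutions are thus analytic on the same open strip
and the three equations can be solved in succession without loss of width
(`homological_equation`). That the coefficients of the Hamiltonian are analytic and have the
symmetry expressing its reality follows from Cauchy's formula on small tori
(`IsEllipticHamiltonian.isCoeffFun`, `IsEllipticHamiltonian.conj_coeff`).

**The matrices.** In `K₃` the normalized part is `∑ I_i (R_{i,j} z_j + R'_{i,j} w_j)`; it has no
resonant terms and disappears. The coefficients of `I_i I_i'` and `I_i z_j w_j` in `G₄` are
averages over the angles: those of coefficients of `K₄`, and those of products of a coefficient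
of `K₃` and a coefficient of `F₃`, or of their derivatives. By Parseval's identity on the torus
(`IsCoeffFun.hasSum_torusCoeff_mul`) these are the series that define the twist and coupling
matrices (`homogPart_two_zero_normalCoeff`, `homogPart_one_two_normalCoeff`).

**The threshold.** The construction works for `η` below a threshold that depends on the
Hamiltonian. Between this threshold and `η₀`, where `η₀` is only limited by the domain of the
Hamiltonian, the error has to be bounded only, because the constant in front of `η⁴` may depend
on the Hamiltonian; there the identity serves as change of coordinates.
-/

noncomputable section

open Set Filter Topology MeasureTheory Metric Function

variable {n m : ℕ}

/-! ### Holomorphic functions of several variables -/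

/-- Cauchy's estimate for the Fréchet derivative of a bounded holomorphic function. -/
lemma norm_fderiv_le_of_norm_le {E F : Type*} [NormedAddCommGroup E] [NormedSpace ℂ E]
    [NormedAddCommGroup F] [NormedSpace ℂ F] {f : E → F} {c : E} {R M : ℝ} (hR : 0 < R)
    (hd : DifferentiableOn ℂ f (ball c R)) (hM : ∀ x ∈ ball c R, ‖f x‖ ≤ M) :
    ‖fderiv ℂ f c‖ ≤ 2 * M / R := by
  refine Complex.norm_fderiv_le_div_of_mapsTo_ball hd (fun x hx => ?_) hR
  rw [mem_closedBall, dist_eq_norm]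
  have h1 := hM x hx
  have h2 := hM c (mem_ball_self hR)
  linarith [norm_sub_le (f x) (f c)]

/-- The integral over a compact set of a continuous family of holomorphic functions is
holomorphic. -/
theorem differentiableOn_setIntegral {E X : Type*} [NormedAddCommGroup E] [NormedSpace ℂ E]
    [FiniteDimensional ℂ E] [TopologicalSpace X] [T2Space X]
    [MeasurableSpace X] [OpensMeasurableSpace X]
    {μ : Measure X} [IsFiniteMeasureOnCompacts μ] {K : Set X} (hK : IsCompact K)
    (hKm : MeasurableSet K) {U : Set E} (hU : IsOpen U) {f : E → X → ℂ}
    (hc : ContinuousOn (uncurry f) (U ×ˢ K)) (hd : ∀ t ∈ K, DifferentiableOn ℂ (fun x => f x t) U) :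
    DifferentiableOn ℂ (fun x => ∫ t in K, f x t ∂μ) U := by
  have : ProperSpace E := FiniteDimensional.proper ℂ E
  intro x₀ hx₀
  obtain ⟨R, hR, hRU⟩ : ∃ R > 0, closedBall x₀ (2 * R) ⊆ U := by
    obtain ⟨ε, hε, h⟩ := Metric.isOpen_iff.1 hU x₀ hx₀
    exact ⟨ε / 3, by positivity, (closedBall_subset_ball (by linarith)).trans h⟩
  obtain ⟨M, hM⟩ : ∃ M, ∀ p ∈ closedBall x₀ (2 * R) ×ˢ K, ‖uncurry f p‖ ≤ M :=
    ((isCompact_closedBall x₀ (2 * R)).prod hK).exists_bound_of_continuousOn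
      (hc.mono (prod_mono hRU Subset.rfl))
  have hsub : ∀ x ∈ ball x₀ R, ball x R ⊆ closedBall x₀ (2 * R) := by
    intro x hx y hy
    rw [mem_ball] at hx hy
    rw [mem_closedBall]
    linarith [dist_triangle y x x₀]
  have hballU : ball x₀ R ⊆ U := (hsub x₀ (mem_ball_self hR)).trans hRU
  have hbd : ∀ t ∈ K, ∀ x ∈ ball x₀ R, ‖fderiv ℂ (fun x => f x t) x‖ ≤ 2 * M / R := by
    intro t ht x hx
    exact norm_fderiv_le_of_norm_le hR ((hd t ht).mono ((hsub x hx).trans hRU))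
      fun y hy => hM (y, t) ⟨hsub x hx hy, ht⟩
  have hslice : ∀ x ∈ U, ContinuousOn (f x) K := fun x hx =>
    hc.comp (f := fun t => (x, t)) (by fun_prop) fun t ht => ⟨hx, ht⟩
  -- Measurability of the derivative in the parameter: it is continuous, by Cauchy's estimate.
  have hcont : ContinuousOn (fun t => fderiv ℂ (fun x => f x t) x₀) K := by
    intro t₀ ht₀
    rw [ContinuousWithinAt, Metric.tendsto_nhds]
    intro ε hε
    have hc' : ContinuousOn (uncurry fun t x => f x t) (K ×ˢ closedBall x₀ (2 * R)) :=
      hc.comp (f := fun p : X × E => (p.2, p.1)) (by fun_prop) fun p hp => ⟨hRU hp.2, hp.1⟩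
    have hu : {p : ℂ × ℂ | dist p.1 p.2 < ε * R / 4} ∈ uniformity ℂ :=
      Metric.dist_mem_uniformity (by positivity)
    obtain ⟨v, hv, hv'⟩ := (isCompact_closedBall x₀ (2 * R)).mem_uniformity_of_prod hc' ht₀ hu
    filter_upwards [hv, self_mem_nhdsWithin] with t ht htK
    have hdt : ∀ t ∈ K, DifferentiableAt ℂ (fun x => f x t) x₀ := fun t ht =>
      (hd t ht).differentiableAt (hU.mem_nhds hx₀)
    rw [dist_eq_norm, ← fderiv_fun_sub (hdt t htK) (hdt t₀ ht₀)]
    have := norm_fderiv_le_of_norm_le (f := fun x => f x t - f x t₀) (c := x₀)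
      (M := ε * R / 4) hR (((hd t htK).mono hballU).sub ((hd t₀ ht₀).mono hballU))
      (fun x hx => by
        have := hv' t ht x (hsub x₀ (mem_ball_self hR) hx)
        simp only [mem_ofPred_eq, dist_eq_norm] at this
        exact this.le)
    refine this.trans_lt ?_
    rw [div_lt_iff₀ hR]
    nlinarith [mul_pos hε hR]
  have key := hasFDerivAt_integral_of_dominated_of_fderiv_le (𝕜 := ℂ) (μ := μ.restrict K)
    (F := f) (F' := fun x t => fderiv ℂ (fun x => f x t) x) (x₀ := x₀) (s := ball x₀ R)
    (bound := fun _ => 2 * M / R) (ball_mem_nhds x₀ hR)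
    (by
      filter_upwards [hU.mem_nhds hx₀] with x hx
      exact (hslice x hx).aestronglyMeasurable_of_isCompact hK hKm)
    ((hslice x₀ hx₀).integrableOn_compact hK)
    (hcont.aestronglyMeasurable_of_isCompact hK hKm)
    ((ae_restrict_iff' hKm).2 (.of_forall hbd))
    (by
      have : IsFiniteMeasure (μ.restrict K) := ⟨by simpa using hK.measure_lt_top⟩
      exact integrable_const _)
    ((ae_restrict_iff' hKm).2 (.of_forall fun t ht x hx =>
      ((hd t ht).differentiableAt (hU.mem_nhds (hballU hx))).hasFDerivAt))
  exact key.differentiableAt.differentiableWithinAt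

/-- Directional derivatives of a holomorphic function are holomorphic, because Cauchy's formula
writes them as integrals. -/
lemma differentiableOn_fderiv_apply_const {E : Type*} [NormedAddCommGroup E] [NormedSpace ℂ E]
    [FiniteDimensional ℂ E] {U : Set E} (hU : IsOpen U) {f : E → ℂ} (hf : DifferentiableOn ℂ f U)
    (v : E) : DifferentiableOn ℂ (fun x => fderiv ℂ f x v) U := by
  intro x₀ hx₀
  obtain ⟨ε, hε, hεU⟩ := Metric.isOpen_iff.1 hU x₀ hx₀
  set δ : ℝ := ε / (2 * (‖v‖ + 1)) with hδ
  have hδ0 : 0 < δ := by positivity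
  have hmem : ∀ x ∈ ball x₀ (ε / 2), ∀ z : ℂ, ‖z‖ ≤ δ → x + z • v ∈ U := by
    intro x hx z hz
    apply hεU
    rw [mem_ball, dist_eq_norm] at hx ⊢
    have h1 : ‖z • v‖ ≤ δ * (‖v‖ + 1) := by
      rw [norm_smul]; gcongr; linarith
    have h2 : δ * (‖v‖ + 1) = ε / 2 := by rw [hδ]; field_simp
    have h3 : x + z • v - x₀ = (x - x₀) + z • v := by abel
    rw [h3]
    linarith [norm_add_le (x - x₀) (z • v)]
  have hformula : ∀ x ∈ ball x₀ (ε / 2), fderiv ℂ f x v =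
      (2 * Real.pi * Complex.I)⁻¹ * ∫ θ in Icc 0 (2 * Real.pi),
        deriv (circleMap 0 δ) θ * ((1 / (circleMap 0 δ θ) ^ 2) * f (x + circleMap 0 δ θ • v)) := by
    intro x hx
    have hline : ∀ z : ℂ, ‖z‖ ≤ δ →
        HasDerivAt (fun z : ℂ => f (x + z • v)) (fderiv ℂ f (x + z • v) v) z := by
      intro z hz
      have h1 := (hf.differentiableAt (hU.mem_nhds (hmem x hx z hz))).hasFDerivAt
      have h2 : HasDerivAt (fun z : ℂ => x + z • v) v z := by
        simpa using ((hasDerivAt_id z).smul_const v).const_add x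
      exact h1.comp_hasDerivAt z h2
    have h0 := hline 0 (by simpa using hδ0.le)
    simp only [zero_smul, add_zero] at h0
    have hcauchy := DifferentiableOn.deriv_eq_smul_circleIntegral (f := fun z : ℂ => f (x + z • v))
      (c := 0) hδ0 (fun z hz => (hline z (by simpa using hz)).differentiableAt.differentiableWithinAt)
    rw [h0.deriv, circleIntegral, intervalIntegral.integral_of_le (by positivity),
      ← integral_Icc_eq_integral_Ioc] at hcauchy
    simp only [sub_zero, smul_eq_mul] at hcauchy
    rw [hcauchy, ← mul_assoc, inv_mul_cancel₀ (by simp [Real.pi_ne_zero]), one_mul]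
  have hdiff : DifferentiableOn ℂ (fun x => ∫ θ in Icc 0 (2 * Real.pi),
      deriv (circleMap 0 δ) θ * ((1 / (circleMap 0 δ θ) ^ 2) * f (x + circleMap 0 δ θ • v)))
      (ball x₀ (ε / 2)) := by
    have hnorm : ∀ θ, ‖circleMap 0 δ θ‖ ≤ δ := fun θ => by
      simp [abs_of_pos hδ0]
    refine differentiableOn_setIntegral isCompact_Icc measurableSet_Icc isOpen_ball ?_ ?_
    · have h1 : ContinuousOn (fun p : E × ℝ => f (p.1 + circleMap 0 δ p.2 • v))
          (ball x₀ (ε / 2) ×ˢ Icc 0 (2 * Real.pi)) :=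
        hf.continuousOn.comp (by fun_prop) fun p hp => hmem p.1 hp.1 _ (hnorm _)
      have h2 : Continuous fun p : E × ℝ => deriv (circleMap 0 δ) p.2 := by
        simp only [deriv_circleMap]; fun_prop
      have h3 : Continuous fun p : E × ℝ => 1 / (circleMap 0 δ p.2) ^ 2 := by
        refine continuous_const.div (by fun_prop) fun p => ?_
        exact pow_ne_zero _ (circleMap_ne_center hδ0.ne')
      exact h2.continuousOn.mul (h3.continuousOn.mul h1)
    · intro θ _ x hx
      have h1 := hf.differentiableAt (hU.mem_nhds (hmem x hx _ (hnorm θ)))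
      have h2 : DifferentiableAt ℂ (fun x => f (x + circleMap 0 δ θ • v)) x :=
        DifferentiableAt.comp x h1 (by fun_prop)
      exact ((h2.const_mul _).const_mul _).differentiableWithinAt
  have h := (hdiff.const_mul (2 * Real.pi * Complex.I)⁻¹).congr hformula
  exact (h.differentiableAt (ball_mem_nhds x₀ (by positivity))).differentiableWithinAt

/-- A holomorphic function is `C^k`, by induction: all its directional derivatives are holomorphic. -/
lemma contDiffOn_nat_of_differentiableOn {E : Type*} [NormedAddCommGroup E]
    [NormedSpace ℂ E] [FiniteDimensional ℂ E] {U : Set E} (hU : IsOpen U) (k : ℕ) {f : E → ℂ}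
    (hf : DifferentiableOn ℂ f U) : ContDiffOn ℂ k f U := by
  induction k generalizing f with
  | zero => exact contDiffOn_zero.2 hf.continuousOn
  | succ k ih =>
    push_cast
    rw [contDiffOn_succ_iff_fderiv_of_isOpen hU]
    refine ⟨hf, by simp, ?_⟩
    rw [contDiffOn_clm_apply]
    exact fun v => ih (differentiableOn_fderiv_apply_const hU hf v)

/-- The iterated derivative along a line is the diagonal of the iterated Fréchet derivative. -/
lemma iteratedDeriv_comp_line {E : Type*} [NormedAddCommGroup E] [NormedSpace ℂ E] {U : Set E}
    (hU : IsOpen U) {f : E → ℂ} (n : ℕ) (hf : ContDiffOn ℂ n f U) (x y : E) (t : ℂ)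
    (ht : x + t • y ∈ U) :
    iteratedDeriv n (fun t : ℂ => f (x + t • y)) t = iteratedFDeriv ℂ n f (x + t • y) fun _ => y := by
  induction n generalizing t with
  | zero => simp
  | succ n ih =>
    have hopen : ∀ᶠ t' in 𝓝 t, x + t' • y ∈ U :=
      (Continuous.continuousAt (by fun_prop : Continuous fun t : ℂ => x + t • y)).eventually
        (hU.mem_nhds ht)
    have heq : iteratedDeriv n (fun t : ℂ => f (x + t • y)) =ᶠ[𝓝 t]
        fun t' => iteratedFDeriv ℂ n f (x + t' • y) fun _ => y :=
      hopen.mono fun t' ht' => ih (hf.of_le (by exact_mod_cast n.le_succ)) t' ht'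
    rw [iteratedDeriv_succ, heq.deriv_eq]
    have h1 : DifferentiableAt ℂ (iteratedFDeriv ℂ n f) (x + t • y) :=
      (hf.contDiffAt (hU.mem_nhds ht)).differentiableAt_iteratedFDeriv (by exact_mod_cast n.lt_succ_self)
    have h2 : HasDerivAt (fun z : ℂ => x + z • y) y t := by
      simpa using ((hasDerivAt_id t).smul_const y).const_add x
    have h3 := h1.hasFDerivAt.comp_hasDerivAt t h2
    have h4 := (ContinuousMultilinearMap.apply ℂ (fun _ : Fin n => E) ℂ fun _ => y).hasFDerivAt.comp_hasDerivAt
      t h3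
    have h5 := h4.deriv
    simp only [Function.comp_def, ContinuousMultilinearMap.apply_apply] at h5
    rw [h5, iteratedFDeriv_succ_apply_left]
    rfl

/-- A function on a finite-dimensional complex space that is complex differentiable on an open set
is analytic there. -/
theorem analyticOnNhd_of_differentiableOn {E : Type*} [NormedAddCommGroup E]
    [NormedSpace ℂ E] [FiniteDimensional ℂ E] {U : Set E} (hU : IsOpen U) {f : E → ℂ}
    (hf : DifferentiableOn ℂ f U) : AnalyticOnNhd ℂ f U := by
  have : ProperSpace E := FiniteDimensional.proper ℂ E
  intro x₀ hx₀
  obtain ⟨R, hR, hRU⟩ : ∃ R > 0, closedBall x₀ R ⊆ U := by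
    obtain ⟨ε, hε, h⟩ := Metric.isOpen_iff.1 hU x₀ hx₀
    exact ⟨ε / 2, by positivity, (closedBall_subset_ball (by linarith)).trans h⟩
  obtain ⟨M, hM⟩ := (isCompact_closedBall x₀ R).exists_bound_of_continuousOn
    (hf.continuousOn.mono hRU)
  have hM0 : 0 ≤ M := (norm_nonneg _).trans (hM x₀ (mem_closedBall_self hR.le))
  -- Iterated Cauchy estimates: each derivative costs a shrinking of the ball by `δ`.
  have hbd : ∀ δ > 0, ∀ j : ℕ, ∀ x, dist x x₀ + j * δ < R →
      ‖iteratedFDeriv ℂ j f x‖ ≤ M * (2 / δ) ^ j := by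
    intro δ hδ j
    induction j with
    | zero =>
      intro x hx
      simpa using hM x (by simpa using hx.le)
    | succ j ih =>
      intro x hx
      have hsub : ∀ y ∈ ball x δ, dist y x₀ + j * δ < R := by
        intro y hy
        rw [mem_ball] at hy
        push_cast at hx
        linarith [dist_triangle y x x₀]
      have hd : DifferentiableOn ℂ (iteratedFDeriv ℂ j f) (ball x δ) := by
        intro y hy
        have hyU : y ∈ U := hRU (by
          rw [mem_closedBall]
          nlinarith [hsub y hy, (Nat.cast_nonneg j : (0 : ℝ) ≤ j)])
        exact (((contDiffOn_nat_of_differentiableOn hU (j + 1) hf).contDiffAt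
          (hU.mem_nhds hyU)).differentiableAt_iteratedFDeriv
            (by exact_mod_cast j.lt_succ_self)).differentiableWithinAt
      have := norm_fderiv_le_of_norm_le hδ hd fun y hy => ih y (hsub y hy)
      rw [norm_fderiv_iteratedFDeriv] at this
      refine this.trans (le_of_eq ?_)
      rw [pow_succ]; ring
  let p : FormalMultilinearSeries ℂ E ℂ := fun k => ((k.factorial : ℂ)⁻¹) • iteratedFDeriv ℂ k f x₀
  set e : ℝ := Real.exp 1 with he
  have he0 : 0 < e := Real.exp_pos 1
  -- With `δ = R / (k + 2)` the `k`-th derivative is `O((k + 2)^k)` up to a geometric factor, which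
  -- `k!` beats up to a geometric factor; this `r` absorbs all of them.
  set r : ℝ := R / (4 * (e + 1)) with hr
  have hr0 : 0 < r := by positivity
  have hp : ∀ k, ‖p k‖ * r ^ k ≤ M * e := by
    intro k
    have hδ : (0 : ℝ) < R / (k + 2) := by positivity
    have h1 := hbd (R / (k + 2)) hδ k x₀ (by
      rw [dist_self, zero_add, mul_div_assoc', div_lt_iff₀ (by positivity)]
      nlinarith)
    have h2 : ‖p k‖ ≤ (k.factorial : ℝ)⁻¹ * (M * (2 / (R / (k + 2))) ^ k) := by
      simp only [p, norm_smul, norm_inv, Complex.norm_natCast]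
      gcongr
    have h3 : ((k : ℝ) + 1) ^ k ≤ k.factorial * (e * e ^ k) := by
      have h := Real.pow_div_factorial_le_exp (x := (k : ℝ) + 1) (by positivity) k
      rw [div_le_iff₀ (by positivity), Real.exp_add, ← Real.exp_one_pow] at h
      linarith
    have h4 : ((k : ℝ) + 2) ^ k ≤ 2 ^ k * (k + 1) ^ k := by
      rw [← mul_pow]; gcongr; linarith
    calc ‖p k‖ * r ^ k ≤ ((k.factorial : ℝ)⁻¹ * (M * (2 / (R / (k + 2))) ^ k)) * r ^ k := by gcongr
      _ = M * (k.factorial : ℝ)⁻¹ * ((k + 2) ^ k * ((2 * (e + 1))⁻¹) ^ k) := by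
        have : (2 / (R / (k + 2)) * r : ℝ) = (k + 2) * (2 * (e + 1))⁻¹ := by
          rw [hr]; field_simp; ring
        rw [← mul_pow, ← this, mul_pow]; ring
      _ ≤ M * (k.factorial : ℝ)⁻¹ * ((2 ^ k * (k.factorial * (e * e ^ k))) *
          ((2 * (e + 1))⁻¹) ^ k) := by
        gcongr
        exact h4.trans (by gcongr)
      _ = M * e * (e * (e + 1)⁻¹) ^ k := by
        rw [mul_pow, inv_pow, inv_pow, mul_pow]; field_simp
      _ ≤ M * e * 1 := by
        gcongr
        refine pow_le_one₀ (by positivity) ?_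
        rw [← div_eq_mul_inv, div_le_one (by positivity)]; linarith
      _ = M * e := mul_one _
  refine ⟨p, ENNReal.ofReal r, ⟨?_, by simpa using hr0, ?_⟩⟩
  · have := p.le_radius_of_bound (r := r.toNNReal) (M * e) (fun k => by
      rw [Real.coe_toNNReal _ hr0.le]; exact hp k)
    simpa [ENNReal.ofReal] using this
  · intro y hy
    have hy' : ‖y‖ < r := by
      rw [Metric.eball_ofReal, mem_ball_zero_iff] at hy
      exact hy
    have hrR : r ≤ R / 4 := by
      rw [hr]; gcongr; linarith
    -- The series at `y` is the one-variable Taylor series of `t ↦ f (x₀ + t y)` at `t = 1`.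
    have hline : ∀ t ∈ ball (0 : ℂ) 2, x₀ + t • y ∈ U := by
      intro t ht
      apply hRU
      rw [mem_ball_zero_iff] at ht
      rw [mem_closedBall, dist_eq_norm, add_sub_cancel_left, norm_smul]
      nlinarith [norm_nonneg y, norm_nonneg t]
    have hg : DifferentiableOn ℂ (fun t : ℂ => f (x₀ + t • y)) (ball 0 2) := fun t ht =>
      (DifferentiableAt.comp t (hf.differentiableAt (hU.mem_nhds (hline t ht)))
        (by fun_prop)).differentiableWithinAt
    have := Complex.hasSum_taylorSeries_on_ball hg (z := 1) (by simp)
    simp only [one_smul] at this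
    convert this using 2 with k
    rw [iteratedDeriv_comp_line hU k (contDiffOn_nat_of_differentiableOn hU k hf) x₀ y 0 (by simpa using hx₀)]
    simp [p]

/-- Taylor's formula with a remainder controlled by the supremum of the function. -/
theorem norm_sub_taylor_le {g : ℂ → ℂ} {R M : ℝ} (hR : 0 < R)
    (hg : DifferentiableOn ℂ g (ball 0 R)) (hM : ∀ z ∈ ball (0 : ℂ) R, ‖g z‖ ≤ M) (N : ℕ) {z : ℂ}
    (hz : ‖z‖ ≤ R / 4) :
    ‖g z - ∑ k ∈ Finset.range N, (k.factorial : ℂ)⁻¹ * z ^ k * iteratedDeriv k g 0‖ ≤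
      2 * M * (2 * ‖z‖ / R) ^ N := by
  have hM0 : 0 ≤ M := (norm_nonneg _).trans (hM 0 (mem_ball_self hR))
  have hsum := Complex.hasSum_taylorSeries_on_ball hg (z := z) (by
    rw [mem_ball_zero_iff]; linarith)
  simp only [sub_zero, smul_eq_mul, ← mul_assoc] at hsum
  -- Cauchy's estimates on the circle of radius `R / 2`, then a geometric tail of ratio at most `1 / 2`.
  have hbd : ∀ k : ℕ, ‖(k.factorial : ℂ)⁻¹ * z ^ k * iteratedDeriv k g 0‖ ≤
      M * (2 * ‖z‖ / R) ^ k := by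
    intro k
    have h1 : ‖iteratedDeriv k g 0‖ ≤ k.factorial * M / (R / 2) ^ k := by
      refine Complex.norm_iteratedDeriv_le_of_forall_mem_sphere_norm_le k (by positivity) ?_ ?_
      · exact (hg.mono (by
          rw [closure_ball _ (by positivity)]
          exact closedBall_subset_ball (by linarith))).diffContOnCl
      · intro w hw
        exact hM w (by simp only [mem_sphere_iff_norm, sub_zero] at hw; simp [hw]; linarith)
    rw [norm_mul, norm_mul, norm_inv, Complex.norm_natCast, norm_pow]
    calc (k.factorial : ℝ)⁻¹ * ‖z‖ ^ k * ‖iteratedDeriv k g 0‖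
        ≤ (k.factorial : ℝ)⁻¹ * ‖z‖ ^ k * (k.factorial * M / (R / 2) ^ k) := by gcongr
      _ = M * (2 * ‖z‖ / R) ^ k := by
        rw [div_pow, div_pow, mul_pow]
        field_simp
  have hq : 2 * ‖z‖ / R ≤ 1 / 2 := by
    rw [div_le_iff₀ hR]; linarith
  have hq0 : 0 ≤ 2 * ‖z‖ / R := by positivity
  have htail := (hasSum_nat_add_iff' N).2 hsum
  rw [← htail.tsum_eq]
  have hgeo : HasSum (fun k => M * (2 * ‖z‖ / R) ^ (k + N))
      (M * (2 * ‖z‖ / R) ^ N * (1 - 2 * ‖z‖ / R)⁻¹) := by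
    have he : (fun k => M * (2 * ‖z‖ / R) ^ (k + N)) =
        fun k => M * (2 * ‖z‖ / R) ^ N * (2 * ‖z‖ / R) ^ k := by
      ext k; rw [pow_add]; ring
    rw [he]
    exact (hasSum_geometric_of_lt_one hq0 (by linarith)).mul_left (M * (2 * ‖z‖ / R) ^ N)
  refine (tsum_of_norm_bounded hgeo fun k => hbd (k + N)).trans ?_
  have : (1 - 2 * ‖z‖ / R)⁻¹ ≤ 2 := by
    rw [inv_le_comm₀ (by linarith) (by norm_num)]; linarith
  calc M * (2 * ‖z‖ / R) ^ N * (1 - 2 * ‖z‖ / R)⁻¹ ≤ M * (2 * ‖z‖ / R) ^ N * 2 := by gcongr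
    _ = _ := by ring

/-- The intersection of a convex set with a complex line is convex. -/
lemma Convex.preimage_complex_line {E : Type*} [AddCommGroup E] [Module ℂ E] {U : Set E}
    (hc : Convex ℝ U) (u v : E) : Convex ℝ ((fun z : ℂ => u + z • v) ⁻¹' U) := by
  intro a ha b hb s t hs ht hst
  have := hc ha hb hs ht hst
  simp only [mem_preimage] at this ⊢
  convert this using 1
  have hu1 : u = s • u + t • u := by rw [← add_smul, hst, one_smul]
  conv_lhs => rw [hu1]
  rw [smul_add, smul_add, add_smul, smul_assoc, smul_assoc]
  abel

/-- Unique continuation off a totally real subspace: a holomorphic function on a convex domain that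
vanishes at all points `u + t v` with `t` real vanishes at `u + i v`. -/
theorem eq_zero_of_eq_zero_on_real_line {E : Type*} [NormedAddCommGroup E] [NormedSpace ℂ E]
    {U : Set E} (hU : IsOpen U) (hc : Convex ℝ U) {f : E → ℂ} (hf : DifferentiableOn ℂ f U) {u v : E}
    (hu : u ∈ U) (huv : u + Complex.I • v ∈ U)
    (h0 : ∀ t : ℝ, u + (t : ℂ) • v ∈ U → f (u + (t : ℂ) • v) = 0) : f (u + Complex.I • v) = 0 := by
  set V : Set ℂ := (fun z : ℂ => u + z • v) ⁻¹' U with hV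
  have hcont : Continuous fun z : ℂ => u + z • v := by fun_prop
  have hVo : IsOpen V := hU.preimage hcont
  have hVc : Convex ℝ V := hc.preimage_complex_line u v
  have hg : AnalyticOnNhd ℂ (fun z : ℂ => f (u + z • v)) V :=
    DifferentiableOn.analyticOnNhd (fun z hz => (DifferentiableAt.comp z
      (hf.differentiableAt (hU.mem_nhds hz)) (by fun_prop)).differentiableWithinAt) hVo
  have h0V : (0 : ℂ) ∈ V := by simpa [hV] using hu
  have hfreq : ∃ᶠ z in 𝓝[≠] (0 : ℂ), (fun z : ℂ => f (u + z • v)) z = 0 := by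
    have htend : Tendsto (fun k : ℕ => ((1 / ((k : ℝ) + 1) : ℝ) : ℂ)) atTop (𝓝[≠] 0) := by
      refine tendsto_nhdsWithin_iff.2 ⟨?_, .of_forall fun k => ?_⟩
      · have := (Complex.continuous_ofReal.tendsto 0).comp
          (tendsto_one_div_add_atTop_nhds_zero_nat (𝕜 := ℝ))
        simpa only [Function.comp_def, Complex.ofReal_zero] using this
      · simp only [mem_compl_iff, mem_singleton_iff, Complex.ofReal_eq_zero]
        positivity
    refine htend.frequently (Eventually.frequently ?_)
    have hmem : ∀ᶠ k : ℕ in atTop, ((1 / ((k : ℝ) + 1) : ℝ) : ℂ) ∈ V :=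
      (htend.mono_right nhdsWithin_le_nhds).eventually (hVo.mem_nhds h0V)
    exact hmem.mono fun k hk => h0 _ hk
  exact hg.eqOn_zero_of_preconnected_of_frequently_eq_zero hVc.isPreconnected h0V hfreq huv

/-! ### The complex domains and the real structure -/

/-- The cylinder over the strip `𝕋ⁿ_s`, without restriction on the other coordinates. -/
def cylinder (n m : ℕ) (s : ℝ) : Set (Phase n m) := {x | x.2.1 ∈ strip n s}

/-- The deck translation `φ ↦ φ + 2πℓ` of the phase space. -/
def shiftPhase {n m : ℕ} (ℓ : Fin n → ℤ) (x : Phase n m) : Phase n m :=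
  (x.1, x.2.1 + angleShift ℓ, x.2.2)

/-- The antiholomorphic involution `(I, φ, z, w) ↦ (Ī, φ̄, w̄, z̄)` whose fixed points are the real
points. -/
def conjPhase {n m : ℕ} (x : Phase n m) : Phase n m :=
  (fun i => (starRingEnd ℂ) (x.1 i), fun i => (starRingEnd ℂ) (x.2.1 i),
    fun j => (starRingEnd ℂ) (x.2.2.2 j), fun j => (starRingEnd ℂ) (x.2.2.1 j))

lemma isOpen_strip (n : ℕ) (s : ℝ) : IsOpen (strip n s) := by
  have : strip n s = ⋂ i, {φ | |(φ i).im| < s} := by ext; simp [strip]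
  rw [this]
  refine isOpen_iInter_of_finite fun i => isOpen_lt ?_ continuous_const
  exact (Complex.continuous_im.comp (continuous_apply i)).abs

lemma convex_strip (n : ℕ) (s : ℝ) : Convex ℝ (strip n s) := by
  intro x hx y hy a b ha hb hab i
  have h1 := abs_lt.1 (hx i)
  have h2 := abs_lt.1 (hy i)
  have : ((a • x + b • y) i).im = a * (x i).im + b * (y i).im := by simp
  rw [this, abs_lt]
  have hb' : b = 1 - a := by linarith
  subst hb'
  rcases ha.eq_or_lt with rfl | ha
  · simpa using h2
  · constructor <;> nlinarith

lemma isOpen_cylinder (n m : ℕ) (s : ℝ) : IsOpen (cylinder n m s) :=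
  (isOpen_strip n s).preimage (by fun_prop : Continuous fun x : Phase n m => x.2.1)

lemma convex_cylinder (n m : ℕ) (s : ℝ) : Convex ℝ (cylinder n m s) :=
  fun _ hx _ hy _ _ ha hb hab => convex_strip n s hx hy ha hb hab

lemma isOpen_domain (n m : ℕ) (r s ρ : ℝ) : IsOpen (domain n m r s ρ) := by
  refine IsOpen.and (isOpen_lt (by fun_prop) continuous_const) (IsOpen.and ?_
    (isOpen_lt (by fun_prop) continuous_const))
  exact isOpen_cylinder n m s

lemma convexOn_sum_norm_sq (d : ℕ) :
    ConvexOn ℝ univ fun x : Fin d → ℂ => ∑ i, ‖x i‖ ^ 2 := by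
  refine ⟨convex_univ, fun x _ y _ a b ha hb hab => ?_⟩
  simp only [smul_eq_mul, Finset.mul_sum, ← Finset.sum_add_distrib]
  refine Finset.sum_le_sum fun i _ => ?_
  have h : ‖(a • x + b • y) i‖ ≤ a * ‖x i‖ + b * ‖y i‖ := by
    refine (norm_add_le _ _).trans ?_
    simp [abs_of_nonneg ha, abs_of_nonneg hb]
  have hb' : b = 1 - a := by linarith
  subst hb'
  calc _ ≤ (a * ‖x i‖ + (1 - a) * ‖y i‖) ^ 2 := by gcongr
    _ ≤ _ := by nlinarith [mul_nonneg (mul_nonneg ha hb) (sq_nonneg (‖x i‖ - ‖y i‖))]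

lemma convex_domain (n m : ℕ) (r s ρ : ℝ) : Convex ℝ (domain n m r s ρ) := by
  intro x hx y hy a b ha hb hab
  refine ⟨?_, convex_cylinder n m s hx.2.1 hy.2.1 ha hb hab, ?_⟩
  · have := (convexOn_sum_norm_sq n).2 (mem_univ x.1) (mem_univ y.1) ha hb hab
    refine this.trans_lt ?_
    have h1 := hx.1; have h2 := hy.1
    have hb' : b = 1 - a := by linarith
    subst hb'
    simp only [smul_eq_mul]
    rcases ha.eq_or_lt with rfl | ha
    · simpa using h2
    · nlinarith
  · have h3 := (convexOn_sum_norm_sq m).2 (mem_univ x.2.2.1) (mem_univ y.2.2.1) ha hb hab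
    have h4 := (convexOn_sum_norm_sq m).2 (mem_univ x.2.2.2) (mem_univ y.2.2.2) ha hb hab
    refine (add_le_add h3 h4).trans_lt ?_
    have h1 := hx.2.2; have h2 := hy.2.2
    have hb' : b = 1 - a := by linarith
    subst hb'
    simp only [smul_eq_mul]
    rcases ha.eq_or_lt with rfl | ha
    · simpa using h2
    · nlinarith

lemma strip_mono {s s' : ℝ} (h : s' ≤ s) : strip n s' ⊆ strip n s := fun _ hx i => (hx i).trans_le h

lemma domain_mono {r r' s s' ρ ρ' : ℝ} (hr : 0 ≤ r') (hrr : r' ≤ r) (hs : s' ≤ s) (hρ : 0 ≤ ρ')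
    (hρρ : ρ' ≤ ρ) : domain n m r' s' ρ' ⊆ domain n m r s ρ := fun _ hx =>
  ⟨hx.1.trans_le (by gcongr), strip_mono hs hx.2.1, hx.2.2.trans_le (by gcongr)⟩

lemma domain_subset_cylinder (r s ρ : ℝ) : domain n m r s ρ ⊆ cylinder n m s := fun _ hx => hx.2.1

lemma shift_mem_strip {s : ℝ} {φ : Fin n → ℂ} (h : φ ∈ strip n s) (ℓ : Fin n → ℤ) :
    φ + angleShift ℓ ∈ strip n s := by
  intro i
  have : ((φ + angleShift ℓ) i).im = (φ i).im := by
    simp [angleShift]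
  rw [this]; exact h i

lemma shiftPhase_mem_domain {r s ρ : ℝ} {x : Phase n m} (h : x ∈ domain n m r s ρ) (ℓ : Fin n → ℤ) :
    shiftPhase ℓ x ∈ domain n m r s ρ := ⟨h.1, shift_mem_strip h.2.1 ℓ, h.2.2⟩

lemma shiftPhase_mem_cylinder {s : ℝ} {x : Phase n m} (h : x ∈ cylinder n m s) (ℓ : Fin n → ℤ) :
    shiftPhase ℓ x ∈ cylinder n m s := shift_mem_strip h ℓ

lemma conjPhase_mem_domain {r s ρ : ℝ} {x : Phase n m} (h : x ∈ domain n m r s ρ) :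
    conjPhase x ∈ domain n m r s ρ := by
  refine ⟨by simpa [conjPhase] using h.1, fun i => by simpa [conjPhase] using h.2.1 i, ?_⟩
  have := h.2.2
  rw [add_comm] at this
  simpa [conjPhase] using this

lemma conjPhase_mem_cylinder {s : ℝ} {x : Phase n m} (h : x ∈ cylinder n m s) :
    conjPhase x ∈ cylinder n m s := fun i => by simpa [conjPhase] using h i

lemma mem_realPoints_iff {x : Phase n m} : x ∈ realPoints n m ↔ conjPhase x = x := by
  constructor
  · rintro ⟨h1, h2, h3⟩
    refine Prod.ext (funext fun i => Complex.conj_eq_iff_im.2 (h1 i)) (Prod.ext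
      (funext fun i => Complex.conj_eq_iff_im.2 (h2 i)) (Prod.ext (funext fun j => ?_)
      (funext fun j => ?_)))
    · simp [conjPhase, h3 j]
    · simp [conjPhase, h3 j]
  · intro h
    refine ⟨fun i => Complex.conj_eq_iff_im.1 (congrFun (congrArg Prod.fst h) i),
      fun i => Complex.conj_eq_iff_im.1 (congrFun (congrArg (fun y => y.2.1) h) i), fun j => ?_⟩
    exact (congrFun (congrArg (fun y => y.2.2.2) h) j).symm

lemma conjPhase_conjPhase (x : Phase n m) : conjPhase (conjPhase x) = x := by
  simp [conjPhase]

lemma conjPhase_add (x y : Phase n m) : conjPhase (x + y) = conjPhase x + conjPhase y := by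
  ext <;> simp [conjPhase]

lemma conjPhase_smul (c : ℂ) (x : Phase n m) :
    conjPhase (c • x) = (starRingEnd ℂ) c • conjPhase x := by
  ext <;> simp [conjPhase]

lemma add_mem_realPoints {x y : Phase n m} (hx : x ∈ realPoints n m) (hy : y ∈ realPoints n m) :
    x + y ∈ realPoints n m := by
  rw [mem_realPoints_iff] at *
  rw [conjPhase_add, hx, hy]

lemma real_smul_mem_realPoints {x : Phase n m} (t : ℝ) (hx : x ∈ realPoints n m) :
    (t : ℂ) • x ∈ realPoints n m := by
  rw [mem_realPoints_iff] at *
  rw [conjPhase_smul, hx, Complex.conj_ofReal]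

lemma isClosed_realPoints (n m : ℕ) : IsClosed (realPoints n m) := by
  have : realPoints n m = {x | conjPhase x = x} := by ext; exact mem_realPoints_iff
  rw [this]
  refine isClosed_eq ?_ continuous_id
  unfold conjPhase
  fun_prop

/-- Schwarz reflection: a holomorphic function on a convex symmetric domain that is real at real
points commutes with the conjugation. -/
theorem apply_conjPhase_of_real {U : Set (Phase n m)} (hU : IsOpen U) (hc : Convex ℝ U)
    (hconj : ∀ x ∈ U, conjPhase x ∈ U) {f : Phase n m → ℂ} (hf : DifferentiableOn ℂ f U)
    (hreal : ∀ x ∈ U, x ∈ realPoints n m → (f x).im = 0) {x : Phase n m} (hx : x ∈ U) :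
    f (conjPhase x) = (starRingEnd ℂ) (f x) := by
  -- Write `x = u + i v` with `u` and `v` real; both sides are holomorphic on the complex line
  -- `u + z v` and agree for real `z`.
  set u : Phase n m := (1 / 2 : ℂ) • (x + conjPhase x) with hu
  set v : Phase n m := (-Complex.I / 2) • (x - conjPhase x) with hv
  have hsub : x - conjPhase x = x + (-1 : ℂ) • conjPhase x := by rw [neg_one_smul, sub_eq_add_neg]
  have huR : conjPhase u = u := by
    rw [hu, conjPhase_smul, conjPhase_add, conjPhase_conjPhase, add_comm]
    congr 1
    rw [map_div₀, map_one, map_ofNat]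
  have hvR : conjPhase v = v := by
    rw [hv, conjPhase_smul, hsub, conjPhase_add, conjPhase_smul, conjPhase_conjPhase]
    simp only [map_div₀, map_neg, Complex.conj_I, map_one, map_ofNat, smul_add, smul_smul]
    rw [add_comm]
    congr 2 <;> ring
  have hpos : u + Complex.I • v = x := by
    rw [hu, hv, smul_smul, hsub, smul_add, smul_add, smul_smul]
    have : Complex.I * (-Complex.I / 2) = 1 / 2 := by
      rw [mul_div_assoc', mul_neg, Complex.I_mul_I, neg_neg]
    rw [this]
    have : x = (1 / 2 : ℂ) • x + (1 / 2 : ℂ) • x := by rw [← add_smul]; norm_num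
    conv_rhs => rw [this]
    rw [mul_neg_one, neg_smul]; abel
  have hmem_u : u ∈ U := by
    have := hc hx (hconj x hx) (by norm_num : (0 : ℝ) ≤ 1 / 2) (by norm_num : (0 : ℝ) ≤ 1 / 2)
      (by norm_num)
    rw [hu, smul_add]
    convert this using 2 <;> · ext <;> simp
  clear_value u v
  set V : Set ℂ := (fun z : ℂ => u + z • v) ⁻¹' U with hV
  have hcont : Continuous fun z : ℂ => u + z • v := by fun_prop
  have hVo : IsOpen V := hU.preimage hcont
  have hVc : Convex ℝ V := hc.preimage_complex_line u v
  have hconjline : ∀ z : ℂ, conjPhase (u + z • v) = u + (starRingEnd ℂ) z • v := by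
    intro z
    rw [conjPhase_add, conjPhase_smul, huR, hvR]
  have hVconj : ∀ z ∈ V, (starRingEnd ℂ) z ∈ V := by
    intro z hz
    simp only [hV, mem_preimage] at hz ⊢
    rw [← hconjline]
    exact hconj _ hz
  set g : ℂ → ℂ := fun z => f (u + z • v) with hg
  have hgd : ∀ z ∈ V, DifferentiableAt ℂ g z := fun z hz =>
    DifferentiableAt.comp z (hf.differentiableAt (hU.mem_nhds hz)) (by fun_prop)
  have hd : DifferentiableOn ℂ (fun z => g z - (starRingEnd ℂ) (g ((starRingEnd ℂ) z))) V := by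
    intro z hz
    refine ((hgd z hz).sub ?_).differentiableWithinAt
    have := (hgd _ (hVconj z hz)).conj_conj
    simpa [Function.comp_def] using this
  have hI : Complex.I ∈ V := by
    simp only [hV, mem_preimage, hpos]; exact hx
  have h0 : (0 : ℂ) ∈ V := by simpa [hV] using hmem_u
  have key := eq_zero_of_eq_zero_on_real_line (u := (0 : ℂ)) (v := (1 : ℂ)) hVo hVc hd h0
    (by simpa using hI) (by
      intro t ht
      simp only [zero_add, smul_eq_mul, mul_one] at ht ⊢
      rw [Complex.conj_ofReal, sub_eq_zero, eq_comm, Complex.conj_eq_iff_im]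
      refine hreal _ ht ?_
      rw [mem_realPoints_iff, hconjline, Complex.conj_ofReal])
  simp only [zero_add, smul_eq_mul, mul_one, hg, sub_eq_zero, hpos] at key
  rw [key, ← hconjline, hpos]
  simp

/-- Modulo the deck translations, every point has angles with real parts in `[0, 2π]`. -/
lemma exists_angleShift_re_mem (φ : Fin n → ℂ) :
    ∃ ℓ : Fin n → ℤ, ∀ i, ((φ + angleShift ℓ) i).re ∈ Icc 0 (2 * Real.pi) := by
  refine ⟨fun i => -⌊(φ i).re / (2 * Real.pi)⌋, fun i => ?_⟩
  have hpi : 0 < 2 * Real.pi := by positivity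
  have h1 : ((φ + angleShift fun i => -⌊(φ i).re / (2 * Real.pi)⌋) i).re =
      (φ i).re - 2 * Real.pi * ⌊(φ i).re / (2 * Real.pi)⌋ := by
    simp [angleShift]; ring
  rw [h1]
  have h2 := Int.floor_le ((φ i).re / (2 * Real.pi))
  have h3 := (Int.lt_floor_add_one ((φ i).re / (2 * Real.pi))).le
  rw [le_div_iff₀ hpi] at h2
  rw [div_le_iff₀ hpi] at h3
  constructor <;> linarith

/-- A continuous periodic function is bounded on smaller domains, by compactness of the closed
domain modulo the deck translations. -/
theorem exists_bound_of_periodic {F : Type*} [NormedAddCommGroup F] {r r' s s' ρ ρ' : ℝ}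
    (hr' : 0 ≤ r') (hr : r' < r) (hs : s' < s) (hρ' : 0 ≤ ρ') (hρ : ρ' < ρ) {T : Phase n m → F}
    (hT : ContinuousOn T (domain n m r s ρ))
    (hper : ∀ x ∈ domain n m r s ρ, ∀ ℓ, T (shiftPhase ℓ x) = T x) :
    ∃ M, ∀ x ∈ domain n m r' s' ρ', ‖T x‖ ≤ M := by
  -- A compact fundamental domain of the closed smaller domain modulo the deck translations.
  set K : Set (Phase n m) := {x | ∑ i, ‖x.1 i‖ ^ 2 ≤ r' ^ 2 ∧
    (∀ i, (x.2.1 i).re ∈ Icc 0 (2 * Real.pi) ∧ |(x.2.1 i).im| ≤ s') ∧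
    ∑ j, ‖x.2.2.1 j‖ ^ 2 + ∑ j, ‖x.2.2.2 j‖ ^ 2 ≤ ρ' ^ 2} with hK
  have hKc : IsClosed K := by
    have h1 : IsClosed {x : Phase n m | ∑ i, ‖x.1 i‖ ^ 2 ≤ r' ^ 2} :=
      isClosed_le (by fun_prop) continuous_const
    have h2 : IsClosed {x : Phase n m |
        ∑ j, ‖x.2.2.1 j‖ ^ 2 + ∑ j, ‖x.2.2.2 j‖ ^ 2 ≤ ρ' ^ 2} :=
      isClosed_le (by fun_prop) continuous_const
    have h3 : IsClosed {x : Phase n m |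
        ∀ i, (x.2.1 i).re ∈ Icc 0 (2 * Real.pi) ∧ |(x.2.1 i).im| ≤ s'} := by
      have : {x : Phase n m | ∀ i, (x.2.1 i).re ∈ Icc 0 (2 * Real.pi) ∧ |(x.2.1 i).im| ≤ s'} =
          ⋂ i, {x : Phase n m | (x.2.1 i).re ∈ Icc 0 (2 * Real.pi)} ∩
            {x : Phase n m | |(x.2.1 i).im| ≤ s'} := by ext; simp
      rw [this]
      refine isClosed_iInter fun i => IsClosed.inter ?_ ?_
      · exact isClosed_Icc.preimage (by fun_prop : Continuous fun x : Phase n m => (x.2.1 i).re)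
      · exact isClosed_le (by fun_prop) continuous_const
    exact h1.inter (h3.inter h2)
  have hKb : Bornology.IsBounded K := by
    refine (Metric.isBounded_closedBall (x := (0 : Phase n m))
      (r := r' + ρ' + 2 * Real.pi + |s'|)).subset fun x hx => ?_
    have hpi := Real.pi_pos
    have hs0 := abs_nonneg s'
    have hsq : ∀ {d : ℕ} (y : Fin d → ℂ) (B : ℝ), 0 ≤ B → ∑ i, ‖y i‖ ^ 2 ≤ B ^ 2 → ‖y‖ ≤ B := by
      intro d y B hB hy
      refine (pi_norm_le_iff_of_nonneg hB).2 fun i => ?_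
      refine abs_le_of_sq_le_sq' ?_ hB |>.2
      exact (Finset.single_le_sum (f := fun i => ‖y i‖ ^ 2) (fun i _ => by positivity)
        (Finset.mem_univ i)).trans hy
    obtain ⟨h1, h2, h3⟩ := hx
    have hz : ‖x.2.2.1‖ ≤ ρ' := hsq _ _ hρ' (by
      have : 0 ≤ ∑ j, ‖x.2.2.2 j‖ ^ 2 := by positivity
      linarith)
    have hw : ‖x.2.2.2‖ ≤ ρ' := hsq _ _ hρ' (by
      have : 0 ≤ ∑ j, ‖x.2.2.1 j‖ ^ 2 := by positivity
      linarith)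
    have hI := hsq _ _ hr' h1
    have hφ : ‖x.2.1‖ ≤ 2 * Real.pi + |s'| := by
      refine (pi_norm_le_iff_of_nonneg (by positivity)).2 fun i => ?_
      refine (Complex.norm_le_abs_re_add_abs_im _).trans (add_le_add ?_ ?_)
      · rw [abs_of_nonneg (h2 i).1.1]; exact (h2 i).1.2
      · exact (h2 i).2.trans (le_abs_self _)
    rw [mem_closedBall_zero_iff]
    simp only [Prod.norm_def, sup_le_iff]
    exact ⟨by linarith, by linarith, by linarith, by linarith⟩
  have hKcomp : IsCompact K := Metric.isCompact_of_isClosed_isBounded hKc hKb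
  have hKsub : K ⊆ domain n m r s ρ := fun x hx =>
    ⟨hx.1.trans_lt (by gcongr), fun i => (hx.2.1 i).2.trans_lt hs, hx.2.2.trans_lt (by gcongr)⟩
  obtain ⟨M, hM⟩ := hKcomp.exists_bound_of_continuousOn (hT.mono hKsub)
  refine ⟨M, fun x hx => ?_⟩
  obtain ⟨ℓ, hℓ⟩ := exists_angleShift_re_mem x.2.1
  have hx' := shiftPhase_mem_domain hx ℓ
  rw [← hper x (domain_mono hr' hr.le hs.le hρ' hρ.le hx) ℓ]
  exact hM _ ⟨hx'.1.le, fun i => ⟨hℓ i, (hx'.2.1 i).le⟩, hx'.2.2.le⟩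

section Torus

/-! ### Fourier coefficients on the torus -/

/-- The measure on `ℝ / ℤ` is normalised to have total mass one. -/
local instance : MeasureSpace UnitAddCircle := ⟨AddCircle.haarAddCircle⟩

local instance : Measure.IsAddHaarMeasure (volume : Measure UnitAddCircle) :=
  inferInstanceAs (Measure.IsAddHaarMeasure AddCircle.haarAddCircle)

local instance : IsProbabilityMeasure (volume : Measure UnitAddCircle) :=
  inferInstanceAs (IsProbabilityMeasure AddCircle.haarAddCircle)

open UnitAddTorus
open scoped Pointwise

lemma norm_mFourier_apply {d : Type*} [Fintype d] (N : d → ℤ) (t : UnitAddTorus d) :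
    ‖mFourier N t‖ = 1 := by
  simp only [mFourier, ContinuousMap.coe_mk, norm_prod, fourier_apply, Circle.norm_coe,
    Finset.prod_const_one]

lemma integral_mFourier {d : Type*} [Fintype d] (N : d → ℤ) :
    ∫ t, mFourier N t = if N = 0 then 1 else 0 := by
  have h := orthonormal_iff_ite.1 (orthonormal_mFourier (d := d)) 0 N
  rw [ContinuousMap.inner_toLp] at h
  simp only [mFourier_zero, ContinuousMap.one_apply, map_one, mul_one] at h
  rw [h]
  simp only [eq_comm]

/-- The Fourier coefficients of an absolutely convergent trigonometric series. -/
theorem hasSum_mFourierCoeff {d ι : Type*} [Fintype d] [Countable ι] {a : ι → ℂ} {k : ι → d → ℤ}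
    (ha : Summable fun i => ‖a i‖) {f : UnitAddTorus d → ℂ}
    (hf : ∀ t, HasSum (fun i => a i * mFourier (k i) t) (f t)) (N : d → ℤ) :
    HasSum (fun i => if k i = N then a i else 0) (mFourierCoeff f N) := by
  have hint : ∀ M : d → ℤ, Integrable (fun t => mFourier M t) (volume : Measure (UnitAddTorus d)) :=
    fun M => (map_continuous (mFourier M)).integrable_of_hasCompactSupport
      (HasCompactSupport.of_compactSpace _)
  have hterm : ∀ i t, mFourier (-N) t • (a i * mFourier (k i) t) = a i * mFourier (k i - N) t := by
    intro i t
    rw [sub_eq_neg_add, mFourier_add, smul_eq_mul]; ring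
  have h := hasSum_integral_of_summable_integral_norm
    (F := fun i (t : UnitAddTorus d) => mFourier (-N) t • (a i * mFourier (k i) t))
    (μ := volume) (fun i => by
      simp_rw [hterm]; exact (hint _).const_mul _) (by
      refine ha.of_norm_bounded fun i => ?_
      rw [Real.norm_of_nonneg (integral_nonneg fun _ => norm_nonneg _)]
      have : ∀ t, ‖mFourier (-N) t • (a i * mFourier (k i) t)‖ ≤ ‖a i‖ := by
        intro t
        rw [hterm, norm_mul, norm_mFourier_apply, mul_one]
      calc ∫ t, ‖mFourier (-N) t • (a i * mFourier (k i) t)‖ ≤ ∫ _t : UnitAddTorus d, ‖a i‖ := by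
            refine integral_mono_of_nonneg (.of_forall fun _ => norm_nonneg _)
              (integrable_const _) (.of_forall this)
        _ = ‖a i‖ := by simp)
  have h1 : (fun i => ∫ t : UnitAddTorus d, mFourier (-N) t • (a i * mFourier (k i) t)) =
      fun i => if k i = N then a i else 0 := by
    ext i
    simp_rw [hterm, integral_const_mul, integral_mFourier, sub_eq_zero]
    simp
  have h2 : mFourierCoeff f N =
      ∫ t : UnitAddTorus d, ∑' i, mFourier (-N) t • (a i * mFourier (k i) t) := by
    refine integral_congr_ae (.of_forall fun t => ?_)
    exact ((hf t).const_smul (mFourier (-N) t)).tsum_eq.symm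
  rw [h2, ← h1]
  exact h

/-! ### Taylor coefficients in the normal directions -/

/-- The point of the distinguished boundary `|I_i| = |z_j| = |w_j| = ε` above the angle `φ`. -/
def torusPoint (ε : ℝ) (φ : Fin n → ℂ) (t : UnitAddTorus (Fin n ⊕ Fin m ⊕ Fin m)) : Phase n m :=
  (fun i => (ε : ℂ) * fourier 1 (t (.inl i)), φ, fun j => (ε : ℂ) * fourier 1 (t (.inr (.inl j))),
    fun j => (ε : ℂ) * fourier 1 (t (.inr (.inr j))))

/-- A multi-index as a frequency vector. -/
def midxFreq (p : MIdx n m) : Fin n ⊕ Fin m ⊕ Fin m → ℤ :=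
  Sum.elim (fun i => (p.1 i : ℤ)) (Sum.elim (fun j => (p.2.1 j : ℤ)) fun j => (p.2.2 j : ℤ))

/-- The unweighted degree `|k| + |a| + |ā|`. -/
def totalDeg (p : MIdx n m) : ℕ := ∑ i, p.1 i + (∑ j, p.2.1 j + ∑ j, p.2.2 j)

/-- The coefficient of `I^k z^a w^ā` in the expansion of `T` above `φ`, as a Cauchy integral over
the torus of radius `ε`. -/
def taylorCoeff (ε : ℝ) (T : Phase n m → ℂ) (p : MIdx n m) (φ : Fin n → ℂ) : ℂ :=
  ((ε : ℂ) ^ totalDeg p)⁻¹ * mFourierCoeff (fun t => T (torusPoint ε φ t)) (midxFreq p)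

lemma midxFreq_injective : Injective (midxFreq (n := n) (m := m)) := by
  intro p q h
  refine Prod.ext (funext fun i => ?_) (Prod.ext (funext fun j => ?_) (funext fun j => ?_))
  · exact Int.ofNat_injective (congrFun h (.inl i))
  · exact Int.ofNat_injective (congrFun h (.inr (.inl j)))
  · exact Int.ofNat_injective (congrFun h (.inr (.inr j)))

lemma mono_torusPoint (ε : ℝ) (φ : Fin n → ℂ) (t : UnitAddTorus (Fin n ⊕ Fin m ⊕ Fin m))
    (p : MIdx n m) :
    mono p (torusPoint ε φ t) = (ε : ℂ) ^ totalDeg p * mFourier (midxFreq p) t := by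
  have hpow : ∀ (x : UnitAddCircle) (k : ℕ), (fourier 1 x : ℂ) ^ k = fourier (k : ℤ) x := by
    intro x k
    simp [fourier_apply, AddCircle.toCircle_nsmul]
  simp only [mono, torusPoint, mul_pow, Finset.prod_mul_distrib, hpow, mFourier, midxFreq,
    ContinuousMap.coe_mk, Fintype.prod_sum_type, Sum.elim_inl, Sum.elim_inr, totalDeg, pow_add,
    Finset.prod_pow_eq_pow_sum]
  ring

/-- The coefficients of a power series that converges on a torus of radius `ε` are recovered by
Cauchy's formula: on the torus the power series is a Fourier series. -/
theorem taylorCoeff_eq_of_hasSum {ε : ℝ} (hε : 0 < ε) {T : Phase n m → ℂ} {φ : Fin n → ℂ}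
    {c : MIdx n m → ℂ}
    (h : ∀ t, HasSum (fun p => c p * mono p (torusPoint ε φ t)) (T (torusPoint ε φ t)))
    (p : MIdx n m) : taylorCoeff ε T p φ = c p := by
  have hεC : (ε : ℂ) ≠ 0 := by exact_mod_cast hε.ne'
  simp only [mono_torusPoint, ← mul_assoc] at h
  have hs : Summable fun p => ‖c p * (ε : ℂ) ^ totalDeg p‖ := by
    have := (h 0).summable.norm
    simpa only [norm_mul, norm_mFourier_apply, mul_one] using this
  have h1 := hasSum_mFourierCoeff hs h (midxFreq p)
  have h2 : HasSum (fun q => if midxFreq q = midxFreq p then c q * (ε : ℂ) ^ totalDeg q else 0)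
      (c p * (ε : ℂ) ^ totalDeg p) := by
    have := hasSum_ite_eq p (c p * (ε : ℂ) ^ totalDeg p)
    refine this.congr_fun fun q => ?_
    by_cases hq : q = p
    · simp [hq]
    · rw [if_neg hq, if_neg (fun h => hq (midxFreq_injective h))]
  rw [taylorCoeff, h1.unique h2]
  field_simp

lemma continuous_torusPoint (ε : ℝ) : Continuous
    fun q : (Fin n → ℂ) × UnitAddTorus (Fin n ⊕ Fin m ⊕ Fin m) => torusPoint ε q.1 q.2 := by
  unfold torusPoint
  refine .prodMk ?_ (.prodMk ?_ (.prodMk ?_ ?_)) <;> fun_prop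

/-- Taylor coefficients of a holomorphic function depend holomorphically on the angle. -/
theorem differentiableOn_taylorCoeff {ε s : ℝ} {U : Set (Phase n m)} (hU : IsOpen U)
    {T : Phase n m → ℂ} (hT : DifferentiableOn ℂ T U)
    (hmem : ∀ φ ∈ strip n s, ∀ t, torusPoint ε φ t ∈ U) (p : MIdx n m) :
    DifferentiableOn ℂ (taylorCoeff ε T p) (strip n s) := by
  refine DifferentiableOn.const_mul ?_ _
  have := differentiableOn_setIntegral (μ := volume) isCompact_univ MeasurableSet.univ
    (isOpen_strip n s)
    (f := fun φ (t : UnitAddTorus (Fin n ⊕ Fin m ⊕ Fin m)) =>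
      mFourier (-midxFreq p) t • T (torusPoint ε φ t)) ?_ ?_
  · simpa only [Measure.restrict_univ] using! this
  · refine ContinuousOn.smul ((map_continuous (mFourier (-midxFreq p))).comp
      continuous_snd).continuousOn ?_
    exact hT.continuousOn.comp (continuous_torusPoint ε).continuousOn fun q hq => hmem _ hq.1 _
  · intro t _ φ hφ
    have h1 : DifferentiableAt ℂ (fun φ => torusPoint (m := m) ε φ t) φ := by
      unfold torusPoint; fun_prop
    have h2 := (hT.differentiableAt (hU.mem_nhds (hmem φ hφ t))).comp φ h1
    exact (h2.const_smul (mFourier (-midxFreq p) t)).differentiableWithinAt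

/-! ### Fourier series on the strip -/

/-- Coefficient functions: analytic and `2π`-periodic functions of the angles on the strip `𝕋ⁿ_s`. -/
structure IsCoeffFun (s : ℝ) (f : (Fin n → ℂ) → ℂ) : Prop where
  analytic : AnalyticOnNhd ℂ f (strip n s)
  periodic : ∀ φ ∈ strip n s, ∀ ℓ : Fin n → ℤ, f (φ + angleShift ℓ) = f φ

/-- The exponential `e^{iℓ·φ}`. -/
def expMode (ℓ : Fin n → ℤ) (φ : Fin n → ℂ) : ℂ := Complex.exp (Complex.I * ∑ i, (ℓ i : ℂ) * φ i)

/-- The `ℓ¹`-norm of an integer vector. -/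
def intNorm (ℓ : Fin n → ℤ) : ℝ := ∑ i, |(ℓ i : ℝ)|

/-- The function induced on `(ℝ/ℤ)ⁿ` by a `2π`-periodic function of the angles. -/
def toTorus (f : (Fin n → ℂ) → ℂ) (t : UnitAddTorus (Fin n)) : ℂ :=
  f fun i => ((2 * Real.pi * (AddCircle.equivIoc (1 : ℝ) 0 (t i) : ℝ) : ℝ) : ℂ)

/-- A real angle vector, as a complex one. -/
def realAngle (θ : Fin n → ℝ) : Fin n → ℂ := fun i => (θ i : ℂ)

lemma realAngle_mem_strip {s : ℝ} (hs : 0 < s) (θ : Fin n → ℝ) : realAngle θ ∈ strip n s := by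
  intro i; simpa [realAngle] using hs

lemma equivIoc_coe_of_mem {x : ℝ} (hx : x ∈ Ioc (0 : ℝ) 1) :
    ((AddCircle.equivIoc (1 : ℝ) 0 (x : UnitAddCircle) : Ioc (0 : ℝ) (0 + 1)) : ℝ) = x := by
  rw [AddCircle.equivIoc_coe_eq (p := (1 : ℝ)) (a := 0) (by simpa using hx)]

/-- The coefficients `torusCoeff` are those of Mathlib's multivariate Fourier series. -/
theorem torusCoeff_eq_mFourierCoeff (f : (Fin n → ℂ) → ℂ) (ℓ : Fin n → ℤ) :
    torusCoeff f ℓ = mFourierCoeff (toTorus f) ℓ := by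
  have hpi : 0 < 2 * Real.pi := by positivity
  rw [mFourierCoeff_eq_integral _ _ 0]
  set h : (Fin n → ℝ) → ℂ := fun θ => f (fun i => (θ i : ℂ)) *
    Complex.exp (-(Complex.I * ∑ i, (ℓ i : ℂ) * (θ i : ℂ))) with hh
  have hset : {x : Fin n → ℝ | ∀ i, x i ∈ Ioc ((0 : Fin n → ℝ) i) ((0 : Fin n → ℝ) i + 1)} =
      univ.pi fun _ => Ioc (0 : ℝ) 1 := by ext; simp
  have h1 : ∫ x in {x : Fin n → ℝ | ∀ i, x i ∈ Ioc ((0 : Fin n → ℝ) i) ((0 : Fin n → ℝ) i + 1)},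
      mFourier (-ℓ) (fun i => (x i : UnitAddCircle)) • toTorus f (fun i => (x i : UnitAddCircle)) =
      ∫ x in univ.pi fun _ : Fin n => Ioc (0 : ℝ) 1, h ((2 * Real.pi) • x) := by
    rw [hset]
    refine setIntegral_congr_fun (MeasurableSet.univ_pi fun _ => measurableSet_Ioc) fun x hx => ?_
    have hx' : ∀ i, ((AddCircle.equivIoc (1 : ℝ) 0 (x i : UnitAddCircle) : Ioc (0 : ℝ) (0 + 1)) : ℝ)
        = x i := fun i => equivIoc_coe_of_mem (hx i (mem_univ i))
    simp only [toTorus, hx', hh, mFourier, ContinuousMap.coe_mk, fourier_coe_apply, smul_eq_mul,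
      Pi.smul_apply, ← Complex.exp_sum, Pi.neg_apply]
    rw [mul_comm]
    congr 2
    rw [Finset.mul_sum, ← Finset.sum_neg_distrib]
    refine Finset.sum_congr rfl fun i _ => ?_
    push_cast; ring
  rw [h1, Measure.setIntegral_comp_smul_of_pos _ h _ hpi]
  have hset2 : ((2 * Real.pi : ℝ) • (univ.pi fun _ : Fin n => Ioc (0 : ℝ) 1) : Set (Fin n → ℝ)) =
      univ.pi fun _ : Fin n => Ioc (0 : ℝ) (2 * Real.pi) := by
    rw [smul_set_univ_pi]
    congr 1
    ext i : 1
    simp only [Pi.smul_apply]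
    rw [LinearOrderedField.smul_Ioc hpi]
    simp
  rw [hset2, torusCoeff]
  have h3 : ∫ x in univ.pi fun _ : Fin n => Ioc (0 : ℝ) (2 * Real.pi), h x =
      ∫ x in Icc (0 : Fin n → ℝ) (fun _ => 2 * Real.pi), h x := by
    refine setIntegral_congr_set ?_
    exact Measure.univ_pi_Ioc_ae_eq_Icc (μ := fun _ => volume)
  rw [h3, Module.finrank_fin_fun, Complex.real_smul]
  push_cast
  rw [inv_pow]

lemma isOpenQuotientMap_coe_torus :
    IsOpenQuotientMap fun (x : Fin n → ℝ) (i : Fin n) => (x i : UnitAddCircle) :=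
  IsOpenQuotientMap.piMap fun _ => QuotientAddGroup.isOpenQuotientMap_mk

lemma toTorus_coe {f : (Fin n → ℂ) → ℂ}
    (hf : ∀ θ : Fin n → ℝ, ∀ ℓ, f (realAngle θ + angleShift ℓ) = f (realAngle θ)) (x : Fin n → ℝ) :
    toTorus f (fun i => (x i : UnitAddCircle)) = f (realAngle fun i => 2 * Real.pi * x i) := by
  have h : ∀ i, ∃ k : ℤ,
      ((AddCircle.equivIoc (1 : ℝ) 0 (x i : UnitAddCircle) : Ioc (0 : ℝ) (0 + 1)) : ℝ) = x i + k := by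
    intro i
    have h1 : (((AddCircle.equivIoc (1 : ℝ) 0 (x i : UnitAddCircle) : Ioc (0 : ℝ) (0 + 1)) : ℝ) :
        UnitAddCircle) = (x i : UnitAddCircle) :=
      (AddCircle.equivIoc (1 : ℝ) 0).symm_apply_apply _
    rw [eq_comm, QuotientAddGroup.eq, AddSubgroup.mem_zmultiples_iff] at h1
    obtain ⟨k, hk⟩ := h1
    refine ⟨k, ?_⟩
    rw [zsmul_one] at hk
    linarith
  choose k hk using h
  rw [toTorus, ← hf _ k]
  congr 1
  ext i
  simp only [hk, realAngle, angleShift, Pi.add_apply]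
  push_cast; ring

lemma IsCoeffFun.periodic_real {s : ℝ} (hs : 0 < s) {f : (Fin n → ℂ) → ℂ} (hf : IsCoeffFun s f)
    (θ : Fin n → ℝ) (ℓ) : f (realAngle θ + angleShift ℓ) = f (realAngle θ) :=
  hf.periodic _ (realAngle_mem_strip hs θ) ℓ

lemma continuous_toTorus {f : (Fin n → ℂ) → ℂ}
    (hf : ∀ θ : Fin n → ℝ, ∀ ℓ, f (realAngle θ + angleShift ℓ) = f (realAngle θ))
    (hc : Continuous fun θ : Fin n → ℝ => f (realAngle θ)) : Continuous (toTorus f) := by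
  rw [isOpenQuotientMap_coe_torus.isQuotientMap.continuous_iff]
  have : toTorus f ∘ (fun (x : Fin n → ℝ) (i : Fin n) => (x i : UnitAddCircle)) =
      fun x => f (realAngle fun i => 2 * Real.pi * x i) := by
    ext x; exact toTorus_coe hf x
  rw [this]
  exact hc.comp (by fun_prop)

lemma expMode_add (ℓ : Fin n → ℤ) (φ ψ : Fin n → ℂ) :
    expMode ℓ (φ + ψ) = expMode ℓ φ * expMode ℓ ψ := by
  simp only [expMode, ← Complex.exp_add, Pi.add_apply, mul_add, Finset.sum_add_distrib]

lemma expMode_ne_zero (ℓ : Fin n → ℤ) (φ : Fin n → ℂ) : expMode ℓ φ ≠ 0 := Complex.exp_ne_zero _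

lemma expMode_angleShift (ℓ k : Fin n → ℤ) : expMode ℓ (angleShift k) = 1 := by
  rw [expMode, Complex.exp_eq_one_iff]
  refine ⟨∑ i, ℓ i * k i, ?_⟩
  simp only [angleShift]
  push_cast
  rw [Finset.mul_sum, Finset.sum_mul]
  refine Finset.sum_congr rfl fun i _ => ?_
  ring

lemma expMode_neg (ℓ : Fin n → ℤ) (φ : Fin n → ℂ) : expMode (-ℓ) φ = (expMode ℓ φ)⁻¹ := by
  simp only [expMode, ← Complex.exp_neg, Pi.neg_apply]
  push_cast
  simp

lemma norm_expMode (ℓ : Fin n → ℤ) (φ : Fin n → ℂ) :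
    ‖expMode ℓ φ‖ = Real.exp (-∑ i, (ℓ i : ℝ) * (φ i).im) := by
  rw [expMode, Complex.norm_exp]
  simp

lemma conj_expMode (ℓ : Fin n → ℤ) (φ : Fin n → ℂ) :
    (starRingEnd ℂ) (expMode ℓ φ) = expMode (-ℓ) fun i => (starRingEnd ℂ) (φ i) := by
  simp only [expMode, ← Complex.exp_conj, map_mul, Complex.conj_I, map_sum, Pi.neg_apply]
  congr 1
  push_cast
  simp [Finset.mul_sum]

lemma norm_expMode_realAngle (ℓ : Fin n → ℤ) (θ : Fin n → ℝ) : ‖expMode ℓ (realAngle θ)‖ = 1 := by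
  simp [norm_expMode, realAngle]

lemma intNorm_nonneg (ℓ : Fin n → ℤ) : 0 ≤ intNorm ℓ := Finset.sum_nonneg fun _ _ => abs_nonneg _

lemma norm_expMode_le {s : ℝ} {φ : Fin n → ℂ} (hφ : φ ∈ strip n s) (ℓ : Fin n → ℤ) :
    ‖expMode ℓ φ‖ ≤ Real.exp (s * intNorm ℓ) := by
  rw [norm_expMode, intNorm, Finset.mul_sum, ← Finset.sum_neg_distrib]
  gcongr with i
  calc -((ℓ i : ℝ) * (φ i).im) ≤ |(ℓ i : ℝ) * (φ i).im| := neg_le_abs _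
    _ = |(φ i).im| * |(ℓ i : ℝ)| := by rw [abs_mul, mul_comm]
    _ ≤ s * |(ℓ i : ℝ)| := by gcongr; exact (hφ i).le

lemma differentiable_expMode (ℓ : Fin n → ℤ) : Differentiable ℂ (expMode ℓ) := by
  unfold expMode; fun_prop

lemma torusCoeff_eq_integral_expMode (f : (Fin n → ℂ) → ℂ) (ℓ : Fin n → ℤ) :
    torusCoeff f ℓ = (2 * (Real.pi : ℂ))⁻¹ ^ n *
      ∫ θ in Icc (0 : Fin n → ℝ) (fun _ => 2 * Real.pi),
        f (realAngle θ) * expMode (-ℓ) (realAngle θ) := by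
  rw [torusCoeff]
  congr 1
  refine integral_congr_ae (.of_forall fun θ => ?_)
  simp only [expMode, Pi.neg_apply, Int.cast_neg, neg_mul, Finset.sum_neg_distrib, mul_neg]
  rfl

lemma toTorus_coe_expMode (ℓ : Fin n → ℤ) (x : Fin n → ℝ) :
    mFourier ℓ (fun i => (x i : UnitAddCircle)) = expMode ℓ (realAngle fun i => 2 * Real.pi * x i) := by
  simp only [mFourier, ContinuousMap.coe_mk, fourier_coe_apply, ← Complex.exp_sum, expMode,
    realAngle, Finset.mul_sum]
  congr 1
  refine Finset.sum_congr rfl fun i _ => ?_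
  push_cast; ring

lemma continuous_realAngle : Continuous (realAngle (n := n)) := by
  unfold realAngle; fun_prop

lemma realAngle_add (θ θ' : Fin n → ℝ) : realAngle (θ + θ') = realAngle θ + realAngle θ' := by
  ext i; simp [realAngle]

lemma realAngle_add_mem_strip {s : ℝ} {ζ : Fin n → ℂ} (hζ : ζ ∈ strip n s) (θ : Fin n → ℝ) :
    realAngle θ + ζ ∈ strip n s := by
  intro i
  have := hζ i
  simpa [realAngle] using this

lemma IsCoeffFun.continuous_slice {s : ℝ} {f : (Fin n → ℂ) → ℂ} (hf : IsCoeffFun s f)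
    {ζ : Fin n → ℂ} (hζ : ζ ∈ strip n s) : Continuous fun θ : Fin n → ℝ => f (realAngle θ + ζ) :=
  hf.analytic.continuousOn.comp_continuous (continuous_realAngle.add continuous_const)
    fun θ => realAngle_add_mem_strip hζ θ

lemma IsCoeffFun.periodic_slice {s : ℝ} {f : (Fin n → ℂ) → ℂ} (hf : IsCoeffFun s f)
    {ζ : Fin n → ℂ} (hζ : ζ ∈ strip n s) (θ : Fin n → ℝ) (ℓ : Fin n → ℤ) :
    f (realAngle θ + angleShift ℓ + ζ) = f (realAngle θ + ζ) := by
  rw [add_right_comm, hf.periodic _ (realAngle_add_mem_strip hζ θ)]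

lemma zero_mem_strip {s : ℝ} (hs : 0 < s) : (0 : Fin n → ℂ) ∈ strip n s := by
  intro i; simpa using hs

lemma IsCoeffFun.continuous_real {s : ℝ} (hs : 0 < s) {f : (Fin n → ℂ) → ℂ}
    (hf : IsCoeffFun s f) : Continuous fun θ : Fin n → ℝ => f (realAngle θ) := by
  simpa using hf.continuous_slice (zero_mem_strip hs)

/-- Real translations multiply Fourier coefficients by a phase. -/
lemma torusCoeff_translate_real {f : (Fin n → ℂ) → ℂ}
    (hf : ∀ θ : Fin n → ℝ, ∀ ℓ, f (realAngle θ + angleShift ℓ) = f (realAngle θ))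
    (τ : Fin n → ℝ) (ℓ : Fin n → ℤ) :
    torusCoeff (fun φ => f (φ + realAngle τ)) ℓ = torusCoeff f ℓ * expMode ℓ (realAngle τ) := by
  set y : UnitAddTorus (Fin n) := fun i => ((τ i / (2 * Real.pi) : ℝ) : UnitAddCircle) with hy
  have hpi : (2 * Real.pi) ≠ 0 := by positivity
  have hf' : ∀ θ : Fin n → ℝ, ∀ ℓ, (fun φ => f (φ + realAngle τ)) (realAngle θ + angleShift ℓ) =
      (fun φ => f (φ + realAngle τ)) (realAngle θ) := by
    intro θ ℓ
    simp only
    rw [add_right_comm, ← realAngle_add, hf]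
  have hτ : ∀ x : Fin n → ℝ, (realAngle fun i => 2 * Real.pi * x i) + realAngle τ =
      realAngle fun i => 2 * Real.pi * (x i + τ i / (2 * Real.pi)) := by
    intro x
    rw [← realAngle_add]
    congr 1
    ext i
    simp only [Pi.add_apply]
    field_simp
  have h1 : ∀ t, mFourier (-ℓ) t • toTorus (fun φ => f (φ + realAngle τ)) t =
      expMode ℓ (realAngle τ) * (mFourier (-ℓ) (t + y) • toTorus f (t + y)) := by
    intro t
    obtain ⟨x, rfl⟩ := isOpenQuotientMap_coe_torus.surjective t
    have hxy : (fun i => (x i : UnitAddCircle)) + y =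
        fun i => ((x i + τ i / (2 * Real.pi) : ℝ) : UnitAddCircle) := by
      ext i; simp [hy]
    simp only
    rw [hxy, toTorus_coe hf', toTorus_coe hf, toTorus_coe_expMode, toTorus_coe_expMode]
    simp only [smul_eq_mul]
    rw [← hτ, expMode_add, expMode_neg ℓ (realAngle τ)]
    field_simp [expMode_ne_zero]
  rw [torusCoeff_eq_mFourierCoeff, torusCoeff_eq_mFourierCoeff, mFourierCoeff]
  simp_rw [h1]
  rw [integral_const_mul, integral_add_right_eq_self
    (fun t => mFourier (-ℓ) t • toTorus f t) y, mul_comm, mFourierCoeff]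

/-- Complex translations multiply Fourier coefficients by the exponential: the shift of the
contour, by analytic continuation from real translations. -/
theorem IsCoeffFun.torusCoeff_translate {s : ℝ} (hs : 0 < s) {f : (Fin n → ℂ) → ℂ}
    (hf : IsCoeffFun s f) {ζ : Fin n → ℂ} (hζ : ζ ∈ strip n s) (ℓ : Fin n → ℤ) :
    torusCoeff (fun φ => f (φ + ζ)) ℓ = torusCoeff f ℓ * expMode ℓ ζ := by
  set G : (Fin n → ℂ) → ℂ := fun ζ =>
    torusCoeff (fun φ => f (φ + ζ)) ℓ - torusCoeff f ℓ * expMode ℓ ζ with hG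
  have hGd : DifferentiableOn ℂ G (strip n s) := by
    refine DifferentiableOn.sub ?_ ((differentiable_expMode ℓ).const_mul _).differentiableOn
    simp only [torusCoeff_eq_integral_expMode]
    refine DifferentiableOn.const_mul ?_ _
    refine differentiableOn_setIntegral isCompact_Icc measurableSet_Icc (isOpen_strip n s)
      (f := fun ζ θ => f (realAngle θ + ζ) * expMode (-ℓ) (realAngle θ)) ?_ ?_
    · refine ContinuousOn.mul ?_ ?_
      · exact hf.analytic.continuousOn.comp
          ((continuous_realAngle.comp continuous_snd).add continuous_fst).continuousOn
          fun p hp => realAngle_add_mem_strip hp.1 p.2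
      · exact ((differentiable_expMode _).continuous.comp
          (continuous_realAngle.comp continuous_snd)).continuousOn
    · intro θ _ ζ hζ
      have h1 : DifferentiableAt ℂ f (realAngle θ + ζ) :=
        (hf.analytic _ (realAngle_add_mem_strip hζ θ)).differentiableAt
      exact ((h1.comp ζ (by fun_prop)).mul_const _).differentiableWithinAt
  have hre : ∀ τ : Fin n → ℝ, G (realAngle τ) = 0 := fun τ =>
    sub_eq_zero.2 (torusCoeff_translate_real (hf.periodic_real hs) τ ℓ)
  have hdecomp : (fun i => ((ζ i).re : ℂ)) + Complex.I • (fun i => ((ζ i).im : ℂ)) = ζ := by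
    ext i
    simp only [Pi.add_apply, Pi.smul_apply, smul_eq_mul]
    rw [mul_comm]; exact Complex.re_add_im _
  have h := eq_zero_of_eq_zero_on_real_line (isOpen_strip n s) (convex_strip n s) hGd
    (u := fun i => ((ζ i).re : ℂ)) (v := fun i => ((ζ i).im : ℂ))
    (realAngle_mem_strip hs fun i => (ζ i).re) (by rw [hdecomp]; exact hζ) (by
      intro t _
      convert hre fun i => (ζ i).re + t * (ζ i).im using 2
      ext i; simp [realAngle])
  rw [hdecomp] at h
  exact sub_eq_zero.1 h

lemma IsCoeffFun.exists_bound {s s' : ℝ} (hss : s' < s) {f : (Fin n → ℂ) → ℂ}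
    (hf : IsCoeffFun s f) : ∃ M, ∀ φ ∈ strip n s', ‖f φ‖ ≤ M := by
  -- A function of the angles is a function on the phase space without elliptic directions.
  obtain ⟨M, hM⟩ := exists_bound_of_periodic (n := n) (m := 0) (T := fun x => f x.2.1)
    (r := 2) (r' := 1) (ρ := 2) (ρ' := 1) (by norm_num) (by norm_num) hss (by norm_num)
    (by norm_num)
    (hf.analytic.continuousOn.comp (by fun_prop) fun x hx => hx.2.1)
    fun x hx ℓ => hf.periodic _ hx.2.1 ℓ
  refine ⟨M, fun φ hφ => hM (0, φ, 0, 0) ⟨by simp, hφ, by simp⟩⟩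

lemma norm_torusCoeff_le {f : (Fin n → ℂ) → ℂ} {M : ℝ} (hM : ∀ θ, ‖f (realAngle θ)‖ ≤ M)
    (ℓ : Fin n → ℤ) : ‖torusCoeff f ℓ‖ ≤ M := by
  rw [torusCoeff_eq_mFourierCoeff, mFourierCoeff]
  have := norm_integral_le_of_norm_le_const (μ := (volume : Measure (UnitAddTorus (Fin n))))
    (f := fun t => mFourier (-ℓ) t • toTorus f t) (C := M) (.of_forall fun t => by
      rw [norm_smul, norm_mFourier_apply, one_mul]
      exact hM _)
  simpa using this

/-- Exponential decay at every rate smaller than the width `s` of the strip. -/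
def ExpDecay (s : ℝ) (c : (Fin n → ℤ) → ℂ) : Prop :=
  ∀ σ, 0 < σ → σ < s → ∃ C, ∀ ℓ, ‖c ℓ‖ ≤ C * Real.exp (-(σ * intNorm ℓ))

/-- The Paley-Wiener estimate: shifting the torus of integration to the imaginary height `σ` gains
the factor `e^{-σ|ℓ|}`. -/
theorem IsCoeffFun.expDecay {s : ℝ} {f : (Fin n → ℂ) → ℂ} (hf : IsCoeffFun s f) :
    ExpDecay s (torusCoeff f) := by
  intro σ hσ hσs
  have hs : 0 < s := hσ.trans hσs
  obtain ⟨M, hM⟩ := hf.exists_bound (s' := (σ + s) / 2) (by linarith)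
  refine ⟨M, fun ℓ => ?_⟩
  -- The imaginary shift that makes the exponential as small as possible.
  set ζ : Fin n → ℂ := fun i => -(σ * SignType.sign (ℓ i : ℝ) : ℝ) * Complex.I with hζ
  have hsign : ∀ x : ℝ, |((SignType.sign x : SignType) : ℝ)| ≤ 1 := by
    intro x
    rcases lt_trichotomy x 0 with h | h | h <;> simp [h]
  have him : ∀ i, (ζ i).im = -(σ * SignType.sign (ℓ i : ℝ)) := by intro i; simp [hζ]
  have hζmem : ζ ∈ strip n ((σ + s) / 2) := by
    intro i
    rw [him, abs_neg, abs_mul, abs_of_pos hσ]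
    nlinarith [hsign (ℓ i : ℝ)]
  have h1 := hf.torusCoeff_translate hs (strip_mono (by linarith) hζmem) ℓ
  have h2 : ‖expMode ℓ ζ‖ = Real.exp (σ * intNorm ℓ) := by
    rw [norm_expMode, intNorm, Finset.mul_sum, ← Finset.sum_neg_distrib]
    congr 1
    refine Finset.sum_congr rfl fun i _ => ?_
    rw [him, ← self_mul_sign (ℓ i : ℝ)]
    ring
  have h3 : ‖torusCoeff (fun φ => f (φ + ζ)) ℓ‖ ≤ M :=
    norm_torusCoeff_le (f := fun φ => f (φ + ζ))
      (fun θ => hM _ (realAngle_add_mem_strip hζmem θ)) ℓ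
  rw [h1, norm_mul, h2] at h3
  rw [Real.exp_neg, ← div_eq_mul_inv, le_div_iff₀ (Real.exp_pos _)]
  exact h3

lemma summable_exp_neg_intNorm {δ : ℝ} (hδ : 0 < δ) :
    Summable fun ℓ : Fin n → ℤ => Real.exp (-(δ * intNorm ℓ)) := by
  have h1 : Summable fun k : ℤ => Real.exp (-(δ * |(k : ℝ)|)) := by
    have hgeo : Summable fun k : ℕ => Real.exp (-δ) ^ k :=
      summable_geometric_of_lt_one (Real.exp_pos _).le (by simpa using hδ)
    have hnat : Summable fun k : ℕ => Real.exp (-(δ * |((k : ℤ) : ℝ)|)) := by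
      refine hgeo.congr fun k => ?_
      rw [← Real.exp_nat_mul]
      congr 1
      simp; ring
    refine Summable.of_nat_of_neg hnat ?_
    refine hnat.congr fun k => ?_
    simp
  induction n with
  | zero => exact Summable.of_finite
  | succ n ih =>
    have h2 := h1.mul_of_nonneg ih (fun _ => (Real.exp_pos _).le) fun _ => (Real.exp_pos _).le
    refine ((Fin.consEquiv fun _ => ℤ).symm.summable_iff.2 h2).congr fun ℓ => ?_
    simp only [Function.comp_apply, Fin.consEquiv_symm_apply, intNorm, ← Real.exp_add,
      Fin.sum_univ_succ, mul_add, neg_add, Fin.tail]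

lemma ExpDecay.exists_pos_bound {s : ℝ} {c : (Fin n → ℤ) → ℂ} (hc : ExpDecay s c) {σ : ℝ}
    (hσ : 0 < σ) (hσs : σ < s) : ∃ C, 0 ≤ C ∧ ∀ ℓ, ‖c ℓ‖ ≤ C * Real.exp (-(σ * intNorm ℓ)) := by
  obtain ⟨C, hC⟩ := hc σ hσ hσs
  exact ⟨|C|, abs_nonneg C, fun ℓ => (hC ℓ).trans (by gcongr; exact le_abs_self C)⟩

/-- A polynomially bounded factor does not destroy the exponential decay. -/
lemma ExpDecay.mul_of_bound {s : ℝ} {c d : (Fin n → ℤ) → ℂ} (hc : ExpDecay s c)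
    (hd : ∀ δ > 0, ∃ D, ∀ ℓ, ‖d ℓ‖ ≤ D * Real.exp (δ * intNorm ℓ)) :
    ExpDecay s fun ℓ => d ℓ * c ℓ := by
  intro σ hσ hσs
  obtain ⟨C, hC0, hC⟩ := hc.exists_pos_bound (σ := (σ + s) / 2) (by linarith) (by linarith)
  obtain ⟨D, hD⟩ := hd ((s - σ) / 2) (by linarith)
  refine ⟨D * C, fun ℓ => ?_⟩
  have hD' : 0 ≤ D * Real.exp ((s - σ) / 2 * intNorm ℓ) := (norm_nonneg _).trans (hD ℓ)
  calc ‖d ℓ * c ℓ‖ = ‖d ℓ‖ * ‖c ℓ‖ := norm_mul _ _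
    _ ≤ (D * Real.exp ((s - σ) / 2 * intNorm ℓ)) *
        (C * Real.exp (-((σ + s) / 2 * intNorm ℓ))) := by gcongr; exacts [hD ℓ, hC ℓ]
    _ = D * C * (Real.exp ((s - σ) / 2 * intNorm ℓ) * Real.exp (-((σ + s) / 2 * intNorm ℓ))) := by
      ring
    _ = D * C * Real.exp (-(σ * intNorm ℓ)) := by rw [← Real.exp_add]; congr 2; ring

lemma intNorm_le_exp {δ : ℝ} (hδ : 0 < δ) (ℓ : Fin n → ℤ) :
    intNorm ℓ ≤ δ⁻¹ * Real.exp (δ * intNorm ℓ) := by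
  have := Real.add_one_le_exp (δ * intNorm ℓ)
  rw [inv_mul_eq_div, le_div_iff₀ hδ]
  linarith

/-- The sum of a Fourier series. -/
def fourierSum (c : (Fin n → ℤ) → ℂ) (φ : Fin n → ℂ) : ℂ := ∑' ℓ, c ℓ * expMode ℓ φ

lemma exists_lt_mem_strip {s : ℝ} (hs : 0 < s) {φ : Fin n → ℂ} (hφ : φ ∈ strip n s) :
    ∃ σ, 0 < σ ∧ σ < s ∧ φ ∈ strip n σ := by
  rcases isEmpty_or_nonempty (Fin n) with h | h
  · exact ⟨s / 2, by linarith, by linarith, fun i => (h.false i).elim⟩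
  · obtain ⟨i, hi⟩ := Finite.exists_max fun i => |(φ i).im|
    refine ⟨(|(φ i).im| + s) / 2, ?_, by linarith [hφ i], fun j => ?_⟩
    · linarith [abs_nonneg (φ i).im]
    · linarith [hi j, hφ i]

lemma ExpDecay.summable_mul_expMode {s : ℝ} {c : (Fin n → ℤ) → ℂ} (hs : 0 < s) (hc : ExpDecay s c)
    {φ : Fin n → ℂ} (hφ : φ ∈ strip n s) : Summable fun ℓ => ‖c ℓ * expMode ℓ φ‖ := by
  obtain ⟨σ, hσ, hσs, hσφ⟩ := exists_lt_mem_strip hs hφ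
  obtain ⟨C, hC0, hC⟩ := hc.exists_pos_bound (σ := (σ + s) / 2) (by linarith) (by linarith)
  refine ((summable_exp_neg_intNorm (n := n) (δ := (s - σ) / 2) (by linarith)).mul_left
    C).of_nonneg_of_le (fun _ => norm_nonneg _) fun ℓ => ?_
  rw [norm_mul]
  calc ‖c ℓ‖ * ‖expMode ℓ φ‖ ≤ (C * Real.exp (-((σ + s) / 2 * intNorm ℓ))) *
        Real.exp (σ * intNorm ℓ) := by gcongr; exacts [hC ℓ, norm_expMode_le hσφ ℓ]
    _ = C * (Real.exp (-((σ + s) / 2 * intNorm ℓ)) * Real.exp (σ * intNorm ℓ)) := by ring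
    _ = _ := by rw [← Real.exp_add]; congr 2; ring

lemma ExpDecay.hasSum {s : ℝ} {c : (Fin n → ℤ) → ℂ} (hs : 0 < s) (hc : ExpDecay s c)
    {φ : Fin n → ℂ} (hφ : φ ∈ strip n s) :
    HasSum (fun ℓ => c ℓ * expMode ℓ φ) (fourierSum c φ) :=
  (hc.summable_mul_expMode hs hφ).of_norm.hasSum

/-- Every coefficient function is the sum of its Fourier series on the whole strip. -/
theorem IsCoeffFun.hasSum {s : ℝ} (hs : 0 < s) {f : (Fin n → ℂ) → ℂ} (hf : IsCoeffFun s f)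
    {φ : Fin n → ℂ} (hφ : φ ∈ strip n s) :
    HasSum (fun ℓ => torusCoeff f ℓ * expMode ℓ φ) (f φ) := by
  have hper : ∀ θ : Fin n → ℝ, ∀ ℓ, (fun ψ => f (ψ + φ)) (realAngle θ + angleShift ℓ) =
      (fun ψ => f (ψ + φ)) (realAngle θ) := fun θ ℓ => hf.periodic_slice hφ θ ℓ
  let g : C(UnitAddTorus (Fin n), ℂ) :=
    ⟨toTorus fun ψ => f (ψ + φ), continuous_toTorus hper (hf.continuous_slice hφ)⟩
  have hcoef : ∀ ℓ, mFourierCoeff g ℓ = torusCoeff f ℓ * expMode ℓ φ := fun ℓ => by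
    rw [← hf.torusCoeff_translate hs hφ, torusCoeff_eq_mFourierCoeff]; rfl
  have h := hasSum_mFourier_series_apply_of_summable (f := g)
    ((hf.expDecay.summable_mul_expMode hs hφ).of_norm.congr fun ℓ => (hcoef ℓ).symm) (0 : UnitAddTorus (Fin n))
  simp only [hcoef] at h
  have h0 : ((0 : UnitAddTorus (Fin n))) = fun i => (((0 : Fin n → ℝ) i : ℝ) : UnitAddCircle) := by
    ext i; simp
  have h1 : g 0 = f φ := by
    change toTorus (fun ψ => f (ψ + φ)) 0 = f φ
    rw [h0, toTorus_coe hper]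
    congr 1
    ext i; simp [realAngle]
  have h2 : ∀ ℓ, mFourier ℓ (0 : UnitAddTorus (Fin n)) = 1 := fun ℓ => by
    rw [h0, toTorus_coe_expMode]; simp [expMode, realAngle]
  simpa only [h1, h2, smul_eq_mul, mul_one] using h

/-- The derivative of the exponential mode. -/
def expModeDeriv (ℓ : Fin n → ℤ) (φ : Fin n → ℂ) : (Fin n → ℂ) →L[ℂ] ℂ :=
  (Complex.I * expMode ℓ φ) • ∑ i, (ℓ i : ℂ) • ContinuousLinearMap.proj (R := ℂ) (φ := fun _ => ℂ) i

lemma hasFDerivAt_expMode (ℓ : Fin n → ℤ) (φ : Fin n → ℂ) :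
    HasFDerivAt (expMode ℓ) (expModeDeriv ℓ φ) φ := by
  have h1 : HasFDerivAt (fun φ : Fin n → ℂ => ∑ i, (ℓ i : ℂ) * φ i)
      (∑ i, (ℓ i : ℂ) • ContinuousLinearMap.proj (R := ℂ) (φ := fun _ => ℂ) i) φ := by
    refine HasFDerivAt.fun_sum fun i _ => ?_
    exact (hasFDerivAt_apply i φ).const_mul _
  have h2 := (h1.const_mul Complex.I).cexp
  convert! h2 using 1
  rw [expModeDeriv, smul_smul, mul_comm]; rfl

lemma norm_expModeDeriv_le (ℓ : Fin n → ℤ) (φ : Fin n → ℂ) :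
    ‖expModeDeriv ℓ φ‖ ≤ intNorm ℓ * ‖expMode ℓ φ‖ := by
  rw [expModeDeriv, norm_smul, norm_mul, Complex.norm_I, one_mul, mul_comm]
  gcongr
  refine (norm_sum_le _ _).trans (Finset.sum_le_sum fun i _ => ?_)
  rw [norm_smul, Complex.norm_intCast]
  refine mul_le_of_le_one_right (abs_nonneg _) ?_
  exact ContinuousLinearMap.opNorm_le_bound _ zero_le_one fun x => by
    simpa using norm_le_pi_norm x i

/-- Fourier series with exponentially decaying coefficients are differentiated term by term. -/
theorem ExpDecay.hasFDerivAt {s : ℝ} {c : (Fin n → ℤ) → ℂ} (hs : 0 < s) (hc : ExpDecay s c)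
    {φ : Fin n → ℂ} (hφ : φ ∈ strip n s) :
    HasFDerivAt (fourierSum c) (∑' ℓ, c ℓ • expModeDeriv ℓ φ) φ := by
  obtain ⟨σ, hσ, hσs, hσφ⟩ := exists_lt_mem_strip hs hφ
  -- Decay at the rate `(σ + s) / 2` exceeds the growth of the modes on the strip of width `σ` by
  -- `(s - σ) / 2`: one half of it absorbs the factor `|ℓ|`, the other one gives summability.
  obtain ⟨C, hC0, hC⟩ := hc.exists_pos_bound (σ := (σ + s) / 2) (by linarith) (by linarith)
  have hδ : 0 < (s - σ) / 4 := by linarith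
  refine hasFDerivAt_tsum_of_isPreconnected (f := fun ℓ φ => c ℓ * expMode ℓ φ)
    (f' := fun ℓ φ => c ℓ • expModeDeriv ℓ φ)
    (u := fun ℓ => C * ((s - σ) / 4)⁻¹ * Real.exp (-((s - σ) / 4 * intNorm ℓ)))
    ((summable_exp_neg_intNorm hδ).mul_left _) (isOpen_strip n σ) (convex_strip n σ).isPreconnected
    (fun ℓ ψ _ => (hasFDerivAt_expMode ℓ ψ).const_mul _) (fun ℓ ψ hψ => ?_) hσφ
    (hc.summable_mul_expMode hs hφ).of_norm hσφ
  rw [norm_smul]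
  calc ‖c ℓ‖ * ‖expModeDeriv ℓ ψ‖ ≤ (C * Real.exp (-((σ + s) / 2 * intNorm ℓ))) *
        ((((s - σ) / 4)⁻¹ * Real.exp ((s - σ) / 4 * intNorm ℓ)) * Real.exp (σ * intNorm ℓ)) := by
        gcongr
        · exact hC ℓ
        · refine (norm_expModeDeriv_le ℓ ψ).trans ?_
          gcongr
          · exact intNorm_le_exp hδ ℓ
          · exact norm_expMode_le hψ ℓ
    _ = C * ((s - σ) / 4)⁻¹ * (Real.exp (-((σ + s) / 2 * intNorm ℓ)) *
        Real.exp ((s - σ) / 4 * intNorm ℓ) * Real.exp (σ * intNorm ℓ)) := by ring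
    _ = _ := by rw [← Real.exp_add, ← Real.exp_add]; congr 2; ring

/-- Converse of `IsCoeffFun.expDecay`, on the same strip. -/
theorem ExpDecay.isCoeffFun {s : ℝ} {c : (Fin n → ℤ) → ℂ} (hs : 0 < s) (hc : ExpDecay s c) :
    IsCoeffFun s (fourierSum c) where
  analytic := analyticOnNhd_of_differentiableOn (isOpen_strip n s) fun _ hφ =>
    (hc.hasFDerivAt hs hφ).differentiableAt.differentiableWithinAt
  periodic φ _ k := by
    simp only [fourierSum, expMode_add, expMode_angleShift, mul_one]

/-- The Fourier coefficients of a sum of modes. -/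
theorem ExpDecay.torusCoeff_fourierSum {s : ℝ} {c : (Fin n → ℤ) → ℂ} (hs : 0 < s)
    (hc : ExpDecay s c) (ℓ : Fin n → ℤ) : torusCoeff (fourierSum c) ℓ = c ℓ := by
  rw [torusCoeff_eq_mFourierCoeff]
  have h0 := hc.summable_mul_expMode hs (zero_mem_strip hs)
  have hn : Summable fun ℓ => ‖c ℓ‖ := by
    refine h0.congr fun ℓ => ?_
    simp [expMode]
  have h1 := hasSum_mFourierCoeff (k := id) hn (f := toTorus (fourierSum c)) (by
    intro t
    obtain ⟨x, rfl⟩ := isOpenQuotientMap_coe_torus.surjective t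
    simp only [id, toTorus_coe_expMode]
    rw [toTorus_coe fun θ k => (hc.isCoeffFun hs).periodic_real hs θ k]
    exact hc.hasSum hs (realAngle_mem_strip hs _)) ℓ
  refine h1.unique ((hasSum_ite_eq ℓ (c ℓ)).congr_fun fun k => ?_)
  by_cases h : k = ℓ <;> simp [h]

/-- The partial derivative with respect to the angle `φ_i`. -/
def angleDeriv (i : Fin n) (f : (Fin n → ℂ) → ℂ) (φ : Fin n → ℂ) : ℂ :=
  fderiv ℂ f φ (Pi.single i 1)

lemma IsCoeffFun.fderiv_shift {s : ℝ} {f : (Fin n → ℂ) → ℂ} (hf : IsCoeffFun s f) {φ : Fin n → ℂ}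
    (hφ : φ ∈ strip n s) (ℓ : Fin n → ℤ) : fderiv ℂ f (φ + angleShift ℓ) = fderiv ℂ f φ := by
  rw [← fderiv_comp_add_right]
  refine Filter.EventuallyEq.fderiv_eq ?_
  filter_upwards [(isOpen_strip n s).mem_nhds hφ] with ψ hψ using hf.periodic ψ hψ ℓ

lemma IsCoeffFun.angleDeriv {s : ℝ} {f : (Fin n → ℂ) → ℂ} (hf : IsCoeffFun s f) (i : Fin n) :
    IsCoeffFun s (angleDeriv i f) where
  analytic φ hφ := by
    have := (hf.analytic φ hφ).fderiv
    exact (ContinuousLinearMap.analyticAt (ContinuousLinearMap.apply ℂ ℂ (Pi.single i 1)) _).comp this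
  periodic φ hφ ℓ := by rw [_root_.angleDeriv, hf.fderiv_shift hφ, _root_.angleDeriv]

lemma ExpDecay.angleDeriv_fourierSum {s : ℝ} {c : (Fin n → ℤ) → ℂ} (hs : 0 < s) (hc : ExpDecay s c)
    (i : Fin n) {φ : Fin n → ℂ} (hφ : φ ∈ strip n s) :
    angleDeriv i (fourierSum c) φ = fourierSum (fun ℓ => Complex.I * ℓ i * c ℓ) φ := by
  have hsum : Summable fun ℓ => c ℓ • expModeDeriv ℓ φ := by
    have hc' : ExpDecay s fun ℓ => (intNorm ℓ : ℂ) * c ℓ := hc.mul_of_bound fun δ hδ =>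
      ⟨δ⁻¹, fun ℓ => by
        rw [Complex.norm_real, Real.norm_of_nonneg (intNorm_nonneg ℓ)]
        exact intNorm_le_exp hδ ℓ⟩
    refine Summable.of_norm ((hc'.summable_mul_expMode hs hφ).of_nonneg_of_le
      (fun _ => norm_nonneg _) fun ℓ => ?_)
    rw [norm_smul, norm_mul, norm_mul, Complex.norm_real, Real.norm_of_nonneg (intNorm_nonneg ℓ)]
    calc ‖c ℓ‖ * ‖expModeDeriv ℓ φ‖ ≤ ‖c ℓ‖ * (intNorm ℓ * ‖expMode ℓ φ‖) := by
          gcongr; exact norm_expModeDeriv_le ℓ φ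
      _ = _ := by ring
  rw [angleDeriv, (hc.hasFDerivAt hs hφ).fderiv]
  have := (ContinuousLinearMap.apply ℂ ℂ (Pi.single i (1 : ℂ))).map_tsum hsum
  simp only [ContinuousLinearMap.apply_apply] at this
  rw [this, fourierSum]
  refine tsum_congr fun ℓ => ?_
  simp [expModeDeriv, Pi.single_apply]
  ring

lemma expDecay_intCoord_mul {s : ℝ} {c : (Fin n → ℤ) → ℂ} (hc : ExpDecay s c) (i : Fin n) :
    ExpDecay s fun ℓ => Complex.I * ℓ i * c ℓ :=
  hc.mul_of_bound fun δ hδ => ⟨δ⁻¹, fun ℓ => by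
    rw [norm_mul, Complex.norm_I, one_mul, Complex.norm_intCast]
    refine le_trans ?_ (intNorm_le_exp hδ ℓ)
    exact Finset.single_le_sum (f := fun i => |(ℓ i : ℝ)|) (fun _ _ => abs_nonneg _)
      (Finset.mem_univ i)⟩

lemma torusCoeff_congr {s : ℝ} (hs : 0 < s) {f g : (Fin n → ℂ) → ℂ} (h : EqOn f g (strip n s))
    (ℓ : Fin n → ℤ) : torusCoeff f ℓ = torusCoeff g ℓ := by
  simp only [torusCoeff_eq_integral_expMode]
  congr 2
  ext θ
  rw [h (realAngle_mem_strip hs θ)]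

lemma IsCoeffFun.eqOn_fourierSum {s : ℝ} (hs : 0 < s) {f : (Fin n → ℂ) → ℂ} (hf : IsCoeffFun s f) :
    EqOn f (fourierSum (torusCoeff f)) (strip n s) := fun _ hφ => (hf.hasSum hs hφ).tsum_eq.symm

lemma angleDeriv_congr {s : ℝ} {f g : (Fin n → ℂ) → ℂ} (h : EqOn f g (strip n s)) (i : Fin n) :
    EqOn (angleDeriv i f) (angleDeriv i g) (strip n s) := fun φ hφ => by
  rw [angleDeriv, angleDeriv, Filter.EventuallyEq.fderiv_eq
    (h.eventuallyEq_of_mem ((isOpen_strip n s).mem_nhds hφ))]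

lemma IsCoeffFun.torusCoeff_angleDeriv {s : ℝ} (hs : 0 < s) {f : (Fin n → ℂ) → ℂ}
    (hf : IsCoeffFun s f) (i : Fin n) (ℓ : Fin n → ℤ) :
    torusCoeff (_root_.angleDeriv i f) ℓ = Complex.I * ℓ i * torusCoeff f ℓ := by
  rw [torusCoeff_congr hs (angleDeriv_congr (hf.eqOn_fourierSum hs) i),
    torusCoeff_congr hs fun φ hφ => hf.expDecay.angleDeriv_fourierSum hs i hφ,
    (expDecay_intCoord_mul hf.expDecay i).torusCoeff_fourierSum hs]

lemma integrableOn_of_continuous_real {f : (Fin n → ℝ) → ℂ} (hf : Continuous f) :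
    IntegrableOn f (Icc (0 : Fin n → ℝ) fun _ => 2 * Real.pi) :=
  hf.continuousOn.integrableOn_compact isCompact_Icc

/-- The average of a product, by Parseval's identity. -/
theorem IsCoeffFun.hasSum_torusCoeff_mul {s : ℝ} (hs : 0 < s) {f g : (Fin n → ℂ) → ℂ}
    (hf : IsCoeffFun s f) (hg : IsCoeffFun s g) :
    HasSum (fun ℓ => torusCoeff f ℓ * torusCoeff g (-ℓ)) (torusCoeff (fun φ => f φ * g φ) 0) := by
  set K : Set (Fin n → ℝ) := Icc (0 : Fin n → ℝ) fun _ => 2 * Real.pi with hK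
  have hn : Summable fun ℓ => ‖torusCoeff f ℓ‖ := by
    refine (hf.expDecay.summable_mul_expMode hs (zero_mem_strip hs)).congr fun ℓ => ?_
    simp [expMode]
  have hgc := hg.continuous_real hs
  have hc : ∀ ℓ, Continuous fun θ => torusCoeff f ℓ * (expMode ℓ (realAngle θ) * g (realAngle θ)) :=
    fun ℓ => continuous_const.mul
      (((differentiable_expMode ℓ).continuous.comp continuous_realAngle).mul hgc)
  have h := hasSum_integral_of_summable_integral_norm (μ := volume.restrict K)
    (F := fun ℓ θ => torusCoeff f ℓ * (expMode ℓ (realAngle θ) * g (realAngle θ)))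
    (fun ℓ => integrableOn_of_continuous_real (hc ℓ)) (by
      have : ∀ ℓ, ∫ θ in K, ‖torusCoeff f ℓ * (expMode ℓ (realAngle θ) * g (realAngle θ))‖ =
          ‖torusCoeff f ℓ‖ * ∫ θ in K, ‖g (realAngle θ)‖ := fun ℓ => by
        simp only [norm_mul, norm_expMode_realAngle, one_mul, integral_const_mul]
      simp only [this]
      exact hn.mul_right _)
  have h2 := h.mul_left ((2 * (Real.pi : ℂ))⁻¹ ^ n)
  have e1 : (2 * (Real.pi : ℂ))⁻¹ ^ n *
      ∫ θ in K, ∑' ℓ, torusCoeff f ℓ * (expMode ℓ (realAngle θ) * g (realAngle θ)) =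
      torusCoeff (fun φ => f φ * g φ) 0 := by
    rw [torusCoeff_eq_integral_expMode]
    congr 2
    ext θ
    have := ((hf.hasSum hs (realAngle_mem_strip hs θ)).mul_right (g (realAngle θ))).tsum_eq
    simp only [← mul_assoc]
    rw [this]
    simp [expMode]
  rw [e1] at h2
  refine h2.congr_fun fun ℓ => ?_
  rw [torusCoeff_eq_integral_expMode g, neg_neg, integral_const_mul]
  simp only [mul_comm (g _)]
  ring

lemma IsCoeffFun.torusCoeff_add {s : ℝ} (hs : 0 < s) {f g : (Fin n → ℂ) → ℂ}
    (hf : IsCoeffFun s f) (hg : IsCoeffFun s g) (ℓ : Fin n → ℤ) :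
    torusCoeff (fun φ => f φ + g φ) ℓ = torusCoeff f ℓ + torusCoeff g ℓ := by
  have hc : Continuous fun θ => expMode (-ℓ) (realAngle θ) :=
    (differentiable_expMode (-ℓ)).continuous.comp continuous_realAngle
  simp only [torusCoeff_eq_integral_expMode, add_mul]
  rw [← mul_add]
  congr 1
  exact integral_add (integrableOn_of_continuous_real ((hf.continuous_real hs).mul hc))
    (integrableOn_of_continuous_real ((hg.continuous_real hs).mul hc))

lemma torusCoeff_const_mul (a : ℂ) (f : (Fin n → ℂ) → ℂ) (ℓ : Fin n → ℤ) :
    torusCoeff (fun φ => a * f φ) ℓ = a * torusCoeff f ℓ := by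
  simp only [torusCoeff_eq_integral_expMode, mul_assoc, integral_const_mul]
  ring

lemma conj_realAngle (θ : Fin n → ℝ) :
    (fun i => (starRingEnd ℂ) (realAngle θ i)) = realAngle θ := by
  ext i; simp [realAngle]

lemma conj_torusCoeff {f g : (Fin n → ℂ) → ℂ}
    (h : ∀ θ, g (realAngle θ) = (starRingEnd ℂ) (f (realAngle θ))) (ℓ : Fin n → ℤ) :
    (starRingEnd ℂ) (torusCoeff f ℓ) = torusCoeff g (-ℓ) := by
  simp only [torusCoeff_eq_integral_expMode, map_mul, map_pow, map_inv₀, map_ofNat,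
    Complex.conj_ofReal, ← integral_conj, conj_expMode, conj_realAngle, h, neg_neg]

end Torus

lemma IsCoeffFun.const (s : ℝ) (a : ℂ) : IsCoeffFun (n := n) s fun _ => a :=
  ⟨analyticOnNhd_const, fun _ _ _ => rfl⟩

lemma IsCoeffFun.add {s : ℝ} {f g : (Fin n → ℂ) → ℂ} (hf : IsCoeffFun s f) (hg : IsCoeffFun s g) :
    IsCoeffFun s fun φ => f φ + g φ :=
  ⟨hf.analytic.add hg.analytic, fun φ hφ ℓ => by rw [hf.periodic φ hφ, hg.periodic φ hφ]⟩

lemma IsCoeffFun.mul {s : ℝ} {f g : (Fin n → ℂ) → ℂ} (hf : IsCoeffFun s f) (hg : IsCoeffFun s g) :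
    IsCoeffFun s fun φ => f φ * g φ :=
  ⟨hf.analytic.mul hg.analytic, fun φ hφ ℓ => by rw [hf.periodic φ hφ, hg.periodic φ hφ]⟩

lemma IsCoeffFun.const_mul {s : ℝ} {f : (Fin n → ℂ) → ℂ} (a : ℂ) (hf : IsCoeffFun s f) :
    IsCoeffFun s fun φ => a * f φ := (IsCoeffFun.const s a).mul hf

lemma IsCoeffFun.sum {ι : Type*} {s : ℝ} (t : Finset ι) {f : ι → (Fin n → ℂ) → ℂ}
    (hf : ∀ i ∈ t, IsCoeffFun s (f i)) : IsCoeffFun s fun φ => ∑ i ∈ t, f i φ :=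
  ⟨Finset.analyticOnNhd_fun_sum t fun i hi => (hf i hi).analytic, fun φ hφ ℓ =>
    Finset.sum_congr rfl fun i hi => (hf i hi).periodic φ hφ ℓ⟩

lemma IsCoeffFun.mono {s s' : ℝ} (h : s' ≤ s) {f : (Fin n → ℂ) → ℂ} (hf : IsCoeffFun s f) :
    IsCoeffFun s' f :=
  ⟨hf.analytic.mono (strip_mono h), fun φ hφ => hf.periodic φ (strip_mono h hφ)⟩

/-! ### Small divisors -/

/-- The divisor `ω·ℓ + Ω·h`. -/
def smallDivisor (ω : Fin n → ℝ) (Ω : Fin m → ℝ) (h : Fin m → ℤ) (ℓ : Fin n → ℤ) : ℂ :=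
  ∑ i, (ω i : ℂ) * (ℓ i : ℂ) + ∑ j, (Ω j : ℂ) * (h j : ℂ)

lemma exists_rpow_le_exp {τ : ℝ} (hτ : 0 < τ) {δ : ℝ} (hδ : 0 < δ) :
    ∃ D, 0 ≤ D ∧ ∀ x : ℝ, 0 ≤ x → 1 + x ^ τ ≤ D * Real.exp (δ * x) := by
  obtain ⟨k, hk⟩ := exists_nat_ge τ
  refine ⟨2 + k.factorial * (δ ^ k)⁻¹, by positivity, fun x hx => ?_⟩
  have h1 : x ^ τ ≤ 1 + x ^ k := by
    rcases le_total x 1 with h | h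
    · have := Real.rpow_le_one hx h hτ.le
      have := pow_nonneg hx k
      linarith
    · have := Real.rpow_le_rpow_of_exponent_le h hk
      rw [Real.rpow_natCast] at this
      linarith
  have h2 : x ^ k ≤ k.factorial * (δ ^ k)⁻¹ * Real.exp (δ * x) := by
    have := Real.pow_div_factorial_le_exp (x := δ * x) (by positivity) k
    rw [div_le_iff₀ (by positivity), mul_pow] at this
    have h3 : 0 < δ ^ k := by positivity
    calc x ^ k = (δ ^ k)⁻¹ * (δ ^ k * x ^ k) := by field_simp
      _ ≤ (δ ^ k)⁻¹ * (Real.exp (δ * x) * k.factorial) := by gcongr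
      _ = _ := by ring
  have h3 : 1 ≤ Real.exp (δ * x) := Real.one_le_exp (by positivity)
  nlinarith

lemma smallDivisor_eq_ofReal (ω : Fin n → ℝ) (Ω : Fin m → ℝ) (h : Fin m → ℤ) (ℓ : Fin n → ℤ) :
    smallDivisor ω Ω h ℓ = ((∑ i, ω i * (ℓ i : ℝ) + ∑ j, Ω j * (h j : ℝ) : ℝ) : ℂ) := by
  simp [smallDivisor]

lemma smallDivisor_neg (ω : Fin n → ℝ) (Ω : Fin m → ℝ) (h : Fin m → ℤ) (ℓ : Fin n → ℤ) :
    smallDivisor ω Ω (-h) (-ℓ) = -smallDivisor ω Ω h ℓ := by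
  simp [smallDivisor]; ring

section Melnikov

variable {ω : Fin n → ℝ} {Ω : Fin m → ℝ} {γ τ s : ℝ}

lemma Melnikov.le_norm (hMel : Melnikov ω Ω γ τ) {h : Fin m → ℤ} (hh : ∑ j, |h j| ≤ 2)
    {ℓ : Fin n → ℤ} (hne : ¬(ℓ = 0 ∧ h = 0)) :
    γ / (1 + intNorm ℓ ^ τ) ≤ ‖smallDivisor ω Ω h ℓ‖ := by
  rw [smallDivisor_eq_ofReal, Complex.norm_real, Real.norm_eq_abs]
  have := hMel ℓ h hh (by tauto)
  simpa [intNorm] using this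

lemma Melnikov.smallDivisor_ne_zero (hγ : 0 < γ) (hMel : Melnikov ω Ω γ τ) {h : Fin m → ℤ}
    (hh : ∑ j, |h j| ≤ 2) {ℓ : Fin n → ℤ} (hne : ¬(ℓ = 0 ∧ h = 0)) : smallDivisor ω Ω h ℓ ≠ 0 := by
  have h1 := hMel.le_norm hh hne
  have h2 : 0 < γ / (1 + intNorm ℓ ^ τ) := by
    have := Real.rpow_nonneg (intNorm_nonneg ℓ) τ
    positivity
  exact norm_pos_iff.1 (h2.trans_le h1)

/-- Fourier coefficients of the solution of the homological equation; the resonant one is `0`. -/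
def homCoeff (ω : Fin n → ℝ) (Ω : Fin m → ℝ) (h : Fin m → ℤ) (c : (Fin n → ℂ) → ℂ)
    (ℓ : Fin n → ℤ) : ℂ :=
  if ℓ = 0 ∧ h = 0 then 0 else Complex.I / smallDivisor ω Ω h ℓ * torusCoeff c ℓ

/-- The solution of the homological equation `ω·∂u + i(Ω·h)u + c = (average of c if h = 0)`. -/
def homSol (ω : Fin n → ℝ) (Ω : Fin m → ℝ) (h : Fin m → ℤ) (c : (Fin n → ℂ) → ℂ) :
    (Fin n → ℂ) → ℂ := fourierSum (homCoeff ω Ω h c)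

/-- Dividing by the small divisors preserves exponential decay at every rate below `s`, because the
divisors are only polynomially small. Hence no width of the strip is lost. -/
theorem expDecay_homCoeff (hγ : 0 < γ) (hτ : 0 < τ) (hMel : Melnikov ω Ω γ τ)
    {h : Fin m → ℤ} (hh : ∑ j, |h j| ≤ 2) {c : (Fin n → ℂ) → ℂ} (hc : IsCoeffFun s c) :
    ExpDecay s (homCoeff ω Ω h c) := by
  have : homCoeff ω Ω h c = fun ℓ =>
      (if ℓ = 0 ∧ h = 0 then 0 else Complex.I / smallDivisor ω Ω h ℓ) * torusCoeff c ℓ := by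
    ext ℓ; rw [homCoeff]; split_ifs <;> simp
  rw [this]
  refine hc.expDecay.mul_of_bound fun δ hδ => ?_
  obtain ⟨D, hD0, hD⟩ := exists_rpow_le_exp hτ hδ
  refine ⟨γ⁻¹ * D, fun ℓ => ?_⟩
  split_ifs with h0
  · rw [norm_zero]; positivity
  · rw [norm_div, Complex.norm_I, one_div]
    have h1 := hMel.le_norm hh h0
    have h2 : 0 < 1 + intNorm ℓ ^ τ := by
      have := Real.rpow_nonneg (intNorm_nonneg ℓ) τ
      positivity
    calc ‖smallDivisor ω Ω h ℓ‖⁻¹ ≤ (γ / (1 + intNorm ℓ ^ τ))⁻¹ := by gcongr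
      _ = γ⁻¹ * (1 + intNorm ℓ ^ τ) := by rw [inv_div, div_eq_inv_mul]
      _ ≤ γ⁻¹ * (D * Real.exp (δ * intNorm ℓ)) := by gcongr; exact hD _ (intNorm_nonneg ℓ)
      _ = _ := by ring

lemma isCoeffFun_homSol (hs : 0 < s) (hγ : 0 < γ) (hτ : 0 < τ) (hMel : Melnikov ω Ω γ τ)
    {h : Fin m → ℤ} (hh : ∑ j, |h j| ≤ 2) {c : (Fin n → ℂ) → ℂ} (hc : IsCoeffFun s c) :
    IsCoeffFun s (homSol ω Ω h c) := (expDecay_homCoeff hγ hτ hMel hh hc).isCoeffFun hs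

lemma torusCoeff_homSol (hs : 0 < s) (hγ : 0 < γ) (hτ : 0 < τ) (hMel : Melnikov ω Ω γ τ)
    {h : Fin m → ℤ} (hh : ∑ j, |h j| ≤ 2) {c : (Fin n → ℂ) → ℂ} (hc : IsCoeffFun s c) (ℓ : Fin n → ℤ) :
    torusCoeff (homSol ω Ω h c) ℓ = homCoeff ω Ω h c ℓ :=
  (expDecay_homCoeff hγ hτ hMel hh hc).torusCoeff_fourierSum hs ℓ

/-- `homSol` solves the homological equation on the whole strip, by comparing Fourier coefficients. -/
theorem homSol_equation (hs : 0 < s) (hγ : 0 < γ) (hτ : 0 < τ) (hMel : Melnikov ω Ω γ τ)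
    {h : Fin m → ℤ} (hh : ∑ j, |h j| ≤ 2) {c : (Fin n → ℂ) → ℂ} (hc : IsCoeffFun s c) {φ : Fin n → ℂ}
    (hφ : φ ∈ strip n s) :
    ∑ i, (ω i : ℂ) * angleDeriv i (homSol ω Ω h c) φ +
        Complex.I * (∑ j, (Ω j : ℂ) * (h j : ℂ)) * homSol ω Ω h c φ + c φ =
      if h = 0 then torusCoeff c 0 else 0 := by
  have hd := expDecay_homCoeff hγ hτ hMel hh hc
  have h1 : HasSum (fun ℓ => ∑ i, (ω i : ℂ) *
      ((Complex.I * ℓ i * homCoeff ω Ω h c ℓ) * expMode ℓ φ))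
      (∑ i, (ω i : ℂ) * angleDeriv i (homSol ω Ω h c) φ) := by
    refine hasSum_sum fun i _ => HasSum.mul_left _ ?_
    rw [homSol, hd.angleDeriv_fourierSum hs i hφ]
    exact (expDecay_intCoord_mul hd i).hasSum hs hφ
  have h2 := (hd.hasSum hs hφ).mul_left (Complex.I * (∑ j, (Ω j : ℂ) * (h j : ℂ)))
  have h3 := (h1.add h2).add (hc.hasSum hs hφ)
  refine h3.unique ?_
  refine (hasSum_ite_eq (0 : Fin n → ℤ) (if h = 0 then torusCoeff c 0 else 0)).congr_fun fun ℓ => ?_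
  have h4 : ∑ i, (ω i : ℂ) * ((Complex.I * ℓ i * homCoeff ω Ω h c ℓ) * expMode ℓ φ) +
      Complex.I * (∑ j, (Ω j : ℂ) * (h j : ℂ)) * (homCoeff ω Ω h c ℓ * expMode ℓ φ) =
      Complex.I * smallDivisor ω Ω h ℓ * homCoeff ω Ω h c ℓ * expMode ℓ φ := by
    have : ∑ i, (ω i : ℂ) * ((Complex.I * ℓ i * homCoeff ω Ω h c ℓ) * expMode ℓ φ) =
        (∑ i, (ω i : ℂ) * (ℓ i : ℂ)) * (Complex.I * homCoeff ω Ω h c ℓ * expMode ℓ φ) := by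
      rw [Finset.sum_mul]
      exact Finset.sum_congr rfl fun i _ => by ring
    rw [this, smallDivisor]; ring
  rw [h4]
  by_cases h0 : ℓ = 0 ∧ h = 0
  · obtain ⟨rfl, rfl⟩ := h0
    simp [homCoeff, expMode]
  · have hne := hMel.smallDivisor_ne_zero hγ hh h0
    rw [homCoeff, if_neg h0]
    have : Complex.I * smallDivisor ω Ω h ℓ * (Complex.I / smallDivisor ω Ω h ℓ * torusCoeff c ℓ) =
        -torusCoeff c ℓ := by
      field_simp
      rw [Complex.I_sq]; ring
    rw [this]
    rw [neg_mul, neg_add_cancel]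
    split_ifs with h5 h6
    · exact absurd ⟨h5, h6⟩ h0
    · rfl
    · rfl

/-- Solutions of conjugate homological equations are conjugate. -/
lemma conj_homSol (h : Fin m → ℤ) {c c' : (Fin n → ℂ) → ℂ}
    (hcc : ∀ θ, c' (realAngle θ) = (starRingEnd ℂ) (c (realAngle θ))) (θ : Fin n → ℝ) :
    homSol ω Ω (-h) c' (realAngle θ) = (starRingEnd ℂ) (homSol ω Ω h c (realAngle θ)) := by
  simp only [homSol, fourierSum]
  rw [Complex.conj_tsum, ← (Equiv.neg (Fin n → ℤ)).tsum_eq]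
  refine tsum_congr fun ℓ => ?_
  simp only [Equiv.neg_apply, map_mul, conj_expMode, conj_realAngle]
  congr 1
  simp only [homCoeff, neg_eq_zero]
  split_ifs with h0
  · simp
  · rw [map_mul, map_div₀, Complex.conj_I, conj_torusCoeff hcc, smallDivisor_neg,
      smallDivisor_eq_ofReal, Complex.conj_ofReal, div_neg, neg_div]

end Melnikov

/-! ### Multi-indices and homogeneous parts -/

/-- The multi-index obtained by exchanging the exponents of `z` and `w`. -/
def conjIdx (p : MIdx n m) : MIdx n m := (p.1, p.2.2, p.2.1)

lemma conjIdx_conjIdx (p : MIdx n m) : conjIdx (conjIdx p) = p := rfl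

lemma wdeg_conjIdx (p : MIdx n m) : wdeg (conjIdx p) = wdeg p := by
  simp only [wdeg, conjIdx]; ring

lemma conj_mono (p : MIdx n m) (x : Phase n m) :
    (starRingEnd ℂ) (mono p x) = mono (conjIdx p) (conjPhase x) := by
  simp only [mono, conjIdx, conjPhase, map_mul, map_prod, map_pow]
  ring

lemma mono_add (p q : MIdx n m) (x : Phase n m) : mono (p + q) x = mono p x * mono q x := by
  simp only [mono, Prod.fst_add, Prod.snd_add, Pi.add_apply, pow_add, Finset.prod_mul_distrib]
  ring

lemma wdeg_add (p q : MIdx n m) : wdeg (p + q) = wdeg p + wdeg q := by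
  simp only [wdeg, Prod.fst_add, Prod.snd_add, Pi.add_apply, Finset.sum_add_distrib]
  ring

/-- The multi-indices with `|k| = q` and `|a + ā| = d`. -/
def bidegSet (n m q d : ℕ) : Finset (MIdx n m) :=
  Finset.piAntidiag Finset.univ q ×ˢ (Finset.HasAntidiagonal.antidiagonal d).biUnion fun e =>
    Finset.piAntidiag Finset.univ e.1 ×ˢ Finset.piAntidiag Finset.univ e.2

lemma mem_bidegSet {q d : ℕ} {p : MIdx n m} :
    p ∈ bidegSet n m q d ↔ ∑ i, p.1 i = q ∧ ∑ j, p.2.1 j + ∑ j, p.2.2 j = d := by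
  simp only [bidegSet, Finset.mem_product, Finset.mem_piAntidiag, Finset.mem_univ, implies_true,
    and_true, Finset.mem_biUnion, Finset.HasAntidiagonal.mem_antidiagonal]
  constructor
  · rintro ⟨h1, e, he, h2, h3⟩
    exact ⟨h1, by rw [h2, h3, he]⟩
  · rintro ⟨h1, h2⟩
    exact ⟨h1, (∑ j, p.2.1 j, ∑ j, p.2.2 j), h2, rfl, rfl⟩

lemma homogPart_eq_sum (q d : ℕ) (c : MIdx n m → (Fin n → ℂ) → ℂ) (x : Phase n m) :
    homogPart q d c x = ∑ p ∈ bidegSet n m q d, c p x.2.1 * mono p x := by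
  rw [homogPart, bidegSet, Finset.sum_product]
  refine Finset.sum_congr rfl fun k _ => ?_
  rw [Finset.sum_biUnion]
  · refine Finset.sum_congr rfl fun e _ => ?_
    rw [Finset.sum_product]
  · intro e _ e' _ hee
    rw [Function.onFun, Finset.disjoint_left]
    intro ab h1 h2
    simp only [Finset.mem_product, Finset.mem_piAntidiag] at h1 h2
    exact hee (Prod.ext (h1.1.1.symm.trans h2.1.1) (h1.2.1.symm.trans h2.2.1))

/-- The multi-indices of weighted degree `d`. -/
def weightSet (n m d : ℕ) : Finset (MIdx n m) :=
  (Finset.range (d + 1)).biUnion fun q => (Finset.range (d + 1)).biUnion fun e =>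
    (bidegSet n m q e).filter fun _ => 2 * q + e = d

lemma mem_weightSet {d : ℕ} {p : MIdx n m} : p ∈ weightSet n m d ↔ wdeg p = d := by
  simp only [weightSet, Finset.mem_biUnion, Finset.mem_range, Finset.mem_filter, mem_bidegSet, wdeg]
  constructor
  · rintro ⟨q, hq, e, he, ⟨h1, h2⟩, h3⟩
    rw [h1, h2, h3]
  · intro h
    exact ⟨_, by omega, _, by omega, ⟨rfl, rfl⟩, h⟩

/-- The function `∑_{2|k| + |a + ā| = d} c_{k,a,ā}(φ) I^k z^a w^ā`. -/
def weightPart (d : ℕ) (c : MIdx n m → (Fin n → ℂ) → ℂ) (x : Phase n m) : ℂ :=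
  ∑ p ∈ weightSet n m d, c p x.2.1 * mono p x

lemma weightSet_eq_biUnion (d : ℕ) : weightSet n m d =
    (Finset.range (d / 2 + 1)).biUnion fun q => bidegSet n m q (d - 2 * q) := by
  ext p
  simp only [mem_weightSet, Finset.mem_biUnion, Finset.mem_range, mem_bidegSet, wdeg]
  constructor
  · intro h
    exact ⟨∑ i, p.1 i, by omega, rfl, by omega⟩
  · rintro ⟨q, hq, h1, h2⟩
    omega

/-- The weighted homogeneous part is the sum of its parts of given degree in the actions. -/
lemma weightPart_eq_sum_homogPart (d : ℕ) (c : MIdx n m → (Fin n → ℂ) → ℂ) (x : Phase n m) :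
    weightPart d c x = ∑ q ∈ Finset.range (d / 2 + 1), homogPart q (d - 2 * q) c x := by
  rw [weightPart, weightSet_eq_biUnion, Finset.sum_biUnion]
  · exact Finset.sum_congr rfl fun q _ => (homogPart_eq_sum q _ c x).symm
  · intro q _ q' _ hqq
    rw [Function.onFun, Finset.disjoint_left]
    intro p h1 h2
    rw [mem_bidegSet] at h1 h2
    exact hqq (h1.1.symm.trans h2.1)

/-! ### The coefficients of an elliptic Hamiltonian -/

lemma torusPoint_mem_domain {ε r s ρ : ℝ} (hr : n * ε ^ 2 < r ^ 2) (hρ : 2 * m * ε ^ 2 < ρ ^ 2)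
    {φ : Fin n → ℂ} (hφ : φ ∈ strip n s) (t : UnitAddTorus (Fin n ⊕ Fin m ⊕ Fin m)) :
    torusPoint ε φ t ∈ domain n m r s ρ := by
  have h1 : ∀ x : UnitAddCircle, ‖(ε : ℂ) * fourier 1 x‖ ^ 2 = ε ^ 2 := by
    intro x
    rw [norm_mul, Complex.norm_real, fourier_apply, Circle.norm_coe, mul_one, Real.norm_eq_abs,
      sq_abs]
  refine ⟨?_, hφ, ?_⟩
  · simpa only [torusPoint, h1, Finset.sum_const, Finset.card_univ, Fintype.card_fin,
      nsmul_eq_mul] using hr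
  · simp only [torusPoint, h1, Finset.sum_const, Finset.card_univ, Fintype.card_fin, nsmul_eq_mul]
    linarith

/-- If a function that commutes with the conjugation has an expansion, then the coefficients of the
expansion are symmetric. -/
theorem conj_coeff_of_hasSum {ε s : ℝ} (hε : 0 < ε) {T : Phase n m → ℂ}
    {c : MIdx n m → (Fin n → ℂ) → ℂ}
    (hconj : ∀ φ ∈ strip n s, ∀ t, T (conjPhase (torusPoint ε φ t)) =
      (starRingEnd ℂ) (T (torusPoint ε φ t)))
    (hsum : ∀ φ ∈ strip n s, ∀ t, HasSum (fun p => c p φ * mono p (torusPoint ε φ t))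
      (T (torusPoint ε φ t)))
    (hsum' : ∀ φ ∈ strip n s, ∀ t, HasSum (fun p => c p (fun i => (starRingEnd ℂ) (φ i)) *
      mono p (conjPhase (torusPoint ε φ t))) (T (conjPhase (torusPoint ε φ t))))
    {φ : Fin n → ℂ} (hφ : φ ∈ strip n s) (p : MIdx n m) :
    c (conjIdx p) φ = (starRingEnd ℂ) (c p fun i => (starRingEnd ℂ) (φ i)) := by
  rw [← taylorCoeff_eq_of_hasSum hε (c := fun p => c p φ) (hsum φ hφ) (conjIdx p)]
  have key := taylorCoeff_eq_of_hasSum (T := T) (φ := φ) hε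
    (c := fun p => (starRingEnd ℂ) (c (conjIdx p) fun i => (starRingEnd ℂ) (φ i))) (fun t => ?_)
    (conjIdx p)
  · rw [key, conjIdx_conjIdx]
  · have h := (hsum' φ hφ t).map (starRingEnd ℂ) Complex.continuous_conj
    rw [hconj φ hφ t, Complex.conj_conj] at h
    let e : MIdx n m ≃ MIdx n m := ⟨conjIdx, conjIdx, conjIdx_conjIdx, conjIdx_conjIdx⟩
    refine (e.hasSum_iff.2 h).congr_fun fun q => ?_
    simp only [e, Function.comp_apply, Equiv.coe_fn_mk, map_mul, conj_mono, conjPhase_conjPhase]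
    rfl

lemma analyticAt_coord_I (i : Fin n) (x : Phase n m) : AnalyticAt ℂ (fun x : Phase n m => x.1 i) x :=
  ((ContinuousLinearMap.proj (R := ℂ) (φ := fun _ => ℂ) i).comp
    (ContinuousLinearMap.fst ℂ _ _)).analyticAt x

lemma analyticAt_coord_z (j : Fin m) (x : Phase n m) :
    AnalyticAt ℂ (fun x : Phase n m => x.2.2.1 j) x :=
  ((ContinuousLinearMap.proj (R := ℂ) (φ := fun _ => ℂ) j).comp
    ((ContinuousLinearMap.fst ℂ _ _).comp ((ContinuousLinearMap.snd ℂ _ _).comp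
      (ContinuousLinearMap.snd ℂ _ _)))).analyticAt x

lemma analyticAt_coord_w (j : Fin m) (x : Phase n m) :
    AnalyticAt ℂ (fun x : Phase n m => x.2.2.2 j) x :=
  ((ContinuousLinearMap.proj (R := ℂ) (φ := fun _ => ℂ) j).comp
    ((ContinuousLinearMap.snd ℂ _ _).comp ((ContinuousLinearMap.snd ℂ _ _).comp
      (ContinuousLinearMap.snd ℂ _ _)))).analyticAt x

lemma analyticOnNhd_linearPart (ω : Fin n → ℝ) (Ω : Fin m → ℝ) (U : Set (Phase n m)) :
    AnalyticOnNhd ℂ (linearPart ω Ω) U := by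
  intro x _
  unfold linearPart
  refine AnalyticAt.add (Finset.analyticAt_fun_sum _ fun i _ => ?_)
    (Finset.analyticAt_fun_sum _ fun j _ => ?_)
  · exact analyticAt_const.mul (analyticAt_coord_I i x)
  · exact (analyticAt_const.mul (analyticAt_coord_z j x)).mul (analyticAt_coord_w j x)

lemma linearPart_conjPhase (ω : Fin n → ℝ) (Ω : Fin m → ℝ) (x : Phase n m) :
    linearPart ω Ω (conjPhase x) = (starRingEnd ℂ) (linearPart ω Ω x) := by
  simp only [linearPart, conjPhase, map_add, map_sum, map_mul, Complex.conj_ofReal]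
  congr 1
  exact Finset.sum_congr rfl fun j _ => by ring

section Elliptic

variable {ω : Fin n → ℝ} {Ω : Fin m → ℝ} {r s ρ : ℝ} {H : Phase n m → ℂ}
  {R : MIdx n m → (Fin n → ℂ) → ℂ}

lemma exists_torus_radius (n m : ℕ) {r ρ : ℝ} (hr : 0 < r) (hρ : 0 < ρ) :
    ∃ ε : ℝ, 0 < ε ∧ n * ε ^ 2 < r ^ 2 ∧ 2 * m * ε ^ 2 < ρ ^ 2 := by
  refine ⟨min r ρ / (n + 2 * m + 1), by positivity, ?_, ?_⟩
  all_goals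
    have hd : (0 : ℝ) < n + 2 * m + 1 := by positivity
    rw [div_pow, mul_div_assoc', div_lt_iff₀ (by positivity)]
    have h0 : 0 < min r ρ := lt_min hr hρ
    have hn : (0 : ℝ) ≤ n := by positivity
    have hm : (0 : ℝ) ≤ m := by positivity
  · have : (n : ℝ) < (n + 2 * m + 1) ^ 2 := by nlinarith
    have h2 : min r ρ ^ 2 ≤ r ^ 2 := by gcongr; exact min_le_left _ _
    nlinarith [sq_nonneg (min r ρ), pow_pos hr 2]
  · have : (2 * m : ℝ) < (n + 2 * m + 1) ^ 2 := by nlinarith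
    have h2 : min r ρ ^ 2 ≤ ρ ^ 2 := by gcongr; exact min_le_right _ _
    nlinarith [sq_nonneg (min r ρ), pow_pos hρ 2]

/-- The nonlinear part `H - ω·I - Ω z·w` of a Hamiltonian. -/
def nonlinearPart (ω : Fin n → ℝ) (Ω : Fin m → ℝ) (H : Phase n m → ℂ) (x : Phase n m) : ℂ :=
  H x - linearPart ω Ω x

/-- The coefficients of weighted degree at least three. -/
def higherCoeff (R : MIdx n m → (Fin n → ℂ) → ℂ) (p : MIdx n m) (φ : Fin n → ℂ) : ℂ :=
  if 3 ≤ wdeg p then R p φ else 0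

lemma IsEllipticHamiltonian.hasSum_nonlinearPart (hH : IsEllipticHamiltonian ω Ω r s ρ H R)
    {x : Phase n m} (hx : x ∈ domain n m r s ρ) :
    HasSum (fun p => higherCoeff R p x.2.1 * mono p x) (nonlinearPart ω Ω H x) := by
  refine (hH.expansion x hx).congr_fun fun p => ?_
  unfold higherCoeff
  split_ifs <;> simp

lemma IsEllipticHamiltonian.apply_conjPhase (hH : IsEllipticHamiltonian ω Ω r s ρ H R)
    {x : Phase n m} (hx : x ∈ domain n m r s ρ) :
    H (conjPhase x) = (starRingEnd ℂ) (H x) :=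
  apply_conjPhase_of_real (isOpen_domain n m r s ρ) (convex_domain n m r s ρ)
    (fun _ h => conjPhase_mem_domain h) hH.analytic.differentiableOn hH.real hx

lemma IsEllipticHamiltonian.hasSum_torusPoint (hH : IsEllipticHamiltonian ω Ω r s ρ H R) {ε : ℝ}
    {φ : Fin n → ℂ} {t : UnitAddTorus (Fin n ⊕ Fin m ⊕ Fin m)}
    (hx : torusPoint ε φ t ∈ domain n m r s ρ) :
    HasSum (fun p => higherCoeff R p φ * mono p (torusPoint ε φ t))
      (nonlinearPart ω Ω H (torusPoint ε φ t)) := by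
  have h := hH.hasSum_nonlinearPart hx
  have hφ : (torusPoint ε φ t).2.1 = φ := rfl
  rw [hφ] at h
  exact h

lemma IsEllipticHamiltonian.hasSum_conj_torusPoint (hH : IsEllipticHamiltonian ω Ω r s ρ H R) {ε : ℝ}
    {φ : Fin n → ℂ} {t : UnitAddTorus (Fin n ⊕ Fin m ⊕ Fin m)}
    (hx : torusPoint ε φ t ∈ domain n m r s ρ) :
    HasSum (fun p => higherCoeff R p (fun i => (starRingEnd ℂ) (φ i)) *
      mono p (conjPhase (torusPoint ε φ t))) (nonlinearPart ω Ω H (conjPhase (torusPoint ε φ t))) := by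
  have h := hH.hasSum_nonlinearPart (conjPhase_mem_domain hx)
  have hφ : (conjPhase (torusPoint ε φ t)).2.1 = fun i => (starRingEnd ℂ) (φ i) := rfl
  rw [hφ] at h
  exact h

/-- The coefficients of an elliptic Hamiltonian are analytic and periodic on the strip, since Cauchy's
formula writes them as integrals of the Hamiltonian over tori. -/
theorem IsEllipticHamiltonian.isCoeffFun (hr : 0 < r) (hρ : 0 < ρ)
    (hH : IsEllipticHamiltonian ω Ω r s ρ H R) {p : MIdx n m} (hp : 3 ≤ wdeg p) :
    IsCoeffFun s (R p) := by
  obtain ⟨ε, hε, h1, h2⟩ := exists_torus_radius n m hr hρ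
  have hmem : ∀ φ ∈ strip n s, ∀ t, torusPoint ε φ t ∈ domain n m r s ρ :=
    fun φ hφ t => torusPoint_mem_domain h1 h2 hφ t
  have heq : ∀ φ ∈ strip n s, taylorCoeff ε (nonlinearPart ω Ω H) p φ = R p φ := by
    intro φ hφ
    have := taylorCoeff_eq_of_hasSum hε (T := nonlinearPart ω Ω H) (φ := φ)
      (c := fun p => higherCoeff R p φ)
      (fun t => hH.hasSum_torusPoint (hmem φ hφ t)) p
    rw [this, higherCoeff, if_pos hp]
  constructor
  · refine AnalyticOnNhd.congr (isOpen_strip n s) (analyticOnNhd_of_differentiableOn (isOpen_strip n s)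
      (differentiableOn_taylorCoeff (isOpen_domain n m r s ρ) ?_ hmem p)) heq
    exact hH.analytic.differentiableOn.sub (analyticOnNhd_linearPart ω Ω _).differentiableOn
  · intro φ hφ ℓ
    rw [← heq φ hφ, ← heq _ (shift_mem_strip hφ ℓ), taylorCoeff, taylorCoeff]
    congr 2
    ext t
    exact congrArg₂ (· - ·) (hH.periodic _ (hmem φ hφ t) ℓ) rfl

/-- The reality of the Hamiltonian in terms of its coefficients: conjugation exchanges the exponents
of `z` and `w`. -/
theorem IsEllipticHamiltonian.conj_coeff (hr : 0 < r) (hρ : 0 < ρ)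
    (hH : IsEllipticHamiltonian ω Ω r s ρ H R) {p : MIdx n m} (hp : 3 ≤ wdeg p) {φ : Fin n → ℂ}
    (hφ : φ ∈ strip n s) :
    R (conjIdx p) φ = (starRingEnd ℂ) (R p fun i => (starRingEnd ℂ) (φ i)) := by
  obtain ⟨ε, hε, h1, h2⟩ := exists_torus_radius n m hr hρ
  have hmem : ∀ φ ∈ strip n s, ∀ t, torusPoint ε φ t ∈ domain n m r s ρ :=
    fun φ hφ t => torusPoint_mem_domain h1 h2 hφ t
  have := conj_coeff_of_hasSum (s := s) hε (T := nonlinearPart ω Ω H) (c := higherCoeff R)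
    (fun φ hφ t => by
      rw [nonlinearPart, nonlinearPart, hH.apply_conjPhase (hmem φ hφ t), linearPart_conjPhase,
        map_sub])
    (fun φ hφ t => hH.hasSum_torusPoint (hmem φ hφ t))
    (fun φ hφ t => hH.hasSum_conj_torusPoint (hmem φ hφ t)) hφ p
  simpa only [higherCoeff, wdeg_conjIdx, if_pos hp] using this

end Elliptic

/-! ### Partial derivatives in the coordinates `(I, φ, z, w)` -/

/-- Labels of the coordinates `I_i`, `φ_i`, `z_j`, `w_j`, in this order. -/
abbrev CoordIdx (n m : ℕ) : Type := Fin n ⊕ Fin n ⊕ Fin m ⊕ Fin m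

/-- The coordinate vectors. -/
def dir : CoordIdx n m → Phase n m
  | .inl i => (Pi.single i 1, 0, 0, 0)
  | .inr (.inl i) => (0, Pi.single i 1, 0, 0)
  | .inr (.inr (.inl j)) => (0, 0, Pi.single j 1, 0)
  | .inr (.inr (.inr j)) => (0, 0, 0, Pi.single j 1)

/-- The coordinate functions. -/
def coord : CoordIdx n m → Phase n m → ℂ
  | .inl i => fun x => x.1 i
  | .inr (.inl i) => fun x => x.2.1 i
  | .inr (.inr (.inl j)) => fun x => x.2.2.1 j
  | .inr (.inr (.inr j)) => fun x => x.2.2.2 j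

/-- The weight of a coordinate: two for the actions, zero for the angles, one for `z` and `w`. -/
def wt : CoordIdx n m → ℤ
  | .inl _ => 2
  | .inr (.inl _) => 0
  | .inr (.inr _) => 1

lemma sum_coord_smul_dir (v : Phase n m) : ∑ α, coord α v • dir α = v := by
  have h : ∀ {d : ℕ} (u : Fin d → ℂ), ∑ i, u i • (Pi.single i 1 : Fin d → ℂ) = u := by
    intro d u
    ext k
    simp [Finset.sum_apply, Pi.single_apply]
  simp only [Fintype.sum_sum_type, coord, dir]
  refine Prod.ext ?_ (Prod.ext ?_ (Prod.ext ?_ ?_)) <;>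
    simp [Prod.fst_sum, Prod.snd_sum, h]

/-- The partial derivative with respect to a coordinate. -/
def pd (α : CoordIdx n m) (T : Phase n m → ℂ) (x : Phase n m) : ℂ := fderiv ℂ T x (dir α)

lemma fderiv_apply_eq_sum (T : Phase n m → ℂ) (x v : Phase n m) :
    fderiv ℂ T x v = ∑ α, coord α v * pd α T x := by
  conv_lhs => rw [← sum_coord_smul_dir v]
  simp only [map_sum, map_smul, smul_eq_mul, pd]

lemma pd_congr {s : ℝ} {T T' : Phase n m → ℂ} (h : EqOn T T' (cylinder n m s)) (α : CoordIdx n m) :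
    EqOn (pd α T) (pd α T') (cylinder n m s) := by
  intro x hx
  have := (h.eventuallyEq_of_mem ((isOpen_cylinder n m s).mem_nhds hx)).fderiv_eq (𝕜 := ℂ)
  rw [pd, pd, this]

lemma pd_apply_of_hasDerivAt {T : Phase n m → ℂ} {x : Phase n m} (hT : DifferentiableAt ℂ T x)
    {α : CoordIdx n m} {a : ℂ} (h : HasDerivAt (fun t : ℂ => T (x + t • dir α)) a 0) :
    pd α T x = a := by
  have h2 : HasDerivAt (fun t : ℂ => x + t • dir α) (dir α) 0 := by
    simpa using ((hasDerivAt_id (0 : ℂ)).smul_const (dir α)).const_add x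
  have h1 : HasFDerivAt T (fderiv ℂ T x) (x + (0 : ℂ) • dir α) := by simpa using hT.hasFDerivAt
  exact (h1.comp_hasDerivAt (0 : ℂ) h2).unique h

lemma hasDerivAt_prod_pow {d : ℕ} (a : Fin d → ℕ) (v : Fin d → ℂ) (j : Fin d) :
    HasDerivAt (fun t : ℂ => ∏ k, (v + t • (Pi.single j 1 : Fin d → ℂ)) k ^ a k)
      (a j * ∏ k, v k ^ (a - Pi.single j 1 : Fin d → ℕ) k) 0 := by
  have h1 : ∀ t : ℂ, ∏ k, (v + t • (Pi.single j 1 : Fin d → ℂ)) k ^ a k =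
      (v j + t) ^ a j * ∏ k ∈ Finset.univ.erase j, v k ^ a k := by
    intro t
    rw [← Finset.mul_prod_erase _ _ (Finset.mem_univ j)]
    congr 1
    · simp
    · refine Finset.prod_congr rfl fun k hk => ?_
      simp [(Finset.mem_erase.1 hk).1]
  have h2 : ∏ k, v k ^ (a - Pi.single j 1 : Fin d → ℕ) k =
      v j ^ (a j - 1) * ∏ k ∈ Finset.univ.erase j, v k ^ a k := by
    rw [← Finset.mul_prod_erase _ _ (Finset.mem_univ j)]
    congr 1
    · simp
    · refine Finset.prod_congr rfl fun k hk => ?_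
      simp [(Finset.mem_erase.1 hk).1]
  simp_rw [h1]
  rw [h2]
  have h3 : HasDerivAt (fun t : ℂ => (v j + t) ^ a j) (a j * v j ^ (a j - 1)) 0 := by
    simpa using ((hasDerivAt_id (0 : ℂ)).const_add (v j)).fun_pow (a j)
  simpa [mul_assoc] using h3.mul_const _

/-! ### Weighted homogeneous polynomials with analytic coefficients -/

/-- On the cylinder `|Im φ| < s`, the function is a polynomial in `(I, z, w)`, homogeneous of the
given weighted degree, whose coefficients are analytic and periodic in `φ`. Negative degrees are
allowed, and contain only the function zero. -/
inductive Pol (s : ℝ) : ℤ → (Phase n m → ℂ) → Prop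
  | coeff {c : (Fin n → ℂ) → ℂ} (hc : IsCoeffFun s c) : Pol s 0 fun x => c x.2.1
  | I (i : Fin n) : Pol s 2 fun x => x.1 i
  | z (j : Fin m) : Pol s 1 fun x => x.2.2.1 j
  | w (j : Fin m) : Pol s 1 fun x => x.2.2.2 j
  | zero (d : ℤ) : Pol s d fun _ => 0
  | add {d : ℤ} {T T' : Phase n m → ℂ} : Pol s d T → Pol s d T' → Pol s d fun x => T x + T' x
  | mul {d d' : ℤ} {T T' : Phase n m → ℂ} : Pol s d T → Pol s d' T' →
      Pol s (d + d') fun x => T x * T' x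
  | congr {d : ℤ} {T T' : Phase n m → ℂ} : Pol s d T → EqOn T' T (cylinder n m s) → Pol s d T'

namespace Pol

variable {s : ℝ} {d d' : ℤ} {T T' : Phase n m → ℂ}

lemma cast_deg (h : Pol s d T) (hd : d = d') : Pol s d' T := hd ▸ h

lemma const_mul (a : ℂ) (h : Pol s d T) : Pol s d fun x => a * T x :=
  ((Pol.coeff (IsCoeffFun.const s a)).mul h).cast_deg (zero_add d)

lemma sum {ι : Type*} (t : Finset ι) {f : ι → Phase n m → ℂ} (h : ∀ i ∈ t, Pol s d (f i)) :
    Pol s d fun x => ∑ i ∈ t, f i x := by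
  classical
  induction t using Finset.induction_on with
  | empty => simpa using Pol.zero d
  | insert a t ha ih =>
    simp only [Finset.sum_insert ha]
    exact (h a (Finset.mem_insert_self a t)).add (ih fun i hi => h i (Finset.mem_insert_of_mem hi))

lemma one : Pol (n := n) (m := m) s 0 fun _ => 1 := Pol.coeff (IsCoeffFun.const s 1)

lemma pow (h : Pol s d T) (k : ℕ) : Pol s (k * d) fun x => T x ^ k := by
  induction k with
  | zero => simpa using one
  | succ k ih =>
    simp only [pow_succ]
    exact (ih.mul h).cast_deg (by push_cast; ring)

lemma prod {ι : Type*} (t : Finset ι) {f : ι → Phase n m → ℂ} {e : ι → ℤ}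
    (h : ∀ i ∈ t, Pol s (e i) (f i)) : Pol s (∑ i ∈ t, e i) fun x => ∏ i ∈ t, f i x := by
  classical
  induction t using Finset.induction_on with
  | empty => simpa using one
  | insert a t ha ih =>
    simp only [Finset.prod_insert ha, Finset.sum_insert ha]
    exact (h a (Finset.mem_insert_self a t)).mul (ih fun i hi => h i (Finset.mem_insert_of_mem hi))

lemma mono (p : MIdx n m) : Pol s (wdeg p) (mono p) := by
  refine (((prod Finset.univ fun i _ => (Pol.I i).pow (p.1 i)).mul
    (prod Finset.univ fun j _ => (Pol.z j).pow (p.2.1 j))).mul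
    (prod Finset.univ fun j _ => (Pol.w j).pow (p.2.2 j))).cast_deg ?_
  simp only [wdeg, mul_one, ← Finset.sum_mul]
  push_cast
  ring

lemma weightPart {d : ℕ} {c : MIdx n m → (Fin n → ℂ) → ℂ}
    (hc : ∀ p, wdeg p = d → IsCoeffFun s (c p)) : Pol s d (weightPart d c) :=
  Pol.sum _ fun p hp => ((Pol.coeff (hc p (mem_weightSet.1 hp))).mul (mono p)).cast_deg
    (by rw [mem_weightSet.1 hp, zero_add])

lemma analyticOnNhd (h : Pol s d T) : AnalyticOnNhd ℂ T (cylinder n m s) := by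
  induction h with
  | coeff hc =>
    intro x hx
    exact (hc.analytic x.2.1 hx).comp (f := fun x : Phase n m => x.2.1)
      ((ContinuousLinearMap.fst ℂ _ _).comp (ContinuousLinearMap.snd ℂ _ _) |>.analyticAt x)
  | I i => exact fun x _ => analyticAt_coord_I i x
  | z i => exact fun x _ => analyticAt_coord_z i x
  | w i => exact fun x _ => analyticAt_coord_w i x
  | zero d => exact analyticOnNhd_const
  | add _ _ h h' => exact h.add h'
  | mul _ _ h h' => exact h.mul h'
  | congr _ he h => exact AnalyticOnNhd.congr (isOpen_cylinder n m s) h he.symm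

lemma differentiableAt (h : Pol s d T) {x : Phase n m} (hx : x ∈ cylinder n m s) :
    DifferentiableAt ℂ T x := (h.analyticOnNhd x hx).differentiableAt

lemma apply_shiftPhase (h : Pol s d T) {x : Phase n m} (hx : x ∈ cylinder n m s)
    (ℓ : Fin n → ℤ) : T (shiftPhase ℓ x) = T x := by
  induction h with
  | coeff hc => exact hc.periodic x.2.1 hx ℓ
  | I i => rfl
  | z i => rfl
  | w i => rfl
  | zero d => rfl
  | add _ _ h h' => exact congrArg₂ (· + ·) h h'
  | mul _ _ h h' => exact congrArg₂ (· * ·) h h'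
  | congr _ he h => rw [he hx, he (shiftPhase_mem_cylinder hx ℓ), h]

lemma pd_coeff {c : (Fin n → ℂ) → ℂ} {x : Phase n m} (hc : DifferentiableAt ℂ c x.2.1)
    (v : Phase n m) : fderiv ℂ (fun x : Phase n m => c x.2.1) x v = fderiv ℂ c x.2.1 v.2.1 := by
  have h := hc.hasFDerivAt.comp x
    ((ContinuousLinearMap.fst ℂ _ _).comp (ContinuousLinearMap.snd ℂ _ _) :
      Phase n m →L[ℂ] (Fin n → ℂ)).hasFDerivAt
  rw [show (fun x : Phase n m => c x.2.1) = c ∘ (((ContinuousLinearMap.fst ℂ _ _).comp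
    (ContinuousLinearMap.snd ℂ _ _) : Phase n m →L[ℂ] (Fin n → ℂ))) from rfl, h.fderiv]
  rfl

lemma fderiv_clm (L : Phase n m →L[ℂ] ℂ) {f : Phase n m → ℂ} (hf : ∀ x, f x = L x)
    (x v : Phase n m) : fderiv ℂ f x v = f v := by
  have : f = L := funext hf
  rw [this, L.fderiv]

lemma fderiv_I (i : Fin n) (x v : Phase n m) :
    fderiv ℂ (fun x : Phase n m => x.1 i) x v = v.1 i :=
  fderiv_clm ((ContinuousLinearMap.proj (R := ℂ) (φ := fun _ => ℂ) i).comp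
    (ContinuousLinearMap.fst ℂ _ _)) (fun _ => rfl) x v

lemma fderiv_z (j : Fin m) (x v : Phase n m) :
    fderiv ℂ (fun x : Phase n m => x.2.2.1 j) x v = v.2.2.1 j :=
  fderiv_clm ((ContinuousLinearMap.proj (R := ℂ) (φ := fun _ => ℂ) j).comp
    ((ContinuousLinearMap.fst ℂ _ _).comp ((ContinuousLinearMap.snd ℂ _ _).comp
      (ContinuousLinearMap.snd ℂ _ _)))) (fun _ => rfl) x v

lemma fderiv_w (j : Fin m) (x v : Phase n m) :
    fderiv ℂ (fun x : Phase n m => x.2.2.2 j) x v = v.2.2.2 j :=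
  fderiv_clm ((ContinuousLinearMap.proj (R := ℂ) (φ := fun _ => ℂ) j).comp
    ((ContinuousLinearMap.snd ℂ _ _).comp ((ContinuousLinearMap.snd ℂ _ _).comp
      (ContinuousLinearMap.snd ℂ _ _)))) (fun _ => rfl) x v

/-- Differentiating with respect to a coordinate lowers the degree by the weight of the
coordinate. -/
theorem pd (h : Pol s d T) (α : CoordIdx n m) : Pol s (d - wt α) (pd α T) := by
  have one' : ∀ {a : ℂ} {e : ℤ}, (e = 0 ∨ a = 0) → Pol (n := n) (m := m) s e fun _ => a := by
    rintro a e (rfl | rfl)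
    · exact Pol.coeff (IsCoeffFun.const s a)
    · exact Pol.zero e
  induction h with
  | @coeff c hc =>
    have key : EqOn (_root_.pd α fun x => c x.2.1)
        (fun x : Phase n m => fderiv ℂ c x.2.1 (dir α).2.1) (cylinder n m s) := fun x hx =>
      pd_coeff (hc.analytic x.2.1 hx).differentiableAt _
    refine Pol.congr ?_ key
    rcases α with i | i | j | j
    · exact (Pol.zero _).congr fun x _ => by simp [dir]
    · exact (Pol.coeff (hc.angleDeriv i)).congr fun x _ => rfl
    · exact (Pol.zero _).congr fun x _ => by simp [dir]
    · exact (Pol.zero _).congr fun x _ => by simp [dir]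
  | I i =>
    refine (one' (a := (dir α).1 i) ?_).congr fun x _ => fderiv_I i x _
    rcases α with i | i | j | j <;> simp [dir, wt]
  | z i =>
    refine (one' (a := (dir α).2.2.1 i) ?_).congr fun x _ => fderiv_z i x _
    rcases α with i | i | j | j <;> simp [dir, wt]
  | w i =>
    refine (one' (a := (dir α).2.2.2 i) ?_).congr fun x _ => fderiv_w i x _
    rcases α with i | i | j | j <;> simp [dir, wt]
  | zero d => exact (Pol.zero _).congr fun x _ => by simp [_root_.pd]
  | @add d T T' hT hT' h h' =>
    refine (h.add h').congr fun x hx => ?_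
    simp only [_root_.pd]
    rw [fderiv_fun_add (hT.differentiableAt hx) (hT'.differentiableAt hx)]
    rfl
  | @mul d d' T T' hT hT' h h' =>
    refine (((hT.mul h').cast_deg (by ring)).add ((h.mul hT').cast_deg (by ring))).congr
      fun x hx => ?_
    simp only [_root_.pd]
    rw [fderiv_fun_mul (hT.differentiableAt hx) (hT'.differentiableAt hx)]
    simp [mul_comm]
  | congr _ he h => exact h.congr (pd_congr he α)

/-- Every polynomial is a finite sum of monomials. -/
theorem exists_sum (h : Pol s d T) : ∃ (ι : Type) (_ : Fintype ι) (c : ι → (Fin n → ℂ) → ℂ)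
    (p : ι → MIdx n m), (∀ k, IsCoeffFun s (c k)) ∧ (∀ k, (wdeg (p k) : ℤ) = d) ∧
    ∀ x ∈ cylinder n m s, T x = ∑ k, c k x.2.1 * _root_.mono (p k) x := by
  have hone := IsCoeffFun.const (n := n) s 1
  induction h with
  | coeff hc => exact ⟨Unit, inferInstance, fun _ => _, fun _ => 0, fun _ => hc,
      fun _ => by simp [wdeg], fun x _ => by simp [_root_.mono]⟩
  | I i => exact ⟨Unit, inferInstance, fun _ _ => 1, fun _ => (Pi.single i 1, 0, 0), fun _ => hone,
      fun _ => by simp [wdeg], fun x _ => by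
        simp [_root_.mono, Pi.single_apply, Finset.prod_ite_eq']⟩
  | z i => exact ⟨Unit, inferInstance, fun _ _ => 1, fun _ => (0, Pi.single i 1, 0), fun _ => hone,
      fun _ => by simp [wdeg], fun x _ => by
        simp [_root_.mono, Pi.single_apply, Finset.prod_ite_eq']⟩
  | w i => exact ⟨Unit, inferInstance, fun _ _ => 1, fun _ => (0, 0, Pi.single i 1), fun _ => hone,
      fun _ => by simp [wdeg], fun x _ => by
        simp [_root_.mono, Pi.single_apply, Finset.prod_ite_eq']⟩
  | zero d => exact ⟨Empty, inferInstance, fun k => k.elim, fun k => k.elim, fun k => k.elim,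
      fun k => k.elim, fun x _ => by simp⟩
  | add _ _ h h' =>
    obtain ⟨ι, _, c, p, h1, h2, h3⟩ := h
    obtain ⟨ι', _, c', p', h1', h2', h3'⟩ := h'
    refine ⟨ι ⊕ ι', inferInstance, Sum.elim c c', Sum.elim p p', ?_, ?_, fun x hx => ?_⟩
    · rintro (k | k); exacts [h1 k, h1' k]
    · rintro (k | k); exacts [h2 k, h2' k]
    · simp only [h3 x hx, h3' x hx, Fintype.sum_sum_type, Sum.elim_inl, Sum.elim_inr]
  | mul _ _ h h' =>
    obtain ⟨ι, _, c, p, h1, h2, h3⟩ := h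
    obtain ⟨ι', _, c', p', h1', h2', h3'⟩ := h'
    refine ⟨ι × ι', inferInstance, fun k φ => c k.1 φ * c' k.2 φ, fun k => p k.1 + p' k.2,
      fun k => (h1 k.1).mul (h1' k.2), fun k => ?_, fun x hx => ?_⟩
    · rw [wdeg_add]; push_cast; rw [h2, h2']
    · simp only [h3 x hx, h3' x hx, Finset.sum_mul_sum, Fintype.sum_prod_type]
      refine Finset.sum_congr rfl fun k _ => Finset.sum_congr rfl fun k' _ => ?_
      rw [mono_add]; ring
  | congr _ he h =>
    obtain ⟨ι, _, c, p, h1, h2, h3⟩ := h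
    exact ⟨ι, inferInstance, c, p, h1, h2, fun x hx => by rw [he hx, h3 x hx]⟩

/-- A weighted homogeneous function is the weighted homogeneous part of some family of coefficient
functions. -/
theorem exists_weightPart {d : ℕ} (h : Pol s d T) : ∃ c : MIdx n m → (Fin n → ℂ) → ℂ,
    (∀ p, IsCoeffFun s (c p)) ∧ EqOn T (_root_.weightPart d c) (cylinder n m s) := by
  classical
  obtain ⟨ι, _, c, p, h1, h2, h3⟩ := h.exists_sum
  refine ⟨fun q φ => ∑ k, (if p k = q then 1 else 0) * c k φ, fun q =>
    IsCoeffFun.sum _ fun k _ => (h1 k).const_mul _, fun x hx => ?_⟩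
  rw [h3 x hx, _root_.weightPart]
  simp_rw [Finset.sum_mul]
  rw [Finset.sum_comm]
  refine Finset.sum_congr rfl fun k _ => ?_
  rw [Finset.sum_eq_single (p k)]
  · simp
  · intro q _ hq
    simp [hq.symm]
  · intro hk
    exact absurd (mem_weightSet.2 (by exact_mod_cast h2 k)) hk

end Pol

/-! ### Hamiltonian vector fields -/

/-- The Hamiltonian vector field of `F` for the form `dI ∧ dφ + i dz ∧ dw`, with the sign for which
`sympl (hamVF F x) v = DF(x) v`. -/
def hamVF (F : Phase n m → ℂ) (x : Phase n m) : Phase n m :=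
  (fun i => pd (.inr (.inl i)) F x, fun i => -pd (.inl i) F x,
    fun j => -Complex.I * pd (.inr (.inr (.inr j))) F x,
    fun j => Complex.I * pd (.inr (.inr (.inl j))) F x)

/-- The Poisson bracket, that is the derivative of `K` along the Hamiltonian vector field of `F`. -/
def bracket (K F : Phase n m → ℂ) (x : Phase n m) : ℂ := fderiv ℂ K x (hamVF F x)

/-- The second derivative of `K` evaluated twice on the Hamiltonian vector field of `F`. -/
def bracketTwo (K F : Phase n m → ℂ) (x : Phase n m) : ℂ :=
  fderiv ℂ (fderiv ℂ K) x (hamVF F x) (hamVF F x)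

lemma sympl_hamVF (F : Phase n m → ℂ) (x v : Phase n m) :
    sympl (hamVF F x) v = fderiv ℂ F x v := by
  rw [fderiv_apply_eq_sum]
  simp only [sympl, hamVF, Fintype.sum_sum_type, coord]
  rw [Finset.mul_sum, ← add_assoc, ← Finset.sum_add_distrib, ← Finset.sum_add_distrib]
  refine congrArg₂ (· + ·) (Finset.sum_congr rfl fun i _ => by ring)
    (Finset.sum_congr rfl fun j _ => ?_)
  linear_combination (-(pd (.inr (.inr (.inr j))) F x * v.2.2.2 j) -
    pd (.inr (.inr (.inl j))) F x * v.2.2.1 j) * Complex.I_sq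

section Pol

variable {s : ℝ} {d d' : ℤ} {K F : Phase n m → ℂ}

lemma Pol.coord_hamVF (h : Pol s d F) (α : CoordIdx n m) :
    Pol s (d - 2 + wt α) fun x => coord α (hamVF F x) := by
  rcases α with i | i | j | j
  · exact (h.pd (.inr (.inl i))).cast_deg (by simp [wt])
  · exact (((h.pd (.inl i)).const_mul (-1)).cast_deg (by simp [wt])).congr fun x _ => by
      simp [coord, hamVF]
  · exact ((h.pd (.inr (.inr (.inr j)))).const_mul (-Complex.I)).cast_deg (by simp only [wt]; ring)
  · exact ((h.pd (.inr (.inr (.inl j)))).const_mul Complex.I).cast_deg (by simp only [wt]; ring)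

/-- Every term of the bracket differentiates in a pair of conjugate coordinates, whose weights add up
to `2`; hence the degree `d + d' - 2`. -/
theorem Pol.bracket (hK : Pol s d K) (hF : Pol s d' F) : Pol s (d + d' - 2) (bracket K F) := by
  refine (Pol.sum Finset.univ fun α _ => ((hF.coord_hamVF α).mul (hK.pd α)).cast_deg ?_).congr
    fun x _ => fderiv_apply_eq_sum K x _
  ring

lemma Pol.fderiv_fderiv_dir (hK : Pol s d K) (α β : CoordIdx n m) {x : Phase n m}
    (hx : x ∈ cylinder n m s) :
    fderiv ℂ (fderiv ℂ K) x (dir α) (dir β) = _root_.pd α (_root_.pd β K) x := by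
  have h := (hK.analyticOnNhd.fderiv x hx).differentiableAt
  have : _root_.pd β K = fun y => fderiv ℂ K y (dir β) := rfl
  rw [_root_.pd, this, fderiv_clm_apply h (differentiableAt_const _)]
  simp

theorem Pol.bracketTwo (hK : Pol s d K) (hF : Pol s d' F) :
    Pol s (d + 2 * d' - 4) (bracketTwo K F) := by
  refine (Pol.sum Finset.univ fun α _ => Pol.sum Finset.univ fun β _ =>
    (((hF.coord_hamVF α).mul (hF.coord_hamVF β)).mul ((hK.pd β).pd α)).cast_deg ?_).congr
    fun x hx => ?_
  · ring
  · rw [_root_.bracketTwo]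
    conv_lhs => rw [← sum_coord_smul_dir (hamVF F x)]
    simp only [map_sum, map_smul, _root_.sum_apply, _root_.smul_apply,
      smul_eq_mul, Finset.mul_sum]
    rw [Finset.sum_comm]
    refine Finset.sum_congr rfl fun α _ => Finset.sum_congr rfl fun β _ => ?_
    rw [hK.fderiv_fderiv_dir α β hx]
    ring

end Pol

/-! ### Reality -/

/-- The function takes real values at the real points of the cylinder. -/
def RealOn (s : ℝ) (T : Phase n m → ℂ) : Prop :=
  ∀ x ∈ cylinder n m s, x ∈ realPoints n m → (T x).im = 0

section Real

variable {s : ℝ} {d d' : ℕ} {K F : Phase n m → ℂ}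

lemma RealOn.add (hK : RealOn s K) (hF : RealOn s F) : RealOn s fun x => K x + F x :=
  fun x hx hr => by rw [Complex.add_im, hK x hx hr, hF x hx hr, add_zero]

lemma RealOn.real_mul (a : ℝ) (hK : RealOn s K) : RealOn s fun x => (a : ℂ) * K x :=
  fun x hx hr => by simp only [Complex.im_ofReal_mul, hK x hx hr, mul_zero]

lemma fderiv_im_eq_zero (hK : RealOn s K) {x v : Phase n m} (hx : x ∈ cylinder n m s)
    (hd : DifferentiableAt ℂ K x) (hr : x ∈ realPoints n m) (hv : v ∈ realPoints n m) :
    (fderiv ℂ K x v).im = 0 := by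
  have h1 : HasDerivAt (fun t : ℝ => x + (t : ℂ) • v) v 0 := by
    simpa using ((Complex.ofRealCLM.hasDerivAt (x := 0)).smul_const v).const_add x
  have h0 : HasFDerivAt K (fderiv ℂ K x) (x + ((0 : ℝ) : ℂ) • v) := by simpa using hd.hasFDerivAt
  have h2 := (h0.restrictScalars ℝ).comp_hasDerivAt (0 : ℝ) h1
  have h3 := (Complex.imCLM.hasFDerivAt.comp_hasDerivAt (0 : ℝ) h2)
  have h4 : (fun t : ℝ => (K (x + (t : ℂ) • v)).im) =ᶠ[𝓝 0] fun _ => 0 := by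
    have h5 : ∀ᶠ t : ℝ in 𝓝 0, x + (t : ℂ) • v ∈ cylinder n m s := by
      refine h1.continuousAt.eventually_mem ?_
      simpa using (isOpen_cylinder n m s).mem_nhds hx
    filter_upwards [h5] with t ht
    exact hK _ ht (add_mem_realPoints hr (real_smul_mem_realPoints t hv))
  exact h3.unique ((hasDerivAt_const (0 : ℝ) (0 : ℝ)).congr_of_eventuallyEq h4)

/-- The Hamiltonian vector field of a real function is real at real points. -/
lemma hamVF_mem_realPoints (hF : RealOn s F) {x : Phase n m} (hx : x ∈ cylinder n m s)
    (hd : DifferentiableAt ℂ F x) (hr : x ∈ realPoints n m) : hamVF F x ∈ realPoints n m := by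
  have key : ∀ v ∈ realPoints n m, (fderiv ℂ F x v).im = 0 := fun v hv =>
    fderiv_im_eq_zero hF hx hd hr hv
  have single_im : ∀ {k : ℕ} (i i' : Fin k), ((Pi.single i 1 : Fin k → ℂ) i').im = 0 := by
    intro k i i'
    rw [Pi.single_apply]; split_ifs <;> simp
  refine ⟨fun i => key _ ⟨fun i' => by simp [dir], fun i' => single_im i i', by simp [dir]⟩,
    fun i => ?_, fun j => ?_⟩
  · simp only [hamVF, Complex.neg_im, neg_eq_zero]
    exact key _ ⟨fun i' => single_im i i', fun i' => by simp [dir], by simp [dir]⟩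
  -- For the elliptic directions, test on the two real vectors `e_z + e_w` and `i (e_z - e_w)`.
  · have h1 := key (dir (.inr (.inr (.inl j))) + dir (.inr (.inr (.inr j))))
      ⟨by simp [dir], by simp [dir], fun j' => by
        by_cases h : j' = j
        · subst h; simp [dir]
        · simp [dir, h]⟩
    have h2 := key (Complex.I • (dir (.inr (.inr (.inl j))) - dir (.inr (.inr (.inr j)))))
      ⟨by simp [dir], by simp [dir], fun j' => by
        by_cases h : j' = j
        · subst h; simp [dir]
        · simp [dir, h]⟩
    rw [map_add, Complex.add_im] at h1
    rw [map_smul, map_sub, smul_eq_mul, Complex.I_mul_im, Complex.sub_re] at h2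
    simp only [hamVF, map_mul, map_neg, Complex.conj_I, neg_neg, pd]
    congr 1
    apply Complex.ext
    · rw [Complex.conj_re]; linarith
    · rw [Complex.conj_im]; linarith

lemma RealOn.bracket (hK : RealOn s K) (hF : RealOn s F)
    (hdK : ∀ x ∈ cylinder n m s, DifferentiableAt ℂ K x)
    (hdF : ∀ x ∈ cylinder n m s, DifferentiableAt ℂ F x) : RealOn s (bracket K F) :=
  fun x hx hr => fderiv_im_eq_zero hK hx (hdK x hx) hr (hamVF_mem_realPoints hF hx (hdF x hx) hr)

lemma RealOn.bracketTwo (hK : RealOn s K) (hF : RealOn s F)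
    (haK : AnalyticOnNhd ℂ K (cylinder n m s))
    (hdF : ∀ x ∈ cylinder n m s, DifferentiableAt ℂ F x) : RealOn s (bracketTwo K F) := by
  intro x hx hr
  have hv := hamVF_mem_realPoints hF hx (hdF x hx) hr
  have hd := (haK.fderiv x hx).differentiableAt
  have h1 : RealOn s fun y => fderiv ℂ K y (hamVF F x) := fun y hy hyr =>
    fderiv_im_eq_zero hK hy (haK y hy).differentiableAt hyr hv
  have h2 := fderiv_im_eq_zero h1 hx (hd.clm_apply (differentiableAt_const _)) hr hv
  rw [fderiv_clm_apply hd (differentiableAt_const _)] at h2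
  simpa [_root_.bracketTwo] using h2

lemma exists_realAngle_eq {x : Phase n m} (hr : x ∈ realPoints n m) :
    ∃ θ, x.2.1 = realAngle θ :=
  ⟨fun i => (x.2.1 i).re, funext fun i => Complex.ext (by simp [realAngle])
    (by simpa [realAngle] using hr.2.1 i)⟩

/-- A family of coefficients is symmetric if exchanging `z` and `w` conjugates the values at real
angles. -/
def SymmCoeff (d : ℕ) (c : MIdx n m → (Fin n → ℂ) → ℂ) : Prop :=
  ∀ p, wdeg p = d → ∀ θ, c (conjIdx p) (realAngle θ) = (starRingEnd ℂ) (c p (realAngle θ))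

lemma SymmCoeff.realOn {c : MIdx n m → (Fin n → ℂ) → ℂ} (hc : SymmCoeff d c) :
    RealOn s (weightPart d c) := by
  intro x _ hr
  obtain ⟨θ, hθ⟩ := exists_realAngle_eq hr
  rw [← Complex.conj_eq_iff_im, weightPart, map_sum]
  refine Finset.sum_bij (fun p _ => conjIdx p)
    (fun p hp => by rw [mem_weightSet] at hp ⊢; rw [wdeg_conjIdx, hp])
    (fun p _ q _ h => by simpa [conjIdx_conjIdx] using congrArg conjIdx h)
    (fun p hp => ⟨conjIdx p, by rw [mem_weightSet] at hp ⊢; rw [wdeg_conjIdx, hp], rfl⟩)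
    fun p hp => ?_
  rw [map_mul, conj_mono, mem_realPoints_iff.1 hr, hθ, hc p (mem_weightSet.1 hp)]

/-- The weighted homogeneous part as a power series over all multi-indices. -/
lemma hasSum_weightPart (d : ℕ) (c : MIdx n m → (Fin n → ℂ) → ℂ) (φ : Fin n → ℂ) (x : Phase n m)
    (hφ : x.2.1 = φ) :
    HasSum (fun p => (if wdeg p = d then c p φ else 0) * mono p x) (weightPart d c x) := by
  have : weightPart d c x = ∑ p ∈ weightSet n m d,
      (if wdeg p = d then c p φ else 0) * mono p x := by
    refine Finset.sum_congr rfl fun p hp => ?_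
    rw [if_pos (mem_weightSet.1 hp), hφ]
  rw [this]
  refine hasSum_sum_of_ne_finset_zero fun p hp => ?_
  rw [if_neg fun h => hp (mem_weightSet.2 h), zero_mul]

/-- The coefficients of a real weighted homogeneous function are conjugation symmetric: recover them
by Cauchy's formula and use the symmetry of the function. -/
lemma RealOn.symmCoeff (hs : 0 < s) {c : MIdx n m → (Fin n → ℂ) → ℂ} {T : Phase n m → ℂ}
    (hT : Pol s d T) (hr : RealOn s T) (hTc : EqOn T (weightPart d c) (cylinder n m s)) :
    SymmCoeff d c := by
  intro p hp θ
  have hcyl : ∀ φ ∈ strip n s, ∀ t, torusPoint (m := m) 1 φ t ∈ cylinder n m s :=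
    fun φ hφ t => hφ
  have hconj : ∀ x ∈ cylinder n m s, T (conjPhase x) = (starRingEnd ℂ) (T x) := fun x hx =>
    apply_conjPhase_of_real (isOpen_cylinder n m s) (convex_cylinder n m s)
      (fun _ h => conjPhase_mem_cylinder h) hT.analyticOnNhd.differentiableOn hr hx
  have := conj_coeff_of_hasSum (s := s) (T := T) (c := fun p φ => if wdeg p = d then c p φ else 0)
    one_pos (fun φ hφ t => hconj _ (hcyl φ hφ t))
    (fun φ hφ t => by rw [hTc (hcyl φ hφ t)]; exact hasSum_weightPart d c φ _ rfl)
    (fun φ hφ t => by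
      rw [hTc (conjPhase_mem_cylinder (hcyl φ hφ t))]; exact hasSum_weightPart d c _ _ rfl)
    (realAngle_mem_strip hs θ) p
  simpa [wdeg_conjIdx, hp, conj_realAngle] using this

end Real

/-! ### The homological equation -/

lemma differentiable_mono (p : MIdx n m) (x : Phase n m) : DifferentiableAt ℂ (mono p) x := by
  unfold mono
  exact ((((Finset.analyticAt_fun_prod _ fun i _ => (analyticAt_coord_I i x).fun_pow _).fun_mul
    (Finset.analyticAt_fun_prod _ fun j _ => (analyticAt_coord_z j x).fun_pow _))).fun_mul
    (Finset.analyticAt_fun_prod _ fun j _ => (analyticAt_coord_w j x).fun_pow _)).differentiableAt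

lemma pd_mono_I (p : MIdx n m) (i : Fin n) (x : Phase n m) :
    pd (.inl i) (mono p) x = p.1 i * mono (p.1 - Pi.single i 1, p.2) x := by
  refine pd_apply_of_hasDerivAt (differentiable_mono p x) ?_
  have h := ((hasDerivAt_prod_pow p.1 x.1 i).mul_const
    (∏ j, x.2.2.1 j ^ p.2.1 j)).mul_const (∏ j, x.2.2.2 j ^ p.2.2 j)
  refine (h.congr_of_eventuallyEq (Eventually.of_forall fun t => ?_)).congr_deriv ?_
  · simp [mono, dir]
  · simp only [mono]; ring

lemma pd_mono_z (p : MIdx n m) (j : Fin m) (x : Phase n m) :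
    pd (.inr (.inr (.inl j))) (mono p) x =
      p.2.1 j * mono (p.1, p.2.1 - Pi.single j 1, p.2.2) x := by
  refine pd_apply_of_hasDerivAt (differentiable_mono p x) ?_
  have h := ((hasDerivAt_prod_pow p.2.1 x.2.2.1 j).const_mul
    (∏ i, x.1 i ^ p.1 i)).mul_const (∏ j, x.2.2.2 j ^ p.2.2 j)
  refine (h.congr_of_eventuallyEq (Eventually.of_forall fun t => ?_)).congr_deriv ?_
  · simp [mono, dir]
  · simp only [mono]; ring

lemma pd_mono_w (p : MIdx n m) (j : Fin m) (x : Phase n m) :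
    pd (.inr (.inr (.inr j))) (mono p) x =
      p.2.2 j * mono (p.1, p.2.1, p.2.2 - Pi.single j 1) x := by
  refine pd_apply_of_hasDerivAt (differentiable_mono p x) ?_
  have h := (hasDerivAt_prod_pow p.2.2 x.2.2.2 j).const_mul
    ((∏ i, x.1 i ^ p.1 i) * ∏ j, x.2.2.1 j ^ p.2.1 j)
  refine (h.congr_of_eventuallyEq (Eventually.of_forall fun t => ?_)).congr_deriv ?_
  · simp [mono, dir]
  · simp only [mono]; ring

lemma pd_mono_phi (p : MIdx n m) (i : Fin n) (x : Phase n m) :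
    pd (.inr (.inl i)) (mono p) x = 0 := by
  refine pd_apply_of_hasDerivAt (differentiable_mono p x) ?_
  refine (hasDerivAt_const (0 : ℂ) (mono p x)).congr_of_eventuallyEq
    (Eventually.of_forall fun t => ?_)
  simp [mono, dir]

section CoeffMono

variable {s : ℝ} {u : (Fin n → ℂ) → ℂ} {x : Phase n m}

lemma pd_coeff_mul_mono (hu : IsCoeffFun s u) (hx : x ∈ cylinder n m s) (p : MIdx n m)
    (α : CoordIdx n m) : pd α (fun x => u x.2.1 * mono p x) x =
      fderiv ℂ u x.2.1 (dir α).2.1 * mono p x + u x.2.1 * pd α (mono p) x := by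
  have h1 := (Pol.coeff (m := m) hu).differentiableAt hx
  rw [pd, fderiv_fun_mul h1 (differentiable_mono p x)]
  simp only [_root_.add_apply, _root_.smul_apply, smul_eq_mul]
  rw [Pol.pd_coeff (hu.analytic _ hx).differentiableAt, pd]
  ring

lemma pow_mul_sub_single {d : ℕ} (a : Fin d → ℕ) (v : Fin d → ℂ) (j : Fin d) :
    v j * (a j * ∏ k, v k ^ (a - Pi.single j 1 : Fin d → ℕ) k) = a j * ∏ k, v k ^ a k := by
  rcases Nat.eq_zero_or_pos (a j) with h | h
  · simp [h]
  · rw [← Finset.mul_prod_erase _ _ (Finset.mem_univ j),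
      ← Finset.mul_prod_erase Finset.univ (fun k => v k ^ a k) (Finset.mem_univ j)]
    have h1 : v j ^ a j = v j * v j ^ (a - Pi.single j 1 : Fin d → ℕ) j := by
      rw [← pow_succ']; congr 1; simp; omega
    have h2 : ∏ k ∈ Finset.univ.erase j, v k ^ (a - Pi.single j 1 : Fin d → ℕ) k =
        ∏ k ∈ Finset.univ.erase j, v k ^ a k :=
      Finset.prod_congr rfl fun k hk => by simp [(Finset.mem_erase.1 hk).1]
    rw [h1, h2]; ring

end CoeffMono

/-- The operator `F ↦ {ω·I + Ω z·w, F}` in coordinates. -/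
lemma bracket_linearPart (ω : Fin n → ℝ) (Ω : Fin m → ℝ) (F : Phase n m → ℂ) (x : Phase n m) :
    bracket (linearPart ω Ω) F x = ∑ i, (ω i : ℂ) * pd (.inr (.inl i)) F x +
      ∑ j, Complex.I * (Ω j : ℂ) * (x.2.2.1 j * pd (.inr (.inr (.inl j))) F x -
        x.2.2.2 j * pd (.inr (.inr (.inr j))) F x) := by
  have hd : HasFDerivAt (linearPart ω Ω) (fderiv ℂ (linearPart ω Ω) x) x :=
    (analyticOnNhd_linearPart ω Ω univ x trivial).differentiableAt.hasFDerivAt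
  set v := hamVF F x with hv
  have h1 : HasDerivAt (fun t : ℂ => x + t • v) v 0 := by
    simpa using ((hasDerivAt_id (0 : ℂ)).smul_const v).const_add x
  have h0 : HasFDerivAt (linearPart ω Ω) (fderiv ℂ (linearPart ω Ω) x) (x + (0 : ℂ) • v) := by
    simpa using hd
  have h2 := h0.comp_hasDerivAt (0 : ℂ) h1
  have h3 : HasDerivAt (linearPart ω Ω ∘ fun t : ℂ => x + t • v) (∑ i, (ω i : ℂ) * v.1 i +
      ∑ j, ((Ω j : ℂ) * v.2.2.1 j * x.2.2.2 j + (Ω j : ℂ) * x.2.2.1 j * v.2.2.2 j)) 0 := by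
    have hl : ∀ a b : ℂ, HasDerivAt (fun t : ℂ => a + t * b) b 0 := fun a b => by
      simpa using ((hasDerivAt_id (0 : ℂ)).mul_const b).const_add a
    refine HasDerivAt.add (f := fun t => ∑ i, (ω i : ℂ) * (x.1 i + t * v.1 i))
      (g := fun t => ∑ j, (Ω j : ℂ) * (x.2.2.1 j + t * v.2.2.1 j) * (x.2.2.2 j + t * v.2.2.2 j))
      (HasDerivAt.fun_sum fun i _ => (hl _ _).const_mul _) (HasDerivAt.fun_sum fun j _ => ?_)
    simpa using ((hl (x.2.2.1 j) (v.2.2.1 j)).const_mul (Ω j : ℂ)).fun_mul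
      (hl (x.2.2.2 j) (v.2.2.2 j))
  rw [bracket, ← hv, h2.unique h3]
  simp only [hv, hamVF]
  congr 1
  exact Finset.sum_congr rfl fun j _ => by ring

/-- The multi-indices whose monomials are put into normal form: those containing an action and at most
two elliptic variables. The last condition keeps the divisors within reach of the Melnikov
conditions. -/
def Solvable (p : MIdx n m) : Prop := p.1 ≠ 0 ∧ ∑ j, p.2.1 j + ∑ j, p.2.2 j ≤ 2

/-- The difference `a - ā` of the exponents of `z` and `w`. -/
def charge (p : MIdx n m) (j : Fin m) : ℤ := p.2.1 j - p.2.2 j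

open Classical in
/-- The coefficients of the generating function that removes `∑ c_p mono p` up to its normal
form. -/
def solCoeff (ω : Fin n → ℝ) (Ω : Fin m → ℝ) (c : MIdx n m → (Fin n → ℂ) → ℂ) (p : MIdx n m) :
    (Fin n → ℂ) → ℂ :=
  if Solvable p then homSol ω Ω (charge p) (c p) else 0

open Classical in
/-- The coefficients of the normal form of `∑ c_p mono p`: a solvable coefficient is replaced by its
average if its charge vanishes and removed otherwise; the other coefficients are untouched. -/
def normalCoeff (c : MIdx n m → (Fin n → ℂ) → ℂ) (p : MIdx n m) (φ : Fin n → ℂ) : ℂ :=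
  if Solvable p then if charge p = 0 then torusCoeff (c p) 0 else 0 else c p φ

lemma Solvable.charge_le {p : MIdx n m} (h : Solvable p) : ∑ j, |charge p j| ≤ 2 := by
  have : ∑ j, |charge p j| ≤ ∑ j, ((p.2.1 j : ℤ) + p.2.2 j) := Finset.sum_le_sum fun j _ => by
    rw [charge, abs_le]; constructor <;> omega
  refine this.trans ?_
  rw [Finset.sum_add_distrib]
  exact_mod_cast h.2

section Homological

variable {ω : Fin n → ℝ} {Ω : Fin m → ℝ} {γ τ s : ℝ} {d : ℕ}
  {c : MIdx n m → (Fin n → ℂ) → ℂ}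

lemma isCoeffFun_solCoeff (hs : 0 < s) (hγ : 0 < γ) (hτ : 0 < τ) (hMel : Melnikov ω Ω γ τ)
    {p : MIdx n m} (hc : IsCoeffFun s (c p)) : IsCoeffFun s (solCoeff ω Ω c p) := by
  unfold solCoeff
  split_ifs with h
  · exact isCoeffFun_homSol hs hγ hτ hMel h.charge_le hc
  · exact IsCoeffFun.const s 0

lemma isCoeffFun_normalCoeff {p : MIdx n m} (hc : IsCoeffFun s (c p)) :
    IsCoeffFun s (normalCoeff c p) := by
  unfold normalCoeff
  split_ifs
  · exact IsCoeffFun.const s _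
  · exact IsCoeffFun.const s 0
  · exact hc

lemma solvable_conjIdx {p : MIdx n m} : Solvable (conjIdx p) ↔ Solvable p := by
  simp only [Solvable, conjIdx, add_comm]

lemma charge_conjIdx (p : MIdx n m) : charge (conjIdx p) = -charge p := by
  ext j; simp [charge, conjIdx]

lemma SymmCoeff.solCoeff (hc : SymmCoeff d c) : SymmCoeff d (solCoeff ω Ω c) := by
  intro p hp θ
  by_cases h : Solvable p
  · rw [_root_.solCoeff, _root_.solCoeff, if_pos h, if_pos (solvable_conjIdx.2 h), charge_conjIdx]
    exact conj_homSol _ (hc p hp) θ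
  · rw [_root_.solCoeff, _root_.solCoeff, if_neg h, if_neg (mt solvable_conjIdx.1 h)]
    simp

lemma SymmCoeff.normalCoeff (hc : SymmCoeff d c) : SymmCoeff d (normalCoeff c) := by
  intro p hp θ
  by_cases h : Solvable p
  · rw [_root_.normalCoeff, _root_.normalCoeff, if_pos h, if_pos (solvable_conjIdx.2 h),
      charge_conjIdx]
    simp only [neg_eq_zero]
    split_ifs
    · rw [conj_torusCoeff (hc p hp), neg_zero]
    · simp
  · rw [_root_.normalCoeff, _root_.normalCoeff, if_neg h, if_neg (mt solvable_conjIdx.1 h)]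
    exact hc p hp θ

/-- The coefficients `solCoeff` solve the homological equation for every weighted homogeneous part.
The bracket with `ω·I + Ωzw` acts on each monomial separately, with a divisor depending on its
charge. -/
theorem homological_equation (hs : 0 < s) (hγ : 0 < γ) (hτ : 0 < τ) (hMel : Melnikov ω Ω γ τ)
    (hc : ∀ p, wdeg p = d → IsCoeffFun s (c p)) {x : Phase n m} (hx : x ∈ cylinder n m s) :
    bracket (linearPart ω Ω) (weightPart d (solCoeff ω Ω c)) x + weightPart d c x =
      weightPart d (normalCoeff c) x := by
  have hsol : ∀ p, wdeg p = d → IsCoeffFun s (solCoeff ω Ω c p) := fun p hp =>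
    isCoeffFun_solCoeff hs hγ hτ hMel (hc p hp)
  have hpd : ∀ α, pd α (weightPart d (solCoeff ω Ω c)) x = ∑ p ∈ weightSet n m d,
      pd α (fun x => solCoeff ω Ω c p x.2.1 * mono p x) x := by
    intro α
    unfold weightPart
    rw [pd, fderiv_fun_sum fun p hp => ((Pol.coeff (hsol p (mem_weightSet.1 hp))).mul
      (Pol.mono p)).differentiableAt hx]
    simp [pd]
  rw [bracket_linearPart]
  simp only [hpd, Finset.mul_sum, ← Finset.sum_sub_distrib]
  rw [Finset.sum_comm, Finset.sum_comm (s := Finset.univ (α := Fin m)), ← Finset.sum_add_distrib,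
    weightPart, weightPart, ← Finset.sum_add_distrib]
  refine Finset.sum_congr rfl fun p hp => ?_
  rw [mem_weightSet] at hp
  have hu := hsol p hp
  simp only [pd_coeff_mul_mono hu hx, pd_mono_phi, pd_mono_z, pd_mono_w, dir, map_zero, zero_mul,
    zero_add, mul_zero, add_zero]
  have e1 : ∀ j, x.2.2.1 j * ((p.2.1 j : ℂ) * mono (p.1, p.2.1 - Pi.single j 1, p.2.2) x) =
      p.2.1 j * mono p x := by
    intro j
    have := pow_mul_sub_single p.2.1 x.2.2.1 j
    simp only [mono]
    linear_combination ((∏ i, x.1 i ^ p.1 i) * ∏ j, x.2.2.2 j ^ p.2.2 j) * this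
  have e2 : ∀ j, x.2.2.2 j * ((p.2.2 j : ℂ) * mono (p.1, p.2.1, p.2.2 - Pi.single j 1) x) =
      p.2.2 j * mono p x := by
    intro j
    have := pow_mul_sub_single p.2.2 x.2.2.2 j
    simp only [mono]
    linear_combination ((∏ i, x.1 i ^ p.1 i) * ∏ j, x.2.2.1 j ^ p.2.1 j) * this
  have e3 : ∀ j, Complex.I * (Ω j : ℂ) * (x.2.2.1 j * (solCoeff ω Ω c p x.2.1 *
        ((p.2.1 j : ℂ) * mono (p.1, p.2.1 - Pi.single j 1, p.2.2) x)) -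
      x.2.2.2 j * (solCoeff ω Ω c p x.2.1 *
        ((p.2.2 j : ℂ) * mono (p.1, p.2.1, p.2.2 - Pi.single j 1) x))) =
      ((Ω j : ℂ) * charge p j) * (Complex.I * solCoeff ω Ω c p x.2.1 * mono p x) := by
    intro j
    have hch : ((charge p j : ℤ) : ℂ) = p.2.1 j - p.2.2 j := by simp [charge]
    rw [hch]
    linear_combination (Complex.I * (Ω j : ℂ) * solCoeff ω Ω c p x.2.1) * (e1 j - e2 j)
  simp only [e3, ← Finset.sum_mul]
  have e4 : ∑ i, (ω i : ℂ) * (fderiv ℂ (solCoeff ω Ω c p) x.2.1 (Pi.single i 1) * mono p x) =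
      (∑ i, (ω i : ℂ) * angleDeriv i (solCoeff ω Ω c p) x.2.1) * mono p x := by
    rw [Finset.sum_mul]
    exact Finset.sum_congr rfl fun i _ => by rw [angleDeriv]; ring
  rw [e4]
  by_cases h : Solvable p
  · have key := homSol_equation hs hγ hτ hMel h.charge_le (hc p hp) hx
    have h1 : solCoeff ω Ω c p = homSol ω Ω (charge p) (c p) := by rw [solCoeff, if_pos h]
    have h2 : normalCoeff c p x.2.1 = if charge p = 0 then torusCoeff (c p) 0 else 0 := by
      rw [normalCoeff, if_pos h]
    rw [h1, h2, ← key]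
    ring
  · have h1 : solCoeff ω Ω c p = 0 := by rw [solCoeff, if_neg h]
    have h2 : normalCoeff c p x.2.1 = c p x.2.1 := by rw [normalCoeff, if_neg h]
    rw [h1, h2]
    simp [angleDeriv]

end Homological

/-! ### Parts of low degree -/

lemma unit_eq_single {d : ℕ} (i : Fin d) : _root_.unit i = Pi.single i 1 := rfl

lemma sum_piAntidiag_one {d : ℕ} (g : (Fin d → ℕ) → ℂ) :
    ∑ k ∈ Finset.piAntidiag Finset.univ 1, g k = ∑ i, g (unit i) := by
  symm
  refine Finset.sum_bij (fun i _ => unit i) (fun i _ => ?_) (fun i _ i' _ h => ?_)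
    (fun k hk => ?_) fun i _ => rfl
  · simp [unit_eq_single]
  · have := congrFun h i
    by_contra hne
    simp [unit_eq_single, hne] at this
  · rw [Finset.mem_piAntidiag] at hk
    have h1 : ∃ i, k i ≠ 0 := by
      by_contra! h
      simp [h] at hk
    obtain ⟨i, hi⟩ := h1
    have h2 := hk.1
    rw [← Finset.add_sum_erase _ _ (Finset.mem_univ i)] at h2
    have h3 : ∑ x ∈ Finset.univ.erase i, k x = 0 := by omega
    rw [Finset.sum_eq_zero_iff] at h3
    refine ⟨i, Finset.mem_univ i, funext fun i' => ?_⟩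
    by_cases h : i' = i
    · subst h; simp [unit_eq_single]; omega
    · simp [unit_eq_single, h, h3 i' (by simp [h])]

lemma sum_piAntidiag_succ {d : ℕ} (q : ℕ) (i : Fin d) (g : (Fin d → ℕ) → ℂ) :
    ∑ k ∈ Finset.piAntidiag Finset.univ (q + 1), (k i : ℂ) * g k =
      ∑ k ∈ Finset.piAntidiag Finset.univ q, ((k i : ℂ) + 1) * g (k + unit i) := by
  symm
  refine Finset.sum_bij_ne_zero (fun k _ _ => k + unit i) (fun k hk _ => ?_)
    (fun k _ _ k' _ _ h => add_right_cancel h) (fun k hk h0 => ?_) fun k _ _ => ?_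
  · simp only [Finset.mem_piAntidiag, Finset.mem_univ, implies_true, and_true] at hk ⊢
    simp [Finset.sum_add_distrib, hk, unit_eq_single]
  · have hki : k i ≠ 0 := fun h => h0 (by simp [h])
    have hle : unit i ≤ k := fun i' => by
      by_cases h : i' = i
      · subst h; simp [unit_eq_single]; omega
      · simp [unit_eq_single, h]
    simp only [Finset.mem_piAntidiag, Finset.mem_univ, implies_true, and_true] at hk
    have hsum : ∑ x, (k - unit i) x + 1 = q + 1 := by
      rw [← hk]
      conv_rhs => rw [← tsub_add_cancel_of_le hle]
      simp [Finset.sum_add_distrib, unit_eq_single]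
    refine ⟨k - unit i, by simpa [Finset.mem_piAntidiag] using hsum, ?_, tsub_add_cancel_of_le hle⟩
    rw [tsub_add_cancel_of_le hle]
    have h1 : g k ≠ 0 := fun h => h0 (by rw [h, mul_zero])
    exact mul_ne_zero (Nat.cast_add_one_ne_zero _) h1
  · simp [unit_eq_single]

/-- Each monomial of degree two arises twice from the pairs `(i, i')` if the diagonal ones are
counted twice. -/
lemma sum_piAntidiag_two {d : ℕ} (g : (Fin d → ℕ) → ℂ) :
    ∑ k ∈ Finset.piAntidiag Finset.univ 2, g k =
      1 / 2 * ∑ i, ∑ i', (1 + if i = i' then 1 else 0) * g (unit i + unit i') := by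
  have h1 : ∀ k ∈ Finset.piAntidiag (Finset.univ : Finset (Fin d)) 2,
      g k = 1 / 2 * ∑ i, (k i : ℂ) * g k := by
    intro k hk
    rw [Finset.mem_piAntidiag] at hk
    have : (∑ i, (k i : ℂ)) = 2 := by exact_mod_cast hk.1
    rw [← Finset.sum_mul, this]; ring
  rw [Finset.sum_congr rfl h1, ← Finset.mul_sum, Finset.sum_comm]
  congr 1
  refine Finset.sum_congr rfl fun i _ => ?_
  rw [sum_piAntidiag_succ 1 i g, sum_piAntidiag_one]
  refine Finset.sum_congr rfl fun i' _ => ?_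
  rw [add_comm (unit i') (unit i), add_comm (_ : ℂ) 1]
  congr 2
  by_cases h : i = i'
  · subst h; simp [unit_eq_single]
  · simp [unit_eq_single, h]

lemma prod_pow_unit {d : ℕ} (v : Fin d → ℂ) (i : Fin d) : ∏ k, v k ^ unit i k = v i := by
  rw [← Finset.mul_prod_erase _ _ (Finset.mem_univ i), Finset.prod_eq_one]
  · simp [unit_eq_single]
  · intro k hk
    simp [unit_eq_single, (Finset.mem_erase.1 hk).1]

/-- The part of degree one in the actions and of degree one in `(z, w)`. -/
def bilinPart (c : MIdx n m → (Fin n → ℂ) → ℂ) (x : Phase n m) : ℂ :=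
  ∑ i, x.1 i * ∑ j, (c (unit i, unit j, 0) x.2.1 * x.2.2.1 j + c (unit i, 0, unit j) x.2.1 * x.2.2.2 j)

lemma homogPart_one_one (c : MIdx n m → (Fin n → ℂ) → ℂ) (x : Phase n m) :
    homogPart 1 1 c x = bilinPart c x := by
  rw [homogPart, sum_piAntidiag_one, bilinPart]
  refine Finset.sum_congr rfl fun i _ => ?_
  have : Finset.HasAntidiagonal.antidiagonal 1 = {((0 : ℕ), 1), (1, 0)} := rfl
  rw [this, Finset.sum_pair (by simp)]
  simp only [Finset.piAntidiag_zero, Finset.sum_singleton, sum_piAntidiag_one]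
  rw [add_comm, ← Finset.sum_add_distrib, Finset.mul_sum]
  refine Finset.sum_congr rfl fun j _ => ?_
  simp only [mono, prod_pow_unit, Pi.zero_apply, pow_zero, Finset.prod_const_one]
  ring

lemma mono_eq_zero {p : MIdx n m} {x : Phase n m} (hz : x.2.2 = 0)
    (hp : ∑ j, p.2.1 j + ∑ j, p.2.2 j ≠ 0) : mono p x = 0 := by
  by_cases h : ∑ j, p.2.1 j = 0
  · have h2 : ∑ j, p.2.2 j ≠ 0 := by omega
    obtain ⟨j, _, hj⟩ := Finset.exists_ne_zero_of_sum_ne_zero h2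
    rw [mono, Finset.prod_eq_zero (s := Finset.univ) (f := fun j => x.2.2.2 j ^ p.2.2 j) (i := j)
      (Finset.mem_univ _), mul_zero]
    simp [hz, hj]
  · obtain ⟨j, _, hj⟩ := Finset.exists_ne_zero_of_sum_ne_zero h
    rw [mono, Finset.prod_eq_zero (s := Finset.univ) (f := fun j => x.2.2.1 j ^ p.2.1 j) (i := j)
      (Finset.mem_univ _), mul_zero, zero_mul]
    simp [hz, hj]

/-! ### Poisson brackets with the part of degree one -/

lemma bracket_eq (K F : Phase n m → ℂ) (x : Phase n m) : bracket K F x =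
    ∑ i, (pd (.inr (.inl i)) F x * pd (.inl i) K x - pd (.inl i) F x * pd (.inr (.inl i)) K x) +
      ∑ j, Complex.I * (pd (.inr (.inr (.inl j))) F x * pd (.inr (.inr (.inr j))) K x -
        pd (.inr (.inr (.inr j))) F x * pd (.inr (.inr (.inl j))) K x) := by
  rw [bracket, fderiv_apply_eq_sum]
  simp only [hamVF, Fintype.sum_sum_type, coord]
  rw [← add_assoc, ← Finset.sum_add_distrib, ← Finset.sum_add_distrib]
  exact congrArg₂ (· + ·) (Finset.sum_congr rfl fun i _ => by ring)
    (Finset.sum_congr rfl fun j _ => by ring)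

section Bilin

variable {s : ℝ} {c : MIdx n m → (Fin n → ℂ) → ℂ} {x : Phase n m}

lemma pol_homogPart {q d : ℕ} (hc : ∀ p, wdeg p = 2 * q + d → IsCoeffFun s (c p)) :
    Pol s ((2 * q + d : ℕ) : ℤ) (homogPart q d c) := by
  refine (Pol.sum (bidegSet n m q d) fun p hp => ?_).congr fun x _ => homogPart_eq_sum q d c x
  have hw : wdeg p = 2 * q + d := by
    rw [mem_bidegSet] at hp
    rw [wdeg, hp.1, hp.2]
  exact ((Pol.coeff (hc p hw)).mul (Pol.mono p)).cast_deg (by rw [hw, zero_add])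

lemma pol_bilinPart (hc : ∀ p, wdeg p = 3 → IsCoeffFun s (c p)) : Pol s 3 (bilinPart c) :=
  (pol_homogPart (q := 1) (d := 1) hc).congr fun x _ => (homogPart_one_one c x).symm

lemma wdeg_unit_unit_zero (i : Fin n) (j : Fin m) : wdeg (unit i, unit j, (0 : Fin m → ℕ)) = 3 := by
  simp [wdeg, unit_eq_single]

lemma wdeg_unit_zero_unit (i : Fin n) (j : Fin m) : wdeg (unit i, (0 : Fin m → ℕ), unit j) = 3 := by
  simp [wdeg, unit_eq_single]

/-- A function that is affine along a coordinate line has the slope as its partial derivative. -/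
lemma pd_of_affine {T : Phase n m → ℂ} (hT : DifferentiableAt ℂ T x) {α : CoordIdx n m} {a : ℂ}
    (h : ∀ t : ℂ, T (x + t • dir α) = T x + t * a) : pd α T x = a := by
  refine pd_apply_of_hasDerivAt hT ?_
  simp only [h]
  simpa using ((hasDerivAt_id (0 : ℂ)).mul_const a).const_add (T x)

lemma pd_bilinPart_I (hc : ∀ p, wdeg p = 3 → IsCoeffFun s (c p)) (hx : x ∈ cylinder n m s)
    (i : Fin n) : pd (.inl i) (bilinPart c) x =
      ∑ j, (c (unit i, unit j, 0) x.2.1 * x.2.2.1 j + c (unit i, 0, unit j) x.2.1 * x.2.2.2 j) := by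
  refine pd_of_affine ((pol_bilinPart hc).differentiableAt hx) fun t => ?_
  have : ∀ (i' : Fin n) (S : ℂ), (x.1 + t • (Pi.single i 1 : Fin n → ℂ)) i' * S =
      x.1 i' * S + if i' = i then t * S else 0 := by
    intro i' S
    by_cases h : i' = i
    · subst h; simp; ring
    · simp [h]
  simp only [bilinPart, dir, Prod.fst_add, Prod.snd_add, Prod.smul_fst, Prod.smul_snd, smul_zero,
    add_zero, this, Finset.sum_add_distrib, Finset.sum_ite_eq', Finset.mem_univ, if_true]

lemma pd_bilinPart_z (hc : ∀ p, wdeg p = 3 → IsCoeffFun s (c p)) (hx : x ∈ cylinder n m s)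
    (j : Fin m) : pd (.inr (.inr (.inl j))) (bilinPart c) x =
      ∑ i, x.1 i * c (unit i, unit j, 0) x.2.1 := by
  refine pd_of_affine ((pol_bilinPart hc).differentiableAt hx) fun t => ?_
  rw [Finset.mul_sum, bilinPart, bilinPart, ← Finset.sum_add_distrib]
  refine Finset.sum_congr rfl fun i _ => ?_
  have : ∀ j', c (unit i, unit j', 0) x.2.1 * (x.2.2.1 + t • (Pi.single j 1 : Fin m → ℂ)) j' +
      c (unit i, 0, unit j') x.2.1 * x.2.2.2 j' =
      (c (unit i, unit j', 0) x.2.1 * x.2.2.1 j' + c (unit i, 0, unit j') x.2.1 * x.2.2.2 j') +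
        if j' = j then t * c (unit i, unit j', 0) x.2.1 else 0 := by
    intro j'
    by_cases h : j' = j
    · subst h; simp; ring
    · simp [h]
  simp only [dir, Prod.fst_add, Prod.snd_add, Prod.smul_fst, Prod.smul_snd, smul_zero, add_zero,
    this, Finset.sum_add_distrib, Finset.sum_ite_eq', Finset.mem_univ, if_true]
  ring

lemma pd_bilinPart_w (hc : ∀ p, wdeg p = 3 → IsCoeffFun s (c p)) (hx : x ∈ cylinder n m s)
    (j : Fin m) : pd (.inr (.inr (.inr j))) (bilinPart c) x =
      ∑ i, x.1 i * c (unit i, 0, unit j) x.2.1 := by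
  refine pd_of_affine ((pol_bilinPart hc).differentiableAt hx) fun t => ?_
  rw [Finset.mul_sum, bilinPart, bilinPart, ← Finset.sum_add_distrib]
  refine Finset.sum_congr rfl fun i _ => ?_
  have : ∀ j', c (unit i, unit j', 0) x.2.1 * x.2.2.1 j' +
      c (unit i, 0, unit j') x.2.1 * (x.2.2.2 + t • (Pi.single j 1 : Fin m → ℂ)) j' =
      (c (unit i, unit j', 0) x.2.1 * x.2.2.1 j' + c (unit i, 0, unit j') x.2.1 * x.2.2.2 j') +
        if j' = j then t * c (unit i, 0, unit j') x.2.1 else 0 := by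
    intro j'
    by_cases h : j' = j
    · subst h; simp; ring
    · simp [h]
  simp only [dir, Prod.fst_add, Prod.snd_add, Prod.smul_fst, Prod.smul_snd, smul_zero, add_zero,
    this, Finset.sum_add_distrib, Finset.sum_ite_eq', Finset.mem_univ, if_true]
  ring

lemma hasDerivAt_coeff_line (hc : ∀ p, wdeg p = 3 → IsCoeffFun s (c p)) {φ : Fin n → ℂ}
    (hφ : φ ∈ strip n s) (i : Fin n) {p : MIdx n m} (hp : wdeg p = 3) :
    HasDerivAt (fun t : ℂ => c p (φ + t • Pi.single i 1)) (angleDeriv i (c p) φ) 0 := by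
  have h1 : HasDerivAt (fun t : ℂ => φ + t • (Pi.single i 1 : Fin n → ℂ)) (Pi.single i 1) 0 := by
    simpa using ((hasDerivAt_id (0 : ℂ)).smul_const (Pi.single i 1 : Fin n → ℂ)).const_add φ
  have h0 : HasFDerivAt (c p) (fderiv ℂ (c p) φ) (φ + (0 : ℂ) • (Pi.single i 1 : Fin n → ℂ)) := by
    simpa using ((hc p hp).analytic φ hφ).differentiableAt.hasFDerivAt
  exact h0.comp_hasDerivAt (0 : ℂ) h1

lemma pd_bilinPart_phi (hc : ∀ p, wdeg p = 3 → IsCoeffFun s (c p)) (hx : x ∈ cylinder n m s)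
    (i : Fin n) : pd (.inr (.inl i)) (bilinPart c) x = bilinPart (fun p => angleDeriv i (c p)) x := by
  refine pd_apply_of_hasDerivAt ((pol_bilinPart hc).differentiableAt hx) ?_
  have hl := fun p hp => hasDerivAt_coeff_line hc (φ := x.2.1) hx i (p := p) hp
  have h : HasDerivAt (fun t : ℂ => ∑ i', x.1 i' * ∑ j,
      (c (unit i', unit j, 0) (x.2.1 + t • Pi.single i 1) * x.2.2.1 j +
        c (unit i', 0, unit j) (x.2.1 + t • Pi.single i 1) * x.2.2.2 j))
      (bilinPart (fun p => angleDeriv i (c p)) x) 0 :=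
    HasDerivAt.fun_sum fun i' _ => (HasDerivAt.fun_sum fun j _ =>
      ((hl _ (wdeg_unit_unit_zero i' j)).mul_const _).fun_add
        ((hl _ (wdeg_unit_zero_unit i' j)).mul_const _)).const_mul _
  refine h.congr_of_eventuallyEq (Eventually.of_forall fun t => ?_)
  simp [bilinPart, dir]

end Bilin

/-! ### The second order of the averaging -/

lemma bracket_add {T T' : Phase n m → ℂ} {x : Phase n m} (hT : DifferentiableAt ℂ T x)
    (hT' : DifferentiableAt ℂ T' x) (F : Phase n m → ℂ) :
    bracket (fun x => T x + T' x) F x = bracket T F x + bracket T' F x := by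
  rw [bracket, fderiv_fun_add hT hT']; rfl

lemma not_solvable_of_fst_eq_zero {p : MIdx n m} (h : p.1 = 0) : ¬Solvable p := fun hp => hp.1 h

lemma fst_eq_zero_of_mem_bidegSet {d : ℕ} {p : MIdx n m} (hp : p ∈ bidegSet n m 0 d) : p.1 = 0 := by
  have := (mem_bidegSet.1 hp).1
  rw [Finset.sum_eq_zero_iff] at this
  exact funext fun i => this i (Finset.mem_univ i)

lemma homogPart_zero_solCoeff (ω : Fin n → ℝ) (Ω : Fin m → ℝ) (c : MIdx n m → (Fin n → ℂ) → ℂ)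
    (d : ℕ) (x : Phase n m) : homogPart 0 d (solCoeff ω Ω c) x = 0 := by
  rw [homogPart_eq_sum]
  refine Finset.sum_eq_zero fun p hp => ?_
  rw [solCoeff, if_neg (not_solvable_of_fst_eq_zero (fst_eq_zero_of_mem_bidegSet hp))]
  simp

lemma homogPart_zero_normalCoeff (c : MIdx n m → (Fin n → ℂ) → ℂ) (d : ℕ) (x : Phase n m) :
    homogPart 0 d (normalCoeff c) x = homogPart 0 d c x := by
  rw [homogPart_eq_sum, homogPart_eq_sum]
  refine Finset.sum_congr rfl fun p hp => ?_
  rw [normalCoeff, if_neg (not_solvable_of_fst_eq_zero (fst_eq_zero_of_mem_bidegSet hp))]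

/-- Parts of odd degree at most two in `(z, w)` are removed completely. -/
lemma homogPart_odd_normalCoeff (c : MIdx n m → (Fin n → ℂ) → ℂ) {q : ℕ} (hq : q ≠ 0)
    (x : Phase n m) : homogPart q 1 (normalCoeff c) x = 0 := by
  rw [homogPart_eq_sum]
  refine Finset.sum_eq_zero fun p hp => ?_
  rw [mem_bidegSet] at hp
  have h1 : Solvable p := by
    refine ⟨fun h => hq ?_, by omega⟩
    rw [← hp.1, h]; simp
  have h2 : charge p ≠ 0 := by
    intro h
    have h3 : ∀ j, p.2.1 j = p.2.2 j := fun j => by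
      have := congrFun h j
      simp only [charge, Pi.zero_apply] at this
      omega
    have h4 := hp.2
    have h5 : ∑ j, p.2.1 j = ∑ j, p.2.2 j := Finset.sum_congr rfl fun j _ => h3 j
    omega
  rw [normalCoeff, if_pos h1, if_neg h2, zero_mul]

lemma homogPart_three_normalCoeff (c : MIdx n m → (Fin n → ℂ) → ℂ) (q : ℕ) (x : Phase n m) :
    homogPart q 3 (normalCoeff c) x = homogPart q 3 c x := by
  rw [homogPart_eq_sum, homogPart_eq_sum]
  refine Finset.sum_congr rfl fun p hp => ?_
  rw [mem_bidegSet] at hp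
  rw [normalCoeff, if_neg fun h => by have := h.2; omega]

lemma weightPart_three (c : MIdx n m → (Fin n → ℂ) → ℂ) (x : Phase n m) :
    weightPart 3 c x = bilinPart c x + homogPart 0 3 c x := by
  rw [weightPart_eq_sum_homogPart, Finset.sum_range_succ, Finset.sum_range_succ, Finset.sum_range_zero,
    ← homogPart_one_one]
  ring

lemma weightPart_four (c : MIdx n m → (Fin n → ℂ) → ℂ) (x : Phase n m) :
    weightPart 4 c x = homogPart 2 0 c x + homogPart 1 2 c x + homogPart 0 4 c x := by
  rw [weightPart_eq_sum_homogPart]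
  simp only [Nat.reduceDiv, Nat.reduceAdd, Finset.sum_range_succ, Finset.sum_range_zero]
  ring

lemma weightPart_five (c : MIdx n m → (Fin n → ℂ) → ℂ) (x : Phase n m) :
    weightPart 5 c x = homogPart 2 1 c x + homogPart 1 3 c x + homogPart 0 5 c x := by
  rw [weightPart_eq_sum_homogPart]
  simp only [Nat.reduceDiv, Nat.reduceAdd, Finset.sum_range_succ, Finset.sum_range_zero]
  ring

lemma weightPart_three_solCoeff (ω : Fin n → ℝ) (Ω : Fin m → ℝ) (c : MIdx n m → (Fin n → ℂ) → ℂ)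
    (x : Phase n m) : weightPart 3 (solCoeff ω Ω c) x = bilinPart (solCoeff ω Ω c) x := by
  rw [weightPart_three, homogPart_zero_solCoeff, add_zero]

lemma weightPart_three_normalCoeff (c : MIdx n m → (Fin n → ℂ) → ℂ) (x : Phase n m) :
    weightPart 3 (normalCoeff c) x = homogPart 0 3 c x := by
  rw [weightPart_three, homogPart_zero_normalCoeff, ← homogPart_one_one,
    homogPart_odd_normalCoeff c one_ne_zero, zero_add]

lemma weightPart_five_normalCoeff (c : MIdx n m → (Fin n → ℂ) → ℂ) (x : Phase n m) :
    weightPart 5 (normalCoeff c) x = homogPart 1 3 c x + homogPart 0 5 c x := by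
  rw [weightPart_five, homogPart_zero_normalCoeff, homogPart_three_normalCoeff,
    homogPart_odd_normalCoeff c two_ne_zero, zero_add]

/-- The terms of weighted degree four that are produced by the first order of the averaging. -/
def secondSource (ω : Fin n → ℝ) (Ω : Fin m → ℝ) (R : MIdx n m → (Fin n → ℂ) → ℂ)
    (x : Phase n m) : ℂ :=
  weightPart 4 R x + 1 / 2 *
    bracket (fun x => weightPart 3 R x + weightPart 3 (normalCoeff R) x)
      (weightPart 3 (solCoeff ω Ω R)) x

section Source

variable {s : ℝ} {R f : MIdx n m → (Fin n → ℂ) → ℂ} {x : Phase n m}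

lemma pol_cubic (hR : ∀ p, wdeg p = 3 → IsCoeffFun s (R p)) : Pol s 3 (homogPart 0 3 R) :=
  pol_homogPart (q := 0) (d := 3) hR

/-- `K₃ + G₃` is the bilinear part plus twice the cubic part in `(z, w)`, since the normalization
removes the former and leaves the latter. -/
lemma secondSource_eq (hR : ∀ p, wdeg p = 3 → IsCoeffFun s (R p)) (ω : Fin n → ℝ) (Ω : Fin m → ℝ)
    (hx : x ∈ cylinder n m s) : secondSource ω Ω R x = weightPart 4 R x +
      1 / 2 * bracket (bilinPart R) (bilinPart (solCoeff ω Ω R)) x +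
        bracket (homogPart 0 3 R) (bilinPart (solCoeff ω Ω R)) x := by
  have h1 : (fun x => weightPart 3 R x + weightPart 3 (normalCoeff R) x) =
      fun x => bilinPart R x + (homogPart 0 3 R x + homogPart 0 3 R x) := by
    ext x; rw [weightPart_three, weightPart_three_normalCoeff, add_assoc]
  have h2 : weightPart 3 (solCoeff ω Ω R) = bilinPart (solCoeff ω Ω R) :=
    funext (weightPart_three_solCoeff ω Ω R)
  have hd := (pol_cubic hR).differentiableAt hx
  rw [secondSource, h1, h2, bracket_add ((pol_bilinPart hR).differentiableAt hx) (hd.fun_add hd),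
    bracket_add hd hd]
  ring

lemma pd_cubic (hR : ∀ p, wdeg p = 3 → IsCoeffFun s (R p)) (hx : x ∈ cylinder n m s)
    (α : CoordIdx n m) : pd α (homogPart 0 3 R) x = ∑ p ∈ bidegSet n m 0 3,
      (fderiv ℂ (R p) x.2.1 (dir α).2.1 * mono p x + R p x.2.1 * pd α (mono p) x) := by
  have hw : ∀ p ∈ bidegSet n m 0 3, wdeg p = 3 := fun p hp => by
    rw [mem_bidegSet] at hp
    rw [wdeg, hp.1, hp.2]
  have : homogPart 0 3 R = fun x => ∑ p ∈ bidegSet n m 0 3, R p x.2.1 * mono p x :=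
    funext fun x => homogPart_eq_sum 0 3 R x
  rw [this, pd, fderiv_fun_sum fun p hp => ((Pol.coeff (hR p (hw p hp))).mul
    (Pol.mono p)).differentiableAt hx, _root_.sum_apply]
  exact Finset.sum_congr rfl fun p hp => pd_coeff_mul_mono (hR p (hw p hp)) hx p α

lemma pd_cubic_I (hR : ∀ p, wdeg p = 3 → IsCoeffFun s (R p)) (hx : x ∈ cylinder n m s)
    (i : Fin n) : pd (.inl i) (homogPart 0 3 R) x = 0 := by
  rw [pd_cubic hR hx]
  refine Finset.sum_eq_zero fun p hp => ?_
  simp [dir, pd_mono_I, fst_eq_zero_of_mem_bidegSet hp]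

lemma pd_cubic_phi (hR : ∀ p, wdeg p = 3 → IsCoeffFun s (R p)) (hx : x ∈ cylinder n m s)
    (i : Fin n) : pd (.inr (.inl i)) (homogPart 0 3 R) x =
      ∑ p ∈ bidegSet n m 0 3, angleDeriv i (R p) x.2.1 * mono p x := by
  rw [pd_cubic hR hx]
  refine Finset.sum_congr rfl fun p hp => ?_
  simp [dir, pd_mono_phi, angleDeriv]

lemma pd_cubic_z (hR : ∀ p, wdeg p = 3 → IsCoeffFun s (R p)) (hx : x ∈ cylinder n m s)
    (j : Fin m) : pd (.inr (.inr (.inl j))) (homogPart 0 3 R) x =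
      ∑ p ∈ bidegSet n m 0 3,
        R p x.2.1 * (p.2.1 j * mono (p.1, p.2.1 - Pi.single j 1, p.2.2) x) := by
  rw [pd_cubic hR hx]
  refine Finset.sum_congr rfl fun p hp => ?_
  simp [dir, pd_mono_z]

lemma pd_cubic_w (hR : ∀ p, wdeg p = 3 → IsCoeffFun s (R p)) (hx : x ∈ cylinder n m s)
    (j : Fin m) : pd (.inr (.inr (.inr j))) (homogPart 0 3 R) x =
      ∑ p ∈ bidegSet n m 0 3,
        R p x.2.1 * (p.2.2 j * mono (p.1, p.2.1, p.2.2 - Pi.single j 1) x) := by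
  rw [pd_cubic hR hx]
  refine Finset.sum_congr rfl fun p hp => ?_
  simp [dir, pd_mono_w]

lemma sum_sub_single {d : ℕ} {a : Fin d → ℕ} {j : Fin d} (h : a j ≠ 0) :
    ∑ k, (a - Pi.single j 1 : Fin d → ℕ) k + 1 = ∑ k, a k := by
  have hle : (Pi.single j 1 : Fin d → ℕ) ≤ a := fun k => by
    by_cases h' : k = j
    · subst h'; simp; omega
    · simp [h']
  conv_rhs => rw [← tsub_add_cancel_of_le hle]
  simp [Finset.sum_add_distrib]

/-- On `z = w = 0` the terms without actions do not contribute. -/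
lemma bracket_cubic_of_eq_zero (hR : ∀ p, wdeg p = 3 → IsCoeffFun s (R p))
    (hx : x ∈ cylinder n m s) (hz : x.2.2 = 0) (F : Phase n m → ℂ) :
    bracket (homogPart 0 3 R) F x = 0 := by
  have hphi : ∀ i, pd (.inr (.inl i)) (homogPart 0 3 R) x = 0 := fun i => by
    rw [pd_cubic_phi hR hx]
    refine Finset.sum_eq_zero fun p hp => ?_
    rw [mono_eq_zero hz (by rw [(mem_bidegSet.1 hp).2]; norm_num), mul_zero]
  have hzz : ∀ j, pd (.inr (.inr (.inl j))) (homogPart 0 3 R) x = 0 := fun j => by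
    rw [pd_cubic_z hR hx]
    refine Finset.sum_eq_zero fun p hp => ?_
    by_cases h : p.2.1 j = 0
    · simp [h]
    · have h1 := (mem_bidegSet.1 hp).2
      have h2 := sum_sub_single h
      rw [mono_eq_zero hz (by dsimp only; omega), mul_zero, mul_zero]
  have hw : ∀ j, pd (.inr (.inr (.inr j))) (homogPart 0 3 R) x = 0 := fun j => by
    rw [pd_cubic_w hR hx]
    refine Finset.sum_eq_zero fun p hp => ?_
    by_cases h : p.2.2 j = 0
    · simp [h]
    · have h1 := (mem_bidegSet.1 hp).2
      have h2 := sum_sub_single h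
      rw [mono_eq_zero hz (by dsimp only; omega), mul_zero, mul_zero]
  rw [bracket_eq]
  simp [hphi, hzz, hw, pd_cubic_I hR hx]

/-- The value of the source on `z = w = 0`. -/
theorem secondSource_of_eq_zero (hR : ∀ p, wdeg p = 3 → IsCoeffFun s (R p)) (ω : Fin n → ℝ)
    (Ω : Fin m → ℝ) (hf : ∀ p, wdeg p = 3 → IsCoeffFun s (solCoeff ω Ω R p))
    (hx : x ∈ cylinder n m s) (hz : x.2.2 = 0) :
    secondSource ω Ω R x = homogPart 2 0 R x + 1 / 2 * ∑ j, Complex.I *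
      ((∑ i, x.1 i * solCoeff ω Ω R (unit i, unit j, 0) x.2.1) *
          (∑ i, x.1 i * R (unit i, 0, unit j) x.2.1) -
        (∑ i, x.1 i * solCoeff ω Ω R (unit i, 0, unit j) x.2.1) *
          ∑ i, x.1 i * R (unit i, unit j, 0) x.2.1) := by
  have h0 : ∀ q d, d ≠ 0 → ∀ c : MIdx n m → (Fin n → ℂ) → ℂ, homogPart q d c x = 0 := by
    intro q d hd c
    rw [homogPart_eq_sum]
    refine Finset.sum_eq_zero fun p hp => ?_
    rw [mono_eq_zero hz (by rw [(mem_bidegSet.1 hp).2]; exact hd), mul_zero]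
  have hb : ∀ c : MIdx n m → (Fin n → ℂ) → ℂ, bilinPart c x = 0 := fun c => by
    rw [← homogPart_one_one, h0 1 1 one_ne_zero]
  have hz1 : ∀ j, x.2.2.1 j = 0 := fun j => by simp [hz]
  have hz2 : ∀ j, x.2.2.2 j = 0 := fun j => by simp [hz]
  rw [secondSource_eq hR ω Ω hx, bracket_cubic_of_eq_zero hR hx hz, weightPart_four,
    h0 1 2 two_ne_zero, h0 0 4 four_ne_zero, bracket_eq]
  simp only [pd_bilinPart_phi hR hx, pd_bilinPart_phi hf hx, hb, pd_bilinPart_z hR hx,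
    pd_bilinPart_z hf hx, pd_bilinPart_w hR hx, pd_bilinPart_w hf hx]
  simp

end Source

/-! ### Extraction of the coefficient of `I_i z_j w_j` -/

/-- The point with `I = σ e_i`, `z = e_j` and `w = τ e_j`. -/
def probe (i : Fin n) (j : Fin m) (φ : Fin n → ℂ) (σ τ : ℂ) : Phase n m :=
  (Pi.single i σ, φ, Pi.single j 1, Pi.single j τ)

/-- The part of `4 T` which is odd in `σ` and in `τ` at the points `probe i j φ σ τ`, for
`σ = τ = 1`. -/
def oddPart (i : Fin n) (j : Fin m) (φ : Fin n → ℂ) (T : Phase n m → ℂ) : ℂ :=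
  (T (probe i j φ 1 1) - T (probe i j φ (-1) 1)) -
    (T (probe i j φ 1 (-1)) - T (probe i j φ (-1) (-1)))

lemma prod_single_pow {d : ℕ} (i : Fin d) (σ : ℂ) (a : Fin d → ℕ) :
    ∏ k, (Pi.single i σ : Fin d → ℂ) k ^ a k = if a = Pi.single i (a i) then σ ^ a i else 0 := by
  split_ifs with h
  · rw [← Finset.mul_prod_erase _ _ (Finset.mem_univ i), Finset.prod_eq_one]
    · simp
    · intro k hk
      rw [h]
      simp [(Finset.mem_erase.1 hk).1]
  · have h1 : ∃ k, k ≠ i ∧ a k ≠ 0 := by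
      by_contra! h2
      refine h (funext fun k => ?_)
      by_cases hk : k = i
      · subst hk; simp
      · simp [hk, h2 k hk]
    obtain ⟨k, hk, hak⟩ := h1
    exact Finset.prod_eq_zero (Finset.mem_univ k) (by simp [hk, hak])

lemma mono_probe (p : MIdx n m) (i : Fin n) (j : Fin m) (φ : Fin n → ℂ) (σ τ : ℂ) :
    mono p (probe i j φ σ τ) = (if p.1 = Pi.single i (p.1 i) then σ ^ p.1 i else 0) *
      (if p.2.1 = Pi.single j (p.2.1 j) then 1 else 0) *
        if p.2.2 = Pi.single j (p.2.2 j) then τ ^ p.2.2 j else 0 := by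
  simp only [mono, probe, prod_single_pow, one_pow]

lemma sum_eq_of_eq_single {d : ℕ} {a : Fin d → ℕ} {i : Fin d} (h : a = Pi.single i (a i)) :
    ∑ k, a k = a i := by
  rw [Finset.sum_eq_single i]
  · intro k _ hk
    rw [h]; simp [hk]
  · simp

/-- Among the monomials of weighted degree four, `oddPart` sees only `I_i z_j w_j`. -/
lemma oddPart_mono {p : MIdx n m} (hp : wdeg p = 4) (i : Fin n) (j : Fin m) (φ : Fin n → ℂ) :
    oddPart i j φ (mono p) = if p = (unit i, unit j, unit j) then 4 else 0 := by
  simp only [oddPart, mono_probe]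
  by_cases h1 : p.1 = Pi.single i (p.1 i)
  swap
  · have hne : p ≠ (unit i, unit j, unit j) := fun h => h1 (by rw [h]; simp [unit_eq_single])
    simp [h1, hne]
  by_cases h2 : p.2.1 = Pi.single j (p.2.1 j)
  swap
  · have hne : p ≠ (unit i, unit j, unit j) := fun h => h2 (by rw [h]; simp [unit_eq_single])
    simp [h2, hne]
  by_cases h3 : p.2.2 = Pi.single j (p.2.2 j)
  swap
  · have hne : p ≠ (unit i, unit j, unit j) := fun h => h3 (by rw [h]; simp [unit_eq_single])
    simp [h3, hne]
  rw [if_pos h1, if_pos h1, if_pos h2, if_pos h3, if_pos h3]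
  have hw : 2 * p.1 i + (p.2.1 j + p.2.2 j) = 4 := by
    rw [← hp, wdeg, sum_eq_of_eq_single h1, sum_eq_of_eq_single h2, sum_eq_of_eq_single h3]
  have hiff : p = (unit i, unit j, unit j) ↔ p.1 i = 1 ∧ p.2.1 j = 1 ∧ p.2.2 j = 1 := by
    constructor
    · intro h; rw [h]; simp [unit_eq_single]
    · rintro ⟨e1, e2, e3⟩
      rw [e1] at h1; rw [e2] at h2; rw [e3] at h3
      exact Prod.ext h1 (Prod.ext h2 h3)
  simp only [hiff]
  have hk : p.1 i ≤ 2 := by omega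
  have hb : p.2.2 j ≤ 4 := by omega
  have ha : p.2.1 j = 4 - 2 * p.1 i - p.2.2 j := by omega
  rw [ha]
  clear h1 h2 h3 hiff hp ha
  generalize p.1 i = k at *
  generalize p.2.2 j = b at *
  interval_cases k <;> interval_cases b <;> first | omega | norm_num

lemma oddPart_weightPart (c : MIdx n m → (Fin n → ℂ) → ℂ) (i : Fin n) (j : Fin m)
    (φ : Fin n → ℂ) : oddPart i j φ (weightPart 4 c) = 4 * c (unit i, unit j, unit j) φ := by
  have h : oddPart i j φ (weightPart 4 c) =
      ∑ p ∈ weightSet n m 4, c p φ * oddPart i j φ (mono p) := by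
    simp only [oddPart, weightPart, ← Finset.sum_sub_distrib, mul_sub]
    rfl
  rw [h, Finset.sum_eq_single (unit i, unit j, unit j)]
  · rw [oddPart_mono (by simp [wdeg, unit_eq_single]), if_pos rfl, mul_comm]
  · intro p hp hne
    rw [oddPart_mono (mem_weightSet.1 hp), if_neg hne, mul_zero]
  · intro h
    exact absurd (mem_weightSet.2 (by simp [wdeg, unit_eq_single])) h

section Probe

variable {s : ℝ} {R f : MIdx n m → (Fin n → ℂ) → ℂ} {φ : Fin n → ℂ} (i : Fin n) (j : Fin m)

lemma bilinPart_probe (c : MIdx n m → (Fin n → ℂ) → ℂ) (σ τ : ℂ) :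
    bilinPart c (probe i j φ σ τ) = σ * (c (unit i, unit j, 0) φ + τ * c (unit i, 0, unit j) φ) := by
  simp only [bilinPart, probe, Pi.single_apply, mul_ite, mul_zero, ite_mul, zero_mul, mul_one,
    Finset.sum_add_distrib, Finset.sum_ite_eq', Finset.mem_univ, if_true]
  ring

lemma pd_bilinPart_I_probe (hR : ∀ p, wdeg p = 3 → IsCoeffFun s (R p)) (hφ : φ ∈ strip n s)
    (i' : Fin n) (σ τ : ℂ) : pd (.inl i') (bilinPart R) (probe i j φ σ τ) =
      R (unit i', unit j, 0) φ + τ * R (unit i', 0, unit j) φ := by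
  rw [pd_bilinPart_I hR (show probe i j φ σ τ ∈ cylinder n m s from hφ)]
  simp only [probe, Pi.single_apply, mul_ite, mul_zero, mul_one,
    Finset.sum_add_distrib, Finset.sum_ite_eq', Finset.mem_univ, if_true]
  ring

lemma pd_bilinPart_z_probe (hR : ∀ p, wdeg p = 3 → IsCoeffFun s (R p)) (hφ : φ ∈ strip n s)
    (j' : Fin m) (σ τ : ℂ) : pd (.inr (.inr (.inl j'))) (bilinPart R) (probe i j φ σ τ) =
      σ * R (unit i, unit j', 0) φ := by
  rw [pd_bilinPart_z hR (show probe i j φ σ τ ∈ cylinder n m s from hφ)]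
  simp [probe, Pi.single_apply]

lemma pd_bilinPart_w_probe (hR : ∀ p, wdeg p = 3 → IsCoeffFun s (R p)) (hφ : φ ∈ strip n s)
    (j' : Fin m) (σ τ : ℂ) : pd (.inr (.inr (.inr j'))) (bilinPart R) (probe i j φ σ τ) =
      σ * R (unit i, 0, unit j') φ := by
  rw [pd_bilinPart_w hR (show probe i j φ σ τ ∈ cylinder n m s from hφ)]
  simp [probe, Pi.single_apply]

lemma oddPart_bracket_bilinPart (hR : ∀ p, wdeg p = 3 → IsCoeffFun s (R p))
    (hf : ∀ p, wdeg p = 3 → IsCoeffFun s (f p)) (hφ : φ ∈ strip n s) :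
    oddPart i j φ (bracket (bilinPart R) (bilinPart f)) = 4 * ∑ i',
      (angleDeriv i' (f (unit i, unit j, 0)) φ * R (unit i', 0, unit j) φ +
        angleDeriv i' (f (unit i, 0, unit j)) φ * R (unit i', unit j, 0) φ -
        f (unit i', unit j, 0) φ * angleDeriv i' (R (unit i, 0, unit j)) φ -
        f (unit i', 0, unit j) φ * angleDeriv i' (R (unit i, unit j, 0)) φ) := by
  have hmem : ∀ σ τ, probe i j φ σ τ ∈ cylinder n m s := fun _ _ => hφ
  simp only [oddPart, bracket_eq, pd_bilinPart_phi hR (hmem _ _), pd_bilinPart_phi hf (hmem _ _),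
    pd_bilinPart_z_probe i j hR hφ, pd_bilinPart_z_probe i j hf hφ,
    pd_bilinPart_w_probe i j hR hφ, pd_bilinPart_w_probe i j hf hφ,
    pd_bilinPart_I_probe i j hR hφ, pd_bilinPart_I_probe i j hf hφ, bilinPart_probe]
  rw [add_sub_add_comm, add_sub_add_comm, add_sub_add_comm]
  simp only [← Finset.sum_sub_distrib, Finset.mul_sum]
  rw [← Finset.sum_congr rfl fun i' _ => ?_, Finset.sum_eq_zero (s := Finset.univ (α := Fin m)),
    add_zero]
  · intro j' _; ring
  · ring

lemma mono_probe_sub {q : MIdx n m} (hq : q.1 = 0) (hd : ∑ k, q.2.1 k + ∑ k, q.2.2 k = 2) (σ : ℂ) :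
    mono q (probe i j φ σ 1) - mono q (probe i j φ σ (-1)) =
      if q = (0, unit j, unit j) then 2 else 0 := by
  simp only [mono_probe]
  have h1 : q.1 = Pi.single i (q.1 i) := by simp [hq]
  by_cases h2 : q.2.1 = Pi.single j (q.2.1 j)
  swap
  · have hne : q ≠ (0, unit j, unit j) := fun h => h2 (by rw [h]; simp [unit_eq_single])
    simp [h2, hne]
  by_cases h3 : q.2.2 = Pi.single j (q.2.2 j)
  swap
  · have hne : q ≠ (0, unit j, unit j) := fun h => h3 (by rw [h]; simp [unit_eq_single])
    simp [h3, hne]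
  rw [if_pos h1, if_pos h2, if_pos h3, if_pos h3, show q.1 i = 0 by simp [hq]]
  rw [sum_eq_of_eq_single h2, sum_eq_of_eq_single h3] at hd
  have hiff : q = (0, unit j, unit j) ↔ q.2.1 j = 1 ∧ q.2.2 j = 1 := by
    constructor
    · intro h; rw [h]; simp [unit_eq_single]
    · rintro ⟨e2, e3⟩
      rw [e2] at h2; rw [e3] at h3
      exact Prod.ext hq (Prod.ext h2 h3)
  simp only [hiff]
  have hb : q.2.2 j ≤ 2 := by omega
  have ha : q.2.1 j = 2 - q.2.2 j := by omega
  rw [ha]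
  generalize q.2.2 j = b at *
  interval_cases b <;> norm_num

lemma sub_single_eq_unit {d : ℕ} {a : Fin d → ℕ} {j j' : Fin d} (h : a j' ≠ 0) :
    a - Pi.single j' 1 = unit j ↔ a = unit j + unit j' := by
  have hle : (Pi.single j' 1 : Fin d → ℕ) ≤ a := fun k => by
    by_cases h' : k = j'
    · subst h'; simp; omega
    · simp [h']
  rw [unit_eq_single j', tsub_eq_iff_eq_add_of_le hle]

lemma pd_cubic_z_probe_sub (hR : ∀ p, wdeg p = 3 → IsCoeffFun s (R p)) (hφ : φ ∈ strip n s)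
    (j' : Fin m) (σ : ℂ) : pd (.inr (.inr (.inl j'))) (homogPart 0 3 R) (probe i j φ σ 1) -
      pd (.inr (.inr (.inl j'))) (homogPart 0 3 R) (probe i j φ σ (-1)) =
      2 * ((1 + if j = j' then 1 else 0) * R (0, unit j + unit j', unit j) φ) := by
  rw [pd_cubic_z hR (show probe i j φ σ 1 ∈ cylinder n m s from hφ),
    pd_cubic_z hR (show probe i j φ σ (-1) ∈ cylinder n m s from hφ), ← Finset.sum_sub_distrib]
  have key : ∀ p ∈ bidegSet n m 0 3,
      R p (probe i j φ σ 1).2.1 * (p.2.1 j' * mono (p.1, p.2.1 - Pi.single j' 1, p.2.2)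
        (probe i j φ σ 1)) - R p (probe i j φ σ (-1)).2.1 * (p.2.1 j' *
          mono (p.1, p.2.1 - Pi.single j' 1, p.2.2) (probe i j φ σ (-1))) =
      if p = (0, unit j + unit j', unit j) then R p φ * (p.2.1 j' * 2) else 0 := by
    intro p hp
    have h0 := fst_eq_zero_of_mem_bidegSet hp
    have h1 := (mem_bidegSet.1 hp).2
    change R p φ * _ - R p φ * _ = _
    rw [← mul_sub, ← mul_sub]
    by_cases h : p.2.1 j' = 0
    · split_ifs <;> simp [h]
    · have h2 := sum_sub_single h
      rw [mono_probe_sub i j (q := (p.1, p.2.1 - Pi.single j' 1, p.2.2)) h0 (by dsimp only; omega)]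
      have hiff : ((p.1, p.2.1 - Pi.single j' 1, p.2.2) : MIdx n m) = (0, unit j, unit j) ↔
          p = (0, unit j + unit j', unit j) := by
        rw [Prod.ext_iff, Prod.ext_iff, Prod.ext_iff (x := p), Prod.ext_iff (x := p.2),
          sub_single_eq_unit h]
      simp only [hiff]
      split_ifs <;> simp
  rw [Finset.sum_congr rfl key, Finset.sum_ite_eq', if_pos]
  · have : (((unit j + unit j' : Fin m → ℕ) j' : ℕ) : ℂ) = 1 + if j = j' then 1 else 0 := by
      by_cases h : j = j'
      · subst h; simp [unit_eq_single]; norm_num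
      · simp [unit_eq_single, h, Ne.symm h]
    rw [this]; ring
  · simp [mem_bidegSet, unit_eq_single, Finset.sum_add_distrib]

lemma pd_cubic_w_probe_sub (hR : ∀ p, wdeg p = 3 → IsCoeffFun s (R p)) (hφ : φ ∈ strip n s)
    (j' : Fin m) (σ : ℂ) : pd (.inr (.inr (.inr j'))) (homogPart 0 3 R) (probe i j φ σ 1) -
      pd (.inr (.inr (.inr j'))) (homogPart 0 3 R) (probe i j φ σ (-1)) =
      2 * ((1 + if j = j' then 1 else 0) * R (0, unit j, unit j + unit j') φ) := by
  rw [pd_cubic_w hR (show probe i j φ σ 1 ∈ cylinder n m s from hφ),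
    pd_cubic_w hR (show probe i j φ σ (-1) ∈ cylinder n m s from hφ), ← Finset.sum_sub_distrib]
  have key : ∀ p ∈ bidegSet n m 0 3,
      R p (probe i j φ σ 1).2.1 * (p.2.2 j' * mono (p.1, p.2.1, p.2.2 - Pi.single j' 1)
        (probe i j φ σ 1)) - R p (probe i j φ σ (-1)).2.1 * (p.2.2 j' *
          mono (p.1, p.2.1, p.2.2 - Pi.single j' 1) (probe i j φ σ (-1))) =
      if p = (0, unit j, unit j + unit j') then R p φ * (p.2.2 j' * 2) else 0 := by
    intro p hp
    have h0 := fst_eq_zero_of_mem_bidegSet hp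
    have h1 := (mem_bidegSet.1 hp).2
    change R p φ * _ - R p φ * _ = _
    rw [← mul_sub, ← mul_sub]
    by_cases h : p.2.2 j' = 0
    · split_ifs <;> simp [h]
    · have h2 := sum_sub_single h
      rw [mono_probe_sub i j (q := (p.1, p.2.1, p.2.2 - Pi.single j' 1)) h0 (by dsimp only; omega)]
      have hiff : ((p.1, p.2.1, p.2.2 - Pi.single j' 1) : MIdx n m) = (0, unit j, unit j) ↔
          p = (0, unit j, unit j + unit j') := by
        rw [Prod.ext_iff, Prod.ext_iff, Prod.ext_iff (x := p), Prod.ext_iff (x := p.2),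
          sub_single_eq_unit h]
      simp only [hiff]
      split_ifs <;> simp
  rw [Finset.sum_congr rfl key, Finset.sum_ite_eq', if_pos]
  · have : (((unit j + unit j' : Fin m → ℕ) j' : ℕ) : ℂ) = 1 + if j = j' then 1 else 0 := by
      by_cases h : j = j'
      · subst h; simp [unit_eq_single]; norm_num
      · simp [unit_eq_single, h, Ne.symm h]
    rw [this]; ring
  · simp [mem_bidegSet, unit_eq_single, Finset.sum_add_distrib]

lemma mono_probe_neg {q : MIdx n m} (hq : q.1 = 0) (σ σ' τ : ℂ) :
    mono q (probe i j φ σ τ) = mono q (probe i j φ σ' τ) := by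
  simp only [mono_probe, hq, Pi.zero_apply, pow_zero]

lemma oddPart_bracket_cubic (hR : ∀ p, wdeg p = 3 → IsCoeffFun s (R p))
    (hf : ∀ p, wdeg p = 3 → IsCoeffFun s (f p)) (hφ : φ ∈ strip n s) :
    oddPart i j φ (bracket (homogPart 0 3 R) (bilinPart f)) = 4 * ∑ j', Complex.I *
      ((1 + if j = j' then 1 else 0) *
        (f (unit i, unit j', 0) φ * R (0, unit j, unit j + unit j') φ -
          f (unit i, 0, unit j') φ * R (0, unit j + unit j', unit j) φ)) := by
  have hmem : ∀ σ τ, probe i j φ σ τ ∈ cylinder n m s := fun _ _ => hφ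
  have hphi : ∀ τ (i' : Fin n), pd (.inr (.inl i')) (homogPart 0 3 R) (probe i j φ (-1) τ) =
      pd (.inr (.inl i')) (homogPart 0 3 R) (probe i j φ 1 τ) := fun τ i' => by
    rw [pd_cubic_phi hR (hmem _ _), pd_cubic_phi hR (hmem _ _)]
    exact Finset.sum_congr rfl fun p hp =>
      congrArg₂ (· * ·) rfl (mono_probe_neg i j (fst_eq_zero_of_mem_bidegSet hp) _ _ _)
  have hz : ∀ τ (j' : Fin m), pd (.inr (.inr (.inl j'))) (homogPart 0 3 R) (probe i j φ (-1) τ) =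
      pd (.inr (.inr (.inl j'))) (homogPart 0 3 R) (probe i j φ 1 τ) := fun τ j' => by
    rw [pd_cubic_z hR (hmem _ _), pd_cubic_z hR (hmem _ _)]
    exact Finset.sum_congr rfl fun p hp => congrArg₂ (· * ·) rfl
      (congrArg₂ (· * ·) rfl (mono_probe_neg i j (q := (p.1, p.2.1 - Pi.single j' 1, p.2.2))
        (show p.1 = 0 from fst_eq_zero_of_mem_bidegSet hp) _ _ _))
  have hw : ∀ τ (j' : Fin m), pd (.inr (.inr (.inr j'))) (homogPart 0 3 R) (probe i j φ (-1) τ) =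
      pd (.inr (.inr (.inr j'))) (homogPart 0 3 R) (probe i j φ 1 τ) := fun τ j' => by
    rw [pd_cubic_w hR (hmem _ _), pd_cubic_w hR (hmem _ _)]
    exact Finset.sum_congr rfl fun p hp => congrArg₂ (· * ·) rfl
      (congrArg₂ (· * ·) rfl (mono_probe_neg i j (q := (p.1, p.2.1, p.2.2 - Pi.single j' 1))
        (show p.1 = 0 from fst_eq_zero_of_mem_bidegSet hp) _ _ _))
  simp only [oddPart, bracket_eq, pd_cubic_I hR (hmem _ _), mul_zero, hphi, hz, hw,
    pd_bilinPart_z_probe i j hf hφ, pd_bilinPart_w_probe i j hf hφ,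
    pd_bilinPart_I_probe i j hf hφ]
  rw [add_sub_add_left_eq_sub, add_sub_add_left_eq_sub]
  simp only [← Finset.sum_sub_distrib, Finset.mul_sum]
  refine Finset.sum_congr rfl fun j' _ => ?_
  have e1 := pd_cubic_z_probe_sub i j hR hφ j' 1
  have e2 := pd_cubic_w_probe_sub i j hR hφ j' 1
  linear_combination 2 * Complex.I * f (unit i, unit j', 0) φ * e2 -
    2 * Complex.I * f (unit i, 0, unit j') φ * e1

/-- The coefficient of `I_i z_j w_j` in the source of the second order. -/
theorem coeff_secondSource {c : MIdx n m → (Fin n → ℂ) → ℂ}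
    (hR : ∀ p, wdeg p = 3 → IsCoeffFun s (R p)) (ω : Fin n → ℝ) (Ω : Fin m → ℝ)
    (hf : ∀ p, wdeg p = 3 → IsCoeffFun s (solCoeff ω Ω R p)) (hφ : φ ∈ strip n s)
    (hc : EqOn (secondSource ω Ω R) (weightPart 4 c) (cylinder n m s)) :
    c (unit i, unit j, unit j) φ = R (unit i, unit j, unit j) φ + 1 / 2 * ∑ i',
      (angleDeriv i' (solCoeff ω Ω R (unit i, unit j, 0)) φ * R (unit i', 0, unit j) φ +
        angleDeriv i' (solCoeff ω Ω R (unit i, 0, unit j)) φ * R (unit i', unit j, 0) φ -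
        solCoeff ω Ω R (unit i', unit j, 0) φ * angleDeriv i' (R (unit i, 0, unit j)) φ -
        solCoeff ω Ω R (unit i', 0, unit j) φ * angleDeriv i' (R (unit i, unit j, 0)) φ) +
      ∑ j', Complex.I * ((1 + if j = j' then 1 else 0) *
        (solCoeff ω Ω R (unit i, unit j', 0) φ * R (0, unit j, unit j + unit j') φ -
          solCoeff ω Ω R (unit i, 0, unit j') φ * R (0, unit j + unit j', unit j) φ)) := by
  have hmem : ∀ σ τ, probe i j φ σ τ ∈ cylinder n m s := fun _ _ => hφ
  have h1 := oddPart_weightPart c i j φ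
  have h2 := oddPart_weightPart R i j φ
  have h3 := oddPart_bracket_bilinPart i j hR hf hφ
  have h4 := oddPart_bracket_cubic i j hR hf hφ
  simp only [oddPart, ← hc (hmem _ _), secondSource_eq hR ω Ω (hmem _ _)] at h1 h2 h3 h4
  linear_combination (-1 / 4) * h1 + (1 / 4) * h2 + (1 / 8) * h3 + (1 / 4) * h4

end Probe

/-! ### The twist matrix and the coupling matrix -/

lemma hasSum_prod_of_fintype {ι β : Type*} [Fintype ι] [DecidableEq ι] {f : ι → β → ℂ} {a : ι → ℂ}
    (h : ∀ j, HasSum (f j) (a j)) : HasSum (fun p : ι × β => f p.1 p.2) (∑ j, a j) := by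
  have h1 : ∀ j ∈ Finset.univ, HasSum (fun p : ι × β => if p.1 = j then f p.1 p.2 else 0) (a j) := by
    intro j _
    rw [← (Prod.mk_right_injective j).hasSum_iff]
    · simpa [Function.comp_def] using h j
    · rintro ⟨j', b⟩ hb
      have : j' ≠ j := fun e => hb ⟨b, by rw [e]⟩
      simp [this]
  refine (hasSum_sum h1).congr_fun fun p => ?_
  simp

lemma torusCoeff_sum {ι : Type*} {s : ℝ} (hs : 0 < s) (t : Finset ι) {f : ι → (Fin n → ℂ) → ℂ}
    (hf : ∀ i ∈ t, IsCoeffFun s (f i)) (ℓ : Fin n → ℤ) :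
    torusCoeff (fun φ => ∑ i ∈ t, f i φ) ℓ = ∑ i ∈ t, torusCoeff (f i) ℓ := by
  classical
  induction t using Finset.induction_on with
  | empty => simp [torusCoeff]
  | insert a t ha ih =>
    simp only [Finset.sum_insert ha]
    have h1 := hf a (Finset.mem_insert_self a t)
    have h2 : ∀ i ∈ t, IsCoeffFun s (f i) := fun i hi => hf i (Finset.mem_insert_of_mem hi)
    rw [IsCoeffFun.torusCoeff_add hs h1 (IsCoeffFun.sum t h2), ih h2]

section Averages

variable {ω : Fin n → ℝ} {Ω : Fin m → ℝ} {γ τ s : ℝ} {R c : MIdx n m → (Fin n → ℂ) → ℂ}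

lemma smallDivisor_single (ω : Fin n → ℝ) (Ω : Fin m → ℝ) (j : Fin m) (ℓ : Fin n → ℤ) :
    smallDivisor ω Ω (Pi.single j 1) ℓ = divisor ω Ω j ℓ := by
  simp [smallDivisor, divisor, Pi.single_apply]

lemma solvable_unit {i : Fin n} {a b : Fin m → ℕ} (h : ∑ j, a j + ∑ j, b j ≤ 2) :
    Solvable (unit i, a, b) := by
  refine ⟨fun h0 => ?_, h⟩
  have := congrFun h0 i
  simp [unit_eq_single] at this

lemma torusCoeff_solCoeff_z (hs : 0 < s) (hγ : 0 < γ) (hτ : 0 < τ) (hMel : Melnikov ω Ω γ τ)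
    {i : Fin n} {j : Fin m} (hR : IsCoeffFun s (R (unit i, unit j, 0))) (ℓ : Fin n → ℤ) :
    torusCoeff (solCoeff ω Ω R (unit i, unit j, 0)) ℓ =
      Complex.I / divisor ω Ω j ℓ * tfCoeff R (unit i) (unit j) 0 ℓ := by
  have hsol : Solvable (unit i, unit j, (0 : Fin m → ℕ)) := solvable_unit (by simp [unit_eq_single])
  have hch : charge (unit i, unit j, (0 : Fin m → ℕ)) = Pi.single j 1 := by
    ext j'
    by_cases h : j' = j
    · subst h; simp [charge, unit_eq_single]
    · simp [charge, unit_eq_single, h]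
  rw [solCoeff, if_pos hsol, torusCoeff_homSol hs hγ hτ hMel hsol.charge_le hR, hch, homCoeff,
    if_neg fun h => by simpa using h.2, smallDivisor_single]
  rfl

lemma torusCoeff_solCoeff_w (hs : 0 < s) (hγ : 0 < γ) (hτ : 0 < τ) (hMel : Melnikov ω Ω γ τ)
    {i : Fin n} {j : Fin m} (hR : IsCoeffFun s (R (unit i, 0, unit j))) (ℓ : Fin n → ℤ) :
    torusCoeff (solCoeff ω Ω R (unit i, 0, unit j)) ℓ =
      -Complex.I / divisor ω Ω j (-ℓ) * tfCoeff R (unit i) 0 (unit j) ℓ := by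
  have hsol : Solvable (unit i, (0 : Fin m → ℕ), unit j) := solvable_unit (by simp [unit_eq_single])
  have hch : charge (unit i, (0 : Fin m → ℕ), unit j) = -Pi.single j 1 := by
    ext j'
    by_cases h : j' = j
    · subst h; simp [charge, unit_eq_single]
    · simp [charge, unit_eq_single, h]
  have hdiv : smallDivisor ω Ω (-Pi.single j 1) ℓ = -divisor ω Ω j (-ℓ) := by
    rw [← smallDivisor_single, ← smallDivisor_neg, neg_neg]
  rw [solCoeff, if_pos hsol, torusCoeff_homSol hs hγ hτ hMel hsol.charge_le hR, hch, homCoeff,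
    if_neg fun h => by simpa using h.2, hdiv, div_neg, neg_div]
  rfl

/-- The series in the twist matrix is an average of products over the torus. -/
theorem hasSum_twistTerm (hs : 0 < s) (hγ : 0 < γ) (hτ : 0 < τ) (hMel : Melnikov ω Ω γ τ)
    (hR : ∀ p, wdeg p = 3 → IsCoeffFun s (R p)) (i i' : Fin n) :
    HasSum (twistTerm ω Ω R i i') (∑ j, -Complex.I *
      (torusCoeff (fun φ => solCoeff ω Ω R (unit i, unit j, 0) φ * R (unit i', 0, unit j) φ) 0 -
        torusCoeff (fun φ => R (unit i', unit j, 0) φ * solCoeff ω Ω R (unit i, 0, unit j) φ) 0)) := by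
  refine hasSum_prod_of_fintype (f := fun j ℓ => twistTerm ω Ω R i i' (j, ℓ)) fun j => ?_
  have hz := fun i => hR _ (wdeg_unit_unit_zero i j)
  have hw := fun i => hR _ (wdeg_unit_zero_unit i j)
  have h1 := IsCoeffFun.hasSum_torusCoeff_mul hs
    (isCoeffFun_solCoeff hs hγ hτ hMel (hz i)) (hw i')
  have h2 := IsCoeffFun.hasSum_torusCoeff_mul hs (hz i')
    (isCoeffFun_solCoeff hs hγ hτ hMel (hw i))
  refine ((h1.sub h2).mul_left (-Complex.I)).congr_fun fun ℓ => ?_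
  rw [torusCoeff_solCoeff_z hs hγ hτ hMel (hz i), torusCoeff_solCoeff_w hs hγ hτ hMel (hw i),
    neg_neg, twistTerm]
  simp only [tfCoeff, div_eq_mul_inv]
  linear_combination ((divisor ω Ω j ℓ)⁻¹ *
    (torusCoeff (R (unit i, unit j, 0)) ℓ * torusCoeff (R (unit i', 0, unit j)) (-ℓ) +
      torusCoeff (R (unit i, 0, unit j)) (-ℓ) * torusCoeff (R (unit i', unit j, 0)) ℓ)) *
      Complex.I_sq

/-- By Parseval, the first series of the coupling matrix sums to averages of products of bilinear
coefficients, in the form in which they occur in the bracket of the bilinear parts. -/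
theorem hasSum_couplingTermA (hs : 0 < s) (hγ : 0 < γ) (hτ : 0 < τ) (hMel : Melnikov ω Ω γ τ)
    (hR : ∀ p, wdeg p = 3 → IsCoeffFun s (R p)) (j : Fin m) (i : Fin n) :
    HasSum (couplingTermA ω Ω R j i) (∑ i', (-1 / 2) *
      (torusCoeff (fun φ => angleDeriv i' (solCoeff ω Ω R (unit i, unit j, 0)) φ *
          R (unit i', 0, unit j) φ) 0 +
        torusCoeff (fun φ => R (unit i', unit j, 0) φ *
          angleDeriv i' (solCoeff ω Ω R (unit i, 0, unit j)) φ) 0 -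
        torusCoeff (fun φ => solCoeff ω Ω R (unit i', unit j, 0) φ *
          angleDeriv i' (R (unit i, 0, unit j)) φ) 0 -
        torusCoeff (fun φ => angleDeriv i' (R (unit i, unit j, 0)) φ *
          solCoeff ω Ω R (unit i', 0, unit j) φ) 0)) := by
  refine hasSum_prod_of_fintype (f := fun i' ℓ => couplingTermA ω Ω R j i (i', ℓ)) fun i' => ?_
  have hz := fun i => hR _ (wdeg_unit_unit_zero i j)
  have hw := fun i => hR _ (wdeg_unit_zero_unit i j)
  have hfz := fun i => isCoeffFun_solCoeff (ω := ω) hs hγ hτ hMel (hz i)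
  have hfw := fun i => isCoeffFun_solCoeff (ω := ω) hs hγ hτ hMel (hw i)
  have h1 := IsCoeffFun.hasSum_torusCoeff_mul hs ((hfz i).angleDeriv i') (hw i')
  have h2 := IsCoeffFun.hasSum_torusCoeff_mul hs (hz i') ((hfw i).angleDeriv i')
  have h3 := IsCoeffFun.hasSum_torusCoeff_mul hs (hfz i') ((hw i).angleDeriv i')
  have h4 := IsCoeffFun.hasSum_torusCoeff_mul hs ((hz i).angleDeriv i') (hfw i')
  refine ((((h1.add h2).sub h3).sub h4).mul_left (-1 / 2)).congr_fun fun ℓ => ?_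
  rw [(hfz i).torusCoeff_angleDeriv hs, (hfw i).torusCoeff_angleDeriv hs,
    (hw i).torusCoeff_angleDeriv hs, (hz i).torusCoeff_angleDeriv hs,
    torusCoeff_solCoeff_z hs hγ hτ hMel (hz i), torusCoeff_solCoeff_w hs hγ hτ hMel (hw i),
    torusCoeff_solCoeff_z hs hγ hτ hMel (hz i'), torusCoeff_solCoeff_w hs hγ hτ hMel (hw i'),
    neg_neg, couplingTermA]
  simp only [tfCoeff, div_eq_mul_inv, Pi.neg_apply, Int.cast_neg]
  linear_combination ((ℓ i' : ℂ) * (divisor ω Ω j ℓ)⁻¹ *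
    (torusCoeff (R (unit i, unit j, 0)) ℓ * torusCoeff (R (unit i', 0, unit j)) (-ℓ) +
      torusCoeff (R (unit i, 0, unit j)) (-ℓ) * torusCoeff (R (unit i', unit j, 0)) ℓ)) *
      Complex.I_sq

lemma wdeg_zero_unit_add (j j' : Fin m) :
    wdeg ((0 : Fin n → ℕ), unit j, unit j + unit j') = 3 := by
  simp [wdeg, unit_eq_single, Finset.sum_add_distrib]

lemma wdeg_zero_add_unit (j j' : Fin m) :
    wdeg ((0 : Fin n → ℕ), unit j + unit j', unit j) = 3 := by
  simp [wdeg, unit_eq_single, Finset.sum_add_distrib]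

/-- By Parseval, the second series of the coupling matrix sums to averages of products of coefficients,
in the form in which they occur in the bracket of the cubic part in `(z, w)` with the bilinear
part. -/
theorem hasSum_couplingTermB (hs : 0 < s) (hγ : 0 < γ) (hτ : 0 < τ) (hMel : Melnikov ω Ω γ τ)
    (hR : ∀ p, wdeg p = 3 → IsCoeffFun s (R p)) (j : Fin m) (i : Fin n) :
    HasSum (couplingTermB ω Ω R j i) (∑ j', -Complex.I * (1 + if j = j' then 1 else 0) *
      (torusCoeff (fun φ => solCoeff ω Ω R (unit i, unit j', 0) φ *
          R (0, unit j, unit j + unit j') φ) 0 -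
        torusCoeff (fun φ => R (0, unit j + unit j', unit j) φ *
          solCoeff ω Ω R (unit i, 0, unit j') φ) 0)) := by
  refine hasSum_prod_of_fintype (f := fun j' ℓ => couplingTermB ω Ω R j i (j', ℓ)) fun j' => ?_
  have hz := hR _ (wdeg_unit_unit_zero i j')
  have hw := hR _ (wdeg_unit_zero_unit i j')
  have h1 := IsCoeffFun.hasSum_torusCoeff_mul hs
    (isCoeffFun_solCoeff hs hγ hτ hMel hz) (hR _ (wdeg_zero_unit_add j j'))
  have h2 := IsCoeffFun.hasSum_torusCoeff_mul hs (hR _ (wdeg_zero_add_unit j j'))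
    (isCoeffFun_solCoeff hs hγ hτ hMel hw)
  refine ((h1.sub h2).mul_left _).congr_fun fun ℓ => ?_
  rw [torusCoeff_solCoeff_z hs hγ hτ hMel hz, torusCoeff_solCoeff_w hs hγ hτ hMel hw,
    neg_neg, couplingTermB]
  simp only [tfCoeff, div_eq_mul_inv]
  linear_combination ((1 + if j = j' then 1 else 0) * (divisor ω Ω j' ℓ)⁻¹ *
    (torusCoeff (R (0, unit j, unit j + unit j')) (-ℓ) * torusCoeff (R (unit i, unit j', 0)) ℓ +
      torusCoeff (R (0, unit j + unit j', unit j)) ℓ * torusCoeff (R (unit i, 0, unit j')) (-ℓ))) *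
      Complex.I_sq

/-- The average of the coefficient of `I_i z_j w_j` is an entry of the coupling matrix. -/
theorem torusCoeff_coeff_secondSource (hs : 0 < s) (hγ : 0 < γ) (hτ : 0 < τ)
    (hMel : Melnikov ω Ω γ τ) (hR : ∀ p, 3 ≤ wdeg p → IsCoeffFun s (R p))
    (hc : EqOn (secondSource ω Ω R) (weightPart 4 c) (cylinder n m s)) (j : Fin m) (i : Fin n) :
    torusCoeff (c (unit i, unit j, unit j)) 0 = couplingMatrix ω Ω R j i := by
  have hR3 : ∀ p, wdeg p = 3 → IsCoeffFun s (R p) := fun p hp => hR p hp.ge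
  have hf : ∀ p, wdeg p = 3 → IsCoeffFun s (solCoeff ω Ω R p) := fun p hp =>
    isCoeffFun_solCoeff hs hγ hτ hMel (hR3 p hp)
  have hz := fun i => hR3 _ (wdeg_unit_unit_zero i j)
  have hw := fun i => hR3 _ (wdeg_unit_zero_unit i j)
  have hfz := fun i => hf _ (wdeg_unit_unit_zero i j)
  have hfw := fun i => hf _ (wdeg_unit_zero_unit i j)
  set f := solCoeff ω Ω R with hfdef
  rw [torusCoeff_congr hs fun φ hφ => coeff_secondSource i j hR3 ω Ω hf hφ hc]
  have a1 := fun i' => ((hfz i).angleDeriv i').mul (hw i')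
  have a2 := fun i' => (hz i').mul ((hfw i).angleDeriv i')
  have a3 := fun i' => (hfz i').mul ((hw i).angleDeriv i')
  have a4 := fun i' => ((hz i).angleDeriv i').mul (hfw i')
  have b1 := fun j' => (hf _ (wdeg_unit_unit_zero i j')).mul (hR3 _ (wdeg_zero_unit_add j j'))
  have b2 := fun j' => (hR3 _ (wdeg_zero_add_unit j j')).mul (hf _ (wdeg_unit_zero_unit i j'))
  have h0 : IsCoeffFun s (R (unit i, unit j, unit j)) :=
    hR _ (by simp [wdeg, unit_eq_single])
  have hA := fun i' => (((a1 i').add (a2 i')).add ((a3 i').const_mul (-1))).add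
    ((a4 i').const_mul (-1))
  have hB := fun j' => ((b1 j').add ((b2 j').const_mul (-1))).const_mul
    (Complex.I * (1 + if j = j' then 1 else 0))
  have hAs := (IsCoeffFun.sum Finset.univ fun i' _ => hA i').const_mul (1 / 2)
  have hBs := IsCoeffFun.sum Finset.univ fun j' _ => hB j'
  have e : EqOn (fun φ => R (unit i, unit j, unit j) φ + 1 / 2 * ∑ i',
      (angleDeriv i' (f (unit i, unit j, 0)) φ * R (unit i', 0, unit j) φ +
        angleDeriv i' (f (unit i, 0, unit j)) φ * R (unit i', unit j, 0) φ -
        f (unit i', unit j, 0) φ * angleDeriv i' (R (unit i, 0, unit j)) φ -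
        f (unit i', 0, unit j) φ * angleDeriv i' (R (unit i, unit j, 0)) φ) +
      ∑ j', Complex.I * ((1 + if j = j' then 1 else 0) *
        (f (unit i, unit j', 0) φ * R (0, unit j, unit j + unit j') φ -
          f (unit i, 0, unit j') φ * R (0, unit j + unit j', unit j) φ)))
      (fun φ => (R (unit i, unit j, unit j) φ + _) + _) (strip n s) := fun φ _ =>
    congrArg₂ (· + ·) (congrArg₂ (· + ·) rfl (congrArg₂ (· * ·) rfl
      (Finset.sum_congr rfl fun i' _ => by ring : _ = ∑ i',
        (angleDeriv i' (f (unit i, unit j, 0)) φ * R (unit i', 0, unit j) φ +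
        R (unit i', unit j, 0) φ * angleDeriv i' (f (unit i, 0, unit j)) φ +
        (-1) * (f (unit i', unit j, 0) φ * angleDeriv i' (R (unit i, 0, unit j)) φ) +
        (-1) * (angleDeriv i' (R (unit i, unit j, 0)) φ * f (unit i', 0, unit j) φ)))))
      (Finset.sum_congr rfl fun j' _ => by ring : _ = ∑ j',
        Complex.I * (1 + if j = j' then 1 else 0) *
          (f (unit i, unit j', 0) φ * R (0, unit j, unit j + unit j') φ +
            (-1) * (R (0, unit j + unit j', unit j) φ * f (unit i, 0, unit j') φ)))
  rw [torusCoeff_congr hs e, IsCoeffFun.torusCoeff_add hs (h0.add hAs) hBs,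
    IsCoeffFun.torusCoeff_add hs h0 hAs, torusCoeff_const_mul,
    torusCoeff_sum hs _ fun i' _ => hA i', torusCoeff_sum hs _ fun j' _ => hB j']
  have c1 : ∀ i', torusCoeff (fun φ => angleDeriv i' (f (unit i, unit j, 0)) φ *
        R (unit i', 0, unit j) φ + R (unit i', unit j, 0) φ *
          angleDeriv i' (f (unit i, 0, unit j)) φ +
        (-1) * (f (unit i', unit j, 0) φ * angleDeriv i' (R (unit i, 0, unit j)) φ) +
        (-1) * (angleDeriv i' (R (unit i, unit j, 0)) φ * f (unit i', 0, unit j) φ)) 0 = _ :=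
    fun i' => by
      rw [IsCoeffFun.torusCoeff_add hs (((a1 i').add (a2 i')).add ((a3 i').const_mul (-1)))
        ((a4 i').const_mul (-1)), IsCoeffFun.torusCoeff_add hs ((a1 i').add (a2 i'))
        ((a3 i').const_mul (-1)), IsCoeffFun.torusCoeff_add hs (a1 i') (a2 i'),
        torusCoeff_const_mul, torusCoeff_const_mul]
  have c2 : ∀ j', torusCoeff (fun φ => Complex.I * (1 + if j = j' then 1 else 0) *
          (f (unit i, unit j', 0) φ * R (0, unit j, unit j + unit j') φ +
            (-1) * (R (0, unit j + unit j', unit j) φ * f (unit i, 0, unit j') φ))) 0 = _ :=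
    fun j' => by
      rw [torusCoeff_const_mul, IsCoeffFun.torusCoeff_add hs (b1 j') ((b2 j').const_mul (-1)),
        torusCoeff_const_mul]
  simp only [c1, c2]
  rw [couplingMatrix, Matrix.of_apply, (hasSum_couplingTermA hs hγ hτ hMel hR3 j i).tsum_eq,
    (hasSum_couplingTermB hs hγ hτ hMel hR3 j i).tsum_eq, sub_eq_add_neg, sub_eq_add_neg,
    ← Finset.sum_neg_distrib, ← Finset.sum_neg_distrib, Finset.mul_sum]
  refine congrArg₂ (· + ·) (congrArg₂ (· + ·) rfl (Finset.sum_congr rfl fun i' _ => ?_))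
    (Finset.sum_congr rfl fun j' _ => ?_)
  · ring
  · ring

lemma homogPart_eq_zero {x : Phase n m} (hz : x.2.2 = 0) (q : ℕ) {d : ℕ} (hd : d ≠ 0)
    (c : MIdx n m → (Fin n → ℂ) → ℂ) : homogPart q d c x = 0 := by
  rw [homogPart_eq_sum]
  refine Finset.sum_eq_zero fun p hp => ?_
  rw [mono_eq_zero hz (by rw [(mem_bidegSet.1 hp).2]; exact hd), mul_zero]

lemma homogPart_two_zero (c : MIdx n m → (Fin n → ℂ) → ℂ) (x : Phase n m) :
    homogPart 2 0 c x =
      ∑ k ∈ Finset.piAntidiag Finset.univ 2, (∏ i, x.1 i ^ k i) * c (k, 0, 0) x.2.1 := by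
  rw [homogPart]
  refine Finset.sum_congr rfl fun k _ => ?_
  simp [mono, mul_comm]

/-- The averaged quadratic part in the actions is given by the twist matrix. -/
theorem homogPart_two_zero_normalCoeff (hs : 0 < s) (hγ : 0 < γ) (hτ : 0 < τ)
    (hMel : Melnikov ω Ω γ τ) (hR : ∀ p, 3 ≤ wdeg p → IsCoeffFun s (R p))
    (hcf : ∀ p, IsCoeffFun s (c p))
    (hc : EqOn (secondSource ω Ω R) (weightPart 4 c) (cylinder n m s)) (x : Phase n m) :
    homogPart 2 0 (normalCoeff c) x =
      1 / 2 * ∑ i, ∑ i', twistMatrix ω Ω R i i' * x.1 i' * x.1 i := by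
  have hR3 : ∀ p, wdeg p = 3 → IsCoeffFun s (R p) := fun p hp => hR p hp.ge
  have hf : ∀ p, wdeg p = 3 → IsCoeffFun s (solCoeff ω Ω R p) := fun p hp =>
    isCoeffFun_solCoeff hs hγ hτ hMel (hR3 p hp)
  have hz := fun i j => hR3 _ (wdeg_unit_unit_zero i j)
  have hw := fun i j => hR3 _ (wdeg_unit_zero_unit i j)
  have hfz := fun i j => hf _ (wdeg_unit_unit_zero i j)
  have hfw := fun i j => hf _ (wdeg_unit_zero_unit i j)
  have hk : ∀ k ∈ Finset.piAntidiag (Finset.univ : Finset (Fin n)) 2,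
      IsCoeffFun s (R (k, 0, 0)) := fun k hk => by
    rw [Finset.mem_piAntidiag] at hk
    exact hR _ (by simp [wdeg, hk.1])
  -- averaging the coefficients amounts to averaging the function on `z = w = 0`
  have e1 : homogPart 2 0 (normalCoeff c) x = torusCoeff (fun φ =>
      ∑ k ∈ Finset.piAntidiag Finset.univ 2, (∏ i, x.1 i ^ k i) * c (k, 0, 0) φ) 0 := by
    rw [torusCoeff_sum hs _ fun k _ => (hcf _).const_mul _, homogPart_two_zero]
    refine Finset.sum_congr rfl fun k hk => ?_
    rw [torusCoeff_const_mul]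
    have h1 : Solvable (k, (0 : Fin m → ℕ), (0 : Fin m → ℕ)) := by
      refine ⟨?_, by simp⟩
      rintro (rfl : k = 0)
      simp [Finset.mem_piAntidiag] at hk
    have h2 : charge (k, (0 : Fin m → ℕ), (0 : Fin m → ℕ)) = 0 := by ext j; simp [charge]
    rw [normalCoeff, if_pos h1, if_pos h2]
  have e2 : EqOn (fun φ => ∑ k ∈ Finset.piAntidiag Finset.univ 2,
        (∏ i, x.1 i ^ k i) * c (k, 0, 0) φ)
      (fun φ => ∑ k ∈ Finset.piAntidiag Finset.univ 2, (∏ i, x.1 i ^ k i) * R (k, 0, 0) φ +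
        ∑ j, ∑ i, ∑ i', (1 / 2 * Complex.I * x.1 i * x.1 i') *
          (solCoeff ω Ω R (unit i, unit j, 0) φ * R (unit i', 0, unit j) φ +
            (-1) * (R (unit i', unit j, 0) φ * solCoeff ω Ω R (unit i, 0, unit j) φ)))
      (strip n s) := by
    intro φ hφ
    set y : Phase n m := (x.1, φ, 0) with hy
    have hyc : y ∈ cylinder n m s := hφ
    have h1 := hc hyc
    rw [secondSource_of_eq_zero hR3 ω Ω hf hyc rfl, weightPart_four,
      homogPart_eq_zero rfl 1 two_ne_zero, homogPart_eq_zero rfl 0 four_ne_zero, add_zero, add_zero,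
      homogPart_two_zero, homogPart_two_zero] at h1
    refine h1.symm.trans (congrArg₂ (· + ·) rfl ?_)
    rw [Finset.mul_sum]
    refine Finset.sum_congr rfl fun j _ => ?_
    rw [Finset.sum_mul_sum, Finset.sum_mul_sum, ← Finset.sum_sub_distrib, ← mul_assoc,
      Finset.mul_sum]
    refine Finset.sum_congr rfl fun i _ => ?_
    rw [← Finset.sum_sub_distrib, Finset.mul_sum]
    refine Finset.sum_congr rfl fun i' _ => ?_
    simp only [hy]
    ring
  have b := fun j i i' => ((hfz i j).mul (hw i' j)).add (((hz i' j).mul (hfw i j)).const_mul (-1))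
  have b' := fun j i i' => (b j i i').const_mul (1 / 2 * Complex.I * x.1 i * x.1 i')
  have b2 := fun j i => IsCoeffFun.sum Finset.univ fun i' _ => b' j i i'
  have b3 := fun j => IsCoeffFun.sum Finset.univ fun i _ => b2 j i
  have b4 := IsCoeffFun.sum Finset.univ fun j _ => b3 j
  rw [e1, torusCoeff_congr hs e2, IsCoeffFun.torusCoeff_add hs
    (IsCoeffFun.sum _ fun k h => (hk k h).const_mul _) b4,
    torusCoeff_sum hs _ fun k h => (hk k h).const_mul _, torusCoeff_sum hs _ fun j _ => b3 j]
  simp only [torusCoeff_sum hs _ fun i _ => b2 _ i, torusCoeff_sum hs _ fun i' _ => b' _ _ i',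
    torusCoeff_const_mul]
  have c1 : ∀ j i i', torusCoeff (fun φ =>
      solCoeff ω Ω R (unit i, unit j, 0) φ * R (unit i', 0, unit j) φ +
        (-1) * (R (unit i', unit j, 0) φ * solCoeff ω Ω R (unit i, 0, unit j) φ)) 0 = _ :=
    fun j i i' => by
      rw [IsCoeffFun.torusCoeff_add hs ((hfz i j).mul (hw i' j))
        (((hz i' j).mul (hfw i j)).const_mul (-1)), torusCoeff_const_mul]
  simp only [c1]
  rw [sum_piAntidiag_two]
  simp only [Finset.sum_comm (s := Finset.univ (α := Fin m)), Finset.mul_sum,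
    ← Finset.sum_add_distrib]
  refine Finset.sum_congr rfl fun i _ => Finset.sum_congr rfl fun i' _ => ?_
  have hprod : ∏ k, x.1 k ^ (unit i + unit i' : Fin n → ℕ) k = x.1 i * x.1 i' := by
    simp only [Pi.add_apply, pow_add, Finset.prod_mul_distrib, prod_pow_unit]
  rw [hprod, twistMatrix, Matrix.of_apply, (hasSum_twistTerm hs hγ hτ hMel hR3 i i').tsum_eq,
    ← Finset.mul_sum]
  simp only [tfCoeff, neg_one_mul, ← sub_eq_add_neg, ← Finset.mul_sum]
  ring

/-- The averaged part of degree one in the actions is given by the coupling matrix. -/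
theorem homogPart_one_two_normalCoeff (hs : 0 < s) (hγ : 0 < γ) (hτ : 0 < τ)
    (hMel : Melnikov ω Ω γ τ) (hR : ∀ p, 3 ≤ wdeg p → IsCoeffFun s (R p))
    (hc : EqOn (secondSource ω Ω R) (weightPart 4 c) (cylinder n m s)) (x : Phase n m) :
    homogPart 1 2 (normalCoeff c) x =
      ∑ j, ∑ i, couplingMatrix ω Ω R j i * x.1 i * x.2.2.1 j * x.2.2.2 j := by
  rw [homogPart, sum_piAntidiag_one, Finset.sum_comm (s := Finset.univ (α := Fin m))]
  refine Finset.sum_congr rfl fun i _ => ?_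
  have hzero : ∀ a b : Fin m → ℕ, ∑ j, a j + ∑ j, b j ≤ 2 → a ≠ b →
      normalCoeff c (unit i, a, b) x.2.1 = 0 := by
    intro a b hab hne
    have h2 : charge (unit i, a, b) ≠ 0 := fun h => hne (funext fun j => by
      have := congrFun h j
      simp only [charge, Pi.zero_apply] at this
      omega)
    rw [normalCoeff, if_pos (solvable_unit hab), if_neg h2]
  have hdiag : ∀ j : Fin m, normalCoeff c (unit i, unit j, unit j) x.2.1 =
      couplingMatrix ω Ω R j i := by
    intro j
    have h2 : charge (unit i, unit j, unit j) = 0 := by ext j'; simp [charge]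
    rw [normalCoeff, if_pos (solvable_unit (by simp [unit_eq_single])), if_pos h2,
      torusCoeff_coeff_secondSource hs hγ hτ hMel hR hc]
  rw [Finset.sum_eq_single (1, 1)]
  · rw [sum_piAntidiag_one]
    refine Finset.sum_congr rfl fun j _ => ?_
    rw [sum_piAntidiag_one, Finset.sum_eq_single j]
    · rw [hdiag]
      simp only [mono, prod_pow_unit]
      ring
    · intro j' _ hj'
      rw [hzero _ _ (by simp [unit_eq_single]), zero_mul]
      intro h
      have := congrFun h j
      simp [unit_eq_single, hj'.symm] at this
    · simp
  · intro e he hne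
    refine Finset.sum_eq_zero fun a ha => Finset.sum_eq_zero fun b hb => ?_
    simp only [Finset.HasAntidiagonal.mem_antidiagonal] at he
    have ha : ∑ j, a j = e.1 := (Finset.mem_piAntidiag.1 ha).1
    have hb : ∑ j, b j = e.2 := (Finset.mem_piAntidiag.1 hb).1
    rw [hzero a b (by omega), zero_mul]
    rintro rfl
    exact hne (Prod.ext (by dsimp only; omega) (by dsimp only; omega))
  · intro h
    exact absurd (by simp) h

lemma conj_divisor (j : Fin m) (ℓ : Fin n → ℤ) :
    (starRingEnd ℂ) (divisor ω Ω j ℓ) = divisor ω Ω j ℓ := by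
  simp [divisor]

/-- Conjugation reverses the mode and exchanges the exponents of `z` and `w`. It therefore fixes the
terms of the twist and coupling series by exchanging their two products. -/
lemma conj_tfCoeff {k : Fin n → ℕ} {a b : Fin m → ℕ} (hsym : SymmCoeff (wdeg (k, a, b)) R)
    (ℓ : Fin n → ℤ) : (starRingEnd ℂ) (tfCoeff R k a b ℓ) = tfCoeff R k b a (-ℓ) :=
  conj_torusCoeff (hsym (k, a, b) rfl) ℓ

lemma conj_twistTerm (hsym : ∀ d, 3 ≤ d → SymmCoeff d R) (i i' : Fin n) (p : Fin m × (Fin n → ℤ)) :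
    (starRingEnd ℂ) (twistTerm ω Ω R i i' p) = twistTerm ω Ω R i i' p := by
  have h1 := fun i : Fin n => hsym _ (wdeg_unit_unit_zero i p.1).ge
  have h2 := fun i : Fin n => hsym _ (wdeg_unit_zero_unit i p.1).ge
  simp only [twistTerm, map_mul, map_add, map_div₀, map_one, conj_divisor, conj_tfCoeff (h1 _),
    conj_tfCoeff (h2 _), neg_neg]
  ring

lemma conj_couplingTermA (hsym : ∀ d, 3 ≤ d → SymmCoeff d R) (j : Fin m) (i : Fin n)
    (p : Fin n × (Fin n → ℤ)) :
    (starRingEnd ℂ) (couplingTermA ω Ω R j i p) = couplingTermA ω Ω R j i p := by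
  have h1 := fun i : Fin n => hsym _ (wdeg_unit_unit_zero i j).ge
  have h2 := fun i : Fin n => hsym _ (wdeg_unit_zero_unit i j).ge
  simp only [couplingTermA, map_mul, map_add, map_div₀, map_intCast, conj_divisor,
    conj_tfCoeff (h1 _), conj_tfCoeff (h2 _), neg_neg]
  ring

lemma conj_couplingTermB (hsym : ∀ d, 3 ≤ d → SymmCoeff d R) (j : Fin m) (i : Fin n)
    (p : Fin m × (Fin n → ℤ)) :
    (starRingEnd ℂ) (couplingTermB ω Ω R j i p) = couplingTermB ω Ω R j i p := by
  have h1 := hsym _ (wdeg_unit_unit_zero i p.1).ge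
  have h2 := hsym _ (wdeg_unit_zero_unit i p.1).ge
  have h3 := hsym _ (wdeg_zero_unit_add (n := n) j p.1).ge
  have h4 := hsym _ (wdeg_zero_add_unit (n := n) j p.1).ge
  have h5 : (starRingEnd ℂ) (1 + if j = p.1 then 1 else 0) = 1 + if j = p.1 then 1 else 0 := by
    split_ifs <;> simp
  simp only [couplingTermB, map_mul, map_add (starRingEnd ℂ) (_ * _), map_div₀, h5, conj_divisor,
    conj_tfCoeff h1, conj_tfCoeff h2, conj_tfCoeff h3, conj_tfCoeff h4, neg_neg]
  ring

lemma twistMatrix_im (hsym : ∀ d, 3 ≤ d → SymmCoeff d R) (i i' : Fin n) :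
    (twistMatrix ω Ω R i i').im = 0 := by
  have h1 : 3 ≤ wdeg (unit i + unit i', (0 : Fin m → ℕ), (0 : Fin m → ℕ)) := by
    simp [wdeg, unit_eq_single, Finset.sum_add_distrib]
  have h5 : (starRingEnd ℂ) (1 + if i = i' then 1 else 0) = 1 + if i = i' then 1 else 0 := by
    split_ifs <;> simp
  rw [← Complex.conj_eq_iff_im, twistMatrix, Matrix.of_apply, map_sub, map_mul, h5,
    Complex.conj_tsum, conj_tfCoeff (hsym _ h1), neg_zero]
  simp only [conj_twistTerm hsym]

lemma couplingMatrix_im (hsym : ∀ d, 3 ≤ d → SymmCoeff d R) (j : Fin m) (i : Fin n) :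
    (couplingMatrix ω Ω R j i).im = 0 := by
  have h1 : 3 ≤ wdeg (unit i, unit j, unit j) := by simp [wdeg, unit_eq_single]
  rw [← Complex.conj_eq_iff_im, couplingMatrix, Matrix.of_apply, map_sub, map_sub,
    Complex.conj_tsum, Complex.conj_tsum, conj_tfCoeff (hsym _ h1), neg_zero]
  simp only [conj_couplingTermA hsym, conj_couplingTermB hsym]

lemma twistMatrix_symm (ω : Fin n → ℝ) (Ω : Fin m → ℝ) (R : MIdx n m → (Fin n → ℂ) → ℂ)
    (i i' : Fin n) : twistMatrix ω Ω R i i' = twistMatrix ω Ω R i' i := by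
  have h : ∀ p, twistTerm ω Ω R i i' p = twistTerm ω Ω R i' i p := fun p => by
    simp only [twistTerm]; ring
  rw [twistMatrix, Matrix.of_apply, Matrix.of_apply, tsum_congr h, add_comm (unit i)]
  simp only [eq_comm]

end Averages

/-! ### The generating function and the normal form -/

/-- The terms of weighted degree five that are produced by the first two orders of the averaging;
`c` is the family of coefficients of `secondSource`. -/
def thirdSource (ω : Fin n → ℝ) (Ω : Fin m → ℝ) (R c : MIdx n m → (Fin n → ℂ) → ℂ)
    (x : Phase n m) : ℂ :=
  weightPart 5 R x +
    1 / 2 * bracket (fun x => weightPart 4 R x + weightPart 4 (normalCoeff c) x)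
      (weightPart 3 (solCoeff ω Ω R)) x +
    1 / 2 * bracket (fun x => weightPart 3 R x + weightPart 3 (normalCoeff R) x)
      (weightPart 4 (solCoeff ω Ω c)) x +
    1 / 8 * bracketTwo (fun x => weightPart 3 R x + (-1) * weightPart 3 (normalCoeff R) x)
      (weightPart 3 (solCoeff ω Ω R)) x

section NormalForm

variable {ω : Fin n → ℝ} {Ω : Fin m → ℝ} {γ τ s : ℝ} {R c : MIdx n m → (Fin n → ℂ) → ℂ}

/-- There are families of coefficients `c 3 = R`, `c 4` and `c 5` such that `c d` are the
coefficients of the source of the homological equation of weighted degree `d`. -/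
theorem exists_sources (hs : 0 < s) (hγ : 0 < γ) (hτ : 0 < τ) (hMel : Melnikov ω Ω γ τ)
    (hR : ∀ p, 3 ≤ wdeg p → IsCoeffFun s (R p)) (hsym : ∀ d, 3 ≤ d → SymmCoeff d R) :
    ∃ c : ℕ → MIdx n m → (Fin n → ℂ) → ℂ, c 3 = R ∧
      (∀ d, 3 ≤ d → ∀ p, wdeg p = d → IsCoeffFun s (c d p)) ∧
      (∀ d, 3 ≤ d → SymmCoeff d (c d)) ∧ (∀ p, IsCoeffFun s (c 4 p)) ∧
      (∀ p, IsCoeffFun s (c 5 p)) ∧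
      EqOn (secondSource ω Ω R) (weightPart 4 (c 4)) (cylinder n m s) ∧
      EqOn (thirdSource ω Ω R (c 4)) (weightPart 5 (c 5)) (cylinder n m s) := by
  have hK : ∀ d : ℕ, 3 ≤ d → Pol s d (weightPart d R) := fun d hd =>
    Pol.weightPart fun p hp => hR p (hp ▸ hd)
  have hKr : ∀ d, 3 ≤ d → RealOn s (weightPart d R) := fun d hd => (hsym d hd).realOn
  have hF : Pol s 3 (weightPart 3 (solCoeff ω Ω R)) :=
    Pol.weightPart (d := 3) fun p hp => isCoeffFun_solCoeff hs hγ hτ hMel (hR p hp.ge)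
  have hFr : RealOn s (weightPart 3 (solCoeff ω Ω R)) := (hsym 3 le_rfl).solCoeff.realOn
  have hG : Pol s 3 (weightPart 3 (normalCoeff R)) :=
    Pol.weightPart (d := 3) fun p hp => isCoeffFun_normalCoeff (hR p hp.ge)
  have hGr : RealOn s (weightPart 3 (normalCoeff R)) := (hsym 3 le_rfl).normalCoeff.realOn
  have hKG := (hK 3 le_rfl).add hG
  have hKGr := (hKr 3 le_rfl).add hGr
  have half : ∀ {T : Phase n m → ℂ}, RealOn s T → RealOn s fun x => 1 / 2 * T x := fun hT => by
    simpa using hT.real_mul (1 / 2)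
  have eighth : ∀ {T : Phase n m → ℂ}, RealOn s T → RealOn s fun x => 1 / 8 * T x := fun hT => by
    simpa using hT.real_mul (1 / 8)
  have neg : ∀ {T : Phase n m → ℂ}, RealOn s T → RealOn s fun x => -1 * T x := fun hT => by
    simpa using hT.real_mul (-1)
  have h4 : Pol s 4 (secondSource ω Ω R) :=
    (hK 4 (by norm_num)).add (((hKG.bracket hF).const_mul (1 / 2)).cast_deg (by norm_num))
  have h4r : RealOn s (secondSource ω Ω R) := (hKr 4 (by norm_num)).add
    (half (hKGr.bracket hFr (fun _ => hKG.differentiableAt) fun _ => hF.differentiableAt))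
  obtain ⟨c4, hc4, he4⟩ := h4.exists_weightPart (d := 4)
  have hs4 : SymmCoeff 4 c4 := RealOn.symmCoeff hs (d := 4) h4 h4r he4
  have hF4 : Pol s 4 (weightPart 4 (solCoeff ω Ω c4)) :=
    Pol.weightPart (d := 4) fun p _ => isCoeffFun_solCoeff hs hγ hτ hMel (hc4 p)
  have hF4r : RealOn s (weightPart 4 (solCoeff ω Ω c4)) := hs4.solCoeff.realOn
  have hG4 : Pol s 4 (weightPart 4 (normalCoeff c4)) :=
    Pol.weightPart (d := 4) fun p _ => isCoeffFun_normalCoeff (hc4 p)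
  have hG4r : RealOn s (weightPart 4 (normalCoeff c4)) := hs4.normalCoeff.realOn
  have hKG4 := (hK 4 (by norm_num)).add hG4
  have hKG4r := (hKr 4 (by norm_num)).add hG4r
  have hKmG := (hK 3 le_rfl).add (hG.const_mul (-1))
  have hKmGr := (hKr 3 le_rfl).add (neg hGr)
  have h5 : Pol s 5 (thirdSource ω Ω R c4) :=
    (((hK 5 (by norm_num)).add (((hKG4.bracket hF).const_mul (1 / 2)).cast_deg (by norm_num))).add
      (((hKG.bracket hF4).const_mul (1 / 2)).cast_deg (by norm_num))).add
      (((hKmG.bracketTwo hF).const_mul (1 / 8)).cast_deg (by norm_num))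
  have h5r : RealOn s (thirdSource ω Ω R c4) :=
    (((hKr 5 (by norm_num)).add (half (hKG4r.bracket hFr (fun _ => hKG4.differentiableAt)
      fun _ => hF.differentiableAt))).add (half (hKGr.bracket hF4r (fun _ => hKG.differentiableAt)
      fun _ => hF4.differentiableAt))).add (eighth (hKmGr.bracketTwo hFr hKmG.analyticOnNhd
      fun _ => hF.differentiableAt))
  obtain ⟨c5, hc5, he5⟩ := h5.exists_weightPart (d := 5)
  have hs5 : SymmCoeff 5 c5 := RealOn.symmCoeff hs (d := 5) h5 h5r he5
  refine ⟨fun d => if d = 4 then c4 else if d = 5 then c5 else R, by simp, fun d hd p hp => ?_,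
    fun d hd => ?_, by simpa using hc4, by simpa using hc5, by simpa using he4, by simpa using he5⟩
  · by_cases h4' : d = 4
    · simpa [h4'] using hc4 p
    · by_cases h5' : d = 5
      · simpa [h5'] using hc5 p
      · simpa [h4', h5'] using hR p (hp ▸ hd)
  · by_cases h4' : d = 4
    · subst h4'; simpa using hs4
    · by_cases h5' : d = 5
      · subst h5'; simpa using hs5
      · simpa [h4', h5'] using hsym d hd

end NormalForm

/-! ### Margins of the domains -/

/-- A domain contains a uniform neighbourhood of any smaller one. -/
lemma exists_closedBall_subset_domain (n m : ℕ) {r r' s s' ρ ρ' : ℝ} (hr' : 0 ≤ r') (hr : r' < r)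
    (hs : s' < s) (hρ' : 0 ≤ ρ') (hρ : ρ' < ρ) :
    ∃ δ > 0, ∀ x ∈ domain n m r' s' ρ', closedBall x δ ⊆ domain n m r s ρ := by
  have aux : ∀ (k : ℕ) {a b : ℝ}, 0 ≤ a → a < b → ∃ δ > 0, ∀ ε, 0 ≤ ε → ε ≤ δ →
      k * (2 * a * ε + ε ^ 2) < b ^ 2 - a ^ 2 := by
    intro k a b ha hab
    have hgap : 0 < b ^ 2 - a ^ 2 := by nlinarith
    refine ⟨min 1 ((b ^ 2 - a ^ 2) / ((k + 1) * (2 * a + 1))), by positivity, fun ε h0 hε => ?_⟩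
    have h1 : ε ≤ 1 := hε.trans (min_le_left _ _)
    have h2 := hε.trans (min_le_right _ _)
    rw [le_div_iff₀ (by positivity)] at h2
    have hk : (0 : ℝ) ≤ k := Nat.cast_nonneg k
    rcases h0.eq_or_lt with rfl | hpos
    · simpa using hgap
    · have h3 : 2 * a * ε + ε ^ 2 ≤ ε * (2 * a + 1) := by nlinarith
      have h4 : k * (2 * a * ε + ε ^ 2) ≤ k * (ε * (2 * a + 1)) := by gcongr
      have h5 : 0 < ε * (2 * a + 1) := by positivity
      nlinarith
  have aux2 : ∀ {k : ℕ} {u v : Fin k → ℂ} {ε a : ℝ}, ‖v - u‖ ≤ ε → 0 ≤ ε → (∀ i, ‖u i‖ ≤ a) →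
      ∑ i, ‖v i‖ ^ 2 ≤ ∑ i, ‖u i‖ ^ 2 + k * (2 * a * ε + ε ^ 2) := by
    intro k u v ε a hv hε hu
    have : ∑ i, ‖v i‖ ^ 2 ≤ ∑ i : Fin k, (‖u i‖ ^ 2 + (2 * a * ε + ε ^ 2)) := by
      refine Finset.sum_le_sum fun i _ => ?_
      have h1 : ‖v i - u i‖ ≤ ε := (norm_le_pi_norm (v - u) i).trans hv
      have h2 : ‖v i‖ ≤ ‖u i‖ + ε := by
        calc ‖v i‖ = ‖u i + (v i - u i)‖ := by rw [add_sub_cancel]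
          _ ≤ ‖u i‖ + ‖v i - u i‖ := norm_add_le _ _
          _ ≤ _ := by gcongr
      have h3 := hu i
      have h4 := norm_nonneg (u i)
      have h5 := norm_nonneg (v i)
      nlinarith
    refine this.trans (le_of_eq ?_)
    rw [Finset.sum_add_distrib, Finset.sum_const, Finset.card_univ, Fintype.card_fin, nsmul_eq_mul]
  have aux3 : ∀ {k : ℕ} {u : Fin k → ℂ} {a : ℝ}, 0 ≤ a → ∑ i, ‖u i‖ ^ 2 ≤ a ^ 2 →
      ∀ i, ‖u i‖ ≤ a := by
    intro k u a ha h i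
    refine abs_le_of_sq_le_sq' ?_ ha |>.2
    exact (Finset.single_le_sum (f := fun i => ‖u i‖ ^ 2) (fun i _ => sq_nonneg _)
      (Finset.mem_univ i)).trans h
  obtain ⟨δ₁, h1, H1⟩ := aux n hr' hr
  obtain ⟨δ₂, h2, H2⟩ := aux (m + m) hρ' hρ
  refine ⟨min (min δ₁ δ₂) ((s - s') / 2), by
    have : 0 < (s - s') / 2 := by linarith
    positivity, fun x hx y hy => ?_⟩
  rw [mem_closedBall, dist_eq_norm] at hy
  set ε := min (min δ₁ δ₂) ((s - s') / 2) with hε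
  have hε0 : 0 ≤ ε := (norm_nonneg _).trans hy
  have hε1 : ε ≤ δ₁ := (min_le_left _ _).trans (min_le_left _ _)
  have hε2 : ε ≤ δ₂ := (min_le_left _ _).trans (min_le_right _ _)
  have hε3 : ε ≤ (s - s') / 2 := min_le_right _ _
  have e1 : ‖y.1 - x.1‖ ≤ ε := (norm_fst_le (y - x)).trans hy
  have e0 : ‖(y - x).2‖ ≤ ε := (norm_snd_le (y - x)).trans hy
  have e2 : ‖y.2.1 - x.2.1‖ ≤ ε := (norm_fst_le (y - x).2).trans e0
  have e3 : ‖(y - x).2.2‖ ≤ ε := (norm_snd_le (y - x).2).trans e0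
  have e4 : ‖y.2.2.1 - x.2.2.1‖ ≤ ε := (norm_fst_le (y - x).2.2).trans e3
  have e5 : ‖y.2.2.2 - x.2.2.2‖ ≤ ε := (norm_snd_le (y - x).2.2).trans e3
  obtain ⟨hI, hφ, hz⟩ := hx
  have p1 : 0 ≤ ∑ j, ‖x.2.2.1 j‖ ^ 2 := Finset.sum_nonneg fun _ _ => sq_nonneg _
  have p2 : 0 ≤ ∑ j, ‖x.2.2.2 j‖ ^ 2 := Finset.sum_nonneg fun _ _ => sq_nonneg _
  refine ⟨?_, fun i => ?_, ?_⟩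
  · have := aux2 e1 hε0 (aux3 hr' hI.le)
    have := H1 ε hε0 hε1
    linarith
  · have h3 : |(y.2.1 i - x.2.1 i).im| ≤ ε :=
      (Complex.abs_im_le_norm _).trans ((norm_le_pi_norm (y.2.1 - x.2.1) i).trans e2)
    have h4 := hφ i
    rw [Complex.sub_im] at h3
    have h5 : |(y.2.1 i).im| ≤ |(y.2.1 i).im - (x.2.1 i).im| + |(x.2.1 i).im| := by
      simpa using abs_add_le ((y.2.1 i).im - (x.2.1 i).im) ((x.2.1 i).im)
    linarith
  · have q1 := aux2 e4 hε0 (aux3 hρ' (by linarith))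
    have q2 := aux2 e5 hε0 (aux3 hρ' (by linarith))
    have q3 := H2 ε hε0 hε2
    push_cast at q3
    linarith

/-! ### Inversion of near-identity maps -/

section Inverse

variable {E : Type*} [NormedAddCommGroup E] [NormedSpace ℂ E]

variable (X : E → E) (W : Set E)

open Classical in
/-- The inverse of `y ↦ y - ½ X(y)`, as a map into `W`; it is the identity where the equation has
no solution in `W`. -/
def halfInverse (x : E) : E :=
  if h : ∃ y ∈ W, y = x + (1 / 2 : ℂ) • X y then h.choose else x

/-- The implicit midpoint map `x = y - ½ X(y) ↦ y + ½ X(y)`. -/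
def midpointMap (x : E) : E := (2 : ℂ) • halfInverse X W x - x

variable {X W}

lemma halfInverse_eq (hLip : ∀ y ∈ W, ∀ y' ∈ W, ‖X y - X y'‖ ≤ ‖y - y'‖) {x y : E} (hy : y ∈ W)
    (h : y = x + (1 / 2 : ℂ) • X y) : halfInverse X W x = y := by
  have hex : ∃ y ∈ W, y = x + (1 / 2 : ℂ) • X y := ⟨y, hy, h⟩
  rw [halfInverse, dif_pos hex]
  obtain ⟨hy', h'⟩ := hex.choose_spec
  set y' := hex.choose
  have h1 : y' - y = (1 / 2 : ℂ) • (X y' - X y) := by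
    rw [smul_sub]
    calc y' - y = (x + (1 / 2 : ℂ) • X y') - (x + (1 / 2 : ℂ) • X y) := by rw [← h', ← h]
      _ = _ := by abel
  have h2 := hLip y' hy' y hy
  have h3 : ‖y' - y‖ = 1 / 2 * ‖X y' - X y‖ := by
    conv_lhs => rw [h1, norm_smul]
    norm_num
  have h4 : ‖y' - y‖ = 0 := by linarith [norm_nonneg (y' - y)]
  exact sub_eq_zero.1 (norm_eq_zero.1 h4)

variable [CompleteSpace E]

/-- The equation `y = x + ½ X(y)` is solved by iteration; the solution stays in every closed set
that is preserved by the iteration. -/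
lemma exists_eq_add_half_smul {Z : Set E} {x : E} {δ : ℝ}
    (hball : closedBall x δ ⊆ W) (hX : ∀ y ∈ W, ‖X y‖ ≤ δ)
    (hLip : ∀ y ∈ W, ∀ y' ∈ W, ‖X y - X y'‖ ≤ ‖y - y'‖) (hZ : IsClosed Z) (hxZ : x ∈ Z)
    (hδ : 0 ≤ δ) (hmaps : ∀ y ∈ W, y ∈ Z → x + (1 / 2 : ℂ) • X y ∈ Z) :
    ∃ y ∈ closedBall x δ, y ∈ Z ∧ y = x + (1 / 2 : ℂ) • X y := by
  set S := closedBall x δ ∩ Z with hS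
  set f : E → E := fun y => x + (1 / 2 : ℂ) • X y with hf
  have hhalf : ‖(1 / 2 : ℂ)‖ = 1 / 2 := by norm_num
  have hmapsTo : MapsTo f S S := by
    rintro y ⟨hy, hyZ⟩
    refine ⟨?_, hmaps y (hball hy) hyZ⟩
    rw [mem_closedBall, dist_eq_norm, hf]
    simp only [add_sub_cancel_left, norm_smul, hhalf]
    have := hX y (hball hy)
    linarith
  have hcontr : ContractingWith (1 / 2) (hmapsTo.restrict f S S) := by
    refine ⟨by rw [← NNReal.coe_lt_coe]; norm_num, LipschitzWith.of_dist_le_mul fun y y' => ?_⟩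
    rw [Subtype.dist_eq, Subtype.dist_eq, dist_eq_norm, dist_eq_norm]
    simp only [MapsTo.val_restrict_apply, hf, add_sub_add_left_eq_sub, ← smul_sub, norm_smul, hhalf]
    have := hLip y (hball y.2.1) y' (hball y'.2.1)
    push_cast
    linarith
  obtain ⟨y, hy, hfix, _⟩ := hcontr.exists_fixedPoint' (isClosed_closedBall.inter hZ).isComplete
    hmapsTo ⟨mem_closedBall_self hδ, hxZ⟩ (edist_ne_top _ _)
  exact ⟨y, hy.1, hy.2, hfix.symm⟩

variable {U : Set E} {δ : ℝ}

lemma halfInverse_spec (hδ : 0 ≤ δ) (hball : ∀ x ∈ U, closedBall x δ ⊆ W)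
    (hX : ∀ y ∈ W, ‖X y‖ ≤ δ) (hLip : ∀ y ∈ W, ∀ y' ∈ W, ‖X y - X y'‖ ≤ ‖y - y'‖) {x : E}
    (hx : x ∈ U) : halfInverse X W x ∈ W ∧
      halfInverse X W x = x + (1 / 2 : ℂ) • X (halfInverse X W x) := by
  obtain ⟨y, hy, -, h⟩ := exists_eq_add_half_smul (hball x hx) hX hLip isClosed_univ (mem_univ x) hδ
    fun _ _ _ => mem_univ _
  rw [halfInverse_eq hLip (hball x hx hy) h]
  exact ⟨hball x hx hy, h⟩

lemma norm_halfInverse_sub_le (hδ : 0 ≤ δ) (hball : ∀ x ∈ U, closedBall x δ ⊆ W)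
    (hX : ∀ y ∈ W, ‖X y‖ ≤ δ) (hLip : ∀ y ∈ W, ∀ y' ∈ W, ‖X y - X y'‖ ≤ ‖y - y'‖) {x x' : E}
    (hx : x ∈ U) (hx' : x' ∈ U) :
    ‖halfInverse X W x - halfInverse X W x'‖ ≤ 2 * ‖x - x'‖ := by
  obtain ⟨h1, h2⟩ := halfInverse_spec hδ hball hX hLip hx
  obtain ⟨h1', h2'⟩ := halfInverse_spec hδ hball hX hLip hx'
  set y := halfInverse X W x
  set y' := halfInverse X W x'
  have h3 : y - y' = (x - x') + (1 / 2 : ℂ) • (X y - X y') := by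
    calc y - y' = (x + (1 / 2 : ℂ) • X y) - (x' + (1 / 2 : ℂ) • X y') := by rw [← h2, ← h2']
      _ = _ := by rw [smul_sub]; abel
  have h4 : ‖y - y'‖ ≤ ‖x - x'‖ + 1 / 2 * ‖X y - X y'‖ := by
    conv_lhs => rw [h3]
    refine (norm_add_le _ _).trans ?_
    rw [norm_smul]
    norm_num
  have h5 := hLip y h1 y' h1'
  linarith

/-- The inverse is differentiable, and its derivative inverts `1 - ½ X'`. -/
lemma exists_hasFDerivAt_halfInverse (hU : IsOpen U) (hW : IsOpen W) (hδ : 0 ≤ δ)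
    (hball : ∀ x ∈ U, closedBall x δ ⊆ W) (hX : ∀ y ∈ W, ‖X y‖ ≤ δ)
    (hLip : ∀ y ∈ W, ∀ y' ∈ W, ‖X y - X y'‖ ≤ ‖y - y'‖) (hd : DifferentiableOn ℂ X W)
    (hd1 : ∀ y ∈ W, ‖fderiv ℂ X y‖ ≤ 1) {x : E} (hx : x ∈ U) :
    ∃ L : E →L[ℂ] E, HasFDerivAt (halfInverse X W) L x ∧
      ∀ u, L u - (1 / 2 : ℂ) • fderiv ℂ X (halfInverse X W x) (L u) = u := by
  obtain ⟨h1, h2⟩ := halfInverse_spec hδ hball hX hLip hx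
  set y := halfInverse X W x with hy
  set t : E →L[ℂ] E := (1 / 2 : ℂ) • fderiv ℂ X y with ht
  have hnorm : ‖t‖ < 1 := by
    rw [ht, norm_smul]
    have := hd1 y h1
    norm_num
    linarith
  set e : E ≃L[ℂ] E := ContinuousLinearEquiv.unitsEquiv ℂ E (Units.oneSub t hnorm) with he
  have he' : ∀ u, e u = u - t u := fun u => rfl
  have hXd : HasFDerivAt X (fderiv ℂ X y) y :=
    (hd.differentiableAt (hW.mem_nhds h1)).hasFDerivAt
  have hf : HasFDerivAt (fun y => y - (1 / 2 : ℂ) • X y) (e : E →L[ℂ] E) y := by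
    refine ((hasFDerivAt_id y).sub (hXd.const_smul (1 / 2 : ℂ))).congr_fderiv ?_
    ext u
    simp [he', ht]
  have hcont : ContinuousAt (halfInverse X W) x := by
    rw [Metric.continuousAt_iff]
    intro ε hε
    obtain ⟨η, hη, hηU⟩ := Metric.isOpen_iff.1 hU x hx
    refine ⟨min η (ε / 2), by positivity, fun x' hx' => ?_⟩
    have hx'U : x' ∈ U := hηU (lt_of_lt_of_le hx' (min_le_left _ _))
    rw [dist_eq_norm] at hx' ⊢
    have := norm_halfInverse_sub_le hδ hball hX hLip hx'U hx
    have := lt_of_lt_of_le hx' (min_le_right _ _)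
    linarith
  have hinv : ∀ᶠ x' in 𝓝 x, (fun y => y - (1 / 2 : ℂ) • X y) (halfInverse X W x') = x' := by
    filter_upwards [hU.mem_nhds hx] with x' hx'
    have := (halfInverse_spec hδ hball hX hLip hx').2
    exact sub_eq_of_eq_add this
  refine ⟨e.symm, HasFDerivAt.of_local_left_inverse hcont hf hinv, fun u => ?_⟩
  have := e.apply_symm_apply u
  rw [he'] at this
  simpa [ht] using this

end Inverse

/-! ### The midpoint map of a Hamiltonian vector field -/

/-- The isomorphism between covectors and vectors given by the symplectic form. -/
def symplGrad (n m : ℕ) : (Phase n m →L[ℂ] ℂ) →L[ℂ] Phase n m :=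
  LinearMap.toContinuousLinearMap
    { toFun := fun f => (fun i => f (dir (.inr (.inl i))), fun i => -f (dir (.inl i)),
        fun j => -Complex.I * f (dir (.inr (.inr (.inr j)))),
        fun j => Complex.I * f (dir (.inr (.inr (.inl j)))))
      map_add' := fun f g => by
        refine Prod.ext ?_ (Prod.ext ?_ (Prod.ext ?_ ?_)) <;> ext i <;>
          simp only [_root_.add_apply, Prod.fst_add, Prod.snd_add, Pi.add_apply] <;> ring
      map_smul' := fun c f => by
        refine Prod.ext ?_ (Prod.ext ?_ (Prod.ext ?_ ?_)) <;> ext i <;>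
          simp only [_root_.smul_apply, Prod.smul_fst, Prod.smul_snd, Pi.smul_apply, smul_eq_mul,
            RingHom.id_apply] <;> ring }

lemma hamVF_eq_symplGrad (F : Phase n m → ℂ) (x : Phase n m) :
    hamVF F x = symplGrad n m (fderiv ℂ F x) := rfl

lemma hamVF_add {F G : Phase n m → ℂ} {x : Phase n m} (hF : DifferentiableAt ℂ F x)
    (hG : DifferentiableAt ℂ G x) : hamVF (fun x => F x + G x) x = hamVF F x + hamVF G x := by
  simp only [hamVF_eq_symplGrad]
  rw [fderiv_fun_add hF hG, map_add]

lemma hamVF_const_mul {F : Phase n m → ℂ} {x : Phase n m} (hF : DifferentiableAt ℂ F x) (a : ℂ) :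
    hamVF (fun x => a * F x) x = a • hamVF F x := by
  simp only [hamVF_eq_symplGrad]
  rw [fderiv_const_mul hF, map_smul]

lemma analyticOnNhd_hamVF {F : Phase n m → ℂ} {U : Set (Phase n m)} (hF : AnalyticOnNhd ℂ F U) :
    AnalyticOnNhd ℂ (hamVF F) U :=
  (symplGrad n m).comp_analyticOnNhd hF.fderiv

lemma fderiv_hamVF {F : Phase n m → ℂ} {x : Phase n m}
    (hF : DifferentiableAt ℂ (fderiv ℂ F) x) :
    fderiv ℂ (hamVF F) x = (symplGrad n m).comp (fderiv ℂ (fderiv ℂ F) x) :=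
  ((symplGrad n m).hasFDerivAt.comp x hF.hasFDerivAt).fderiv

lemma sympl_symplGrad (f : Phase n m →L[ℂ] ℂ) (v : Phase n m) :
    sympl (symplGrad n m f) v = f v := by
  have := sympl_hamVF (fun x => f x) 0 v
  rwa [hamVF_eq_symplGrad, ContinuousLinearMap.fderiv] at this

lemma sympl_swap (u v : Phase n m) : sympl v u = -sympl u v := by
  simp only [sympl]
  rw [neg_add, ← mul_neg, ← Finset.sum_neg_distrib, ← Finset.sum_neg_distrib]
  refine congrArg₂ (· + ·) (Finset.sum_congr rfl fun i _ => by ring)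
    (congrArg _ (Finset.sum_congr rfl fun j _ => by ring))

lemma sympl_add_smul (u u' v : Phase n m) (c : ℂ) :
    sympl (u + c • u') v = sympl u v + c * sympl u' v := by
  simp only [sympl, Prod.fst_add, Prod.snd_add, Prod.smul_fst, Prod.smul_snd, Pi.add_apply,
    Pi.smul_apply, smul_eq_mul]
  have h : ∀ {k : ℕ} (f g e : Fin k → ℂ), (∀ i, f i = g i + c * e i) →
      ∑ i, f i = ∑ i, g i + c * ∑ i, e i := fun f g e h => by
    rw [Finset.mul_sum, ← Finset.sum_add_distrib]
    exact Finset.sum_congr rfl fun i _ => h i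
  rw [h _ (fun i => u.1 i * v.2.1 i - u.2.1 i * v.1 i)
      (fun i => u'.1 i * v.2.1 i - u'.2.1 i * v.1 i) fun i => by ring,
    h _ (fun j => u.2.2.1 j * v.2.2.2 j - u.2.2.2 j * v.2.2.1 j)
      (fun j => u'.2.2.1 j * v.2.2.2 j - u'.2.2.2 j * v.2.2.1 j) fun j => by ring]
  ring

/-- `1 ± ½ X'` scale the symplectic form in the same way, as `X'` is in its Lie algebra. -/
lemma sympl_add_half_eq_sub_half {F : Phase n m → ℂ} {x : Phase n m} (hF : AnalyticAt ℂ F x)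
    (a b : Phase n m) :
    sympl (a + (1 / 2 : ℂ) • fderiv ℂ (hamVF F) x a) (b + (1 / 2 : ℂ) • fderiv ℂ (hamVF F) x b) =
      sympl (a - (1 / 2 : ℂ) • fderiv ℂ (hamVF F) x a)
        (b - (1 / 2 : ℂ) • fderiv ℂ (hamVF F) x b) := by
  have hd := hF.fderiv.differentiableAt
  have key : ∀ u v, sympl (fderiv ℂ (hamVF F) x u) v = fderiv ℂ (fderiv ℂ F) x u v := fun u v => by
    rw [fderiv_hamVF hd, ContinuousLinearMap.comp_apply, sympl_symplGrad]
  have hsymm : fderiv ℂ (fderiv ℂ F) x a b = fderiv ℂ (fderiv ℂ F) x b a :=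
    (hF.contDiffAt (n := 2)).isSymmSndFDerivAt (by simp) a b
  simp only [sub_eq_add_neg, ← neg_smul, sympl_add_smul]
  rw [sympl_swap _ a, sympl_swap _ a, sympl_swap _ (fderiv ℂ (hamVF F) x a),
    sympl_swap _ (fderiv ℂ (hamVF F) x a)]
  simp only [sympl_add_smul]
  have h1 := key a b
  have h2 := key b a
  rw [sympl_swap] at h1
  linear_combination h1 - h2 + hsymm

section

variable {s : ℝ} {F : Phase n m → ℂ}

lemma shiftPhase_eq_add (ℓ : Fin n → ℤ) (x : Phase n m) :
    shiftPhase ℓ x = x + (0, angleShift ℓ, 0) := by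
  simp [shiftPhase, Prod.ext_iff]

lemma fderiv_shiftPhase {G : Type*} [NormedAddCommGroup G] [NormedSpace ℂ G] {T : Phase n m → G}
    (hper : ∀ x ∈ cylinder n m s, ∀ ℓ, T (shiftPhase ℓ x) = T x) {x : Phase n m}
    (hx : x ∈ cylinder n m s) (ℓ : Fin n → ℤ) :
    fderiv ℂ T (shiftPhase ℓ x) = fderiv ℂ T x := by
  have h : (fun y => T (y + (0, angleShift ℓ, 0))) =ᶠ[𝓝 x] T := by
    filter_upwards [(isOpen_cylinder n m s).mem_nhds hx] with y hy
    rw [← shiftPhase_eq_add, hper y hy]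
  rw [← h.fderiv_eq, fderiv_comp_add_right, shiftPhase_eq_add]

lemma hamVF_shiftPhase (hper : ∀ x ∈ cylinder n m s, ∀ ℓ, F (shiftPhase ℓ x) = F x)
    {x : Phase n m} (hx : x ∈ cylinder n m s) (ℓ : Fin n → ℤ) :
    hamVF F (shiftPhase ℓ x) = hamVF F x := by
  rw [hamVF_eq_symplGrad, hamVF_eq_symplGrad, fderiv_shiftPhase hper hx]

variable {U W : Set (Phase n m)} {δ : ℝ}

lemma midpointMap_eq (hδ : 0 ≤ δ) (hball : ∀ x ∈ U, closedBall x δ ⊆ W)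
    (hX : ∀ y ∈ W, ‖hamVF F y‖ ≤ δ)
    (hLip : ∀ y ∈ W, ∀ y' ∈ W, ‖hamVF F y - hamVF F y'‖ ≤ ‖y - y'‖) {x : Phase n m} (hx : x ∈ U) :
    midpointMap (hamVF F) W x = halfInverse (hamVF F) W x +
      (1 / 2 : ℂ) • hamVF F (halfInverse (hamVF F) W x) := by
  obtain ⟨-, h2⟩ := halfInverse_spec hδ hball hX hLip hx
  rw [midpointMap, sub_eq_iff_eq_add]
  conv_lhs => rw [two_smul]
  nth_rw 2 [h2]
  abel

lemma norm_midpointMap_sub_le (hδ : 0 ≤ δ) (hball : ∀ x ∈ U, closedBall x δ ⊆ W)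
    (hX : ∀ y ∈ W, ‖hamVF F y‖ ≤ δ)
    (hLip : ∀ y ∈ W, ∀ y' ∈ W, ‖hamVF F y - hamVF F y'‖ ≤ ‖y - y'‖) {x : Phase n m} (hx : x ∈ U) :
    ‖midpointMap (hamVF F) W x - x‖ ≤ δ := by
  obtain ⟨h1, h2⟩ := halfInverse_spec hδ hball hX hLip hx
  have h3 := midpointMap_eq hδ hball hX hLip hx
  set y := halfInverse (hamVF F) W x
  have : midpointMap (hamVF F) W x - x = hamVF F y := by
    rw [h3]
    have : x = y - (1 / 2 : ℂ) • hamVF F y := eq_sub_of_add_eq h2.symm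
    calc _ = y + (1 / 2 : ℂ) • hamVF F y - (y - (1 / 2 : ℂ) • hamVF F y) := by rw [← this]
      _ = (1 / 2 + 1 / 2 : ℂ) • hamVF F y := by rw [add_smul]; abel
      _ = _ := by norm_num
  rw [this]
  exact hX y h1

/-- The midpoint map of a small periodic real Hamiltonian vector field is a canonical change of
coordinates. -/
theorem isCanonicalChange_midpointMap (hF : AnalyticOnNhd ℂ F (cylinder n m s))
    (hper : ∀ x ∈ cylinder n m s, ∀ ℓ, F (shiftPhase ℓ x) = F x) (hreal : RealOn s F)
    (hU : IsOpen U) (hW : IsOpen W) (hWs : W ⊆ cylinder n m s)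
    (hWshift : ∀ x ∈ W, ∀ ℓ, shiftPhase ℓ x ∈ W)
    (hδ : 0 ≤ δ) (hball : ∀ x ∈ U, closedBall x δ ⊆ W)
    (hX : ∀ y ∈ W, ‖hamVF F y‖ ≤ δ)
    (hLip : ∀ y ∈ W, ∀ y' ∈ W, ‖hamVF F y - hamVF F y'‖ ≤ ‖y - y'‖)
    (hd1 : ∀ y ∈ W, ‖fderiv ℂ (hamVF F) y‖ ≤ 1) :
    IsCanonicalChange (midpointMap (hamVF F) W) U W := by
  have hXan := analyticOnNhd_hamVF hF
  have hdiff : DifferentiableOn ℂ (hamVF F) W := (hXan.mono hWs).differentiableOn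
  have hderiv : ∀ x ∈ U, ∃ L : Phase n m →L[ℂ] Phase n m,
      HasFDerivAt (midpointMap (hamVF F) W) ((2 : ℂ) • L - ContinuousLinearMap.id ℂ _) x ∧
      ∀ u, L u - (1 / 2 : ℂ) • fderiv ℂ (hamVF F) (halfInverse (hamVF F) W x) (L u) = u := by
    intro x hx
    obtain ⟨L, hL, hL'⟩ := exists_hasFDerivAt_halfInverse hU hW hδ hball hX hLip hdiff hd1 hx
    exact ⟨L, (hL.const_smul (2 : ℂ)).sub (hasFDerivAt_id x), hL'⟩
  refine ⟨?_, fun x hx => ?_, fun x hx x' hx' h => ?_, fun x hx ℓ => ?_, fun x hx hxr => ?_,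
    fun x hx u v => ?_⟩
  · have hco : ∀ α, AnalyticOnNhd ℂ (fun x => coord α (midpointMap (hamVF F) W x)) U := fun α => by
      refine analyticOnNhd_of_differentiableOn hU fun x hx => ?_
      obtain ⟨L, hL, -⟩ := hderiv x hx
      have h0 := hL.differentiableAt
      have h2 := differentiableAt_snd.comp x h0
      have h3 := differentiableAt_snd.comp x h2
      refine DifferentiableAt.differentiableWithinAt ?_
      rcases α with i | i | j | j
      · exact differentiableAt_pi.1 (differentiableAt_fst.comp x h0) i
      · exact differentiableAt_pi.1 (differentiableAt_fst.comp x h2) i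
      · exact differentiableAt_pi.1 (differentiableAt_fst.comp x h3) j
      · exact differentiableAt_pi.1 (differentiableAt_snd.comp x h3) j
    have := Finset.univ.analyticOnNhd_fun_sum fun α _ =>
      (hco α).smul (analyticOnNhd_const (v := dir α) (𝕜 := ℂ))
    refine this.congr hU fun x _ => ?_
    exact sum_coord_smul_dir _
  · refine hball x hx ?_
    rw [mem_closedBall, dist_eq_norm]
    exact norm_midpointMap_sub_le hδ hball hX hLip hx
  · obtain ⟨h1, h2⟩ := halfInverse_spec hδ hball hX hLip hx
    obtain ⟨h1', h2'⟩ := halfInverse_spec hδ hball hX hLip hx'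
    rw [midpointMap_eq hδ hball hX hLip hx, midpointMap_eq hδ hball hX hLip hx'] at h
    set y := halfInverse (hamVF F) W x
    set y' := halfInverse (hamVF F) W x'
    have h3 : y - y' = (1 / 2 : ℂ) • (hamVF F y' - hamVF F y) := by
      rw [smul_sub, sub_eq_sub_iff_add_eq_add, h, add_comm]
    have h4 := hLip y' h1' y h1
    have h5 : ‖y - y'‖ = 1 / 2 * ‖hamVF F y' - hamVF F y‖ := by
      rw [h3, norm_smul]; norm_num
    have h6 : y = y' := by
      rw [norm_sub_rev y'] at h4
      exact sub_eq_zero.1 (norm_eq_zero.1 (by linarith [norm_nonneg (y - y')]))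
    rw [h6] at h2
    exact add_right_cancel (h2.symm.trans h2')
  · obtain ⟨h1, h2⟩ := halfInverse_spec hδ hball hX hLip hx
    have h3 : halfInverse (hamVF F) W (shiftPhase ℓ x) =
        shiftPhase ℓ (halfInverse (hamVF F) W x) := by
      refine halfInverse_eq hLip (hWshift _ h1 ℓ) ?_
      rw [hamVF_shiftPhase hper (hWs h1), shiftPhase_eq_add, shiftPhase_eq_add]
      conv_lhs => rw [h2]
      abel
    have h4 : midpointMap (hamVF F) W (shiftPhase ℓ x) =
        shiftPhase ℓ (midpointMap (hamVF F) W x) := by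
      rw [midpointMap, midpointMap, h3, shiftPhase_eq_add, shiftPhase_eq_add, shiftPhase_eq_add,
        smul_add, two_smul ℂ ((0, angleShift ℓ, 0) : Phase n m)]
      abel
    exact h4
  · obtain ⟨y, hy, hyr, he⟩ := exists_eq_add_half_smul (hball x hx) hX hLip
      (isClosed_realPoints n m) hxr hδ fun y hy hyr => by
        have := hamVF_mem_realPoints hreal (hWs hy) (hF y (hWs hy)).differentiableAt hyr
        simpa using add_mem_realPoints hxr (real_smul_mem_realPoints (1 / 2) this)
    have h1 := halfInverse_eq hLip (hball x hx hy) he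
    have h2 : midpointMap (hamVF F) W x = ((2 : ℝ) : ℂ) • y + ((-1 : ℝ) : ℂ) • x := by
      rw [midpointMap, h1]; simp [sub_eq_add_neg]
    rw [h2]
    exact add_mem_realPoints (real_smul_mem_realPoints _ hyr) (real_smul_mem_realPoints _ hxr)
  · obtain ⟨L, hL, hL'⟩ := hderiv x hx
    obtain ⟨h1, -⟩ := halfInverse_spec hδ hball hX hLip hx
    have key := sympl_add_half_eq_sub_half (hF _ (hWs h1)) (L u) (L v)
    rw [hL', hL'] at key
    rw [← key, hL.fderiv]
    have : ∀ u, ((2 : ℂ) • L - ContinuousLinearMap.id ℂ (Phase n m)) u = L u + (1 / 2 : ℂ) •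
        fderiv ℂ (hamVF F) (halfInverse (hamVF F) W x) (L u) := fun u => by
      have h := hL' u
      rw [sub_eq_iff_eq_add] at h
      have h' : (1 / 2 : ℂ) • fderiv ℂ (hamVF F) (halfInverse (hamVF F) W x) (L u) = L u - u :=
        eq_sub_of_add_eq' h.symm
      rw [h']
      simp only [_root_.sub_apply, _root_.smul_apply, ContinuousLinearMap.id_apply, two_smul]
      abel
    rw [this, this]

end

/-- A canonical change of coordinates remains one into a larger target. -/
lemma IsCanonicalChange.mono_right {Φ : Phase n m → Phase n m} {U V V' : Set (Phase n m)}
    (h : IsCanonicalChange Φ U V) (hV : V ⊆ V') : IsCanonicalChange Φ U V' :=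
  ⟨h.analytic, h.mapsTo.mono_right hV, h.injOn, h.equivariant, h.real, h.symplectic⟩

lemma isCanonicalChange_id {U V : Set (Phase n m)} (hV : U ⊆ V) : IsCanonicalChange id U V :=
  ⟨analyticOnNhd_id, fun _ hx => hV hx, injOn_id U, fun _ _ _ => rfl, fun _ _ h => h,
    fun _ _ _ _ => by simp [fderiv_id]⟩

/-! ### Expansion of the rescaled Hamiltonian -/

/-- The anisotropic dilation `(μ² I, φ, μ z, μ w)`, for which the monomials are homogeneous of degree
`wdeg`. -/
def dilate (μ : ℂ) (x : Phase n m) : Phase n m :=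
  (μ ^ 2 • x.1, x.2.1, μ • x.2.2.1, μ • x.2.2.2)

lemma rescaled_eq_dilate (H : Phase n m → ℂ) (η : ℝ) (x : Phase n m) :
    rescaled H η x = ((η : ℂ) ^ 2)⁻¹ * H (dilate η x) := rfl

lemma mono_dilate (p : MIdx n m) (μ : ℂ) (x : Phase n m) :
    mono p (dilate μ x) = μ ^ wdeg p * mono p x := by
  simp only [mono, dilate, Pi.smul_apply, smul_eq_mul, mul_pow, Finset.prod_mul_distrib,
    Finset.prod_pow_eq_pow_sum, wdeg, pow_add, ← pow_mul, Finset.mul_sum]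
  ring

lemma linearPart_dilate (ω : Fin n → ℝ) (Ω : Fin m → ℝ) (μ : ℂ) (x : Phase n m) :
    linearPart ω Ω (dilate μ x) = μ ^ 2 * linearPart ω Ω x := by
  simp only [linearPart, dilate, Pi.smul_apply, smul_eq_mul, mul_add, Finset.mul_sum]
  refine congrArg₂ (· + ·) (Finset.sum_congr rfl fun i _ => by ring)
    (Finset.sum_congr rfl fun j _ => by ring)

lemma dilate_mem_domain {r s ρ r' s' ρ' : ℝ} {μ : ℂ}
    (h1 : ‖μ‖ ^ 2 * r ≤ r') (h2 : s ≤ s') (h3 : ‖μ‖ * ρ ≤ ρ') (hr : 0 < r) (hρ : 0 < ρ)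
    (hr'' : 0 < r') (hρ'' : 0 < ρ') {x : Phase n m} (hx : x ∈ domain n m r s ρ) :
    dilate μ x ∈ domain n m r' s' ρ' := by
  obtain ⟨hI, hφ, hz⟩ := hx
  have aux : ∀ {c a b S : ℝ}, 0 ≤ c → 0 < a → 0 < b → c * a ≤ b → S < a ^ 2 →
      c ^ 2 * S < b ^ 2 := by
    intro c a b S hc ha hb hcab hS
    rcases hc.eq_or_lt with rfl | hc
    · simpa using pow_pos hb 2
    · calc c ^ 2 * S < c ^ 2 * a ^ 2 := by gcongr
        _ = (c * a) ^ 2 := by ring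
        _ ≤ b ^ 2 := by gcongr
  refine ⟨?_, strip_mono h2 hφ, ?_⟩
  · have := aux (sq_nonneg ‖μ‖) hr hr'' h1 hI
    simpa [dilate, mul_pow, ← Finset.mul_sum] using this
  · have := aux (norm_nonneg μ) hρ hρ'' h3 hz
    simpa [dilate, mul_pow, ← Finset.mul_sum, ← mul_add] using this

/-- Regrouping of a series over the multi-indices by weighted degree. -/
lemma hasSum_sum_weightSet {f : MIdx n m → ℂ} {a : ℂ} (h : HasSum f a) :
    HasSum (fun k => ∑ p ∈ weightSet n m k, f p) a := by
  refine ((Equiv.sigmaFiberEquiv (wdeg (n := n) (m := m))).hasSum_iff.2 h).sigma fun k => ?_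
  let _ : Fintype {p : MIdx n m // wdeg p = k} :=
    Fintype.subtype (weightSet n m k) fun _ => mem_weightSet
  have := hasSum_fintype fun p : {p : MIdx n m // wdeg p = k} => f p
  rw [Finset.sum_subtype (p := fun p => wdeg p = k) (weightSet n m k) (fun _ => mem_weightSet) f]
  exact this

lemma inv_factorial_mul_iteratedDeriv_of_hasSum {g : ℂ → ℂ} {a : ℕ → ℂ} {R : ℝ} (hR : 0 < R)
    (h : ∀ z ∈ ball (0 : ℂ) R, HasSum (fun k => z ^ k * a k) (g z)) (k : ℕ) :
    (k.factorial : ℂ)⁻¹ * iteratedDeriv k g 0 = a k := by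
  have h1 : HasFPowerSeriesAt g (FormalMultilinearSeries.ofScalars ℂ a) 0 := by
    rw [hasFPowerSeriesAt_iff]
    filter_upwards [ball_mem_nhds (0 : ℂ) hR] with z hz
    simpa [FormalMultilinearSeries.coeff_ofScalars] using h z hz
  obtain ⟨r, hr⟩ := h1
  have h2 := hr.factorial_smul 1 k
  rw [← iteratedDeriv_eq_iteratedFDeriv] at h2
  rw [← h2]
  have : (k.factorial : ℂ) ≠ 0 := by exact_mod_cast k.factorial_ne_zero
  simp [FormalMultilinearSeries.ofScalars, nsmul_eq_mul, this]

section Rescaled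

variable {ω : Fin n → ℝ} {Ω : Fin m → ℝ} {rStar sStar ρStar : ℝ} {H : Phase n m → ℂ}
  {R : MIdx n m → (Fin n → ℂ) → ℂ}

lemma weightPart_higherCoeff (k : ℕ) (x : Phase n m) :
    weightPart k (higherCoeff R) x = if 3 ≤ k then weightPart k R x else 0 := by
  rw [weightPart]
  split_ifs with h
  · exact Finset.sum_congr rfl fun p hp => by rw [higherCoeff, if_pos (by rwa [mem_weightSet.1 hp])]
  · exact Finset.sum_eq_zero fun p hp => by
      rw [higherCoeff, if_neg (by rwa [mem_weightSet.1 hp]), zero_mul]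

lemma analyticAt_dilate (x : Phase n m) (μ : ℂ) : AnalyticAt ℂ (fun μ : ℂ => dilate μ x) μ := by
  unfold dilate
  fun_prop

/-- The weighted Taylor expansion of the rescaled Hamiltonian. -/
theorem exists_norm_rescaled_sub_le (hH : IsEllipticHamiltonian ω Ω rStar sStar ρStar H R)
    {r s ρ η₀ : ℝ} (hr : 0 < r) (hρ : 0 < ρ) (hη₀ : 0 < η₀) {r' s' ρ' : ℝ} (hr' : 0 < r')
    (hrr : r' < rStar) (hss : s' < sStar) (hρ' : 0 < ρ') (hρρ : ρ' < ρStar)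
    (h1 : η₀ ^ 2 * r ≤ r') (h2 : s ≤ s') (h3 : η₀ * ρ ≤ ρ') :
    ∃ C, ∀ η : ℝ, 0 < η → η ≤ η₀ / 4 → ∀ x ∈ domain n m r s ρ,
      ‖rescaled H η x - (linearPart ω Ω x + η * weightPart 3 R x + η ^ 2 * weightPart 4 R x +
        η ^ 3 * weightPart 5 R x)‖ ≤ C * η ^ 4 := by
  have han : AnalyticOnNhd ℂ (nonlinearPart ω Ω H) (domain n m rStar sStar ρStar) :=
    hH.analytic.sub (analyticOnNhd_linearPart ω Ω _)
  obtain ⟨M, hM⟩ := exists_bound_of_periodic hr'.le hrr hss hρ'.le hρρ han.continuousOn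
    fun x hx ℓ => congrArg₂ (· - ·) (hH.periodic x hx ℓ) rfl
  have hsub : domain n m r' s' ρ' ⊆ domain n m rStar sStar ρStar :=
    domain_mono hr'.le hrr.le hss.le hρ'.le hρρ.le
  refine ⟨2 * M * (2 / η₀) ^ 6, fun η hη hη4 x hx => ?_⟩
  have hmem : ∀ μ ∈ ball (0 : ℂ) η₀, dilate μ x ∈ domain n m r' s' ρ' := fun μ hμ => by
    have hμ' : ‖μ‖ ≤ η₀ := by simpa using (mem_ball_zero_iff.1 hμ).le
    refine dilate_mem_domain (le_trans ?_ h1) h2 (le_trans ?_ h3) hr hρ hr' hρ' hx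
    · gcongr
    · gcongr
  set g : ℂ → ℂ := fun μ => nonlinearPart ω Ω H (dilate μ x) with hg
  have hgd : DifferentiableOn ℂ g (ball 0 η₀) := fun μ hμ => by
    have hd : DifferentiableAt ℂ (nonlinearPart ω Ω H) (dilate μ x) :=
      (han _ (hsub (hmem μ hμ))).differentiableAt
    exact (hd.comp μ (analyticAt_dilate x μ).differentiableAt).differentiableWithinAt
  have hcoef : ∀ k, (k.factorial : ℂ)⁻¹ * iteratedDeriv k g 0 =
      weightPart k (higherCoeff R) x := by
    refine inv_factorial_mul_iteratedDeriv_of_hasSum hη₀ fun μ hμ => ?_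
    refine (hasSum_sum_weightSet (hH.hasSum_nonlinearPart (hsub (hmem μ hμ)))).congr_fun fun k => ?_
    rw [weightPart, Finset.mul_sum]
    refine Finset.sum_congr rfl fun p hp => ?_
    rw [mono_dilate, mem_weightSet.1 hp]
    simp only [dilate]
    ring
  have hT := norm_sub_taylor_le hη₀ hgd (fun μ hμ => hM _ (hmem μ hμ)) 6 (z := (η : ℂ))
    (by rwa [Complex.norm_real, Real.norm_of_nonneg hη.le])
  have hsum : ∑ k ∈ Finset.range 6, (k.factorial : ℂ)⁻¹ * (η : ℂ) ^ k * iteratedDeriv k g 0 =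
      (η : ℂ) ^ 2 * (η * weightPart 3 R x + η ^ 2 * weightPart 4 R x +
        η ^ 3 * weightPart 5 R x) := by
    have : ∀ k, (k.factorial : ℂ)⁻¹ * (η : ℂ) ^ k * iteratedDeriv k g 0 =
        (η : ℂ) ^ k * if 3 ≤ k then weightPart k R x else 0 := fun k => by
      rw [← weightPart_higherCoeff, ← hcoef]; ring
    simp only [this, Finset.sum_range_succ, Finset.sum_range_zero]
    norm_num
    ring
  have hηc : (η : ℂ) ≠ 0 := by exact_mod_cast hη.ne'
  have heq : rescaled H η x - (linearPart ω Ω x + η * weightPart 3 R x + η ^ 2 * weightPart 4 R x +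
      η ^ 3 * weightPart 5 R x) = ((η : ℂ) ^ 2)⁻¹ * (g η - (η : ℂ) ^ 2 * (η * weightPart 3 R x +
        η ^ 2 * weightPart 4 R x + η ^ 3 * weightPart 5 R x)) := by
    rw [rescaled_eq_dilate, hg]
    simp only [nonlinearPart, linearPart_dilate]
    field_simp
    ring
  rw [heq, norm_mul, norm_inv, norm_pow, Complex.norm_real, Real.norm_of_nonneg hη.le, ← hsum,
    inv_mul_le_iff₀ (by positivity)]
  refine hT.trans (le_of_eq ?_)
  rw [Complex.norm_real, Real.norm_of_nonneg hη.le]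
  ring

end Rescaled

/-! ### Taylor expansion along a line -/

section Line

variable {U : Set (Phase n m)} {T : Phase n m → ℂ} {M δ V : ℝ} {y v : Phase n m} {t : ℂ}

lemma norm_sub_taylor_line_le (hU : IsOpen U) (hT : DifferentiableOn ℂ T U)
    (hM : ∀ x ∈ U, ‖T x‖ ≤ M) (hδ : 0 < δ) (hball : closedBall y δ ⊆ U) (hV : 0 < V)
    (hv : ‖v‖ ≤ V) (ht : ‖t‖ ≤ δ / V / 4) (N : ℕ) :
    ‖T (y + t • v) - ∑ k ∈ Finset.range N, (k.factorial : ℂ)⁻¹ * t ^ k *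
      iteratedFDeriv ℂ k T y fun _ => v‖ ≤ 2 * M * (2 * ‖t‖ / (δ / V)) ^ N := by
  have hmem : ∀ z ∈ ball (0 : ℂ) (δ / V), y + z • v ∈ U := fun z hz => by
    refine hball ?_
    rw [mem_closedBall, dist_eq_norm, add_sub_cancel_left, norm_smul]
    have hz' : ‖z‖ ≤ δ / V := by simpa using (mem_ball_zero_iff.1 hz).le
    calc ‖z‖ * ‖v‖ ≤ δ / V * V := by gcongr
      _ = δ := by field_simp
  have hg : DifferentiableOn ℂ (fun z : ℂ => T (y + z • v)) (ball 0 (δ / V)) := fun z hz =>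
    ((hT.differentiableAt (hU.mem_nhds (hmem z hz))).comp z
      (by fun_prop : DifferentiableAt ℂ (fun z : ℂ => y + z • v) z)).differentiableWithinAt
  have h := norm_sub_taylor_le (by positivity) hg (fun z hz => hM _ (hmem z hz)) N ht
  have hk : ∀ k, iteratedDeriv k (fun z : ℂ => T (y + z • v)) 0 =
      iteratedFDeriv ℂ k T y fun _ => v := fun k => by
    have h0 : y + (0 : ℂ) • v ∈ U := hmem 0 (mem_ball_self (by positivity))
    rw [iteratedDeriv_comp_line hU k (contDiffOn_nat_of_differentiableOn hU k hT) y v 0 h0]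
    simp
  simpa only [hk] using h

end Line

/-! ### The remainder of the transformed Hamiltonian -/

/-- Along a line the quadratic integrable part is a polynomial of degree two, so that its symmetric
difference is given by the derivative at the midpoint. -/
lemma linearPart_add_half_sub (ω : Fin n → ℝ) (Ω : Fin m → ℝ) (y u : Phase n m) :
    linearPart ω Ω (y + (1 / 2 : ℂ) • u) - linearPart ω Ω (y - (1 / 2 : ℂ) • u) =
      fderiv ℂ (linearPart ω Ω) y u := by
  set A : ℂ := ∑ i, (ω i : ℂ) * u.1 i +
    ∑ j, (Ω j : ℂ) * (y.2.2.1 j * u.2.2.2 j + y.2.2.2 j * u.2.2.1 j) with hA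
  set B : ℂ := ∑ j, (Ω j : ℂ) * (u.2.2.1 j * u.2.2.2 j) with hB
  have hline : ∀ t : ℂ, linearPart ω Ω (y + t • u) = linearPart ω Ω y + t * A + t ^ 2 * B := by
    intro t
    simp only [linearPart, hA, hB, Prod.fst_add, Prod.snd_add, Prod.smul_fst, Prod.smul_snd,
      Pi.add_apply, Pi.smul_apply, smul_eq_mul, mul_add, Finset.mul_sum]
    have e1 : ∑ i, ((ω i : ℂ) * y.1 i + ω i * (t * u.1 i)) =
        ∑ i, (ω i : ℂ) * y.1 i + ∑ i, t * (ω i * u.1 i) := by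
      rw [← Finset.sum_add_distrib]; exact Finset.sum_congr rfl fun i _ => by ring
    have e2 : ∑ j, (((Ω j : ℂ) * y.2.2.1 j + Ω j * (t * u.2.2.1 j)) * y.2.2.2 j +
        ((Ω j : ℂ) * y.2.2.1 j + Ω j * (t * u.2.2.1 j)) * (t * u.2.2.2 j)) =
        ∑ j, (Ω j : ℂ) * y.2.2.1 j * y.2.2.2 j + ∑ j, (t * ((Ω j : ℂ) * (y.2.2.1 j * u.2.2.2 j)) +
          t * (Ω j * (y.2.2.2 j * u.2.2.1 j))) +
          ∑ j, t ^ 2 * ((Ω j : ℂ) * (u.2.2.1 j * u.2.2.2 j)) := by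
      rw [← Finset.sum_add_distrib, ← Finset.sum_add_distrib]
      exact Finset.sum_congr rfl fun j _ => by ring
    rw [e1, e2]
    ring
  have hd : HasFDerivAt (linearPart ω Ω) (fderiv ℂ (linearPart ω Ω) y) (y + (0 : ℂ) • u) := by
    have := (analyticOnNhd_linearPart (n := n) (m := m) ω Ω univ y
      (mem_univ y)).differentiableAt.hasFDerivAt
    simpa using this
  have h2 : HasDerivAt (fun t : ℂ => y + t • u) u 0 := by
    simpa using ((hasDerivAt_id (0 : ℂ)).smul_const u).const_add y
  have h3 : HasDerivAt (fun t : ℂ => linearPart ω Ω y + t * A + t ^ 2 * B) A 0 := by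
    have := (((hasDerivAt_id (0 : ℂ)).mul_const A).const_add (linearPart ω Ω y)).fun_add
      (((hasDerivAt_id (0 : ℂ)).fun_pow 2).mul_const B)
    simpa using this
  have h5 : HasDerivAt (linearPart ω Ω ∘ fun t : ℂ => y + t • u)
      (fderiv ℂ (linearPart ω Ω) y u) 0 := hd.comp_hasDerivAt (0 : ℂ) h2
  have h4 : fderiv ℂ (linearPart ω Ω) y u = A :=
    h5.unique (h3.congr_of_eventuallyEq (Eventually.of_forall fun t => hline t))
  rw [sub_eq_add_neg y, ← neg_smul, hline, hline, h4]
  ring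

/-- The terms of order less than four cancel in the transformed Hamiltonian. Here `l`, `p₃`, `q₃`,
`p₄`, `q₄` are first derivatives and `P`, `Q` second derivatives at the midpoint, `k`, `g` are values
at the midpoint and `a`, `b` values at the two end points. -/
lemma transform_identity {E : Type*} [NormedAddCommGroup E] [NormedSpace ℂ E]
    {l p₃ q₃ p₄ q₄ : E →L[ℂ] ℂ} {P Q : E →L[ℂ] E →L[ℂ] ℂ} {X₃ X₄ X₅ : E}
    {a₂ a₃ a₄ a₅ b₂ b₃ b₄ b₅ k₃ k₄ k₅ g₃ g₄ g₅ η : ℂ}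
    (h2 : a₂ - b₂ = l (η • (X₃ + η • (X₄ + η • X₅)))) (h3 : l X₃ + k₃ = g₃)
    (h4 : l X₄ + k₄ + 1 / 2 * (p₃ X₃ + q₃ X₃) = g₄)
    (h5 : l X₅ + (k₅ + 1 / 2 * (p₄ X₃ + q₄ X₃) + 1 / 2 * (p₃ X₄ + q₃ X₄) +
      1 / 8 * (P X₃ X₃ - Q X₃ X₃)) = g₅) :
    (a₂ + η * a₃ + η ^ 2 * a₄ + η ^ 3 * a₅) - (b₂ + η * b₃ + η ^ 2 * b₄ + η ^ 3 * b₅) =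
      η * ((a₃ - (k₃ + η / 2 * p₃ (X₃ + η • (X₄ + η • X₅)) +
        1 / 2 * (η / 2) ^ 2 * P (X₃ + η • (X₄ + η • X₅)) (X₃ + η • (X₄ + η • X₅)))) -
        (b₃ - (g₃ + -(η / 2) * q₃ (X₃ + η • (X₄ + η • X₅)) +
        1 / 2 * (-(η / 2)) ^ 2 * Q (X₃ + η • (X₄ + η • X₅)) (X₃ + η • (X₄ + η • X₅))))) +
      η ^ 2 * ((a₄ - (k₄ + η / 2 * p₄ (X₃ + η • (X₄ + η • X₅)))) -
        (b₄ - (g₄ + -(η / 2) * q₄ (X₃ + η • (X₄ + η • X₅))))) +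
      η ^ 3 * ((a₅ - k₅) - (b₅ - g₅)) +
      η ^ 4 * (1 / 2 * (p₃ X₅ + q₃ X₅) + 1 / 2 * (p₄ (X₄ + η • X₅) + q₄ (X₄ + η • X₅)) +
        1 / 8 * ((P X₃ (X₄ + η • X₅) + P (X₄ + η • X₅) (X₃ + η • (X₄ + η • X₅))) -
          (Q X₃ (X₄ + η • X₅) + Q (X₄ + η • X₅) (X₃ + η • (X₄ + η • X₅))))) := by
  simp only [map_add, map_smul, _root_.add_apply, _root_.smul_apply, smul_eq_mul] at h2 ⊢
  linear_combination h2 + η * h3 + η ^ 2 * h4 + η ^ 3 * h5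

/-- A weighted homogeneous function and its derivatives are bounded on the domains with a smaller
width of the strip. -/
lemma Pol.exists_bound {s : ℝ} {d : ℤ} {T : Phase n m → ℂ} (h : Pol s d T) {r' s' ρ' : ℝ}
    (hr' : 0 ≤ r') (hs : s' < s) (hρ' : 0 ≤ ρ') :
    ∃ M, ∀ x ∈ domain n m r' s' ρ', ‖T x‖ ≤ M ∧ ‖fderiv ℂ T x‖ ≤ M ∧
      ‖fderiv ℂ (fderiv ℂ T) x‖ ≤ M ∧ ‖hamVF T x‖ ≤ M := by
  have hsub : domain n m (r' + 1) s (ρ' + 1) ⊆ cylinder n m s := domain_subset_cylinder _ _ _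
  have an := h.analyticOnNhd.mono hsub
  have anH := analyticOnNhd_hamVF an
  have per : ∀ x ∈ cylinder n m s, ∀ ℓ, T (shiftPhase ℓ x) = T x := fun x hx ℓ =>
    h.apply_shiftPhase hx ℓ
  have per1 : ∀ x ∈ cylinder n m s, ∀ ℓ, fderiv ℂ T (shiftPhase ℓ x) = fderiv ℂ T x :=
    fun x hx ℓ => fderiv_shiftPhase per hx ℓ
  have perH : ∀ x ∈ cylinder n m s, ∀ ℓ, hamVF T (shiftPhase ℓ x) = hamVF T x :=
    fun x hx ℓ => hamVF_shiftPhase per hx ℓ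
  have hr1 : r' < r' + 1 := lt_add_one _
  have hρ1 : ρ' < ρ' + 1 := lt_add_one _
  obtain ⟨M0, h0⟩ := exists_bound_of_periodic hr' hr1 hs hρ' hρ1 an.continuousOn
    fun x hx ℓ => per x (hsub hx) ℓ
  obtain ⟨M1, h1⟩ := exists_bound_of_periodic hr' hr1 hs hρ' hρ1 an.fderiv.continuousOn
    fun x hx ℓ => per1 x (hsub hx) ℓ
  obtain ⟨M2, h2⟩ := exists_bound_of_periodic hr' hr1 hs hρ' hρ1 an.fderiv.fderiv.continuousOn
    fun x hx ℓ => fderiv_shiftPhase per1 (hsub hx) ℓ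
  obtain ⟨M3, h3⟩ := exists_bound_of_periodic hr' hr1 hs hρ' hρ1 anH.continuousOn
    fun x hx ℓ => perH x (hsub hx) ℓ
  refine ⟨max M0 (max M1 (max M2 M3)), fun x hx => ?_⟩
  simp only [le_max_iff]
  have := h0 x hx
  have := h1 x hx
  have := h2 x hx
  have := h3 x hx
  tauto

/-- The uniform version of the previous bound for a family. -/
lemma exists_bound_of_pol {s : ℝ} {T : ℕ → Phase n m → ℂ} (h : ∀ d : ℕ, 3 ≤ d → Pol s d (T d))
    {r' s' ρ' : ℝ} (hr' : 0 ≤ r') (hs : s' < s) (hρ' : 0 ≤ ρ') :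
    ∃ M, ∀ d ∈ Finset.Icc (3 : ℕ) 5, ∀ x ∈ domain n m r' s' ρ', ‖T d x‖ ≤ M ∧ ‖fderiv ℂ (T d) x‖ ≤ M ∧
      ‖fderiv ℂ (fderiv ℂ (T d)) x‖ ≤ M ∧ ‖hamVF (T d) x‖ ≤ M := by
  choose! M hM using fun d hd => (h d hd).exists_bound hr' hs hρ'
  obtain ⟨B, hB⟩ := ((Finset.Icc 3 5).image M).bddAbove
  refine ⟨B, fun d hd x hx => ?_⟩
  have hle : M d ≤ B := hB (by exact_mod_cast Finset.mem_image_of_mem M hd)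
  obtain ⟨h0, h1, h2, h3⟩ := hM d (Finset.mem_Icc.1 hd).1 x hx
  exact ⟨h0.trans hle, h1.trans hle, h2.trans hle, h3.trans hle⟩

/-- The generating Hamiltonian `η F₃ + η² F₄ + η³ F₅`. -/
def generator (F : ℕ → Phase n m → ℂ) (η : ℝ) (x : Phase n m) : ℂ :=
  η * F 3 x + η ^ 2 * F 4 x + η ^ 3 * F 5 x

section Transform

variable {ω : Fin n → ℝ} {Ω : Fin m → ℝ} {s : ℝ} {K G F : ℕ → Phase n m → ℂ}

lemma hamVF_generator (hF : ∀ d : ℕ, 3 ≤ d → Pol s d (F d)) (η : ℝ) {x : Phase n m}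
    (hx : x ∈ cylinder n m s) : hamVF (generator F η) x =
      (η : ℂ) • (hamVF (F 3) x + (η : ℂ) • (hamVF (F 4) x + (η : ℂ) • hamVF (F 5) x)) := by
  have d3 := (hF 3 (by norm_num)).differentiableAt hx
  have d4 := (hF 4 (by norm_num)).differentiableAt hx
  have d5 := (hF 5 (by norm_num)).differentiableAt hx
  have : generator F η = fun x => (η * F 3 x + η ^ 2 * F 4 x) + η ^ 3 * F 5 x := rfl
  rw [this, hamVF_add ((d3.const_mul _).fun_add (d4.const_mul _)) (d5.const_mul _),
    hamVF_add (d3.const_mul _) (d4.const_mul _), hamVF_const_mul d3, hamVF_const_mul d4,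
    hamVF_const_mul d5]
  simp only [smul_add, smul_smul, add_assoc]
  congr 3 <;> ring_nf

/-- The homological equations up to weighted degree five remove all terms of order less than four
from the difference of the Hamiltonian and its normal form at the two ends of the segment. -/
theorem exists_transform_bound (hK : ∀ d : ℕ, 3 ≤ d → Pol s d (K d)) (hG : ∀ d : ℕ, 3 ≤ d → Pol s d (G d))
    (hF : ∀ d : ℕ, 3 ≤ d → Pol s d (F d))
    (e3 : ∀ x ∈ cylinder n m s, bracket (linearPart ω Ω) (F 3) x + K 3 x = G 3 x)
    (e4 : ∀ x ∈ cylinder n m s, bracket (linearPart ω Ω) (F 4) x +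
      (K 4 x + 1 / 2 * bracket (fun x => K 3 x + G 3 x) (F 3) x) = G 4 x)
    (e5 : ∀ x ∈ cylinder n m s, bracket (linearPart ω Ω) (F 5) x +
      (K 5 x + 1 / 2 * bracket (fun x => K 4 x + G 4 x) (F 3) x +
        1 / 2 * bracket (fun x => K 3 x + G 3 x) (F 4) x +
        1 / 8 * bracketTwo (fun x => K 3 x + (-1) * G 3 x) (F 3) x) = G 5 x)
    {r₁ s₁ ρ₁ δ : ℝ} (hr₁ : 0 ≤ r₁) (hs₁ : s₁ < s) (hρ₁ : 0 ≤ ρ₁) (hδ : 0 < δ)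
    {W : Set (Phase n m)} (hW : ∀ y ∈ W, closedBall y δ ⊆ domain n m r₁ s₁ ρ₁) :
    ∃ C, ∃ η₁ > 0, ∀ η : ℝ, 0 < η → η ≤ η₁ → ∀ y ∈ W, ∀ a b,
      a = y + (1 / 2 : ℂ) • hamVF (generator F η) y →
      b = y - (1 / 2 : ℂ) • hamVF (generator F η) y →
      ‖(linearPart ω Ω a + η * K 3 a + η ^ 2 * K 4 a + η ^ 3 * K 5 a) -
        (linearPart ω Ω b + η * G 3 b + η ^ 2 * G 4 b + η ^ 3 * G 5 b)‖ ≤ C * η ^ 4 := by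
  obtain ⟨MK, hMK⟩ := exists_bound_of_pol hK hr₁ hs₁ hρ₁
  obtain ⟨MG, hMG⟩ := exists_bound_of_pol hG hr₁ hs₁ hρ₁
  obtain ⟨MF, hMF⟩ := exists_bound_of_pol hF hr₁ hs₁ hρ₁
  set M : ℝ := max 1 (max MK (max MG MF)) with hMdef
  have hM1 : 1 ≤ M := le_max_left _ _
  have hMK' : MK ≤ M := (le_max_left _ _).trans (le_max_right _ _)
  have hMG' : MG ≤ M := (le_max_left _ _).trans ((le_max_right _ _).trans (le_max_right _ _))
  have hMF' : MF ≤ M := (le_max_right _ _).trans ((le_max_right _ _).trans (le_max_right _ _))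
  have hM0 : 0 < M := by linarith
  set V : ℝ := 3 * M with hV
  have hV0 : 0 < V := by positivity
  refine ⟨4 * M * (V / δ) ^ 3 + 4 * M * (V / δ) ^ 2 + 4 * M * (V / δ) + (3 * M ^ 2 + 3 * M ^ 3),
    min 1 (δ / V / 2), by positivity, fun η hη hηle y hy a b ha hb => ?_⟩
  have hη1 : η ≤ 1 := hηle.trans (min_le_left _ _)
  have hη2 : η ≤ δ / V / 2 := hηle.trans (min_le_right _ _)
  have hyD : y ∈ domain n m r₁ s₁ ρ₁ := hW y hy (mem_closedBall_self hδ.le)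
  have hyc : y ∈ cylinder n m s :=
    strip_mono hs₁.le (domain_subset_cylinder _ _ _ hyD)
  have hηn : ‖(η : ℂ)‖ = η := by rw [Complex.norm_real, Real.norm_of_nonneg hη.le]
  set X₃ := hamVF (F 3) y with hX3
  set X₄ := hamVF (F 4) y with hX4
  set X₅ := hamVF (F 5) y with hX5
  have bX : ∀ d ∈ Finset.Icc (3 : ℕ) 5, ‖hamVF (F d) y‖ ≤ M := fun d hd =>
    (hMF d hd y hyD).2.2.2.trans hMF'
  have b3 : ‖X₃‖ ≤ M := bX 3 (by decide)
  have b4 : ‖X₄‖ ≤ M := bX 4 (by decide)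
  have b5 : ‖X₅‖ ≤ M := bX 5 (by decide)
  have hsm : ∀ v : Phase n m, ‖(η : ℂ) • v‖ ≤ ‖v‖ := fun v => by
    rw [norm_smul, hηn]
    exact mul_le_of_le_one_left (norm_nonneg _) hη1
  set Z := X₄ + (η : ℂ) • X₅ with hZ
  have bZ : ‖Z‖ ≤ 2 * M := by
    have := (norm_add_le X₄ ((η : ℂ) • X₅)).trans (add_le_add b4 ((hsm _).trans b5))
    linarith
  set Y := X₃ + (η : ℂ) • Z with hY
  have bY : ‖Y‖ ≤ V := by
    have := (norm_add_le X₃ ((η : ℂ) • Z)).trans (add_le_add b3 ((hsm _).trans bZ))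
    linarith
  have hgen : hamVF (generator F η) y = (η : ℂ) • Y := hamVF_generator hF η hyc
  rw [hgen] at ha hb
  have ha' : a = y + ((η : ℂ) / 2) • Y := by rw [ha, smul_smul]; congr 2; ring
  have hb' : b = y + (-((η : ℂ) / 2)) • Y := by
    rw [hb, smul_smul, sub_eq_add_neg, ← neg_smul]; congr 2; ring
  have ht : ‖(η : ℂ) / 2‖ = η / 2 := by rw [norm_div, hηn]; norm_num
  have ht' : ‖-((η : ℂ) / 2)‖ = η / 2 := by rw [norm_neg, ht]
  -- Taylor remainders at both ends
  have taylor : ∀ {T : ℕ → Phase n m → ℂ}, (∀ d : ℕ, 3 ≤ d → Pol s d (T d)) →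
      (∀ d ∈ Finset.Icc (3 : ℕ) 5, ∀ x ∈ domain n m r₁ s₁ ρ₁, ‖T d x‖ ≤ M) → ∀ d ∈ Finset.Icc (3 : ℕ) 5,
      ∀ t : ℂ, ‖t‖ = η / 2 → ∀ N, ‖T d (y + t • Y) - ∑ k ∈ Finset.range N,
        (k.factorial : ℂ)⁻¹ * t ^ k * iteratedFDeriv ℂ k (T d) y fun _ => Y‖ ≤
          2 * M * (η * (V / δ)) ^ N := by
    intro T hT hTM d hd t ht N
    have hsub : domain n m r₁ s₁ ρ₁ ⊆ cylinder n m s := fun x hx =>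
      strip_mono hs₁.le (domain_subset_cylinder _ _ _ hx)
    refine (norm_sub_taylor_line_le (isOpen_domain n m r₁ s₁ ρ₁)
      (((hT d (Finset.mem_Icc.1 hd).1).analyticOnNhd.mono hsub).differentiableOn)
      (hTM d hd) hδ (hW y hy) hV0 bY (by rw [ht]; linarith) N).trans (le_of_eq ?_)
    rw [ht]
    congr 2
    field_simp
  have tK := taylor hK fun d hd x hx => ((hMK d hd x hx).1.trans hMK')
  have tG := taylor hG fun d hd x hx => ((hMG d hd x hx).1.trans hMG')
  have r1 := tK 3 (by decide) _ ht 3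
  have r2 := tG 3 (by decide) _ ht' 3
  have r3 := tK 4 (by decide) _ ht 2
  have r4 := tG 4 (by decide) _ ht' 2
  have r5 := tK 5 (by decide) _ ht 1
  have r6 := tG 5 (by decide) _ ht' 1
  simp only [Finset.sum_range_succ, Finset.sum_range_zero, iteratedFDeriv_zero_apply,
    iteratedFDeriv_one_apply, iteratedFDeriv_two_apply, zero_add, pow_zero, pow_one, mul_one,
    Nat.factorial, Nat.cast_one, inv_one, one_mul, ← ha', ← hb'] at r1 r2 r3 r4 r5 r6
  have hfac : ((Nat.succ 1 * Nat.succ 0 : ℕ) : ℂ)⁻¹ = 1 / 2 := by norm_num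
  rw [hfac] at r1 r2
  -- the equations at the midpoint
  have hdiff : ∀ {T : ℕ → Phase n m → ℂ}, (∀ d : ℕ, 3 ≤ d → Pol s d (T d)) → ∀ d, 3 ≤ d →
      DifferentiableAt ℂ (T d) y := fun hT d hd => (hT d hd).differentiableAt hyc
  have hbr : ∀ d, 3 ≤ d → ∀ F' : Phase n m → ℂ, bracket (fun x => K d x + G d x) F' y =
      fderiv ℂ (K d) y (hamVF F' y) + fderiv ℂ (G d) y (hamVF F' y) := fun d hd F' => by
    rw [bracket, fderiv_fun_add (hdiff hK d hd) (hdiff hG d hd), _root_.add_apply]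
  have hbr2 : bracketTwo (fun x => K 3 x + (-1) * G 3 x) (F 3) y =
      fderiv ℂ (fderiv ℂ (K 3)) y X₃ X₃ - fderiv ℂ (fderiv ℂ (G 3)) y X₃ X₃ := by
    have h1 : fderiv ℂ (fun x => K 3 x + (-1) * G 3 x) =ᶠ[𝓝 y]
        fun x => fderiv ℂ (K 3) x - fderiv ℂ (G 3) x := by
      filter_upwards [(isOpen_cylinder n m s).mem_nhds hyc] with x hx
      have hk := (hK 3 le_rfl).differentiableAt hx
      have hg := (hG 3 le_rfl).differentiableAt hx
      have : (fun x => K 3 x + (-1) * G 3 x) = fun x => K 3 x - G 3 x := by ext; ring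
      rw [this, fderiv_fun_sub hk hg]
    rw [bracketTwo, h1.fderiv_eq, fderiv_fun_sub
      ((hK 3 le_rfl).analyticOnNhd.fderiv y hyc).differentiableAt
      ((hG 3 le_rfl).analyticOnNhd.fderiv y hyc).differentiableAt]
    simp only [_root_.sub_apply, ← hX3]
  have h3 := e3 y hyc
  have h4 := e4 y hyc
  have h5 := e5 y hyc
  rw [hbr 3 le_rfl, ← add_assoc] at h4
  rw [hbr 3 le_rfl, hbr 4 (by norm_num), hbr2] at h5
  have h2 : linearPart ω Ω a - linearPart ω Ω b = fderiv ℂ (linearPart ω Ω) y ((η : ℂ) • Y) := by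
    rw [ha, hb, linearPart_add_half_sub]
  have hid := transform_identity (a₃ := K 3 a) (a₄ := K 4 a) (a₅ := K 5 a) (b₃ := G 3 b)
    (b₄ := G 4 b) (b₅ := G 5 b) h2 h3 h4 h5
  simp only [← hZ, ← hY] at hid
  rw [hid]
  have op : ∀ (f : Phase n m →L[ℂ] ℂ) (v : Phase n m) (c : ℝ), ‖f‖ ≤ M → ‖v‖ ≤ c →
      ‖f v‖ ≤ M * c := fun f v c hf hv => f.le_of_opNorm_le_of_le hf hv
  have op2 : ∀ (f : Phase n m →L[ℂ] Phase n m →L[ℂ] ℂ) (u v : Phase n m) (c c' : ℝ), ‖f‖ ≤ M →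
      ‖u‖ ≤ c → ‖v‖ ≤ c' → ‖f u v‖ ≤ M * c * c' := fun f u v c c' hf hu hv =>
    (f u).le_of_opNorm_le_of_le (f.le_of_opNorm_le_of_le hf hu) hv
  have bK : ∀ d ∈ Finset.Icc (3 : ℕ) 5, ‖fderiv ℂ (K d) y‖ ≤ M ∧ ‖fderiv ℂ (fderiv ℂ (K d)) y‖ ≤ M :=
    fun d hd => ⟨(hMK d hd y hyD).2.1.trans hMK', (hMK d hd y hyD).2.2.1.trans hMK'⟩
  have bG : ∀ d ∈ Finset.Icc (3 : ℕ) 5, ‖fderiv ℂ (G d) y‖ ≤ M ∧ ‖fderiv ℂ (fderiv ℂ (G d)) y‖ ≤ M :=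
    fun d hd => ⟨(hMG d hd y hyD).2.1.trans hMG', (hMG d hd y hyD).2.2.1.trans hMG'⟩
  have j1 : ‖1 / 2 * (fderiv ℂ (K 3) y X₅ + fderiv ℂ (G 3) y X₅)‖ ≤ M ^ 2 := by
    rw [norm_mul]
    have := (norm_add_le _ _).trans (add_le_add (op _ X₅ M (bK 3 (by decide)).1 b5)
      (op _ X₅ M (bG 3 (by decide)).1 b5))
    norm_num
    linarith
  have j2 : ‖1 / 2 * (fderiv ℂ (K 4) y Z + fderiv ℂ (G 4) y Z)‖ ≤ 2 * M ^ 2 := by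
    rw [norm_mul]
    have := (norm_add_le _ _).trans (add_le_add (op _ Z _ (bK 4 (by decide)).1 bZ)
      (op _ Z _ (bG 4 (by decide)).1 bZ))
    norm_num
    linarith
  have j3 : ‖1 / 8 * ((fderiv ℂ (fderiv ℂ (K 3)) y X₃ Z + fderiv ℂ (fderiv ℂ (K 3)) y Z Y) -
      (fderiv ℂ (fderiv ℂ (G 3)) y X₃ Z + fderiv ℂ (fderiv ℂ (G 3)) y Z Y))‖ ≤ 3 * M ^ 3 := by
    rw [norm_mul]
    have q1 := (norm_add_le _ _).trans (add_le_add
      (op2 _ X₃ Z _ _ (bK 3 (by decide)).2 b3 bZ) (op2 _ Z Y _ _ (bK 3 (by decide)).2 bZ bY))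
    have q2 := (norm_add_le _ _).trans (add_le_add
      (op2 _ X₃ Z _ _ (bG 3 (by decide)).2 b3 bZ) (op2 _ Z Y _ _ (bG 3 (by decide)).2 bZ bY))
    have q3 := (norm_sub_le _ _).trans (add_le_add q1 q2)
    have hM3 := pow_pos hM0 3
    rw [hV] at q3
    norm_num
    nlinarith
  have hJ := (norm_add₃_le).trans (add_le_add (add_le_add j1 j2) j3)
  have s1 := (norm_sub_le _ _).trans (add_le_add r1 r2)
  have s2 := (norm_sub_le _ _).trans (add_le_add r3 r4)
  have s3 := (norm_sub_le _ _).trans (add_le_add r5 r6)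
  have hpow : ∀ k, ‖(η : ℂ) ^ k‖ = η ^ k := fun k => by rw [norm_pow, hηn]
  refine (norm_add_le _ _).trans ((add_le_add norm_add₃_le le_rfl).trans ?_)
  simp only [norm_mul _ (_ - _), norm_mul _ (_ + _), hpow]
  rw [hηn]
  calc _ ≤ η * (2 * M * (η * (V / δ)) ^ 3 + 2 * M * (η * (V / δ)) ^ 3) +
        η ^ 2 * (2 * M * (η * (V / δ)) ^ 2 + 2 * M * (η * (V / δ)) ^ 2) +
        η ^ 3 * (2 * M * (η * (V / δ)) + 2 * M * (η * (V / δ))) +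
        η ^ 4 * (M ^ 2 + 2 * M ^ 2 + 3 * M ^ 3) := by gcongr
    _ = _ := by ring

end Transform

/-! ### The averaging transformation -/

/-- The normal form up to weighted degree five, where `c d` are the coefficients of the source of the
homological equation of weighted degree `d`. -/
def normalForm (ω : Fin n → ℝ) (Ω : Fin m → ℝ) (c : ℕ → MIdx n m → (Fin n → ℂ) → ℂ) (η : ℝ)
    (x : Phase n m) : ℂ :=
  linearPart ω Ω x + η * weightPart 3 (normalCoeff (c 3)) x +
    η ^ 2 * weightPart 4 (normalCoeff (c 4)) x + η ^ 3 * weightPart 5 (normalCoeff (c 5)) x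

section Averaging

variable {ω : Fin n → ℝ} {Ω : Fin m → ℝ} {γ τ s : ℝ} {c : ℕ → MIdx n m → (Fin n → ℂ) → ℂ}
  {H : Phase n m → ℂ} {rStar sStar ρStar r ρ η₀ : ℝ}

lemma analyticOnNhd_generator {F : ℕ → Phase n m → ℂ} (hF : ∀ d : ℕ, 3 ≤ d → Pol s d (F d))
    (η : ℝ) : AnalyticOnNhd ℂ (generator F η) (cylinder n m s) := fun x hx =>
  (((analyticAt_const.fun_mul ((hF 3 le_rfl).analyticOnNhd x hx)).fun_add
    (analyticAt_const.fun_mul ((hF 4 (by norm_num)).analyticOnNhd x hx))).fun_add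
    (analyticAt_const.fun_mul ((hF 5 (by norm_num)).analyticOnNhd x hx)))

lemma generator_shiftPhase {F : ℕ → Phase n m → ℂ} (hF : ∀ d : ℕ, 3 ≤ d → Pol s d (F d)) (η : ℝ)
    {x : Phase n m} (hx : x ∈ cylinder n m s) (ℓ : Fin n → ℤ) :
    generator F η (shiftPhase ℓ x) = generator F η x := by
  simp only [generator]
  rw [(hF 3 le_rfl).apply_shiftPhase hx, (hF 4 (by norm_num)).apply_shiftPhase hx,
    (hF 5 (by norm_num)).apply_shiftPhase hx]

lemma realOn_generator {F : ℕ → Phase n m → ℂ} (hF : ∀ d : ℕ, 3 ≤ d → RealOn s (F d)) (η : ℝ) :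
    RealOn s (generator F η) := by
  have := (((hF 3 le_rfl).real_mul η).add ((hF 4 (by norm_num)).real_mul (η ^ 2))).add
    ((hF 5 (by norm_num)).real_mul (η ^ 3))
  simp only [Complex.ofReal_pow] at this
  exact this

/-- For small `η` the midpoint map of the generating Hamiltonian brings the rescaled Hamiltonian to
normal form up to an error of order `η ^ 4`. -/
theorem exists_averaging_transformation (hs : 0 < s) (hγ : 0 < γ) (hτ : 0 < τ)
    (hMel : Melnikov ω Ω γ τ) (hrStar : 0 < rStar) (hρStar : 0 < ρStar) (hr : 0 < r) (hρ : 0 < ρ)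
    (hsStar : s ≤ sStar) (hη₀ : 0 < η₀) (h1 : η₀ ^ 2 * r ≤ rStar) (h2 : η₀ * ρ ≤ ρStar)
    (hH : IsEllipticHamiltonian ω Ω rStar sStar ρStar H (c 3))
    (hR : ∀ p, 3 ≤ wdeg p → IsCoeffFun s (c 3 p))
    (hc : ∀ d, 3 ≤ d → ∀ p, wdeg p = d → IsCoeffFun s (c d p))
    (hsym : ∀ d, 3 ≤ d → SymmCoeff d (c d))
    (h4 : EqOn (secondSource ω Ω (c 3)) (weightPart 4 (c 4)) (cylinder n m s))
    (h5 : EqOn (thirdSource ω Ω (c 3) (c 4)) (weightPart 5 (c 5)) (cylinder n m s)) :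
    ∃ C, ∃ η₁ > 0, ∀ η : ℝ, 0 < η → η ≤ η₁ → ∃ Φ : Phase n m → Phase n m,
      IsCanonicalChange Φ (domain n m (r / 2) (s / 2) (ρ / 2)) (domain n m r s ρ) ∧
      (∀ x ∈ domain n m (r / 2) (s / 2) (ρ / 2), ‖Φ x - x‖ ≤ C * η) ∧
      ∀ x ∈ domain n m (r / 2) (s / 2) (ρ / 2),
        ‖rescaled H η (Φ x) - normalForm ω Ω c η x‖ ≤ C * η ^ 4 := by
  set K : ℕ → Phase n m → ℂ := fun d => weightPart d (c 3) with hKdef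
  set G : ℕ → Phase n m → ℂ := fun d => weightPart d (normalCoeff (c d)) with hGdef
  set F : ℕ → Phase n m → ℂ := fun d => weightPart d (solCoeff ω Ω (c d)) with hFdef
  have hK : ∀ d : ℕ, 3 ≤ d → Pol s d (K d) := fun d hd =>
    Pol.weightPart fun p hp => hR p (by rwa [hp])
  have hG : ∀ d : ℕ, 3 ≤ d → Pol s d (G d) := fun d hd =>
    Pol.weightPart fun p hp => isCoeffFun_normalCoeff (hc d hd p hp)
  have hF : ∀ d : ℕ, 3 ≤ d → Pol s d (F d) := fun d hd =>
    Pol.weightPart fun p hp => isCoeffFun_solCoeff hs hγ hτ hMel (hc d hd p hp)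
  have hom : ∀ d, 3 ≤ d → ∀ x ∈ cylinder n m s,
      bracket (linearPart ω Ω) (F d) x + weightPart d (c d) x = G d x := fun d hd x hx =>
    homological_equation hs hγ hτ hMel (hc d hd) hx
  have hs7 : 7 / 8 * s < s := by linarith
  obtain ⟨δ₁, hδ₁, hball₁⟩ := exists_closedBall_subset_domain n m (r := 3 / 4 * r) (r' := r / 2)
    (s := 3 / 4 * s) (s' := s / 2) (ρ := 3 / 4 * ρ) (ρ' := ρ / 2)
    (by positivity) (by linarith) (by linarith) (by positivity) (by linarith)
  obtain ⟨δ₂, hδ₂, hball₂⟩ := exists_closedBall_subset_domain n m (r := 7 / 8 * r) (r' := 3 / 4 * r)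
    (s := 7 / 8 * s) (s' := 3 / 4 * s) (ρ := 7 / 8 * ρ) (ρ' := 3 / 4 * ρ)
    (by positivity) (by linarith) (by linarith) (by positivity) (by linarith)
  set U := domain n m (r / 2) (s / 2) (ρ / 2) with hU
  set W := domain n m (3 / 4 * r) (3 / 4 * s) (3 / 4 * ρ) with hW
  set D := domain n m (7 / 8 * r) (7 / 8 * s) (7 / 8 * ρ) with hD
  have hDcyl : D ⊆ cylinder n m s := fun x hx =>
    strip_mono hs7.le (domain_subset_cylinder _ _ _ hx)
  have hWD : W ⊆ D := fun x hx => hball₂ x hx (mem_closedBall_self hδ₂.le)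
  obtain ⟨C₁, η₂, hη₂, hC₁⟩ := exists_transform_bound hK hG hF (hom 3 le_rfl)
    (fun x hx => by rw [← hom 4 (by norm_num) x hx, ← h4 hx]; rfl)
    (fun x hx => by rw [← hom 5 (by norm_num) x hx, ← h5 hx]; rfl)
    (by positivity) hs7 (by positivity) hδ₂ hball₂
  obtain ⟨C₂, hC₂⟩ := exists_norm_rescaled_sub_le hH (r := 7 / 8 * r) (s := 7 / 8 * s)
    (ρ := 7 / 8 * ρ) (by positivity) (by positivity) hη₀ (r' := 7 / 8 * rStar)
    (s' := 7 / 8 * sStar) (ρ' := 7 / 8 * ρStar) (by positivity) (by linarith) (by linarith)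
    (by positivity) (by linarith) (by linarith) (by linarith) (by linarith)
  obtain ⟨M', hM'⟩ := exists_bound_of_pol hF (r' := 7 / 8 * r) (ρ' := 7 / 8 * ρ) (by positivity)
    hs7 (by positivity)
  set M := max 1 M' with hM
  have hM0 : 0 < M := by positivity
  set δ := min δ₁ δ₂ with hδ
  have hδ0 : 0 < δ := lt_min hδ₁ hδ₂
  refine ⟨max (3 * M) (C₁ + C₂), min (min 1 (δ / (6 * M))) (min η₂ (η₀ / 4)), by positivity,
    fun η hη hηle => ?_⟩
  have e1 : η ≤ 1 := hηle.trans ((min_le_left _ _).trans (min_le_left _ _))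
  have e2 : η ≤ δ / (6 * M) := hηle.trans ((min_le_left _ _).trans (min_le_right _ _))
  have e3 : η ≤ η₂ := hηle.trans ((min_le_right _ _).trans (min_le_left _ _))
  have e4 : η ≤ η₀ / 4 := hηle.trans ((min_le_right _ _).trans (min_le_right _ _))
  rw [le_div_iff₀ (by positivity)] at e2
  set X := hamVF (generator F η) with hX
  have hXan : AnalyticOnNhd ℂ X (cylinder n m s) :=
    analyticOnNhd_hamVF (analyticOnNhd_generator hF η)
  have hXD : ∀ y ∈ D, ‖X y‖ ≤ 3 * M * η := fun y hy => by
    have b : ∀ d ∈ Finset.Icc (3 : ℕ) 5, ‖hamVF (F d) y‖ ≤ M := fun d hd =>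
      (hM' d hd y hy).2.2.2.trans (le_max_right _ _)
    have b3 := b 3 (by decide)
    have b4 := b 4 (by decide)
    have b5 := b 5 (by decide)
    have hsm : ∀ v : Phase n m, ‖(η : ℂ) • v‖ ≤ ‖v‖ := fun v => by
      rw [norm_smul, Complex.norm_real, Real.norm_of_nonneg hη.le]
      exact mul_le_of_le_one_left (norm_nonneg _) e1
    rw [hX, hamVF_generator hF η (hDcyl hy), norm_smul, Complex.norm_real,
      Real.norm_of_nonneg hη.le, mul_comm]
    refine mul_le_mul_of_nonneg_right ?_ hη.le
    have q1 := (norm_add_le (hamVF (F 4) y) _).trans (add_le_add b4 ((hsm _).trans b5))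
    have q2 := (norm_add_le (hamVF (F 3) y) _).trans (add_le_add b3 ((hsm _).trans q1))
    linarith
  have hδη : 3 * M * η ≤ δ := by nlinarith
  have hXW : ∀ y ∈ W, ‖X y‖ ≤ 3 * M * η := fun y hy => hXD y (hWD hy)
  have hd1 : ∀ y ∈ W, ‖fderiv ℂ X y‖ ≤ 1 := fun y hy => by
    have hsub : ball y δ ⊆ D := ball_subset_closedBall.trans
      ((closedBall_subset_closedBall (min_le_right _ _)).trans (hball₂ y hy))
    refine (norm_fderiv_le_of_norm_le hδ0 ((hXan.mono hDcyl).differentiableOn.mono hsub)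
      fun z hz => hXD z (hsub hz)).trans ?_
    rw [div_le_one hδ0]
    linarith
  have hLip : ∀ y ∈ W, ∀ y' ∈ W, ‖X y - X y'‖ ≤ ‖y - y'‖ := fun y hy y' hy' => by
    have := (convex_domain n m (3 / 4 * r) (3 / 4 * s) (3 / 4 * ρ)).norm_image_sub_le_of_norm_fderiv_le
      (fun z hz => (hXan z (hDcyl (hWD hz))).differentiableAt) hd1 hy' hy
    rwa [one_mul] at this
  have hball : ∀ x ∈ U, closedBall x (3 * M * η) ⊆ W := fun x hx =>
    (closedBall_subset_closedBall (hδη.trans (min_le_left _ _))).trans (hball₁ x hx)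
  have hδ' : 0 ≤ 3 * M * η := by positivity
  refine ⟨midpointMap X W, ?_, fun x hx => ?_, fun x hx => ?_⟩
  · refine (isCanonicalChange_midpointMap (analyticOnNhd_generator hF η)
      (fun x hx ℓ => generator_shiftPhase hF η hx ℓ)
      (realOn_generator (fun d hd => (hsym d hd).solCoeff.realOn) η) (isOpen_domain _ _ _ _ _)
      (isOpen_domain _ _ _ _ _) (hWD.trans hDcyl) (fun x hx ℓ => shiftPhase_mem_domain hx ℓ) hδ'
      hball hXW hLip hd1).mono_right ?_
    exact domain_mono (by positivity) (by linarith) (by linarith) (by positivity) (by linarith)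
  · refine (norm_midpointMap_sub_le hδ' hball hXW hLip hx).trans ?_
    gcongr
    exact le_max_left _ _
  · obtain ⟨hy, hyx⟩ := halfInverse_spec hδ' hball hXW hLip hx
    have ha := midpointMap_eq hδ' hball hXW hLip hx
    set y := halfInverse X W x with hydef
    have hx' : x = y - (1 / 2 : ℂ) • X y := eq_sub_of_add_eq hyx.symm
    have haD : midpointMap X W x ∈ D := by
      refine hball₂ y hy ?_
      rw [mem_closedBall, dist_eq_norm, ha, add_sub_cancel_left, norm_smul]
      have := (hXW y hy).trans (hδη.trans (min_le_right _ _))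
      have h0 := norm_nonneg (X y)
      norm_num
      linarith
    have t1 := hC₁ η hη e3 y hy _ _ ha hx'
    have t2 := hC₂ η hη e4 _ haD
    have t3 := norm_add_le_of_le t2 t1
    have hle : C₂ * η ^ 4 + C₁ * η ^ 4 ≤ max (3 * M) (C₁ + C₂) * η ^ 4 := by
      rw [← add_mul, add_comm C₂]
      gcongr
      exact le_max_right _ _
    refine le_trans (le_of_eq (congrArg _ ?_)) (t3.trans hle)
    simp only [normalForm, hKdef, hGdef]
    ring

/-- The normal form is bounded on the smaller domains, locally uniformly in `η`. -/
lemma exists_norm_normalForm_le (hs : 0 < s) (hr : 0 < r) (hρ : 0 < ρ) (hη₀ : 0 ≤ η₀)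
    (hc : ∀ d, 3 ≤ d → ∀ p, wdeg p = d → IsCoeffFun s (c d p)) :
    ∃ B, ∀ η : ℝ, 0 < η → η ≤ η₀ → ∀ x ∈ domain n m (r / 2) (s / 2) (ρ / 2),
      ‖normalForm ω Ω c η x‖ ≤ B := by
  have hG : ∀ d : ℕ, 3 ≤ d → Pol s d (weightPart d (normalCoeff (c d))) := fun d hd =>
    Pol.weightPart fun p hp => isCoeffFun_normalCoeff (hc d hd p hp)
  obtain ⟨M, hM⟩ := exists_bound_of_pol hG (r' := r / 2) (s' := s / 2) (ρ' := ρ / 2) (by positivity)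
    (by linarith) (by positivity)
  obtain ⟨M', hM'⟩ := exists_bound_of_periodic (r := r) (s := s) (ρ := ρ) (r' := r / 2)
    (s' := s / 2) (ρ' := ρ / 2) (by positivity) (by linarith) (by linarith) (by positivity)
    (by linarith) (analyticOnNhd_linearPart (n := n) (m := m) ω Ω _).continuousOn fun x _ ℓ => rfl
  refine ⟨M' + η₀ * M + η₀ ^ 2 * M + η₀ ^ 3 * M, fun η hη hηle x hx => ?_⟩
  have b : ∀ d ∈ Finset.Icc (3 : ℕ) 5, ∀ k, ‖(η : ℂ) ^ k * weightPart d (normalCoeff (c d)) x‖ ≤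
      η₀ ^ k * M := fun d hd k => by
    rw [norm_mul, norm_pow, Complex.norm_real, Real.norm_of_nonneg hη.le]
    have := (hM d hd x hx).1
    gcongr
  have b3 := b 3 (by decide) 1
  rw [pow_one, pow_one] at b3
  exact norm_add_le_of_le (norm_add_le_of_le (norm_add_le_of_le (hM' x hx) b3) (b 4 (by decide) 2))
    (b 5 (by decide) 3)

lemma rescaled_dilate_mem (hrStar : 0 < rStar) (hρStar : 0 < ρStar) (hr : 0 < r) (hρ : 0 < ρ)
    (hsStar : s ≤ sStar) (h1 : η₀ ^ 2 * r ≤ rStar) (h2 : η₀ * ρ ≤ ρStar) {η : ℝ}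
    (hη : 0 < η) (hηle : η ≤ η₀) {x : Phase n m} (hx : x ∈ domain n m r s ρ) :
    dilate η x ∈ domain n m rStar sStar ρStar := by
  have hn : ‖(η : ℂ)‖ ≤ η₀ := by rwa [Complex.norm_real, Real.norm_of_nonneg hη.le]
  refine dilate_mem_domain (le_trans ?_ h1) hsStar (le_trans ?_ h2) hr hρ hrStar hρStar hx
  · gcongr
  · gcongr

/-- The rescaled Hamiltonian is bounded on the smaller domains as long as `η` stays away from
zero. -/
lemma exists_norm_rescaled_le (hrStar : 0 < rStar) (hρStar : 0 < ρStar) (hr : 0 < r) (hρ : 0 < ρ)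
    (hs : 0 < s) (hsStar : s ≤ sStar) (h1 : η₀ ^ 2 * r ≤ rStar) (h2 : η₀ * ρ ≤ ρStar)
    {R : MIdx n m → (Fin n → ℂ) → ℂ} (hH : IsEllipticHamiltonian ω Ω rStar sStar ρStar H R)
    {η₁ : ℝ} (hη₁ : 0 < η₁) :
    ∃ B, ∀ η : ℝ, η₁ ≤ η → η ≤ η₀ → ∀ x ∈ domain n m (r / 2) (s / 2) (ρ / 2),
      ‖rescaled H η x‖ ≤ B := by
  obtain ⟨M, hM⟩ := exists_bound_of_periodic (r := rStar) (s := sStar) (ρ := ρStar)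
    (r' := rStar / 2) (s' := sStar / 2) (ρ' := ρStar / 2) (by positivity) (by linarith)
    (by linarith) (by positivity) (by linarith) hH.analytic.continuousOn fun x hx ℓ =>
      hH.periodic x hx ℓ
  refine ⟨(η₁ ^ 2)⁻¹ * M, fun η hη hηle x hx => ?_⟩
  have hη0 : 0 < η := hη₁.trans_le hη
  rw [rescaled_eq_dilate, norm_mul, norm_inv, norm_pow, Complex.norm_real,
    Real.norm_of_nonneg hη0.le]
  have := hM _ (rescaled_dilate_mem (by positivity) (by positivity) (by positivity) (by positivity)
    (by linarith) (rStar := rStar / 2) (ρStar := ρStar / 2) (sStar := sStar / 2) (η₀ := η₀)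
    (by linarith) (by linarith) hη0 hηle hx)
  gcongr

lemma analyticOnNhd_rescaled (hrStar : 0 < rStar) (hρStar : 0 < ρStar) (hr : 0 < r) (hρ : 0 < ρ)
    (hsStar : s ≤ sStar) (h1 : η₀ ^ 2 * r ≤ rStar) (h2 : η₀ * ρ ≤ ρStar)
    {R : MIdx n m → (Fin n → ℂ) → ℂ} (hH : IsEllipticHamiltonian ω Ω rStar sStar ρStar H R)
    {η : ℝ} (hη : 0 < η) (hηle : η ≤ η₀) :
    AnalyticOnNhd ℂ (rescaled H η) (domain n m r s ρ) := by
  refine analyticOnNhd_of_differentiableOn (isOpen_domain n m r s ρ) fun x hx => ?_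
  have hd : DifferentiableAt ℂ (fun x : Phase n m => dilate η x) x := by
    unfold dilate
    fun_prop
  have := (hH.analytic _ (rescaled_dilate_mem hrStar hρStar hr hρ hsStar h1 h2 hη hηle
    hx)).differentiableAt
  exact ((this.comp x hd).const_mul _).differentiableWithinAt

lemma rescaled_im (hrStar : 0 < rStar) (hρStar : 0 < ρStar) (hr : 0 < r) (hρ : 0 < ρ)
    (hsStar : s ≤ sStar) (h1 : η₀ ^ 2 * r ≤ rStar) (h2 : η₀ * ρ ≤ ρStar)
    {R : MIdx n m → (Fin n → ℂ) → ℂ} (hH : IsEllipticHamiltonian ω Ω rStar sStar ρStar H R)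
    {η : ℝ} (hη : 0 < η) (hηle : η ≤ η₀) {x : Phase n m} (hx : x ∈ domain n m r s ρ)
    (hxr : x ∈ realPoints n m) : (rescaled H η x).im = 0 := by
  have hreal : dilate η x ∈ realPoints n m := by
    refine ⟨fun i => ?_, fun i => hxr.2.1 i, fun j => ?_⟩
    · have : (dilate (η : ℂ) x).1 i = ((η ^ 2 : ℝ) : ℂ) * x.1 i := by simp [dilate]
      rw [this, Complex.im_ofReal_mul, hxr.1 i, mul_zero]
    · simp [dilate, hxr.2.2 j]
  have := hH.real _ (rescaled_dilate_mem hrStar hρStar hr hρ hsStar h1 h2 hη hηle hx) hreal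
  have he : rescaled H η x = (((η ^ 2)⁻¹ : ℝ) : ℂ) * H (dilate η x) := by
    rw [rescaled_eq_dilate]; push_cast; rfl
  rw [he, Complex.im_ofReal_mul, this, mul_zero]

lemma analyticOnNhd_normalForm (hc : ∀ d, 3 ≤ d → ∀ p, wdeg p = d → IsCoeffFun s (c d p)) (η : ℝ) :
    AnalyticOnNhd ℂ (normalForm ω Ω c η) (cylinder n m s) := by
  have hG : ∀ d : ℕ, 3 ≤ d → Pol s d (weightPart d (normalCoeff (c d))) := fun d hd =>
    Pol.weightPart fun p hp => isCoeffFun_normalCoeff (hc d hd p hp)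
  intro x hx
  have := (analyticOnNhd_linearPart ω Ω _ x hx).fun_add (analyticOnNhd_generator hG η x hx)
  refine this.congr (Eventually.of_forall fun y => ?_)
  simp only [normalForm, generator]
  ring

lemma realOn_normalForm (hsym : ∀ d, 3 ≤ d → SymmCoeff d (c d)) (η : ℝ) :
    RealOn s (normalForm ω Ω c η) := by
  have hl : RealOn s (linearPart (n := n) (m := m) ω Ω) := fun x _ hr => by
    rw [← Complex.conj_eq_iff_im, ← linearPart_conjPhase, mem_realPoints_iff.1 hr]
  have := hl.add (realOn_generator (s := s) (F := fun d => weightPart d (normalCoeff (c d)))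
    (fun d hd => (hsym d hd).normalCoeff.realOn) η)
  have he : normalForm ω Ω c η = fun x => linearPart ω Ω x +
      generator (fun d => weightPart d (normalCoeff (c d))) η x := by
    ext x
    simp only [normalForm, generator]
    ring
  rwa [he]

lemma homogPart_congr {q d : ℕ} {b b' : MIdx n m → (Fin n → ℂ) → ℂ}
    (h : ∀ p, wdeg p = 2 * q + d → b p = b' p) (x : Phase n m) :
    homogPart q d b x = homogPart q d b' x := by
  rw [homogPart_eq_sum, homogPart_eq_sum]
  refine Finset.sum_congr rfl fun p hp => ?_
  obtain ⟨h1, h2⟩ := mem_bidegSet.1 hp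
  rw [h p (by rw [wdeg, h1, h2])]

/-- The coefficients of weighted degree four and five of the normal form. -/
def averagedCoeff (c : ℕ → MIdx n m → (Fin n → ℂ) → ℂ) (p : MIdx n m) : (Fin n → ℂ) → ℂ :=
  if wdeg p = 4 then c 4 p else if wdeg p = 5 then c 5 p else fun _ => 0

/-- The normal form is the explicit averaged Hamiltonian. -/
theorem averagedPart_eq_normalForm (hs : 0 < s) (hγ : 0 < γ) (hτ : 0 < τ)
    (hMel : Melnikov ω Ω γ τ) (hR : ∀ p, 3 ≤ wdeg p → IsCoeffFun s (c 3 p))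
    (hsymR : ∀ d, 3 ≤ d → SymmCoeff d (c 3)) (hc4 : ∀ p, IsCoeffFun s (c 4 p))
    (h4 : EqOn (secondSource ω Ω (c 3)) (weightPart 4 (c 4)) (cylinder n m s)) (η : ℝ)
    (x : Phase n m) :
    averagedPart ω Ω (c 3) (averagedCoeff c) (Matrix.of fun i i' => (twistMatrix ω Ω (c 3) i i').re)
      (Matrix.of fun j i => (couplingMatrix ω Ω (c 3) j i).re) η x = normalForm ω Ω c η x := by
  have e1 : ∀ i i', (((twistMatrix ω Ω (c 3) i i').re : ℝ) : ℂ) = twistMatrix ω Ω (c 3) i i' :=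
    fun i i' => Complex.ext (by simp) (by simp [twistMatrix_im hsymR])
  have e2 : ∀ j i, (((couplingMatrix ω Ω (c 3) j i).re : ℝ) : ℂ) = couplingMatrix ω Ω (c 3) j i :=
    fun j i => Complex.ext (by simp) (by simp [couplingMatrix_im hsymR])
  have s4 : homogPart 0 4 (averagedCoeff c) x = homogPart 0 4 (c 4) x :=
    homogPart_congr (fun p hp => by simp [averagedCoeff, hp]) x
  have s5 : ∀ q d, 2 * q + d = 5 →
      homogPart q d (averagedCoeff c) x = homogPart q d (c 5) x := fun q d hqd =>
    homogPart_congr (fun p hp => by simp [averagedCoeff, hp, hqd]) x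
  simp only [averagedPart, Matrix.of_apply, e1, e2]
  rw [s4, s5 1 3 rfl, s5 0 5 rfl, normalForm, weightPart_three_normalCoeff,
    weightPart_five_normalCoeff, weightPart_four, homogPart_zero_normalCoeff,
    homogPart_two_zero_normalCoeff hs hγ hτ hMel hR hc4 h4,
    homogPart_one_two_normalCoeff hs hγ hτ hMel hR h4]

end Averaging

end

theorem mainTheorem8 (n m : ℕ) (ω : Fin n → ℝ) (Ω : Fin m → ℝ) (γ τ : ℝ)
    (hγ : 0 < γ) (hτ : 0 < τ) (hMel : Melnikov ω Ω γ τ)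
    (rStar sStar ρStar : ℝ) (hrStar : 0 < rStar) (hρStar : 0 < ρStar)
    (r s ρ : ℝ) (hr : 0 < r) (hs : 0 < s) (hρ : 0 < ρ) (hsStar : s ≤ sStar) :
    ∃ η₀ : ℝ, 0 < η₀ ∧ η₀ ^ 2 * r ≤ rStar ∧ η₀ * ρ ≤ ρStar ∧
      ∀ (H : Phase n m → ℂ) (R : MIdx n m → (Fin n → ℂ) → ℂ),
        IsEllipticHamiltonian ω Ω rStar sStar ρStar H R →
        (∀ i i', Summable (twistTerm ω Ω R i i')) ∧
        (∀ j i, Summable (couplingTermA ω Ω R j i)) ∧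
        (∀ j i, Summable (couplingTermB ω Ω R j i)) ∧
        ∃ (A : Matrix (Fin n) (Fin n) ℝ) (Q : Matrix (Fin m) (Fin n) ℝ)
          (S : MIdx n m → (Fin n → ℂ) → ℂ) (C : ℝ),
          A.IsSymm ∧
          A.map Complex.ofReal = twistMatrix ω Ω R ∧
          Q.map Complex.ofReal = couplingMatrix ω Ω R ∧
          (∀ p, AnalyticOnNhd ℂ (S p) (strip n (s / 2)) ∧
            ∀ φ ∈ strip n (s / 2), ∀ ℓ : Fin n → ℤ, S p (φ + angleShift ℓ) = S p φ) ∧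
          ∀ η : ℝ, 0 < η → η ≤ η₀ →
            ∃ (Φ : Phase n m → Phase n m) (E : Phase n m → ℂ),
              IsCanonicalChange Φ (domain n m (r / 2) (s / 2) (ρ / 2)) (domain n m r s ρ) ∧
              (∀ x ∈ domain n m (r / 2) (s / 2) (ρ / 2), ‖Φ x - x‖ ≤ C * η) ∧
              AnalyticOnNhd ℂ E (domain n m (r / 2) (s / 2) (ρ / 2)) ∧
              (∀ x ∈ domain n m (r / 2) (s / 2) (ρ / 2),
                x ∈ realPoints n m → (E x).im = 0) ∧
              (∀ x ∈ domain n m (r / 2) (s / 2) (ρ / 2), ‖E x‖ ≤ C * η ^ 4) ∧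
              ∀ x ∈ domain n m (r / 2) (s / 2) (ρ / 2),
                rescaled H η (Φ x) = averagedPart ω Ω R S A Q η x + E x := by
  -- The largest `η` for which the rescaled Hamiltonian is defined on the whole domain.
  have hη₀ : 0 < min √(rStar / r) (ρStar / ρ) := by positivity
  have h1 : min √(rStar / r) (ρStar / ρ) ^ 2 * r ≤ rStar := by
    rw [← le_div_iff₀ hr]
    calc _ ≤ √(rStar / r) ^ 2 := by gcongr; exact min_le_left _ _
      _ = _ := Real.sq_sqrt (by positivity)
  have h2 : min √(rStar / r) (ρStar / ρ) * ρ ≤ ρStar := by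
    rw [← le_div_iff₀ hρ]
    exact min_le_right _ _
  generalize min √(rStar / r) (ρStar / ρ) = η₀ at hη₀ h1 h2
  refine ⟨η₀, hη₀, h1, h2, fun H R hH => ?_⟩
  have hsub : strip n s ⊆ strip n sStar := strip_mono hsStar
  have hR : ∀ p, 3 ≤ wdeg p → IsCoeffFun s (R p) := fun p hp =>
    (hH.isCoeffFun hrStar hρStar hp).mono hsStar
  have hsymR : ∀ d, 3 ≤ d → SymmCoeff d R := fun d hd p hp θ => by
    rw [hH.conj_coeff hrStar hρStar (hp ▸ hd) (hsub (realAngle_mem_strip hs θ)), conj_realAngle]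
  have hR3 : ∀ p, wdeg p = 3 → IsCoeffFun s (R p) := fun p hp => hR p hp.ge
  refine ⟨fun i i' => (hasSum_twistTerm hs hγ hτ hMel hR3 i i').summable,
    fun j i => (hasSum_couplingTermA hs hγ hτ hMel hR3 j i).summable,
    fun j i => (hasSum_couplingTermB hs hγ hτ hMel hR3 j i).summable, ?_⟩
  obtain ⟨c, rfl, hc, hsym, hc4, hc5, h4, h5⟩ := exists_sources hs hγ hτ hMel hR hsymR
  obtain ⟨C₁, η₁, hη₁, hC₁⟩ := exists_averaging_transformation hs hγ hτ hMel hrStar hρStar hr hρ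
    hsStar hη₀ h1 h2 hH hR hc hsym h4 h5
  obtain ⟨B₁, hB₁⟩ := exists_norm_normalForm_le (ω := ω) (Ω := Ω) hs hr hρ hη₀.le hc
  obtain ⟨B₂, hB₂⟩ := exists_norm_rescaled_le hrStar hρStar hr hρ hs hsStar h1 h2 hH hη₁
  have hUV : domain n m (r / 2) (s / 2) (ρ / 2) ⊆ domain n m r s ρ :=
    domain_mono (by positivity) (by linarith) (by linarith) (by positivity) (by linarith)
  set C : ℝ := max C₁ (max 0 ((B₂ + B₁) / η₁ ^ 4)) with hC
  have hC1 : C₁ ≤ C := le_max_left _ _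
  have hC0 : 0 ≤ C := (le_max_left _ _).trans (le_max_right _ _)
  -- For `η` above the threshold the identity does, since the error is only required to be bounded.
  have key : ∀ η : ℝ, 0 < η → η ≤ η₀ → ∃ Φ : Phase n m → Phase n m,
      IsCanonicalChange Φ (domain n m (r / 2) (s / 2) (ρ / 2)) (domain n m r s ρ) ∧
      (∀ x ∈ domain n m (r / 2) (s / 2) (ρ / 2), ‖Φ x - x‖ ≤ C * η) ∧
      ∀ x ∈ domain n m (r / 2) (s / 2) (ρ / 2),
        ‖rescaled H η (Φ x) - normalForm ω Ω c η x‖ ≤ C * η ^ 4 := by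
    intro η hη hηle
    rcases le_or_gt η η₁ with h | h
    · obtain ⟨Φ, hΦ, hd, hE⟩ := hC₁ η hη h
      refine ⟨Φ, hΦ, fun x hx => (hd x hx).trans ?_, fun x hx => (hE x hx).trans ?_⟩ <;> gcongr
    · refine ⟨id, isCanonicalChange_id hUV, fun x _ => ?_, fun x hx => ?_⟩
      · simp only [id, sub_self, norm_zero]; positivity
      · have h6 : (B₂ + B₁) / η₁ ^ 4 ≤ C := (le_max_right _ _).trans (le_max_right _ _)
        rw [div_le_iff₀ (by positivity)] at h6
        calc ‖rescaled H η x - normalForm ω Ω c η x‖ ≤ B₂ + B₁ :=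
              norm_sub_le_of_le (hB₂ η h.le hηle x hx) (hB₁ η hη hηle x hx)
          _ ≤ C * η₁ ^ 4 := h6
          _ ≤ C * η ^ 4 := by gcongr
  refine ⟨Matrix.of fun i i' => (twistMatrix ω Ω (c 3) i i').re,
    Matrix.of fun j i => (couplingMatrix ω Ω (c 3) j i).re, averagedCoeff c, C, ?_, ?_, ?_,
    fun p => ?_, fun η hη hηle => ?_⟩
  · ext i i'
    simp [twistMatrix_symm ω Ω (c 3) i' i]
  · ext i i'
    exact Complex.ext (by simp) (by simp [twistMatrix_im hsymR])
  · ext j i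
    exact Complex.ext (by simp) (by simp [couplingMatrix_im hsymR])
  · have hp : IsCoeffFun s (averagedCoeff c p) := by
      unfold averagedCoeff
      split_ifs
      exacts [hc4 p, hc5 p, IsCoeffFun.const s 0]
    have := hp.mono (show s / 2 ≤ s by linarith)
    exact ⟨this.analytic, this.periodic⟩
  · obtain ⟨Φ, hΦ, hd, hE⟩ := key η hη hηle
    have hcyl : domain n m (r / 2) (s / 2) (ρ / 2) ⊆ cylinder n m s :=
      hUV.trans (domain_subset_cylinder _ _ _)
    refine ⟨Φ, fun x => rescaled H η (Φ x) - normalForm ω Ω c η x, hΦ, hd, ?_,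
      fun x hx hxr => ?_, hE, fun x hx => ?_⟩
    · exact ((analyticOnNhd_rescaled hrStar hρStar hr hρ hsStar h1 h2 hH hη hηle).comp hΦ.analytic
        hΦ.mapsTo).sub ((analyticOnNhd_normalForm hc η).mono hcyl)
    · rw [Complex.sub_im, rescaled_im hrStar hρStar hr hρ hsStar h1 h2 hH hη hηle (hΦ.mapsTo hx)
        (hΦ.real x hx hxr), realOn_normalForm hsym η x (hcyl hx) hxr, sub_zero]
    · rw [averagedPart_eq_normalForm hs hγ hτ hMel hR hsymR hc4 h4]
      ring
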